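/- **Conventions.** All manifolds are $C^\infty$, Hausdorff, second countable and without boundary; all chains have real coefficients. Let $\mathcal U$ be the set of all oriented $m$-dimensional submanifolds of $\mathbb R^n$, $n\ge m\ge 0$. $\mathcal A_c^j(U)$ denotes the space of compactly supported $C^\infty$ $j$-forms on $U\in\mathcal U$ (zero unless $0\le j\le\dim U$). For a submersion $\pi:V\to U$ between elements of $\mathcal U$, with $r=\dim V-\dim U$, $\pi_!:\mathcal A_c^{*}(V)\to\mathcal A_c^{*-r}(U)$ is integration along the fibers; for positively oriented coordinates $(x,y)$ on $V$ and $x$ on $U$ with $\pi(x,y)=x$, it is given by $\pi_!(u\,dx_I\,dy_1\cdots dy_r)=\bigl(\int_{\mathbb R^r}u(x,y)\,dy\bigr)dx_I$ and $\pi_!(u\,dx_I\,dy_J)=0$ for $|J|<r$. A *differentiable space* is a set $X$ with a family of maps $\varphi:U\to X$, $U\in\mathcal U$, called *plots*, such that $\varphi\circ\pi$ is a plot whenever $\varphi:U\to X$ is a plot and $\pi:V\to U$ is a submersion, $V\in\mathcal U$. A map $f:X\to Y$ is *smooth* if $f\circ\varphi$ is a plot of $Y$ for every plot $\varphi$ of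 $X$. On a manifold $M$ the plots are all $C^\infty$ maps $U\to M$; on a subset $Y\subset X$ they are the maps $U\to Y$ which are plots of $X$. The *de Rham chain complex* of $X$ is $$C^{\mathrm{dR}}_k(X)=\Bigl(\bigoplus_{(U,\varphi)}\mathcal A_c^{\dim U-k}(U)\Bigr)\Big/Z_k(X),\qquad \partial[(U,\varphi,\omega)]=[(U,\varphi,d\omega)],$$ where the sum is over all plots $\varphi:U\to X$, $(U,\varphi,\omega)$ is $\omega$ in the summand of $(U,\varphi)$, and $Z_k(X)$ is spanned by all $(U,\varphi,\pi_!\omega)-(V,\varphi\circ\pi,\omega)$ with $\varphi:U\to X$ a plot, $\pi:V\to U$ a submersion and $\omega\in\mathcal A_c^{\dim V-k}(V)$. Its homology is $H^{\mathrm{dR}}_*(X)$. A smooth map $f$ induces the chain map $f_*[(U,\varphi,\omega)]=[(U,f\circ\varphi,\omega)]$, and $\varepsilon:C_0^{\mathrm{dR}}(X)\to\mathbb R$ is $\varepsilon[(U,\varphi,\omega)]=\int_U\omega$. Let $\Delta^k=\{0\le t_1\le\dots\le t_k\le 1\}\subset\mathbb R^k$, with the differentiable structure of a subset of $\mathbb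 R^k$, and for $0\le j\le k$ let $d_{k,j}:\Delta^{k-1}\to\Delta^k$ be $(t_1,\dots,t_{k-1})\mapsto(t_1,\dots,t_j,t_j,\dots,t_{k-1})$, where $t_0=0$ and $t_k=1$. $C^{\mathrm{sm}}_k(X)$ is the real vector space with basis the maps $\sigma:\Delta^k\to X$ which extend to a smooth map on an open neighborhood of $\Delta^k$ in $\mathbb R^k$; $\partial\sigma=\sum_{j=0}^k(-1)^j\sigma\circ d_{k,j}$, and $H^{\mathrm{sm}}_*(X)$ is the homology of this complex. For a manifold $M$, $C^{\mathrm{sm}}_*(M)$ is a subcomplex of the singular chain complex $C_*(M)$, whose homology is $H_*(M)$. Call a sequence $u=(u_k)_{k\ge0}$ with $u_k\in C^{\mathrm{dR}}_k(\Delta^k)$ *admissible* if $\varepsilon(u_0)=1$ and $\partial u_k=\sum_{j=0}^k(-1)^j(d_{k,j})_*u_{k-1}$ for all $k\ge1$. An admissible $u$ gives a chain map $\iota^u:C^{\mathrm{sm}}_*(X)\to C^{\mathrm{dR}}_*(X)$, $\iota^u(\sigma)=\sigma_*(u_k)$ for $\sigma:\Delta^k\to X$. **Theorem.** Let $M$ be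 an oriented $C^\infty$-manifold. Admissible sequences $u$ exist, the map $H_*(\iota^u):H^{\mathrm{sm}}_*(M)\to H^{\mathrm{dR}}_*(M)$ does not depend on the admissible sequence $u$, and it is an isomorphism in every degree. Consequently, in every degree $k$ there is an isomorphism $H_k(M)\cong H^{\mathrm{dR}}_k(M)$ whose composition with the map $H^{\mathrm{sm}}_k(M)\to H_k(M)$ induced by the inclusion $C^{\mathrm{sm}}_*(M)\subset C_*(M)$ is $H_k(\iota^u)$. -/

import Mathlib

open scoped Manifold ContDiff Topology
open Set MeasureTheory

universe u v

noncomputable section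

namespace DeRhamChain

/-! ### Oriented submanifolds of Euclidean spaces -/

/-- A smooth local parametrization, with open domain `source` in `ℝᵐ`, of a relatively open part of
a subset `S` of `ℝⁿ`: an immersion which is a homeomorphism onto a relatively open subset of `S`.
The values of `toFun` outside `source` are irrelevant. -/
structure LocalParam {n : ℕ} (S : Set (Fin n → ℝ)) (m : ℕ) where
  source : TopologicalSpace.Opens (Fin m → ℝ)
  toFun : (Fin m → ℝ) → (Fin n → ℝ)
  mem : ∀ x ∈ source, toFun x ∈ S
  smooth : ContDiffOn ℝ ∞ toFun source
  immersive : ∀ x ∈ source, Function.Injective (fderiv ℝ toFun x)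
  injOn : InjOn toFun source
  image_open : ∀ O : Set (Fin m → ℝ), IsOpen O → O ⊆ source →
    ∃ W : Set (Fin n → ℝ), IsOpen W ∧ toFun '' O = S ∩ W

namespace LocalParam

variable {n m : ℕ} {S : Set (Fin n → ℝ)}

instance : CoeFun (LocalParam S m) (fun _ => (Fin m → ℝ) → (Fin n → ℝ)) := ⟨toFun⟩

/-- The parametrization as a map into `S`. -/
def lift (ψ : LocalParam S m) (x : ψ.source) : S := ⟨ψ x, ψ.mem x x.2⟩

lemma contDiffAt (ψ : LocalParam S m) {x : Fin m → ℝ} (hx : x ∈ ψ.source) :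
    ContDiffAt ℝ ∞ ψ x :=
  ψ.smooth.contDiffAt (ψ.source.isOpen.mem_nhds hx)

/-- Smooth maps into `S` factor locally and smoothly through a local parametrization. -/
lemma exists_factor (χ : LocalParam S m) {p : ℕ} {f : (Fin p → ℝ) → (Fin n → ℝ)}
    {x : Fin p → ℝ} {y : Fin m → ℝ} (hy : y ∈ χ.source) (hf : ContDiffAt ℝ ∞ f x)
    (hfx : f x = χ y) (hS : ∀ᶠ x' in 𝓝 x, f x' ∈ S) :
    ∃ τ : (Fin p → ℝ) → (Fin m → ℝ), ContDiffAt ℝ ∞ τ x ∧ τ x = y ∧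
      ∀ᶠ x' in 𝓝 x, τ x' ∈ χ.source ∧ f x' = χ (τ x') := by
  have hχ := χ.contDiffAt hy
  have hker : LinearMap.ker (fderiv ℝ χ y : (Fin m → ℝ) →ₗ[ℝ] (Fin n → ℝ)) = ⊥ :=
    LinearMap.ker_eq_bot.mpr (χ.immersive y hy)
  obtain ⟨l, hl⟩ := LinearMap.exists_leftInverse_of_injective _ hker
  let L : (Fin n → ℝ) →L[ℝ] (Fin m → ℝ) := LinearMap.toContinuousLinearMap l
  have hLd : HasFDerivAt (fun z => L (χ z))
      ((ContinuousLinearEquiv.refl ℝ (Fin m → ℝ) : (Fin m → ℝ) ≃L[ℝ] (Fin m → ℝ)) :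
        (Fin m → ℝ) →L[ℝ] (Fin m → ℝ)) y := by
    have h1 := L.hasFDerivAt.comp y (hχ.differentiableAt (by simp)).hasFDerivAt
    have h2 : L.comp (fderiv ℝ χ y) =
        ((ContinuousLinearEquiv.refl ℝ (Fin m → ℝ) : (Fin m → ℝ) ≃L[ℝ] (Fin m → ℝ)) :
          (Fin m → ℝ) →L[ℝ] (Fin m → ℝ)) := by
      apply ContinuousLinearMap.ext
      intro v
      exact congrArg (fun g : (Fin m → ℝ) →ₗ[ℝ] (Fin m → ℝ) => g v) hl
    rw [← h2]
    exact h1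
  have hLs : ContDiffAt ℝ ∞ (fun z => L (χ z)) y := L.contDiff.contDiffAt.comp y hχ
  have hn : (∞ : WithTop ℕ∞) ≠ 0 := by simp
  set e := hLs.toOpenPartialHomeomorph (fun z => L (χ z)) hLd hn with he
  have hye : y ∈ e.source := hLs.mem_toOpenPartialHomeomorph_source hLd hn
  have hecoe : ∀ z, e z = L (χ z) := fun z => rfl
  let τ : (Fin p → ℝ) → (Fin m → ℝ) := fun x' => hLs.localInverse hLd hn (L (f x'))
  have hLfx : L (f x) = L (χ y) := by rw [hfx]
  have hτ : ContDiffAt ℝ ∞ τ x := by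
    have h1 : ContDiffAt ℝ ∞ (hLs.localInverse hLd hn) (L (f x)) := by
      rw [hLfx]; exact hLs.to_localInverse hLd hn
    exact h1.comp x (L.contDiff.contDiffAt.comp x hf)
  have hτx : τ x = y := by
    change hLs.localInverse hLd hn (L (f x)) = y
    rw [hLfx]; exact hLs.localInverse_apply_image hLd hn
  refine ⟨τ, hτ, hτx, ?_⟩
  obtain ⟨W, hW, hWS⟩ := χ.image_open (e.source ∩ χ.source)
    (e.open_source.inter χ.source.isOpen) inter_subset_right
  have hxW : f x ∈ W := by
    have : f x ∈ S ∩ W := by rw [← hWS, hfx]; exact ⟨y, ⟨hye, hy⟩, rfl⟩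
    exact this.2
  filter_upwards [hS, hf.continuousAt.preimage_mem_nhds (hW.mem_nhds hxW)] with x' h1 h2
  have h3 : f x' ∈ χ '' (e.source ∩ χ.source) := by rw [hWS]; exact ⟨h1, h2⟩
  obtain ⟨z, ⟨hz1, hz2⟩, hz⟩ := h3
  have h4 : τ x' = z := by
    change e.symm (L (f x')) = z
    rw [← hz, ← hecoe]
    exact e.left_inv hz1
  rw [h4]
  exact ⟨hz2, hz.symm⟩

end LocalParam

/-- An oriented `dim`-dimensional embedded submanifold `carrier` of `ℝⁿ`, `n = ambient`.

The orientation of the tangent spaces is recorded by the signs `sgn ψ x = ± 1` of the coordinate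
frames `∂₁ψ(x), …, ∂ₘψ(x)` of the local parametrizations `ψ`: the sign is locally constant and two
frames at the same point have the same sign iff their transition matrix `A` has positive
determinant. (By convention `sgn ψ x = 0` outside the domain of `ψ`.) -/
structure OrientedSubmanifold where
  ambient : ℕ
  dim : ℕ
  dim_le : dim ≤ ambient
  carrier : Set (Fin ambient → ℝ)
  exists_param : ∀ p ∈ carrier, ∃ ψ : LocalParam carrier dim, ∃ x ∈ ψ.source, ψ x = p
  sgn : LocalParam carrier dim → (Fin dim → ℝ) → SignType
  sgn_eq_zero_iff : ∀ ψ x, sgn ψ x = 0 ↔ x ∉ ψ.source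
  sgn_locallyConst : ∀ ψ, ∀ x ∈ ψ.source, ∀ᶠ x' in 𝓝 x, sgn ψ x' = sgn ψ x
  sgn_compat : ∀ (ψ χ : LocalParam carrier dim) (x y : Fin dim → ℝ)
    (A : (Fin dim → ℝ) →L[ℝ] (Fin dim → ℝ)), x ∈ ψ.source → y ∈ χ.source → ψ x = χ y →
    fderiv ℝ ψ x = (fderiv ℝ χ y).comp A → sgn ψ x = SignType.sign A.det * sgn χ y

/-- Local parametrizations of an oriented submanifold. -/
abbrev OrientedSubmanifold.Param (U : OrientedSubmanifold) := LocalParam U.carrier U.dim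

/-! ### Smooth maps and submersions -/

section Smooth

variable {E : Type*} [NormedAddCommGroup E] [NormedSpace ℝ E] {H : Type*} [TopologicalSpace H]
  (I : ModelWithCorners ℝ E H) {M : Type*} [TopologicalSpace M] [ChartedSpace H M]

/-- `C^∞` maps from a submanifold of a Euclidean space to a manifold. -/
def IsSmoothMap (U : OrientedSubmanifold) (f : U.carrier → M) : Prop :=
  ∀ ψ : U.Param, ContMDiff 𝓘(ℝ, Fin U.dim → ℝ) I ∞ (fun x : ψ.source => f (ψ.lift x))

end Smooth

open Classical in
/-- Coordinate expression of a map between submanifolds (extended by `0` outside the domain of the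
parametrization). -/
def coordMap {V U : OrientedSubmanifold} (π : V.carrier → U.carrier) (ψ : V.Param) :
    (Fin V.dim → ℝ) → (Fin U.ambient → ℝ) :=
  fun x => if hx : x ∈ ψ.source then (π (ψ.lift ⟨x, hx⟩) : Fin U.ambient → ℝ) else 0

/-- Submersions: `C^∞` maps all of whose differentials are surjective. Here the tangent space of `U`
at `χ y` is the range of the differential of `χ` at `y`. -/
structure IsSubmersion (V U : OrientedSubmanifold) (π : V.carrier → U.carrier) : Prop where
  smooth : IsSmoothMap 𝓘(ℝ, Fin U.ambient → ℝ) V (fun p => (π p : Fin U.ambient → ℝ))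
  surjective : ∀ (ψ : V.Param) (x : ψ.source) (χ : U.Param) (y : χ.source),
    π (ψ.lift x) = χ.lift y →
    LinearMap.range (fderiv ℝ χ y : (Fin U.dim → ℝ) →ₗ[ℝ] (Fin U.ambient → ℝ)) ≤
      LinearMap.range (fderiv ℝ (coordMap π ψ) x : (Fin V.dim → ℝ) →ₗ[ℝ] (Fin U.ambient → ℝ))

lemma coordMap_apply {V U : OrientedSubmanifold} (π : V.carrier → U.carrier) (ψ : V.Param)
    {x : Fin V.dim → ℝ} (hx : x ∈ ψ.source) :
    coordMap π ψ x = (π (ψ.lift ⟨x, hx⟩) : Fin U.ambient → ℝ) := by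
  simp [coordMap, hx]

lemma contDiffAt_coordMap {V U : OrientedSubmanifold} {π : V.carrier → U.carrier}
    (hπ : IsSmoothMap 𝓘(ℝ, Fin U.ambient → ℝ) V (fun p => (π p : Fin U.ambient → ℝ)))
    (ψ : V.Param) {x : Fin V.dim → ℝ} (hx : x ∈ ψ.source) :
    ContDiffAt ℝ ∞ (coordMap π ψ) x := by
  have h1 : ContMDiffAt 𝓘(ℝ, Fin V.dim → ℝ) 𝓘(ℝ, Fin U.ambient → ℝ) ∞
      (fun z : ψ.source => coordMap π ψ z) ⟨x, hx⟩ := by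
    have : (fun z : ψ.source => coordMap π ψ z) = fun z => ((π (ψ.lift z) : U.carrier) :
        Fin U.ambient → ℝ) := by
      funext z; exact coordMap_apply π ψ z.2
    rw [this]
    exact hπ ψ ⟨x, hx⟩
  exact (contMDiffAt_subtype_iff.mp h1).contDiffAt

lemma IsSmoothMap.comp {E : Type*} [NormedAddCommGroup E] [NormedSpace ℝ E] {H : Type*}
    [TopologicalSpace H] {I : ModelWithCorners ℝ E H} {M : Type*} [TopologicalSpace M]
    [ChartedSpace H M] {V U : OrientedSubmanifold} {f : U.carrier → M} {π : V.carrier → U.carrier}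
    (hf : IsSmoothMap I U f)
    (hπ : IsSmoothMap 𝓘(ℝ, Fin U.ambient → ℝ) V (fun p => (π p : Fin U.ambient → ℝ))) :
    IsSmoothMap I V (f ∘ π) := by
  classical
  intro ψ x
  obtain ⟨χ, y, hy, hχ⟩ := U.exists_param (π (ψ.lift x)) (π (ψ.lift x)).2
  have hc := coordMap_apply π ψ x.2
  obtain ⟨τ, hτ, hτx, hev⟩ := χ.exists_factor hy (contDiffAt_coordMap hπ ψ x.2)
    (hc.trans hχ.symm) (by
      filter_upwards [ψ.source.isOpen.mem_nhds x.2] with x' hx'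
      rw [coordMap_apply π ψ hx']; exact (π _).2)
  let G : (Fin U.dim → ℝ) → M := fun z =>
    if h : z ∈ χ.source then f (χ.lift ⟨z, h⟩) else f (π (ψ.lift x))
  have hG : ContMDiffAt 𝓘(ℝ, Fin U.dim → ℝ) I ∞ G y := by
    have h1 : ContMDiffAt 𝓘(ℝ, Fin U.dim → ℝ) I ∞ (fun z : χ.source => G z) ⟨y, hy⟩ := by
      have : (fun z : χ.source => G z) = fun z => f (χ.lift z) := by
        funext z; simp [G]
      rw [this]; exact hf χ ⟨y, hy⟩
    exact contMDiffAt_subtype_iff.mp h1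
  have hF : ContMDiffAt 𝓘(ℝ, Fin V.dim → ℝ) I ∞ (G ∘ τ) x := by
    apply ContMDiffAt.comp (I' := 𝓘(ℝ, Fin U.dim → ℝ))
    · rw [hτx]; exact hG
    · exact hτ.contMDiffAt
  have hF' : ContMDiffAt 𝓘(ℝ, Fin V.dim → ℝ) I ∞ (fun z : ψ.source => (G ∘ τ) z) x :=
    contMDiffAt_subtype_iff.mpr hF
  refine hF'.congr_of_eventuallyEq ?_
  have hev' : ∀ᶠ z : ψ.source in 𝓝 x, τ z ∈ χ.source ∧ coordMap π ψ z = χ (τ z) :=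
    continuous_subtype_val.continuousAt.eventually hev
  filter_upwards [hev'] with z hz
  have : π (ψ.lift z) = χ.lift ⟨τ z, hz.1⟩ := by
    apply Subtype.ext
    exact (coordMap_apply π ψ z.2).symm.trans hz.2
  simp [G, hz.1, this]

/-! ### Differential forms -/

/-- Families of coordinate expressions of `j`-forms on `U`. -/
abbrev CoordForm (U : OrientedSubmanifold) (j : ℕ) :=
  U.Param → (Fin U.dim → ℝ) → (Fin U.dim → ℝ) [⋀^Fin j]→L[ℝ] ℝ

/-- `C^∞` differential `j`-forms on `U`, given by their coordinate expressions (pullbacks)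
`α ψ = ψ^*α` in all local parametrizations `ψ`; these are smooth and compatible with changes of
coordinates, where `A` is the derivative of the change of coordinates. (By convention `α ψ`
vanishes outside the domain of `ψ`.) -/
structure IsDifferentialForm {U : OrientedSubmanifold} {j : ℕ} (α : CoordForm U j) : Prop where
  eq_zero : ∀ ψ, ∀ x ∉ ψ.source, α ψ x = 0
  smooth : ∀ ψ, ContDiffOn ℝ ∞ (α ψ) ψ.source
  compat : ∀ (ψ χ : U.Param) (x y : Fin U.dim → ℝ) (A : (Fin U.dim → ℝ) →L[ℝ] (Fin U.dim → ℝ)),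
    x ∈ ψ.source → y ∈ χ.source → ψ x = χ y →
    fderiv ℝ ψ x = (fderiv ℝ χ y).comp A → α ψ x = (α χ y).compContinuousLinearMap A

/-- The form `α` vanishes at all points of `U` outside of the subset `K`. -/
def VanishesOff {U : OrientedSubmanifold} {j : ℕ} (α : CoordForm U j)
    (K : Set (Fin U.ambient → ℝ)) : Prop :=
  ∀ (ψ : U.Param), ∀ x ∈ ψ.source, ψ x ∉ K → α ψ x = 0

/-- The space of compactly supported `C^∞` differential `j`-forms on `U`. -/
def compactForms (U : OrientedSubmanifold) (j : ℕ) : Submodule ℝ (CoordForm U j) where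
  carrier := {α | IsDifferentialForm α ∧ ∃ K, IsCompact K ∧ K ⊆ U.carrier ∧ VanishesOff α K}
  zero_mem' := ⟨⟨fun _ _ _ => rfl, fun _ => contDiffOn_const,
    fun _ _ _ _ _ _ _ _ _ => by ext; simp⟩,
    ∅, isCompact_empty, empty_subset _, fun _ _ _ _ => rfl⟩
  add_mem' := by
    rintro α β ⟨hα, K, hK, hKU, hαK⟩ ⟨hβ, L, hL, hLU, hβL⟩
    refine ⟨⟨fun ψ x hx => ?_, fun ψ => (hα.smooth ψ).add (hβ.smooth ψ),
      fun ψ χ x y A hx hy h hA => ?_⟩, K ∪ L, hK.union hL, union_subset hKU hLU,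
      fun ψ x hx hxK => ?_⟩
    · simp [hα.eq_zero ψ x hx, hβ.eq_zero ψ x hx]
    · ext v
      simp [hα.compat ψ χ x y A hx hy h hA, hβ.compat ψ χ x y A hx hy h hA]
    · rw [mem_union, not_or] at hxK
      simp [hαK ψ x hx hxK.1, hβL ψ x hx hxK.2]
  smul_mem' := by
    rintro c α ⟨hα, K, hK, hKU, hαK⟩
    refine ⟨⟨fun ψ x hx => ?_, fun ψ => (hα.smooth ψ).const_smul c,
      fun ψ χ x y A hx hy h hA => ?_⟩, K, hK, hKU, fun ψ x hx hxK => ?_⟩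
    · simp [hα.eq_zero ψ x hx]
    · ext v
      simp [hα.compat ψ χ x y A hx hy h hA]
    · simp [hαK ψ x hx hxK]

instance (U : OrientedSubmanifold) (j : ℕ) : AddCommGroup (compactForms U j) :=
  Submodule.addCommGroup (compactForms U j)

lemma IsDifferentialForm.contDiffAt {U : OrientedSubmanifold} {j : ℕ} {α : CoordForm U j}
    (hα : IsDifferentialForm α) (ψ : U.Param) {x : Fin U.dim → ℝ} (hx : x ∈ ψ.source) :
    ContDiffAt ℝ ∞ (α ψ) x :=
  (hα.smooth ψ).contDiffAt (ψ.source.isOpen.mem_nhds hx)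

/-- The exterior derivative, computed in local coordinates. -/
def extD {U : OrientedSubmanifold} {j : ℕ} (α : CoordForm U j) : CoordForm U (j + 1) :=
  fun ψ => (ψ.source : Set (Fin U.dim → ℝ)).indicator (extDeriv (α ψ))

lemma extD_apply {U : OrientedSubmanifold} {j : ℕ} (α : CoordForm U j) (ψ : U.Param)
    {x : Fin U.dim → ℝ} (hx : x ∈ ψ.source) : extD α ψ x = extDeriv (α ψ) x :=
  indicator_of_mem (s := (ψ.source : Set (Fin U.dim → ℝ))) hx _

lemma extD_apply_of_notMem {U : OrientedSubmanifold} {j : ℕ} (α : CoordForm U j) (ψ : U.Param)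
    {x : Fin U.dim → ℝ} (hx : x ∉ ψ.source) : extD α ψ x = 0 :=
  indicator_of_notMem (s := (ψ.source : Set (Fin U.dim → ℝ))) hx _

lemma minSmoothness_le : minSmoothness ℝ 2 ≤ ∞ := by
  rw [minSmoothness_of_isRCLikeNormedField]
  exact WithTop.coe_le_coe.mpr (le_top : (2 : ℕ∞) ≤ ⊤)

lemma contDiffAt_extDeriv {m j : ℕ} {f : (Fin m → ℝ) → (Fin m → ℝ) [⋀^Fin j]→L[ℝ] ℝ}
    {x : Fin m → ℝ} (hf : ContDiffAt ℝ ∞ f x) : ContDiffAt ℝ ∞ (extDeriv f) x := by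
  have h1 : ContDiffAt ℝ ∞ (fderiv ℝ f) x := hf.fderiv_right (by simp)
  exact (ContinuousAlternatingMap.alternatizeUncurryFinCLM ℝ (Fin m → ℝ) ℝ
    (n := j)).contDiff.contDiffAt.comp x h1

lemma IsDifferentialForm.extD {U : OrientedSubmanifold} {j : ℕ} {α : CoordForm U j}
    (hα : IsDifferentialForm α) : IsDifferentialForm (extD α) := by
  refine ⟨fun ψ x hx => extD_apply_of_notMem α ψ hx, fun ψ => ?_, fun ψ χ x y A hx hy h hA => ?_⟩
  · have h1 : ContDiffOn ℝ ∞ (extDeriv (α ψ)) ψ.source := fun x hx =>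
      (contDiffAt_extDeriv (hα.contDiffAt ψ hx)).contDiffWithinAt
    exact h1.congr fun x hx => extD_apply α ψ hx
  · obtain ⟨τ, hτ, hτx, hev⟩ := χ.exists_factor hy (ψ.contDiffAt hx) h (by
      filter_upwards [ψ.source.isOpen.mem_nhds hx] with x' hx' using ψ.mem x' hx')
    have key : ∀ᶠ x' in 𝓝 x, fderiv ℝ ψ x' = (fderiv ℝ χ (τ x')).comp (fderiv ℝ τ x') := by
      have hdiff : ∀ᶠ x' in 𝓝 x, DifferentiableAt ℝ τ x' := by
        have h1 : ContDiffAt ℝ 1 τ x := hτ.of_le (by simp)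
        filter_upwards [h1.eventually (by simp)] with x' hx' using hx'.differentiableAt (by simp)
      filter_upwards [hev.eventually_nhds, hdiff] with x' h1 h2
      have h3 : ψ.toFun =ᶠ[𝓝 x'] fun z => χ (τ z) := h1.mono fun z hz => hz.2
      rw [h3.fderiv_eq]
      exact fderiv_comp x' ((χ.contDiffAt h1.self_of_nhds.1).differentiableAt (by simp)) h2
    have hAτ : A = fderiv ℝ τ x := by
      have h1 := key.self_of_nhds
      rw [hτx, hA] at h1
      ext v : 1
      apply χ.immersive y hy
      exact congrArg (fun g => g v) h1
    have heq : α ψ =ᶠ[𝓝 x] fun x' =>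
        (α χ (τ x')).compContinuousLinearMap (fderiv ℝ τ x') := by
      filter_upwards [hev, key, ψ.source.isOpen.mem_nhds hx] with x' h1 h2 h3
      exact hα.compat ψ χ x' (τ x') _ h3 h1.1 h1.2 h2
    rw [extD_apply α ψ hx, extD_apply α χ hy, heq.extDeriv_eq, hAτ]
    have h2 := extDeriv_pullback (f := τ) (x := x) (r := ∞)
      (by rw [hτx]; exact (hα.contDiffAt χ hy).differentiableAt (by simp)) hτ minSmoothness_le
    rw [h2, hτx]

lemma VanishesOff.extD {U : OrientedSubmanifold} {j : ℕ} {α : CoordForm U j}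
    {K : Set (Fin U.ambient → ℝ)} (hK : IsCompact K) (hα : VanishesOff α K) :
    VanishesOff (extD α) K := by
  intro ψ x hx hxK
  have hψ := (ψ.contDiffAt hx).continuousAt
  have h1 : α ψ =ᶠ[𝓝 x] fun _ => 0 := by
    filter_upwards [ψ.source.isOpen.mem_nhds hx,
      hψ.preimage_mem_nhds (hK.isClosed.isOpen_compl.mem_nhds hxK)] with x' h1 h2
    exact hα ψ x' h1 h2
  rw [extD_apply α ψ hx, h1.extDeriv_eq]
  have h2 : extDeriv (fun _ : Fin U.dim → ℝ => (0 : (Fin U.dim → ℝ) [⋀^Fin j]→L[ℝ] ℝ)) x = 0 := by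
    ext v
    rw [extDeriv_apply (differentiableAt_const _)]
    simp
  exact h2

/-- The exterior derivative on compactly supported forms. -/
def extDForm (U : OrientedSubmanifold) (j : ℕ) :
    compactForms U j →ₗ[ℝ] compactForms U (j + 1) where
  toFun α := ⟨extD α.1, α.2.1.extD, by
    obtain ⟨K, hK, hKU, h⟩ := α.2.2
    exact ⟨K, hK, hKU, h.extD hK⟩⟩
  map_add' α β := by
    apply Subtype.ext
    funext ψ x
    by_cases hx : x ∈ ψ.source
    · have h := extDeriv_add ((α.2.1.contDiffAt ψ hx).differentiableAt (by simp))
        ((β.2.1.contDiffAt ψ hx).differentiableAt (by simp))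
      simpa [extD_apply _ ψ hx] using h
    · simp [extD_apply_of_notMem _ ψ hx]
  map_smul' c α := by
    apply Subtype.ext
    funext ψ x
    by_cases hx : x ∈ ψ.source
    · have h := extDeriv_smul (x := x) c (α.1 ψ)
      simpa [extD_apply _ ψ hx] using h
    · simp [extD_apply_of_notMem _ ψ hx]

lemma extDForm_extDForm (U : OrientedSubmanifold) (j : ℕ) (α : compactForms U j) :
    extDForm U (j + 1) (extDForm U j α) = 0 := by
  apply Subtype.ext
  funext ψ x
  change extD (extD α.1) ψ x = 0
  by_cases hx : x ∈ ψ.source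
  · have h1 : extD α.1 ψ =ᶠ[𝓝 x] extDeriv (α.1 ψ) := by
      filter_upwards [ψ.source.isOpen.mem_nhds hx] with x' h using extD_apply _ ψ h
    rw [extD_apply _ ψ hx, h1.extDeriv_eq]
    exact extDeriv_extDeriv_apply (α.2.1.contDiffAt ψ hx) minSmoothness_le
  · exact extD_apply_of_notMem _ ψ hx

end DeRhamChain

namespace DeRhamChain

/-! ### Integration along fibers -/

/-- The point `(x, y)` of `ℝᵐ × ℝʳ = ℝᵐ⁺ʳ`. -/
def join {m r m' : ℕ} (h : m' = m + r) (x : Fin m → ℝ) (y : Fin r → ℝ) : Fin m' → ℝ :=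
  fun i => Fin.append x y (Fin.cast h i)

/-- The vectors `(v₁, 0), …, (vⱼ, 0), (0, e₁), …, (0, eᵣ)` of `ℝᵐ × ℝʳ = ℝᵐ⁺ʳ`. -/
def frame {m r m' i j : ℕ} (h : m' = m + r) (hi : i = j + r) (v : Fin j → Fin m → ℝ) :
    Fin i → Fin m' → ℝ :=
  fun a => Fin.append (fun b => join h (v b) 0) (fun c => join h 0 (Pi.single c 1)) (Fin.cast hi a)

section Calculus

variable {m r m' : ℕ}

lemma join_add (h : m' = m + r) (x x' : Fin m → ℝ) (y y' : Fin r → ℝ) :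
    join h (x + x') (y + y') = join h x y + join h x' y' := by
  subst h
  funext i
  refine Fin.addCases (fun a => ?_) (fun a => ?_) i <;> simp [join]

lemma join_smul (h : m' = m + r) (c : ℝ) (x : Fin m → ℝ) (y : Fin r → ℝ) :
    join h (c • x) (c • y) = c • join h x y := by
  subst h
  funext i
  refine Fin.addCases (fun a => ?_) (fun a => ?_) i <;> simp [join]

/-- `join` as a continuous linear map. -/
def joinL (h : m' = m + r) : ((Fin m → ℝ) × (Fin r → ℝ)) →L[ℝ] (Fin m' → ℝ) :=
  LinearMap.toContinuousLinearMap
    { toFun := fun p => join h p.1 p.2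
      map_add' := fun _ _ => join_add h _ _ _ _
      map_smul' := fun c _ => join_smul h c _ _ }

lemma joinL_apply (h : m' = m + r) (x : Fin m → ℝ) (y : Fin r → ℝ) :
    joinL h (x, y) = join h x y := rfl

/-- Fiber coordinates. -/
def fiberCoord (h : m' = m + r) (z : Fin m' → ℝ) : Fin r → ℝ :=
  fun c => z (Fin.cast h.symm (Fin.natAdd m c))

lemma fiberCoord_join (h : m' = m + r) (x : Fin m → ℝ) (y : Fin r → ℝ) :
    fiberCoord h (join h x y) = y := by
  subst h
  funext c
  simp [fiberCoord, join]

lemma continuous_fiberCoord (h : m' = m + r) : Continuous (fiberCoord (m := m) (r := r) h) :=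
  continuous_pi fun _ => continuous_apply _

variable {g : (Fin m' → ℝ) → ℝ}

lemma hasCompactSupport_fiber {F : Type*} [Zero F] {g : (Fin m' → ℝ) → F}
    (h : m' = m + r) (hc : HasCompactSupport g) (x : Fin m → ℝ) :
    HasCompactSupport fun y : Fin r → ℝ => g (join h x y) := by
  refine HasCompactSupport.intro (hc.isCompact.image (continuous_fiberCoord h)) fun y hy => ?_
  by_contra hne
  exact hy ⟨join h x y, subset_tsupport _ hne, fiberCoord_join h x y⟩

lemma hasFDerivAt_join_fiber (h : m' = m + r) (hg : ContDiff ℝ ∞ g) (x : Fin m → ℝ)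
    (y : Fin r → ℝ) :
    HasFDerivAt (fun y => g (join h x y))
      (((fderiv ℝ g (join h x y)).comp (joinL h)).comp
        (ContinuousLinearMap.inr ℝ (Fin m → ℝ) (Fin r → ℝ))) y := by
  have h1 : HasFDerivAt (fun y : Fin r → ℝ => joinL h (x, y))
      ((joinL h).comp (ContinuousLinearMap.inr ℝ (Fin m → ℝ) (Fin r → ℝ))) y :=
    (joinL h).hasFDerivAt.comp y (hasFDerivAt_prodMk_right x y)
  exact ((hg.differentiable (by simp)) (join h x y)).hasFDerivAt.comp y h1

lemma hasFDerivAt_join_base (h : m' = m + r) (hg : ContDiff ℝ ∞ g) (x : Fin m → ℝ)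
    (y : Fin r → ℝ) :
    HasFDerivAt (fun x => g (join h x y))
      (((fderiv ℝ g (join h x y)).comp (joinL h)).comp
        (ContinuousLinearMap.inl ℝ (Fin m → ℝ) (Fin r → ℝ))) x := by
  have h1 : HasFDerivAt (fun x : Fin m → ℝ => joinL h (x, y))
      ((joinL h).comp (ContinuousLinearMap.inl ℝ (Fin m → ℝ) (Fin r → ℝ))) x :=
    (joinL h).hasFDerivAt.comp x (hasFDerivAt_prodMk_left x y)
  exact ((hg.differentiable (by simp)) (join h x y)).hasFDerivAt.comp x h1

lemma continuous_join_fiber (h : m' = m + r) (x : Fin m → ℝ) :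
    Continuous fun y : Fin r → ℝ => join h x y :=
  (joinL h).continuous.comp (Continuous.prodMk_right x)

/-- The integral of a derivative in a fiber direction vanishes. -/
lemma integral_fderiv_fiber (h : m' = m + r) (hg : ContDiff ℝ ∞ g) (hc : HasCompactSupport g)
    (x : Fin m → ℝ) (w : Fin r → ℝ) :
    ∫ y, fderiv ℝ g (join h x y) (join h 0 w) = 0 := by
  have hd : Differentiable ℝ fun y : Fin r → ℝ => g (join h x y) := fun y =>
    (hasFDerivAt_join_fiber h hg x y).differentiableAt
  have hcs := hasCompactSupport_fiber h hc x
  have hcont : Continuous fun y : Fin r → ℝ => g (join h x y) := hd.continuous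
  have heq : ∀ y, fderiv ℝ (fun y : Fin r → ℝ => g (join h x y)) y w
      = fderiv ℝ g (join h x y) (join h 0 w) := fun y => by
    rw [(hasFDerivAt_join_fiber h hg x y).fderiv]; rfl
  have hc' : HasCompactSupport fun z => fderiv ℝ g z (join h 0 w) :=
    hc.fderiv_apply (𝕜 := ℝ) (join h 0 w)
  have hint : Integrable fun y : Fin r → ℝ => fderiv ℝ g (join h x y) (join h 0 w) := by
    refine Continuous.integrable_of_hasCompactSupport ?_ (hasCompactSupport_fiber h hc' x)
    exact ((hg.continuous_fderiv (by simp)).comp (continuous_join_fiber h x)).clm_apply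
      continuous_const
  have key := integral_mul_fderiv_eq_neg_fderiv_mul_of_integrable (μ := volume)
    (f := fun _ : Fin r → ℝ => (1 : ℝ)) (g := fun y : Fin r → ℝ => g (join h x y)) (v := w)
    (by simp) (by simpa [heq] using hint)
    (by simpa using hcont.integrable_of_hasCompactSupport hcs)
    (fun _ _ => differentiableAt_const _) (fun z _ => hd z)
  simpa [heq] using key

/-- Differentiation under the integral sign over the fibers. -/
lemma fderiv_integral_fiber (h : m' = m + r) (hg : ContDiff ℝ ∞ g) (hc : HasCompactSupport g)
    (x u : Fin m → ℝ) :
    DifferentiableAt ℝ (fun x => ∫ y : Fin r → ℝ, g (join h x y)) x ∧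
    fderiv ℝ (fun x => ∫ y : Fin r → ℝ, g (join h x y)) x u =
      ∫ y : Fin r → ℝ, fderiv ℝ g (join h x y) (join h u 0) := by
  let F' : (Fin m → ℝ) → (Fin r → ℝ) → (Fin m → ℝ) →L[ℝ] ℝ := fun x y =>
    ((fderiv ℝ g (join h x y)).comp (joinL h)).comp
      (ContinuousLinearMap.inl ℝ (Fin m → ℝ) (Fin r → ℝ))
  let R : ((Fin m' → ℝ) →L[ℝ] ℝ) →L[ℝ] ((Fin m → ℝ) →L[ℝ] ℝ) :=
    ContinuousLinearMap.precomp ℝ ((joinL h).comp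
      (ContinuousLinearMap.inl ℝ (Fin m → ℝ) (Fin r → ℝ)))
  have hF'R : ∀ x y, F' x y = R (fderiv ℝ g (join h x y)) := fun x y => rfl
  have hcd : HasCompactSupport fun z => R (fderiv ℝ g z) :=
    (hc.fderiv (𝕜 := ℝ)).comp_left (g := R) (map_zero R)
  have hcont : Continuous fun z => R (fderiv ℝ g z) :=
    R.continuous.comp (hg.continuous_fderiv (by simp))
  obtain ⟨C, hC⟩ := hcd.exists_bound_of_continuous hcont
  let Kr : Set (Fin r → ℝ) := fiberCoord h '' tsupport fun z => R (fderiv ℝ g z)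
  have hKr : IsCompact Kr := hcd.isCompact.image (continuous_fiberCoord h)
  have hF'c : ∀ x, Continuous (F' x) := fun x => hcont.comp (continuous_join_fiber h x)
  have hgc : ∀ x, Continuous fun y : Fin r → ℝ => g (join h x y) := fun x =>
    hg.continuous.comp (continuous_join_fiber h x)
  have key := hasFDerivAt_integral_of_dominated_of_fderiv_le (𝕜 := ℝ) (μ := volume)
    (F := fun x (y : Fin r → ℝ) => g (join h x y)) (F' := F') (x₀ := x) (s := univ)
    (bound := Kr.indicator fun _ => C) Filter.univ_mem
    (Filter.Eventually.of_forall fun x => (hgc x).aestronglyMeasurable)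
    ((hgc x).integrable_of_hasCompactSupport (hasCompactSupport_fiber h hc x))
    (hF'c x).aestronglyMeasurable
    (Filter.Eventually.of_forall fun y x _ => by
      by_cases hy : y ∈ Kr
      · rw [indicator_of_mem hy]; exact hC _
      · rw [indicator_of_notMem hy]
        have : F' x y = 0 := by
          by_contra hne
          exact hy ⟨join h x y, subset_tsupport _ hne, fiberCoord_join h x y⟩
        simp [this])
    ((integrable_indicator_iff hKr.measurableSet).mpr
      (integrableOn_const hKr.measure_lt_top.ne))
    (Filter.Eventually.of_forall fun y x _ => hasFDerivAt_join_base h hg x y)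
  refine ⟨key.differentiableAt, ?_⟩
  have hint : Integrable (F' x) :=
    (hF'c x).integrable_of_hasCompactSupport (hasCompactSupport_fiber h hcd x)
  rw [key.fderiv, ContinuousLinearMap.integral_apply hint]
  rfl

lemma frame_castAdd {i j : ℕ} (h : m' = m + r) (hi : i = j + r) (v : Fin j → Fin m → ℝ)
    (a : Fin j) : frame h hi v (Fin.cast hi.symm (Fin.castAdd r a)) = join h (v a) 0 := by
  subst hi; simp [frame]

lemma frame_natAdd {i j : ℕ} (h : m' = m + r) (hi : i = j + r) (v : Fin j → Fin m → ℝ)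
    (c : Fin r) :
    frame h hi v (Fin.cast hi.symm (Fin.natAdd j c)) = join h 0 (Pi.single c 1) := by
  subst hi; simp [frame]

/-- The fiber integral of the exterior derivative of a compactly supported form. -/
lemma integral_extDeriv_frame {i j : ℕ} (h : m' = m + r) (hi : i + 1 = j + r)
    {G : (Fin m' → ℝ) → (Fin m' → ℝ) [⋀^Fin i]→L[ℝ] ℝ} (hG : ContDiff ℝ ∞ G)
    (hc : HasCompactSupport G) (x : Fin m → ℝ) (v : Fin j → Fin m → ℝ) :
    ∫ y, extDeriv G (join h x y) (frame h hi v) =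
      ∑ a : Fin j, (-1) ^ a.val * ∫ y, fderiv ℝ (fun z => G z
        ((Fin.cast hi.symm (Fin.castAdd r a)).removeNth (frame h hi v)))
          (join h x y) (join h (v a) 0) := by
  have hs : ∀ w : Fin i → Fin m' → ℝ, ContDiff ℝ ∞ fun z => G z w := fun w =>
    (ContinuousAlternatingMap.apply ℝ (Fin m' → ℝ) ℝ w).contDiff.comp hG
  have hcs : ∀ w : Fin i → Fin m' → ℝ, HasCompactSupport fun z => G z w := fun w =>
    hc.comp_left (g := fun A : (Fin m' → ℝ) [⋀^Fin i]→L[ℝ] ℝ => A w) rfl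
  have hint : ∀ (w : Fin i → Fin m' → ℝ) (u : Fin m' → ℝ),
      Integrable fun y : Fin r → ℝ => fderiv ℝ (fun z => G z w) (join h x y) u := fun w u => by
    refine Continuous.integrable_of_hasCompactSupport ?_
      (hasCompactSupport_fiber h ((hcs w).fderiv_apply (𝕜 := ℝ) u) x)
    exact (((hs w).continuous_fderiv (by simp)).comp (continuous_join_fiber h x)).clm_apply
      continuous_const
  have h1 : ∀ y : Fin r → ℝ, extDeriv G (join h x y) (frame h hi v) =
      ∑ b : Fin (i + 1), (-1) ^ b.val * fderiv ℝ (fun z => G z (b.removeNth (frame h hi v)))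
        (join h x y) (frame h hi v b) := fun y => by
    rw [extDeriv_apply ((hG.differentiable (by simp)) _)]
    simp
  simp_rw [h1]
  rw [integral_finsetSum _ fun b _ => (hint _ _).const_mul _]
  rw [← Equiv.sum_comp (finCongr hi.symm), Fin.sum_univ_add]
  have h2 : ∀ c : Fin r, ∫ y : Fin r → ℝ, (-1 : ℝ) ^ (finCongr hi.symm (Fin.natAdd j c)).val *
      fderiv ℝ (fun z => G z ((finCongr hi.symm (Fin.natAdd j c)).removeNth (frame h hi v)))
        (join h x y) (frame h hi v (finCongr hi.symm (Fin.natAdd j c))) = 0 := fun c => by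
    rw [integral_const_mul]
    have h3 : frame h hi v (finCongr hi.symm (Fin.natAdd j c)) = join h 0 (Pi.single c 1) :=
      frame_natAdd h hi v c
    rw [h3, integral_fderiv_fiber h (hs _) (hcs _), mul_zero]
  rw [Finset.sum_congr rfl fun c _ => h2 c, Finset.sum_const_zero, add_zero]
  refine Finset.sum_congr rfl fun a _ => ?_
  rw [integral_const_mul]
  have h3 : frame h hi v (finCongr hi.symm (Fin.castAdd r a)) = join h (v a) 0 :=
    frame_castAdd h hi v a
  rw [h3]
  rfl

lemma removeNth_frame {i j : ℕ} (h : m' = m + r) (hi : i = j + r) (hi' : i + 1 = (j + 1) + r)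
    (v : Fin (j + 1) → Fin m → ℝ) (a : Fin (j + 1)) :
    (Fin.cast hi'.symm (Fin.castAdd r a)).removeNth (frame h hi' v) =
      frame h hi (a.removeNth v) := by
  subst hi
  funext b
  refine Fin.addCases (fun b => ?_) (fun c => ?_) b
  · have h1 : (Fin.cast hi'.symm (Fin.castAdd r a)).succAbove (Fin.castAdd r b) =
        Fin.cast hi'.symm (Fin.castAdd r (a.succAbove b)) := by
      apply Fin.ext
      simp only [Fin.succAbove, Fin.lt_def, Fin.val_castSucc, Fin.val_castAdd, Fin.val_cast]
      split_ifs <;> simp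
    have h2 := frame_castAdd h rfl (a.removeNth v) b
    rw [Fin.removeNth, h1, frame_castAdd h hi' v]
    exact h2.symm
  · have h1 : (Fin.cast hi'.symm (Fin.castAdd r a)).succAbove (Fin.natAdd j c) =
        Fin.cast hi'.symm (Fin.natAdd (j + 1) c) := by
      apply Fin.ext
      have := a.2
      have h3 : ¬ (j + c.val < a.val) := by omega
      simp only [Fin.succAbove, Fin.lt_def, Fin.val_castSucc, Fin.val_castAdd, Fin.val_cast,
        Fin.val_natAdd, h3, if_false, Fin.val_succ]
      omega
    have h2 := frame_natAdd h rfl (a.removeNth v) c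
    rw [Fin.removeNth, h1, frame_natAdd h hi' v]
    exact h2.symm

end Calculus

/-- Local parametrizations `ψ` of `V` and `χ` of `U` in which the map `π : V → U` is the standard
projection `(x, y) ↦ x` of `ℝᵐ × ℝʳ` to `ℝᵐ`. -/
structure AdaptedParams {V U : OrientedSubmanifold} (π : V.carrier → U.carrier) where
  r : ℕ
  dim_eq : V.dim = U.dim + r
  ψ : V.Param
  χ : U.Param
  adapted : ∀ (x : Fin U.dim → ℝ) (y : Fin r → ℝ) (hz : join dim_eq x y ∈ ψ.source),
    ∃ hx : x ∈ χ.source, π (ψ.lift ⟨join dim_eq x y, hz⟩) = χ.lift ⟨x, hx⟩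

/-- The support of `α` is compact and contained in the image of the local parametrization `ψ`. -/
def SupportedIn {V : OrientedSubmanifold} {i : ℕ} (α : CoordForm V i) (ψ : V.Param) : Prop :=
  ∃ K : Set (Fin V.dim → ℝ), IsCompact K ∧ K ⊆ ψ.source ∧ VanishesOff α (ψ '' K)

/-- `β = π_! α` for a form `α` with compact support in the image of a parametrization `ψ` as in
`AdaptedParams`. In the coordinates `(x, y)` and `x`,
`β (v₁, …, vⱼ)` at `x` is the integral over `y` of `± α (v₁, …, vⱼ, ∂/∂y₁, …, ∂/∂yᵣ)` at `(x, y)`,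
that is to say `∫ u(x, y) dy₁ ⋯ dyᵣ dx_I` for `α = u(x, y) dx_I dy₁ ⋯ dyᵣ`, and `0` for
`α = u(x, y) dx_I dy_J` with `|J| < r`. The sign is `+` iff the coordinate frames of `ψ` and `χ`
are both positive or both negative. -/
structure IsFiberIntegral {V U : OrientedSubmanifold} {π : V.carrier → U.carrier}
    (a : AdaptedParams π) {i j : ℕ} (hi : i = j + a.r) (α : CoordForm V i) (β : CoordForm U j) :
    Prop where
  supported : SupportedIn α a.ψ
  supported' : SupportedIn β a.χ
  formula : ∀ x ∈ a.χ.source, ∀ v : Fin j → Fin U.dim → ℝ,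
    β a.χ x v = ∫ y : Fin a.r → ℝ,
      ((V.sgn a.ψ (join a.dim_eq x y) : ℝ) * (U.sgn a.χ x : ℝ)) *
        α a.ψ (join a.dim_eq x y) (frame a.dim_eq hi v)

/-- A form with compact support in the image of `ψ`, multiplied by the sign of `ψ`, as a form on a
Euclidean space. -/
def signedForm {V : OrientedSubmanifold} {i : ℕ} (α : CoordForm V i) (ψ : V.Param) :
    (Fin V.dim → ℝ) → (Fin V.dim → ℝ) [⋀^Fin i]→L[ℝ] ℝ :=
  fun z => (V.sgn ψ z : ℝ) • α ψ z

lemma signedForm_spec {V : OrientedSubmanifold} {i : ℕ} {α : CoordForm V i} {ψ : V.Param}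
    (hα : IsDifferentialForm α) (hs : SupportedIn α ψ) :
    ContDiff ℝ ∞ (signedForm α ψ) ∧ HasCompactSupport (signedForm α ψ) ∧
      ∀ z, extDeriv (signedForm α ψ) z = (V.sgn ψ z : ℝ) • extD α ψ z := by
  obtain ⟨K, hK, hKs, hv⟩ := hs
  have hzero : ∀ z ∉ K, signedForm α ψ z = 0 := fun z hz => by
    by_cases hzs : z ∈ ψ.source
    · have : ψ z ∉ ψ '' K := by
        rintro ⟨w, hw, hwz⟩
        exact hz (ψ.injOn (hKs hw) hzs hwz ▸ hw)
      simp [signedForm, hv ψ z hzs this]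
    · simp [signedForm, hα.eq_zero ψ z hzs]
  have hzero' : ∀ z ∉ K, signedForm α ψ =ᶠ[𝓝 z] fun _ => 0 := fun z hz => by
    filter_upwards [hK.isClosed.isOpen_compl.mem_nhds hz] with z' hz' using hzero z' hz'
  have hloc : ∀ z ∈ ψ.source, signedForm α ψ =ᶠ[𝓝 z] (V.sgn ψ z : ℝ) • α ψ := fun z hz => by
    filter_upwards [V.sgn_locallyConst ψ z hz] with z' hz'
    simp [signedForm, hz']
  refine ⟨contDiff_iff_contDiffAt.mpr fun z => ?_, HasCompactSupport.intro hK hzero, fun z => ?_⟩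
  · by_cases hz : z ∈ ψ.source
    · exact ((hα.contDiffAt ψ hz).const_smul (V.sgn ψ z : ℝ)).congr_of_eventuallyEq (hloc z hz)
    · exact contDiffAt_const.congr_of_eventuallyEq (hzero' z fun h => hz (hKs h))
  · by_cases hz : z ∈ ψ.source
    · rw [(hloc z hz).extDeriv_eq, extDeriv_smul, extD_apply α ψ hz]
    · rw [(hzero' z fun h => hz (hKs h)).extDeriv_eq, extD_apply_of_notMem α ψ hz, smul_zero]
      ext v
      rw [extDeriv_apply (differentiableAt_const _)]
      simp

lemma SupportedIn.extD {V : OrientedSubmanifold} {i : ℕ} {α : CoordForm V i} {ψ : V.Param}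
    (hs : SupportedIn α ψ) : SupportedIn (extD α) ψ := by
  obtain ⟨K, hK, hKs, hv⟩ := hs
  exact ⟨K, hK, hKs, hv.extD (hK.image_of_continuousOn (ψ.smooth.continuousOn.mono hKs))⟩

/-- Integration along fibers commutes with the exterior derivative. -/
lemma IsFiberIntegral.extD {V U : OrientedSubmanifold} {π : V.carrier → U.carrier}
    {a : AdaptedParams π} {i j : ℕ} {hi : i = j + a.r} {α : CoordForm V i} {β : CoordForm U j}
    (hα : IsDifferentialForm α) (hβ : IsDifferentialForm β) (hab : IsFiberIntegral a hi α β)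
    (hi' : i + 1 = (j + 1) + a.r) : IsFiberIntegral a hi' (extD α) (extD β) := by
  refine ⟨hab.supported.extD, hab.supported'.extD, fun x hx v => ?_⟩
  obtain ⟨hG, hGc, hGd⟩ := signedForm_spec hα hab.supported
  have hs : ∀ w : Fin i → Fin V.dim → ℝ, ContDiff ℝ ∞ fun z => signedForm α a.ψ z w := fun w =>
    (ContinuousAlternatingMap.apply ℝ (Fin V.dim → ℝ) ℝ w).contDiff.comp hG
  have hcs : ∀ w : Fin i → Fin V.dim → ℝ, HasCompactSupport fun z => signedForm α a.ψ z w :=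
    fun w => hGc.comp_left (g := fun A : (Fin V.dim → ℝ) [⋀^Fin i]→L[ℝ] ℝ => A w) rfl
  have hloc : ∀ w : Fin j → Fin U.dim → ℝ, (fun x' => β a.χ x' w) =ᶠ[𝓝 x] fun x' =>
      (U.sgn a.χ x : ℝ) * ∫ y : Fin a.r → ℝ,
        signedForm α a.ψ (join a.dim_eq x' y) (frame a.dim_eq hi w) := fun w => by
    filter_upwards [U.sgn_locallyConst a.χ x hx, a.χ.source.isOpen.mem_nhds hx] with x' h1 h2
    rw [hab.formula x' h2 w, h1, ← integral_const_mul]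
    refine integral_congr_ae (Filter.Eventually.of_forall fun y => ?_)
    simp only [signedForm, ContinuousAlternatingMap.smul_apply, smul_eq_mul]
    ring
  rw [extD_apply β a.χ hx, extDeriv_apply ((hβ.contDiffAt a.χ hx).differentiableAt (by simp))]
  have hR : ∫ y : Fin a.r → ℝ, ((V.sgn a.ψ (join a.dim_eq x y) : ℝ) * (U.sgn a.χ x : ℝ)) *
      DeRhamChain.extD α a.ψ (join a.dim_eq x y) (frame a.dim_eq hi' v) = (U.sgn a.χ x : ℝ) *
        ∫ y : Fin a.r → ℝ, extDeriv (signedForm α a.ψ) (join a.dim_eq x y)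
          (frame a.dim_eq hi' v) := by
    rw [← integral_const_mul]
    refine integral_congr_ae (Filter.Eventually.of_forall fun y => ?_)
    simp only [hGd, ContinuousAlternatingMap.smul_apply, smul_eq_mul]
    ring
  rw [hR, integral_extDeriv_frame a.dim_eq hi' hG hGc x v, Finset.mul_sum]
  refine Finset.sum_congr rfl fun b _ => ?_
  rw [removeNth_frame a.dim_eq hi hi' v b, (hloc _).fderiv_eq]
  obtain ⟨hd, hf⟩ := fderiv_integral_fiber a.dim_eq (hs (frame a.dim_eq hi (b.removeNth v)))
    (hcs _) x (v b)
  rw [fderiv_const_mul hd, smul_apply, hf]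
  simp only [smul_eq_mul, zsmul_eq_mul, Int.cast_pow, Int.cast_neg, Int.cast_one]
  ring

/-- The zero `0`-form is the fiber integral of the exterior derivative of a form of degree
`r - 1`. -/
lemma isFiberIntegral_extD_zero {V U : OrientedSubmanifold} {π : V.carrier → U.carrier}
    (a : AdaptedParams π) {i : ℕ} {α : CoordForm V i} (hα : IsDifferentialForm α)
    (hs : SupportedIn α a.ψ) (hi : i + 1 = 0 + a.r) :
    IsFiberIntegral a hi (extD α) (0 : CoordForm U 0) := by
  refine ⟨hs.extD, ⟨∅, isCompact_empty, empty_subset _, fun _ _ _ _ => rfl⟩, fun x hx v => ?_⟩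
  obtain ⟨hG, hGc, hGd⟩ := signedForm_spec hα hs
  have hR : ∫ y : Fin a.r → ℝ, ((V.sgn a.ψ (join a.dim_eq x y) : ℝ) * (U.sgn a.χ x : ℝ)) *
      extD α a.ψ (join a.dim_eq x y) (frame a.dim_eq hi v) = (U.sgn a.χ x : ℝ) *
        ∫ y : Fin a.r → ℝ, extDeriv (signedForm α a.ψ) (join a.dim_eq x y)
          (frame a.dim_eq hi v) := by
    rw [← integral_const_mul]
    refine integral_congr_ae (Filter.Eventually.of_forall fun y => ?_)
    simp only [hGd, ContinuousAlternatingMap.smul_apply, smul_eq_mul]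
    ring
  rw [hR, integral_extDeriv_frame a.dim_eq hi hG hGc x v]
  simp

end DeRhamChain

namespace DeRhamChain

open CategoryTheory

/-! ### Differentiable spaces -/

/-- Differentiable spaces: sets with a family of plots, closed under composition with
submersions. -/
structure DiffSpace where
  carrier : Type u
  IsPlot : ∀ U : OrientedSubmanifold, (U.carrier → carrier) → Prop
  comp_submersion : ∀ {U V : OrientedSubmanifold} {φ : U.carrier → carrier}
    {π : V.carrier → U.carrier}, IsPlot U φ → IsSubmersion V U π → IsPlot V (φ ∘ π)

/-- Smooth maps between differentiable spaces. -/
structure SmoothHom (X : DiffSpace.{u}) (Y : DiffSpace.{v}) where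
  toFun : X.carrier → Y.carrier
  isPlot : ∀ {U : OrientedSubmanifold} {φ : U.carrier → X.carrier},
    X.IsPlot U φ → Y.IsPlot U (toFun ∘ φ)

/-- Composition of smooth maps. -/
def SmoothHom.comp {X Y Z : DiffSpace} (g : SmoothHom Y Z) (f : SmoothHom X Y) : SmoothHom X Z where
  toFun := g.toFun ∘ f.toFun
  isPlot h := g.isPlot (f.isPlot h)

/-- The differentiable structure on a manifold whose plots are all `C^∞` maps. -/
def DiffSpace.ofManifold {E : Type*} [NormedAddCommGroup E] [NormedSpace ℝ E] {H : Type*}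
    [TopologicalSpace H] (I : ModelWithCorners ℝ E H) (M : Type u) [TopologicalSpace M]
    [ChartedSpace H M] : DiffSpace.{u} where
  carrier := M
  IsPlot U φ := IsSmoothMap I U φ
  comp_submersion hφ hπ := hφ.comp hπ.smooth

/-- The differentiable structure on a subset of a differentiable space. -/
def DiffSpace.sub (X : DiffSpace.{u}) (Y : Set X.carrier) : DiffSpace.{u} where
  carrier := Y
  IsPlot U φ := X.IsPlot U (fun p => (φ p : X.carrier))
  comp_submersion hφ hπ := X.comp_submersion hφ hπ

/-- The Euclidean space `ℝᵏ` as a differentiable space. -/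
abbrev euclidean (k : ℕ) : DiffSpace.{0} := DiffSpace.ofManifold 𝓘(ℝ, Fin k → ℝ) (Fin k → ℝ)

/-! ### The de Rham chain complex -/

/-- Indices of the direct sum `⨁ 𝒜_c^{dim U - k}(U)` over the plots `(U, φ)` of `X`; plots with
`dim U - k < 0` contribute zero and are left out. -/
structure ChainIndex (X : DiffSpace.{u}) (k : ℕ) where
  U : OrientedSubmanifold
  φ : U.carrier → X.carrier
  isPlot : X.IsPlot U φ
  degree : ℕ
  degree_add : degree + k = U.dim

/-- The direct sum of the spaces `𝒜_c^{dim U - k}(U)` over all plots `(U, φ)` of `X`. -/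
abbrev PreChains (X : DiffSpace.{u}) (k : ℕ) : Type u :=
  DirectSum (ChainIndex X k) fun g => compactForms g.U g.degree

open Classical in
/-- The element `(U, φ, α)` of the direct sum. -/
def preMk {X : DiffSpace.{u}} {k : ℕ} {U : OrientedSubmanifold} (φ : U.carrier → X.carrier)
    (hφ : X.IsPlot U φ) {j : ℕ} (hj : j + k = U.dim) : compactForms U j →ₗ[ℝ] PreChains X k :=
  DirectSum.lof ℝ (ChainIndex X k) (fun g => compactForms g.U g.degree) ⟨U, φ, hφ, j, hj⟩

open Classical in
/-- Linear maps on the direct sum. -/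
def preLift {X : DiffSpace.{u}} {k : ℕ} {N : Type*} [AddCommGroup N] [Module ℝ N]
    (F : ∀ g : ChainIndex X k, compactForms g.U g.degree →ₗ[ℝ] N) : PreChains X k →ₗ[ℝ] N :=
  DirectSum.toModule ℝ (ChainIndex X k) N F

lemma preLift_preMk {X : DiffSpace.{u}} {k : ℕ} {N : Type*} [AddCommGroup N] [Module ℝ N]
    (F : ∀ g : ChainIndex X k, compactForms g.U g.degree →ₗ[ℝ] N) {U : OrientedSubmanifold}
    (φ : U.carrier → X.carrier) (hφ : X.IsPlot U φ) {j : ℕ} (hj : j + k = U.dim)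
    (α : compactForms U j) : preLift F (preMk φ hφ hj α) = F ⟨U, φ, hφ, j, hj⟩ α := by
  classical
  exact DirectSum.toModule_lof (M := fun g : ChainIndex X k => compactForms g.U g.degree) ℝ
    ⟨U, φ, hφ, j, hj⟩ α

/-- The relations `(U, φ, π_! α) - (V, φ ∘ π, α)` for submersions `π : V → U`. Integration along
fibers is defined by local charts and partitions of unity, so it suffices to take the relations for
forms `α` with compact support in the domain of a chart adapted to `π`; the others are linear
combinations of these. If `dim U < k`, then `π_! α` has negative degree `dim U - k` and is zero. -/
inductive IsRelation (X : DiffSpace.{u}) (k : ℕ) : PreChains X k → Prop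
  | fiber {U V : OrientedSubmanifold} (φ : U.carrier → X.carrier) (hφ : X.IsPlot U φ)
      (π : V.carrier → U.carrier) (hπ : IsSubmersion V U π) (a : AdaptedParams π) {i j : ℕ}
      (hi : i + k = V.dim) (hj : j + k = U.dim) (hij : i = j + a.r)
      (α : compactForms V i) (β : compactForms U j) (hαβ : IsFiberIntegral a hij α.1 β.1) :
      IsRelation X k (preMk φ hφ hj β - preMk (φ ∘ π) (X.comp_submersion hφ hπ) hi α)
  | negative {U V : OrientedSubmanifold} (φ : U.carrier → X.carrier) (hφ : X.IsPlot U φ)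
      (π : V.carrier → U.carrier) (hπ : IsSubmersion V U π) (a : AdaptedParams π) {i : ℕ}
      (hi : i + k = V.dim) (hk : U.dim < k) (α : compactForms V i) (hα : SupportedIn α.1 a.ψ) :
      IsRelation X k (0 - preMk (φ ∘ π) (X.comp_submersion hφ hπ) hi α)

/-- The subspace `Z_k(X)` generated by the relations. -/
def relations (X : DiffSpace.{u}) (k : ℕ) : Submodule ℝ (PreChains X k) :=
  Submodule.span ℝ {c | IsRelation X k c}

/-- De Rham chains. -/
abbrev Chains (X : DiffSpace.{u}) (k : ℕ) : Type u := PreChains X k ⧸ relations X k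

/-- The de Rham chain `[(U, φ, α)]`. -/
def chainMk {X : DiffSpace.{u}} {k : ℕ} {U : OrientedSubmanifold} (φ : U.carrier → X.carrier)
    (hφ : X.IsPlot U φ) {j : ℕ} (hj : j + k = U.dim) (α : compactForms U j) : Chains X k :=
  (relations X k).mkQ (preMk φ hφ hj α)

/-- Linear maps on de Rham chains agree if they agree on all `[(U, φ, α)]`. -/
lemma chains_hom_ext {X : DiffSpace.{u}} {k : ℕ} {N : Type*} [AddCommGroup N] [Module ℝ N]
    {f g : Chains X k →ₗ[ℝ] N}
    (h : ∀ (U : OrientedSubmanifold) (φ : U.carrier → X.carrier) (hφ : X.IsPlot U φ) (j : ℕ)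
      (hj : j + k = U.dim) (α : compactForms U j),
      f (chainMk φ hφ hj α) = g (chainMk φ hφ hj α)) : f = g := by
  classical
  have h1 : f.comp (relations X k).mkQ = g.comp (relations X k).mkQ :=
    DirectSum.linearMap_ext ℝ fun i => LinearMap.ext fun α =>
      h i.U i.φ i.isPlot i.degree i.degree_add α
  exact Submodule.linearMap_qext _ h1

/-- The map `(U, φ, α) ↦ (U, φ, dα)`. -/
def preBoundary (X : DiffSpace.{u}) (k : ℕ) : PreChains X (k + 1) →ₗ[ℝ] PreChains X k :=
  preLift fun g => (preMk (j := g.degree + 1) g.φ g.isPlot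
    (by have := g.degree_add; omega)).comp (extDForm g.U g.degree)

lemma preBoundary_preMk {X : DiffSpace.{u}} {k : ℕ} {U : OrientedSubmanifold}
    (φ : U.carrier → X.carrier) (hφ : X.IsPlot U φ) {j : ℕ} (hj : j + (k + 1) = U.dim)
    (α : compactForms U j) :
    preBoundary X k (preMk φ hφ hj α) =
      preMk φ hφ (j := j + 1) (by omega) (extDForm U j α) :=
  preLift_preMk _ φ hφ hj α

lemma relations_le_comap_preBoundary (X : DiffSpace.{u}) (k : ℕ) :
    relations X (k + 1) ≤ (relations X k).comap (preBoundary X k) := by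
  refine Submodule.span_le.mpr fun c hc => ?_
  change preBoundary X k c ∈ relations X k
  cases hc with
  | fiber φ hφ π hπ a hi hj hij α β hαβ =>
    rw [map_sub, preBoundary_preMk, preBoundary_preMk]
    exact Submodule.subset_span (IsRelation.fiber φ hφ π hπ a (by omega) (by omega) (by omega) _ _
      (hαβ.extD α.2.1 β.2.1 (by omega)))
  | @negative U V φ hφ π hπ a i hi hk α hα =>
    rw [map_sub, map_zero, preBoundary_preMk]
    by_cases hkU : U.dim < k
    · exact Submodule.subset_span (IsRelation.negative φ hφ π hπ a (by omega) hkU _ hα.extD)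
    · have hdim := a.dim_eq
      have h := IsRelation.fiber φ hφ π hπ a (k := k) (i := i + 1) (j := 0) (by omega) (by omega)
        (by omega) (extDForm V i α) 0
        (isFiberIntegral_extD_zero a α.2.1 hα (by omega))
      rw [map_zero] at h
      exact Submodule.subset_span h

/-- The boundary operator `[(U, φ, α)] ↦ [(U, φ, dα)]` of the de Rham chain complex. -/
def boundary (X : DiffSpace.{u}) (k : ℕ) : Chains X (k + 1) →ₗ[ℝ] Chains X k :=
  (relations X (k + 1)).mapQ (relations X k) (preBoundary X k) (relations_le_comap_preBoundary X k)

lemma boundary_chainMk {X : DiffSpace.{u}} {k : ℕ} {U : OrientedSubmanifold}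
    (φ : U.carrier → X.carrier) (hφ : X.IsPlot U φ) {j : ℕ} (hj : j + (k + 1) = U.dim)
    (α : compactForms U j) :
    boundary X k (chainMk φ hφ hj α) =
      chainMk φ hφ (j := j + 1) (by omega) (extDForm U j α) := by
  simp only [boundary, chainMk, Submodule.mkQ_apply, Submodule.mapQ_apply, preBoundary_preMk]

lemma boundary_comp_boundary (X : DiffSpace.{u}) (k : ℕ) :
    (boundary X k).comp (boundary X (k + 1)) = 0 := by
  refine chains_hom_ext fun U φ hφ j hj α => ?_
  rw [LinearMap.comp_apply, boundary_chainMk, boundary_chainMk, extDForm_extDForm, chainMk,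
    map_zero, map_zero, LinearMap.zero_apply]

/-- The de Rham chain complex of a differentiable space. -/
def deRhamComplex (X : DiffSpace.{u}) : ChainComplex (ModuleCat.{u} ℝ) ℕ :=
  ChainComplex.of (fun k => ModuleCat.of ℝ (Chains X k)) (fun k => ModuleCat.ofHom (boundary X k))
    (fun k => by rw [← ModuleCat.ofHom_comp, boundary_comp_boundary]; rfl)

/-- The map `(U, φ, α) ↦ (U, f ∘ φ, α)`. -/
def prePush {X : DiffSpace.{u}} {Y : DiffSpace.{v}} (f : SmoothHom X Y) (k : ℕ) :
    PreChains X k →ₗ[ℝ] PreChains Y k :=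
  preLift fun g => preMk (f.toFun ∘ g.φ) (f.isPlot g.isPlot) g.degree_add

lemma prePush_preMk {X : DiffSpace.{u}} {Y : DiffSpace.{v}} (f : SmoothHom X Y) {k : ℕ}
    {U : OrientedSubmanifold} (φ : U.carrier → X.carrier) (hφ : X.IsPlot U φ) {j : ℕ}
    (hj : j + k = U.dim) (α : compactForms U j) :
    prePush f k (preMk φ hφ hj α) = preMk (f.toFun ∘ φ) (f.isPlot hφ) hj α :=
  preLift_preMk _ φ hφ hj α

lemma relations_le_comap_prePush {X : DiffSpace.{u}} {Y : DiffSpace.{v}} (f : SmoothHom X Y)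
    (k : ℕ) : relations X k ≤ (relations Y k).comap (prePush f k) := by
  refine Submodule.span_le.mpr fun c hc => ?_
  change prePush f k c ∈ relations Y k
  cases hc with
  | fiber φ hφ π hπ a hi hj hij α β hαβ =>
    rw [map_sub, prePush_preMk, prePush_preMk]
    exact Submodule.subset_span
      (IsRelation.fiber (f.toFun ∘ φ) (f.isPlot hφ) π hπ a hi hj hij α β hαβ)
  | negative φ hφ π hπ a hi hk α hα =>
    rw [map_sub, map_zero, prePush_preMk]
    exact Submodule.subset_span
      (IsRelation.negative (f.toFun ∘ φ) (f.isPlot hφ) π hπ a hi hk α hα)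

/-- The map `f_* [(U, φ, α)] = [(U, f ∘ φ, α)]` induced by a smooth map `f` on de Rham chains. -/
def push {X : DiffSpace.{u}} {Y : DiffSpace.{v}} (f : SmoothHom X Y) (k : ℕ) :
    Chains X k →ₗ[ℝ] Chains Y k :=
  (relations X k).mapQ (relations Y k) (prePush f k) (relations_le_comap_prePush f k)

lemma push_chainMk {X : DiffSpace.{u}} {Y : DiffSpace.{v}} (f : SmoothHom X Y) {k : ℕ}
    {U : OrientedSubmanifold} (φ : U.carrier → X.carrier) (hφ : X.IsPlot U φ) {j : ℕ}
    (hj : j + k = U.dim) (α : compactForms U j) :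
    push f k (chainMk φ hφ hj α) = chainMk (f.toFun ∘ φ) (f.isPlot hφ) hj α := by
  simp only [push, chainMk, Submodule.mkQ_apply, Submodule.mapQ_apply, prePush_preMk]

lemma boundary_push {X : DiffSpace.{u}} {Y : DiffSpace.{v}} (f : SmoothHom X Y) (k : ℕ)
    (c : Chains X (k + 1)) : boundary Y k (push f (k + 1) c) = push f k (boundary X k c) := by
  have h : (boundary Y k).comp (push f (k + 1)) = (push f k).comp (boundary X k) := by
    refine chains_hom_ext fun U φ hφ j hj α => ?_
    simp only [LinearMap.comp_apply, push_chainMk, boundary_chainMk]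
  exact congrArg (fun F => F c) h

lemma push_comp {X : DiffSpace} {Y : DiffSpace} {Z : DiffSpace} (g : SmoothHom Y Z)
    (f : SmoothHom X Y) (k : ℕ) (c : Chains X k) : push (g.comp f) k c = push g k (push f k c) := by
  have h : push (g.comp f) k = (push g k).comp (push f k) := by
    refine chains_hom_ext fun U φ hφ j hj α => ?_
    simp only [LinearMap.comp_apply, push_chainMk]
    rfl
  exact congrArg (fun F => F c) h

/-! ### Simplices and smooth singular chains -/

/-- The simplex `Δᵏ = {0 ≤ t₁ ≤ ⋯ ≤ tₖ ≤ 1} ⊆ ℝᵏ`. -/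
def simplexSet (k : ℕ) : Set (Fin k → ℝ) := {t | (∀ i, 0 ≤ t i) ∧ Monotone t ∧ ∀ i, t i ≤ 1}

/-- The face map `(t₁, …, tₖ) ↦ (t₁, …, tⱼ, tⱼ, …, tₖ)`, `0 ≤ j ≤ k + 1`, with the conventions
`t₀ = 0` and `tₖ₊₁ = 1`. -/
def faceFun (k : ℕ) (j : Fin (k + 2)) (t : Fin k → ℝ) : Fin (k + 1) → ℝ := fun l =>
  if l.val < j.val then (if h : l.val < k then t ⟨l.val, h⟩ else 1)
  else (if h : 0 < l.val then t ⟨l.val - 1, by have := l.2; omega⟩ else 0)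

lemma contDiff_faceFun (k : ℕ) (j : Fin (k + 2)) : ContDiff ℝ ∞ (faceFun k j) := by
  refine contDiff_pi.mpr fun l => ?_
  unfold faceFun
  split_ifs <;> fun_prop

lemma faceFun_mem (k : ℕ) (j : Fin (k + 2)) {t : Fin k → ℝ} (ht : t ∈ simplexSet k) :
    faceFun k j t ∈ simplexSet (k + 1) := by
  obtain ⟨h0, hm, h1⟩ := ht
  refine ⟨fun i => ?_, fun a b hab => ?_, fun i => ?_⟩
  · unfold faceFun; split_ifs <;> simp [h0]
  · have hab' : a.val ≤ b.val := hab
    have := a.2; have := b.2; have := j.2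
    unfold faceFun
    split_ifs <;> first | exact hm (Fin.mk_le_mk.mpr (by omega)) | exact h1 _ | exact h0 _ |
      exact zero_le_one | exact le_rfl | (exfalso; omega)
  · unfold faceFun; split_ifs <;> simp [h1]

/-- The simplex `Δᵏ` as a differentiable space (subset of `ℝᵏ`). -/
abbrev simplex (k : ℕ) : DiffSpace.{0} := (euclidean k).sub (simplexSet k)

/-- `C^∞` maps between Euclidean spaces induce smooth maps between subsets. -/
def smoothHomOfContDiff {k l : ℕ} (f : (Fin k → ℝ) → (Fin l → ℝ)) (hf : ContDiff ℝ ∞ f)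
    (S : Set (Fin k → ℝ)) (T : Set (Fin l → ℝ)) (hST : ∀ t ∈ S, f t ∈ T) :
    SmoothHom ((euclidean k).sub S) ((euclidean l).sub T) where
  toFun t := ⟨f t.1, hST t.1 t.2⟩
  isPlot h := fun ψ => hf.contMDiff.comp (h ψ)

/-- The face maps of simplices. -/
def face (k : ℕ) (j : Fin (k + 2)) : SmoothHom (simplex k) (simplex (k + 1)) :=
  smoothHomOfContDiff (faceFun k j) (contDiff_faceFun k j) _ _ fun _ => faceFun_mem k j

/-- Strongly smooth maps `Δᵏ → X`: those which extend to a smooth map on an open neighborhood. -/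
def IsStronglySmooth {X : DiffSpace.{u}} {k : ℕ} (σ : simplexSet k → X.carrier) : Prop :=
  ∃ (W : Set (Fin k → ℝ)) (hW : simplexSet k ⊆ W) (F : SmoothHom ((euclidean k).sub W) X),
    IsOpen W ∧ ∀ t : simplexSet k, F.toFun ⟨t.1, hW t.2⟩ = σ t

/-- The set of strongly smooth maps `Δᵏ → X`. -/
abbrev SmoothSimplex (X : DiffSpace.{u}) (k : ℕ) : Type u :=
  {σ : simplexSet k → X.carrier // IsStronglySmooth σ}

/-- A strongly smooth map as a smooth map. -/
def SmoothSimplex.hom {X : DiffSpace.{u}} {k : ℕ} (σ : SmoothSimplex X k) :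
    SmoothHom (simplex k) X where
  toFun := σ.1
  isPlot {U φ} h := by
    obtain ⟨W, hW, F, -, hF⟩ := σ.2
    have h1 : ((euclidean k).sub W).IsPlot U fun p => ⟨(φ p).1, hW (φ p).2⟩ := h
    have h2 := F.isPlot h1
    have h3 : σ.1 ∘ φ = F.toFun ∘ fun p => ⟨(φ p).1, hW (φ p).2⟩ := by
      funext p; exact (hF (φ p)).symm
    exact h3 ▸ h2

/-- The `j`-th face `σ ∘ d_j` of a strongly smooth simplex. -/
def SmoothSimplex.face {X : DiffSpace.{u}} {k : ℕ} (σ : SmoothSimplex X (k + 1))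
    (j : Fin (k + 2)) : SmoothSimplex X k :=
  ⟨fun t => σ.1 ⟨faceFun k j t.1, faceFun_mem k j t.2⟩, by
    obtain ⟨W, hW, F, hWo, hF⟩ := σ.2
    exact ⟨faceFun k j ⁻¹' W, fun t ht => hW (faceFun_mem k j ht),
      F.comp (smoothHomOfContDiff (faceFun k j) (contDiff_faceFun k j) _ _ fun _ h => h),
      hWo.preimage (contDiff_faceFun k j).continuous, fun t => hF ⟨_, faceFun_mem k j t.2⟩⟩⟩

/-- Smooth singular chains. -/
abbrev SmoothChains (X : DiffSpace.{u}) (k : ℕ) : Type u := SmoothSimplex X k →₀ ℝ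

/-- The boundary operator `∂ σ = ∑ (-1)ʲ σ ∘ d_j` on smooth singular chains. -/
def smoothBoundary (X : DiffSpace.{u}) (k : ℕ) : SmoothChains X (k + 1) →ₗ[ℝ] SmoothChains X k :=
  Finsupp.linearCombination ℝ fun σ =>
    ∑ j : Fin (k + 2), (-1 : ℝ) ^ j.val • Finsupp.single (σ.face j) (1 : ℝ)

end DeRhamChain

namespace DeRhamChain

open CategoryTheory

lemma faceFun_faceFun (k : ℕ) (i i' : Fin (k + 2)) (j j' : Fin (k + 3)) (h : i.val < j.val)
    (hj' : j'.val = i.val) (hi' : i'.val + 1 = j.val) (t : Fin k → ℝ) :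
    faceFun (k + 1) j (faceFun k i t) = faceFun (k + 1) j' (faceFun k i' t) := by
  funext l
  have hl := l.2
  have hj := j.2
  simp only [faceFun]
  split_ifs <;> first | rfl | (exfalso; omega)

lemma SmoothSimplex.face_face {X : DiffSpace.{u}} {k : ℕ} (σ : SmoothSimplex X (k + 2))
    (i i' : Fin (k + 2)) (j j' : Fin (k + 3)) (h : i.val < j.val)
    (hj' : j'.val = i.val) (hi' : i'.val + 1 = j.val) :
    (σ.face j).face i = (σ.face j').face i' := by
  apply Subtype.ext
  funext t
  change σ.1 ⟨faceFun (k + 1) j (faceFun k i t.1), _⟩ =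
    σ.1 ⟨faceFun (k + 1) j' (faceFun k i' t.1), _⟩
  exact congrArg σ.1 (Subtype.ext (faceFun_faceFun k i i' j j' h hj' hi' t.1))

lemma smoothBoundary_single {X : DiffSpace.{u}} {k : ℕ} (σ : SmoothSimplex X (k + 1)) :
    smoothBoundary X k (Finsupp.single σ 1) =
      ∑ j : Fin (k + 2), (-1 : ℝ) ^ j.val • Finsupp.single (σ.face j) (1 : ℝ) := by
  simp [smoothBoundary]

lemma smoothBoundary_comp (X : DiffSpace.{u}) (k : ℕ) :
    (smoothBoundary X k).comp (smoothBoundary X (k + 1)) = 0 := by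
  refine Finsupp.lhom_ext' fun σ => LinearMap.ext_ring ?_
  simp only [LinearMap.comp_apply, Finsupp.lsingle_apply, smoothBoundary_single, map_sum, map_smul,
    LinearMap.zero_apply, Finset.smul_sum, smul_smul]
  rw [← Finset.sum_product']
  let g : Fin (k + 3) × Fin (k + 2) → Fin (k + 3) × Fin (k + 2) := fun p =>
    if h : p.2.val < p.1.val then (p.2.castSucc, ⟨p.1.val - 1, by have := p.1.2; omega⟩)
    else (p.2.succ, ⟨p.1.val, by have := p.2.2; omega⟩)
  refine Finset.sum_involution (fun p _ => g p) ?_ ?_ (fun _ _ => Finset.mem_univ _) ?_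
  · rintro ⟨j, i⟩ -
    by_cases h : i.val < j.val
    · have hf := σ.face_face i ⟨j.val - 1, by have := j.2; omega⟩ j i.castSucc h rfl
        (by simp only []; omega)
      simp only [g, h, dif_pos, hf, ← add_smul]
      have : (-1 : ℝ) ^ j.val = (-1) ^ (j.val - 1) * (-1) := by
        rw [← pow_succ]; congr 1; omega
      simp only [Fin.val_castSucc, this]
      ring_nf
      simp
    · have hf := σ.face_face ⟨j.val, by have := i.2; omega⟩ i i.succ j
        (by simp only [Fin.val_succ]; omega) rfl (by simp)
      simp only [g, h, dif_neg, not_false_eq_true, hf, ← add_smul]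
      simp only [Fin.val_succ, pow_succ]
      ring_nf
      simp
  · rintro ⟨j, i⟩ - - heq
    by_cases h : i.val < j.val
    · simp only [g, h, dif_pos, Prod.mk.injEq, Fin.ext_iff, Fin.val_castSucc] at heq
      omega
    · simp only [g, h, dif_neg, not_false_eq_true, Prod.mk.injEq, Fin.ext_iff, Fin.val_succ] at heq
      omega
  · rintro ⟨j, i⟩ -
    by_cases h : i.val < j.val
    · have h2 : ¬ (j.val - 1 < i.val) := by omega
      simp only [g, h, dif_pos, Fin.val_castSucc, h2, dif_neg, not_false_eq_true, Prod.mk.injEq,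
        Fin.ext_iff, Fin.val_succ, and_true]
      omega
    · have h2 : j.val < i.val + 1 := by omega
      simp only [g, h, dif_neg, not_false_eq_true, Fin.val_succ, h2, dif_pos, Prod.mk.injEq,
        Fin.ext_iff, Fin.val_castSucc, true_and]
      omega

/-- The smooth singular chain complex of a differentiable space. -/
def smoothSingularComplex (X : DiffSpace.{u}) : ChainComplex (ModuleCat.{u} ℝ) ℕ :=
  ChainComplex.of (fun k => ModuleCat.of ℝ (SmoothChains X k))
    (fun k => ModuleCat.ofHom (smoothBoundary X k))
    (fun k => by rw [← ModuleCat.ofHom_comp, smoothBoundary_comp]; rfl)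

/-! ### Open subsets of Euclidean spaces -/

lemma det_ne_zero_of_injective {k : ℕ} {A : (Fin k → ℝ) →L[ℝ] (Fin k → ℝ)}
    (hA : Function.Injective A) : A.det ≠ 0 := by
  intro h
  have h1 := LinearMap.bot_lt_ker_of_det_eq_zero (f := (A : (Fin k → ℝ) →ₗ[ℝ] (Fin k → ℝ))) h
  rw [LinearMap.ker_eq_bot.mpr hA] at h1
  exact lt_irrefl _ h1

/-- The identity as a parametrization of an open subset of `ℝᵏ`. -/
def idParam {k : ℕ} (W : Set (Fin k → ℝ)) (hW : IsOpen W) : LocalParam W k where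
  source := ⟨W, hW⟩
  toFun := id
  mem _ hx := hx
  smooth := contDiffOn_id
  immersive x _ := by rw [fderiv_id]; exact Function.injective_id
  injOn := injOn_id _
  image_open O hO hOW := ⟨O, hO, by simpa using (inter_eq_right.mpr hOW).symm⟩

open Classical in
/-- An open subset of `ℝᵏ` with the standard orientation, as an oriented submanifold of `ℝᵏ`. -/
def openSubmanifold {k : ℕ} (W : Set (Fin k → ℝ)) (hW : IsOpen W) : OrientedSubmanifold where
  ambient := k
  dim := k
  dim_le := le_rfl
  carrier := W
  exists_param p hp := ⟨idParam W hW, p, hp, rfl⟩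
  sgn ψ x := if x ∈ ψ.source then SignType.sign (fderiv ℝ ψ x).det else 0
  sgn_eq_zero_iff ψ x := by
    by_cases hx : x ∈ ψ.source
    · simp [hx, det_ne_zero_of_injective (ψ.immersive x hx)]
    · simp [hx]
  sgn_locallyConst ψ x hx := by
    have hd := det_ne_zero_of_injective (ψ.immersive x hx)
    have hc : ContinuousAt (fun x' => (fderiv ℝ ψ x').det) x :=
      ContinuousLinearMap.continuous_det.continuousAt.comp
        (((ψ.contDiffAt hx).fderiv_right (m := 0) (by simp)).continuousAt)
    rcases lt_or_gt_of_ne hd with h | h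
    · filter_upwards [ψ.source.isOpen.mem_nhds hx, hc.eventually (gt_mem_nhds h)] with x' h1 h2
      have h1' : x' ∈ ψ.source := h1
      rw [if_pos h1', if_pos hx, sign_neg h2, sign_neg h]
    · filter_upwards [ψ.source.isOpen.mem_nhds hx, hc.eventually (lt_mem_nhds h)] with x' h1 h2
      have h1' : x' ∈ ψ.source := h1
      rw [if_pos h1', if_pos hx, sign_pos h2, sign_pos h]
  sgn_compat ψ χ x y A hx hy _ hA := by
    rw [if_pos hx, if_pos hy, hA, ← sign_mul, mul_comm]
    congr 1
    exact LinearMap.det_comp _ _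

lemma isSmoothMap_coe (U : OrientedSubmanifold) :
    IsSmoothMap 𝓘(ℝ, Fin U.ambient → ℝ) U (fun p => (p : Fin U.ambient → ℝ)) := fun ψ x =>
  contMDiffAt_subtype_iff.mpr (ψ.contDiffAt x.2).contMDiffAt

/-! ### The map from smooth singular homology to de Rham chain homology -/

/-- The one-point manifold `ℝ⁰` with the positive orientation. -/
def pointSubmanifold : OrientedSubmanifold :=
  openSubmanifold (univ : Set (Fin 0 → ℝ)) isOpen_univ

open Classical in
/-- The constant function `1` on the one-point manifold `ℝ⁰`. -/
def oneForm : compactForms pointSubmanifold 0 :=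
  ⟨fun ψ x => if x ∈ ψ.source then
      ContinuousAlternatingMap.constOfIsEmpty ℝ (Fin pointSubmanifold.dim → ℝ) (Fin 0)
        (1 : ℝ) else 0,
    { eq_zero := fun ψ x hx => if_neg hx
      smooth := fun ψ => contDiffOn_const.congr fun x hx => if_pos hx
      compat := fun ψ χ x y A hx hy _ _ => by rw [if_pos hx, if_pos hy]; ext v; simp },
    univ, (Set.toFinite (univ : Set (Fin 0 → ℝ))).isCompact, subset_rfl,
    fun _ _ _ h => absurd (mem_univ _) h⟩

/-- The de Rham chain `[(ℝ⁰, ℝ⁰ → Δ⁰, 1)]` of `Δ⁰`, with the positive orientation of the one-point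
manifold `ℝ⁰`. It is the unique element of `C₀(Δ⁰) ≅ ℝ` of augmentation `∫ 1 = 1`. -/
def pointChain : Chains (simplex 0) 0 :=
  chainMk (U := pointSubmanifold)
    (fun p => ⟨p.1, fun i => i.elim0, fun i => i.elim0, fun i => i.elim0⟩)
    (isSmoothMap_coe pointSubmanifold) rfl oneForm

/-- Sequences of de Rham chains `u_k` of `Δᵏ` such that `u₀` has augmentation `1` and
`∂ u_{k+1} = ∑ (-1)ʲ (d_j)_* u_k` for all `k`. -/
structure IsSimplexSequence (u : ∀ k, Chains (simplex k) k) : Prop where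
  zero : u 0 = pointChain
  succ : ∀ k, boundary (simplex (k + 1)) k (u (k + 1)) =
    ∑ j : Fin (k + 2), (-1 : ℝ) ^ j.val • push (face k j) k (u k)

/-- The map `σ ↦ σ_*(u_k)` from smooth singular chains to de Rham chains. -/
def comparisonMap (u : ∀ k, Chains (simplex k) k) (X : DiffSpace.{u}) (k : ℕ) :
    SmoothChains X k →ₗ[ℝ] Chains X k :=
  Finsupp.linearCombination ℝ fun σ => push σ.hom k (u k)

lemma boundary_comparisonMap {u : ∀ k, Chains (simplex k) k} (hu : IsSimplexSequence u)
    (X : DiffSpace.{u}) (k : ℕ) :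
    (boundary X k).comp (comparisonMap u X (k + 1)) =
      (comparisonMap u X k).comp (smoothBoundary X k) := by
  refine Finsupp.lhom_ext' fun σ => LinearMap.ext_ring ?_
  simp only [LinearMap.comp_apply, Finsupp.lsingle_apply, smoothBoundary_single, comparisonMap,
    Finsupp.linearCombination_single, one_smul, map_sum, map_smul, boundary_push, hu.succ]
  refine Finset.sum_congr rfl fun j _ => ?_
  rw [← push_comp]
  rfl

/-- The chain map from smooth singular chains to de Rham chains determined by `u`. -/
def comparison {u : ∀ k, Chains (simplex k) k} (hu : IsSimplexSequence u) (X : DiffSpace.{u}) :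
    smoothSingularComplex X ⟶ deRhamComplex X :=
  ChainComplex.ofHom (X := smoothSingularComplex X) (Y := deRhamComplex X)
    (fun k => ModuleCat.ofHom (comparisonMap u X k)) fun k => by
    simp only [smoothSingularComplex, deRhamComplex, ChainComplex.of_d]
    rw [← ModuleCat.ofHom_comp, ← ModuleCat.ofHom_comp, boundary_comparisonMap hu]

end DeRhamChain

namespace DeRhamChain

open CategoryTheory

/-! ### Smooth singular chains and singular chains on manifolds -/

/-- The affine homeomorphism `(s₀, …, sₖ) ↦ (s₀, s₀ + s₁, …, s₀ + ⋯ + sₖ₋₁)` from the standard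
simplex with barycentric coordinates `s` to `Δᵏ`. -/
def partialSum (k : ℕ) (s : Fin (k + 1) → ℝ) (l : Fin k) : ℝ :=
  ∑ i : Fin (k + 1), if i.val ≤ l.val then s i else 0

lemma continuous_partialSum (k : ℕ) : Continuous (partialSum k) := by
  refine continuous_pi fun l => continuous_finsetSum _ fun i _ => ?_
  split_ifs <;> fun_prop

lemma partialSum_mem {k : ℕ} (s : stdSimplex ℝ (Fin (k + 1))) : partialSum k s ∈ simplexSet k := by
  have h0 : ∀ i, 0 ≤ s i := s.2.1
  refine ⟨fun l => Finset.sum_nonneg fun i _ => ?_, fun a b hab => Finset.sum_le_sum fun i _ => ?_,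
    fun l => ?_⟩
  · split_ifs <;> simp [h0]
  · have hab' : a.val ≤ b.val := hab
    split_ifs <;> first | exact le_rfl | exact h0 i | (exfalso; omega)
  · refine (Finset.sum_le_sum fun i _ => ?_).trans_eq s.2.2
    split_ifs
    · exact le_rfl
    · exact h0 i

lemma partialSum_map {k : ℕ} (j : Fin (k + 2)) (s : stdSimplex ℝ (Fin (k + 1))) :
    partialSum (k + 1) (stdSimplex.map j.succAbove s) = faceFun k j (partialSum k s) := by
  classical
  have hsum : ∑ a, s a = 1 := s.2.2
  funext l
  have h1 : partialSum (k + 1) (stdSimplex.map j.succAbove s) l =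
      ∑ a : Fin (k + 1), if (j.succAbove a).val ≤ l.val then s a else 0 := by
    simp only [partialSum, stdSimplex.map_coe, FunOnFinite.linearMap_apply_apply,
      Finset.sum_filter]
    have h2 : ∀ b : Fin (k + 2), (if b.val ≤ l.val then
        ∑ a, (if j.succAbove a = b then s a else 0) else 0) =
        ∑ a, if j.succAbove a = b then (if (j.succAbove a).val ≤ l.val then s a else 0) else 0 := by
      intro b
      split_ifs with hb
      · refine Finset.sum_congr rfl fun a _ => ?_
        by_cases h : j.succAbove a = b
        · simp [h, hb]
        · simp [h]
      · symm
        refine Finset.sum_eq_zero fun a _ => ?_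
        by_cases h : j.succAbove a = b
        · simp [h, hb]
        · simp [h]
    rw [Finset.sum_congr rfl fun b _ => h2 b, Finset.sum_comm]
    simp
  have hval : ∀ a : Fin (k + 1), (j.succAbove a).val = if a.val < j.val then a.val else a.val + 1 :=
    fun a => by
      simp only [Fin.succAbove, Fin.lt_def, Fin.val_castSucc]
      split_ifs <;> simp
  have hl := l.2
  have hj := j.2
  rw [h1]
  unfold faceFun
  split_ifs with ha hb hc
  · refine Finset.sum_congr rfl fun a _ => ?_
    rw [hval]
    dsimp only
    split_ifs <;> first | rfl | (exfalso; omega)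
  · rw [← hsum]
    refine Finset.sum_congr rfl fun a _ => ?_
    have := a.2
    rw [hval]
    split_ifs <;> first | rfl | (exfalso; omega)
  · refine Finset.sum_congr rfl fun a _ => ?_
    rw [hval]
    simp only []
    split_ifs <;> first | rfl | (exfalso; omega)
  · refine Finset.sum_eq_zero fun a _ => ?_
    rw [hval]
    split_ifs <;> first | rfl | (exfalso; omega)

section Manifold

variable {E : Type*} [NormedAddCommGroup E] [NormedSpace ℝ E] {H : Type*} [TopologicalSpace H]
  (I : ModelWithCorners ℝ E H) (M : Type u) [TopologicalSpace M] [ChartedSpace H M]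

variable {I M} in
lemma continuous_smoothSimplex {k : ℕ} (σ : SmoothSimplex (DiffSpace.ofManifold I M) k) :
    Continuous (X := simplexSet k) (Y := M) σ.1 := by
  obtain ⟨W, hW, F, hWo, hF⟩ := σ.2
  have hid : ((euclidean k).sub W).IsPlot (openSubmanifold W hWo) id :=
    isSmoothMap_coe (openSubmanifold W hWo)
  have h1 : ContMDiff (M' := M) 𝓘(ℝ, Fin k → ℝ) I ∞ fun x : (idParam W hWo).source =>
      F.toFun ⟨x.1, x.2⟩ := F.isPlot hid (idParam W hWo)
  have h2 : Continuous (Y := M) fun t : simplexSet k => F.toFun ⟨t.1, hW t.2⟩ :=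
    h1.continuous.comp (f := fun t : simplexSet k =>
      (⟨t.1, hW t.2⟩ : (idParam W hWo).source)) (by fun_prop)
  exact h2.congr hF

/-- The singular chain complex of `M` with real coefficients. -/
abbrev singularComplex (M : Type u) [TopologicalSpace M] : ChainComplex (ModuleCat.{u} ℝ) ℕ :=
  ((AlgebraicTopology.singularChainComplexFunctor (ModuleCat.{u} ℝ)).obj
    (ModuleCat.of ℝ (ULift.{u} ℝ))).obj (TopCat.of M)

variable {I M} in
/-- A strongly smooth simplex of a manifold as a singular simplex. -/
def toSingularSimplex {k : ℕ} (σ : SmoothSimplex (DiffSpace.ofManifold I M) k) :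
    (TopCat.toSSet.obj (TopCat.of M)).obj (Opposite.op (SimplexCategory.mk k)) :=
  (TopCat.toSSetObjEquiv (TopCat.of M) (Opposite.op (SimplexCategory.mk k))).symm
    ⟨fun s => σ.1 ⟨partialSum k s, partialSum_mem s⟩,
      (continuous_smoothSimplex σ).comp (((continuous_partialSum k).comp
        continuous_induced_dom).subtype_mk _)⟩

lemma toSingularSimplex_face {k : ℕ} (σ : SmoothSimplex (DiffSpace.ofManifold I M) (k + 1))
    (j : Fin (k + 2)) :
    toSingularSimplex (σ.face j) =
      (TopCat.toSSet.obj (TopCat.of M)).δ j (toSingularSimplex σ) := by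
  apply (TopCat.toSSetObjEquiv (TopCat.of M) _).injective
  ext s
  change σ.1 ⟨faceFun k j (partialSum k s), _⟩ =
    σ.1 ⟨partialSum (k + 1) (stdSimplex.map j.succAbove s), _⟩
  exact congrArg σ.1 (Subtype.ext (partialSum_map j s).symm)

/-- A singular simplex as an element of the singular chain complex. -/
def singularChain {M : Type u} [TopologicalSpace M] {k : ℕ}
    (τ : (TopCat.toSSet.obj (TopCat.of M)).obj (Opposite.op (SimplexCategory.mk k))) :
    (singularComplex M).X k :=
  (SSet.ιChainComplex (R := ModuleCat.of ℝ (ULift.{u} ℝ)) (TopCat.toSSet.obj (TopCat.of M))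
    τ).hom (ULift.up 1)

lemma singularChain_d {M : Type u} [TopologicalSpace M] {k : ℕ}
    (τ : (TopCat.toSSet.obj (TopCat.of M)).obj (Opposite.op (SimplexCategory.mk (k + 1)))) :
    ((singularComplex M).d (k + 1) k).hom (singularChain τ) =
      ∑ j : Fin (k + 2), (-1 : ℝ) ^ j.val •
        singularChain ((TopCat.toSSet.obj (TopCat.of M)).δ j τ) := by
  have h := congrArg (fun F => F.hom (ULift.up (1 : ℝ)))
    (SSet.ιChainComplex_d (R := ModuleCat.of ℝ (ULift.{u} ℝ)) (TopCat.toSSet.obj (TopCat.of M)) τ)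
  refine h.trans ?_
  have h1 : ∀ (j : ℕ) {A : ModuleCat.{u} ℝ} (f : ModuleCat.of ℝ (ULift.{u} ℝ) ⟶ A)
      (x : ULift.{u} ℝ), ((-1 : ℤ) ^ j • f).hom x = (-1 : ℝ) ^ j • f.hom x := by
    intro j A f x
    rcases Nat.even_or_odd j with hj | hj <;> simp [hj.neg_one_pow]
  simp only [ModuleCat.hom_sum, LinearMap.sum_apply]
  exact Finset.sum_congr rfl fun j _ => h1 _ _ _

/-- The inclusion `σ ↦ σ` of smooth singular chains into singular chains. -/
def toSingularMap (k : ℕ) : SmoothChains (DiffSpace.ofManifold I M) k →ₗ[ℝ] (singularComplex M).X k :=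
  Finsupp.linearCombination ℝ fun σ => singularChain (toSingularSimplex σ)

lemma toSingularMap_boundary (k : ℕ) :
    ((singularComplex M).d (k + 1) k).hom.comp (toSingularMap I M (k + 1)) =
      (toSingularMap I M k).comp (smoothBoundary (DiffSpace.ofManifold I M) k) := by
  refine Finsupp.lhom_ext' fun σ => LinearMap.ext_ring ?_
  simp only [LinearMap.comp_apply, Finsupp.lsingle_apply, smoothBoundary_single, toSingularMap,
    Finsupp.linearCombination_single, one_smul, map_sum, map_smul, toSingularSimplex_face]
  exact singularChain_d _

/-- The inclusion of the smooth singular chain complex of a manifold into its singular chain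
complex. -/
def toSingular : smoothSingularComplex (DiffSpace.ofManifold I M) ⟶ singularComplex M :=
  ChainComplex.ofHom (X := smoothSingularComplex (DiffSpace.ofManifold I M))
    (Y := singularComplex M) (fun k => ModuleCat.ofHom (toSingularMap I M k)) fun k => by
    simp only [smoothSingularComplex, ChainComplex.of_d]
    exact ModuleCat.hom_ext (toSingularMap_boundary I M k)

end Manifold

/-- An orientation of a `d`-dimensional `C^∞` manifold, recorded by the signs `sgn e p = ± 1` of the
coordinate frames at `p` of the charts `e` of the maximal atlas: the sign is locally constant, and
two frames at `p` have the same sign iff the Jacobian of the change of coordinates has positive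
determinant. -/
structure ManifoldOrientation (d : ℕ) (M : Type u) [TopologicalSpace M]
    [ChartedSpace (EuclideanSpace ℝ (Fin d)) M] where
  sgn : OpenPartialHomeomorph M (EuclideanSpace ℝ (Fin d)) → M → SignType
  sgn_ne_zero : ∀ e ∈ IsManifold.maximalAtlas (𝓡 d) ∞ M, ∀ p ∈ e.source, sgn e p ≠ 0
  sgn_locallyConst : ∀ e ∈ IsManifold.maximalAtlas (𝓡 d) ∞ M, ∀ p ∈ e.source,
    ∀ᶠ q in 𝓝 p, sgn e q = sgn e p
  sgn_compat : ∀ e ∈ IsManifold.maximalAtlas (𝓡 d) ∞ M, ∀ e' ∈ IsManifold.maximalAtlas (𝓡 d) ∞ M,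
    ∀ p ∈ e.source ∩ e'.source,
      sgn e p = SignType.sign (fderiv ℝ (e' ∘ e.symm) (e p)).det * sgn e' p

end DeRhamChain


end

noncomputable section

namespace DeRhamChain

open TopologicalSpace (Opens)

/-! ### Smoothness of families of alternating forms -/

section AltSmooth

variable {m n j : ℕ} {G : Type*} [NormedAddCommGroup G] [NormedSpace ℝ G]

/-- The coefficients of an alternating form on `ℝᵐ`. -/
def altCoeff (m j : ℕ) :
    ((Fin m → ℝ) [⋀^Fin j]→L[ℝ] ℝ) →ₗ[ℝ] ((Fin j → Fin m) → ℝ) where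
  toFun A s := A fun i => Pi.single (s i) 1
  map_add' _ _ := rfl
  map_smul' _ _ := rfl

lemma alt_apply_eq_sum (A : (Fin m → ℝ) [⋀^Fin j]→L[ℝ] ℝ) (v : Fin j → Fin m → ℝ) :
    A v = ∑ s : Fin j → Fin m, (∏ i, v i (s i)) * altCoeff m j A s := by
  have h1 : v = fun i => ∑ c : Fin m, v i c • (Pi.single c (1 : ℝ) : Fin m → ℝ) := by
    funext i
    exact pi_eq_sum_univ' (v i)
  conv_lhs => rw [h1]
  change A.toMultilinearMap _ = _
  rw [MultilinearMap.map_sum]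
  refine Finset.sum_congr rfl fun s _ => ?_
  rw [MultilinearMap.map_smul_univ]
  rfl

lemma altCoeff_injective : Function.Injective (altCoeff m j) := by
  intro A B h
  ext v
  rw [alt_apply_eq_sum, alt_apply_eq_sum, h]

lemma contDiffAt_alt {f : G → (Fin m → ℝ) [⋀^Fin j]→L[ℝ] ℝ} {x : G}
    (h : ∀ v, ContDiffAt ℝ ∞ (fun z => f z v) x) : ContDiffAt ℝ ∞ f x := by
  obtain ⟨l, hl⟩ := LinearMap.exists_leftInverse_of_injective _
    (LinearMap.ker_eq_bot.mpr (altCoeff_injective (m := m) (j := j)))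
  have h1 : ContDiffAt ℝ ∞ (fun z => altCoeff m j (f z)) x :=
    contDiffAt_pi.mpr fun s => h _
  have h2 : f = fun z => LinearMap.toContinuousLinearMap l (altCoeff m j (f z)) := by
    funext z
    exact (congrArg (fun g : _ →ₗ[ℝ] _ => g (f z)) hl).symm
  rw [h2]
  exact (LinearMap.toContinuousLinearMap l).contDiff.contDiffAt.comp x h1

lemma ContDiffAt.alt_comp {g : G → (Fin n → ℝ) [⋀^Fin j]→L[ℝ] ℝ}
    {L : G → (Fin m → ℝ) →L[ℝ] (Fin n → ℝ)} {x : G} (hg : ContDiffAt ℝ ∞ g x)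
    (hL : ContDiffAt ℝ ∞ L x) :
    ContDiffAt ℝ ∞ (fun z => (g z).compContinuousLinearMap (L z)) x := by
  refine contDiffAt_alt fun v => ?_
  have h1 : (fun z => (g z).compContinuousLinearMap (L z) v) = fun z =>
      ∑ s : Fin j → Fin n, (∏ i, L z (v i) (s i)) * altCoeff n j (g z) s := by
    funext z
    rw [ContinuousAlternatingMap.compContinuousLinearMap_apply, alt_apply_eq_sum]
    rfl
  rw [h1]
  refine ContDiffAt.sum fun s _ => ContDiffAt.mul (contDiffAt_prod fun i _ => ?_) ?_
  · exact (contDiffAt_pi.mp (hL.clm_apply contDiffAt_const)) (s i)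
  · exact (ContinuousAlternatingMap.apply ℝ (Fin n → ℝ) ℝ _).contDiff.contDiffAt.comp x hg

end AltSmooth

/-! ### Compactly supported forms on open subsets of Euclidean spaces -/

/-- Open subsets of `ℝᵐ` as oriented submanifolds. -/
abbrev opn {m : ℕ} (O : Opens (Fin m → ℝ)) : OrientedSubmanifold :=
  openSubmanifold (O : Set (Fin m → ℝ)) O.isOpen

/-- Smooth `j`-forms on `ℝᵐ` with compact support in the open subset `O`. -/
def testForms {m : ℕ} (O : Opens (Fin m → ℝ)) (j : ℕ) :
    Submodule ℝ ((Fin m → ℝ) → (Fin m → ℝ) [⋀^Fin j]→L[ℝ] ℝ) where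
  carrier := {η | ContDiff ℝ ∞ η ∧ ∃ K, IsCompact K ∧ K ⊆ (O : Set (Fin m → ℝ)) ∧ ∀ x ∉ K, η x = 0}
  zero_mem' := ⟨contDiff_const, ∅, isCompact_empty, empty_subset _, fun _ _ => rfl⟩
  add_mem' := by
    rintro α β ⟨hα, K, hK, hKU, hαK⟩ ⟨hβ, L, hL, hLU, hβL⟩
    refine ⟨hα.add hβ, K ∪ L, hK.union hL, union_subset hKU hLU, fun x hx => ?_⟩
    rw [mem_union, not_or] at hx
    simp [hαK x hx.1, hβL x hx.2]
  smul_mem' := by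
    rintro c α ⟨hα, K, hK, hKU, hαK⟩
    exact ⟨contDiff_const.smul hα, K, hK, hKU, fun x hx => by simp [hαK x hx]⟩

instance {m : ℕ} (O : Opens (Fin m → ℝ)) (j : ℕ) : AddCommGroup (testForms O j) :=
  Submodule.addCommGroup (testForms O j)

lemma testForms.contDiff {m j : ℕ} {O : Opens (Fin m → ℝ)} (η : testForms O j) :
    ContDiff ℝ ∞ η.1 := η.2.1

lemma testForms.hasCompactSupport {m j : ℕ} {O : Opens (Fin m → ℝ)} (η : testForms O j) :
    HasCompactSupport η.1 := by
  obtain ⟨K, hK, -, h⟩ := η.2.2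
  exact HasCompactSupport.intro hK h

lemma testForms.eq_zero {m j : ℕ} {O : Opens (Fin m → ℝ)} (η : testForms O j) {x : Fin m → ℝ}
    (hx : x ∉ O) : η.1 x = 0 := by
  obtain ⟨K, hK, hKO, h⟩ := η.2.2
  exact h x fun hxK => hx (hKO hxK)

open Classical in
/-- The pullback of a form by a parametrization, extended by zero. -/
def LocalParam.pull {n m j : ℕ} {S : Set (Fin n → ℝ)} (ψ : LocalParam S m)
    (η : (Fin n → ℝ) → (Fin n → ℝ) [⋀^Fin j]→L[ℝ] ℝ) (x : Fin m → ℝ) :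
    (Fin m → ℝ) [⋀^Fin j]→L[ℝ] ℝ :=
  if x ∈ ψ.source then (η (ψ x)).compContinuousLinearMap (fderiv ℝ ψ x) else 0

namespace LocalParam

variable {n m j : ℕ} {S : Set (Fin n → ℝ)} (ψ : LocalParam S m)
  {η : (Fin n → ℝ) → (Fin n → ℝ) [⋀^Fin j]→L[ℝ] ℝ}

lemma pull_of_mem {x : Fin m → ℝ} (hx : x ∈ ψ.source) :
    ψ.pull η x = (η (ψ x)).compContinuousLinearMap (fderiv ℝ ψ x) := if_pos hx

lemma pull_of_notMem {x : Fin m → ℝ} (hx : x ∉ ψ.source) : ψ.pull η x = 0 := if_neg hx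

lemma pull_eventuallyEq {x : Fin m → ℝ} (hx : x ∈ ψ.source) :
    ψ.pull η =ᶠ[𝓝 x] fun z => (η (ψ z)).compContinuousLinearMap (fderiv ℝ ψ z) := by
  filter_upwards [ψ.source.isOpen.mem_nhds hx] with z hz using ψ.pull_of_mem hz

lemma contDiffOn_pull (hη : ContDiff ℝ ∞ η) : ContDiffOn ℝ ∞ (ψ.pull η) ψ.source := fun x hx =>
  ((ContDiffAt.alt_comp (hη.contDiffAt.comp x (ψ.contDiffAt hx))
    ((ψ.contDiffAt hx).fderiv_right (by simp))).congr_of_eventuallyEq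
      (ψ.pull_eventuallyEq hx)).contDiffWithinAt

lemma pull_compat (χ : LocalParam S m) {x y : Fin m → ℝ} {A : (Fin m → ℝ) →L[ℝ] (Fin m → ℝ)}
    (hx : x ∈ ψ.source) (hy : y ∈ χ.source) (h : ψ x = χ y)
    (hA : fderiv ℝ ψ x = (fderiv ℝ χ y).comp A) :
    ψ.pull η x = (χ.pull η y).compContinuousLinearMap A := by
  rw [ψ.pull_of_mem hx, χ.pull_of_mem hy, hA, h]
  rfl

lemma pull_add (η η' : (Fin n → ℝ) → (Fin n → ℝ) [⋀^Fin j]→L[ℝ] ℝ) :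
    ψ.pull (η + η') = ψ.pull η + ψ.pull η' := by
  funext x
  by_cases hx : x ∈ ψ.source
  · rw [Pi.add_apply, pull_of_mem _ hx, pull_of_mem _ hx, pull_of_mem _ hx]
    rfl
  · simp [pull_of_notMem _ hx]

lemma pull_smul (c : ℝ) (η : (Fin n → ℝ) → (Fin n → ℝ) [⋀^Fin j]→L[ℝ] ℝ) :
    ψ.pull (c • η) = c • ψ.pull η := by
  funext x
  by_cases hx : x ∈ ψ.source
  · rw [Pi.smul_apply, pull_of_mem _ hx, pull_of_mem _ hx]
    rfl
  · simp [pull_of_notMem _ hx]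

lemma extDeriv_pull (hη : ContDiff ℝ ∞ η) {x : Fin m → ℝ} (hx : x ∈ ψ.source) :
    extDeriv (ψ.pull η) x = ψ.pull (extDeriv η) x := by
  rw [(ψ.pull_eventuallyEq hx).extDeriv_eq, ψ.pull_of_mem hx]
  exact extDeriv_pullback (hη.differentiable (by simp) _) (ψ.contDiffAt hx) minSmoothness_le

lemma pull_eq_zero {x : Fin m → ℝ} (h : η (ψ x) = 0) : ψ.pull η x = 0 := by
  by_cases hx : x ∈ ψ.source
  · rw [ψ.pull_of_mem hx, h]
    ext v
    simp
  · exact ψ.pull_of_notMem hx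

end LocalParam

/-- The form on the submanifold `O` given by the form `η` on `ℝᵐ`. -/
def euclForm {m : ℕ} (O : Opens (Fin m → ℝ)) (j : ℕ) :
    testForms O j →ₗ[ℝ] compactForms (opn O) j where
  toFun η := ⟨fun (ψ : LocalParam (O : Set (Fin m → ℝ)) m) => ψ.pull η.1,
    { eq_zero := fun (ψ : LocalParam (O : Set (Fin m → ℝ)) m) _ hx => ψ.pull_of_notMem hx
      smooth := fun (ψ : LocalParam (O : Set (Fin m → ℝ)) m) =>
        ψ.contDiffOn_pull (testForms.contDiff η)
      compat := fun (ψ χ : LocalParam (O : Set (Fin m → ℝ)) m) _ _ _ hx hy h hA =>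
        ψ.pull_compat χ hx hy h hA },
    by
      obtain ⟨K, hK, hKO, h⟩ := η.2.2
      exact ⟨K, hK, hKO, fun (ψ : LocalParam (O : Set (Fin m → ℝ)) m) x hx hxK =>
        ψ.pull_eq_zero (h _ hxK)⟩⟩
  map_add' η η' := Subtype.ext
    (funext fun (ψ : LocalParam (O : Set (Fin m → ℝ)) m) => ψ.pull_add η.1 η'.1)
  map_smul' c η := Subtype.ext
    (funext fun (ψ : LocalParam (O : Set (Fin m → ℝ)) m) => ψ.pull_smul c η.1)

/-- The exterior derivative of forms with compact support in an open subset of `ℝᵐ`. -/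
def testD {m : ℕ} (O : Opens (Fin m → ℝ)) (j : ℕ) : testForms O j →ₗ[ℝ] testForms O (j + 1) where
  toFun η := ⟨extDeriv η.1, contDiff_iff_contDiffAt.mpr fun _ =>
      contDiffAt_extDeriv (testForms.contDiff η).contDiffAt, by
    obtain ⟨K, hK, hKO, h⟩ := η.2.2
    refine ⟨K, hK, hKO, fun x hx => ?_⟩
    have h1 : η.1 =ᶠ[𝓝 x] fun _ => 0 := by
      filter_upwards [hK.isClosed.isOpen_compl.mem_nhds hx] with z hz using h z hz
    rw [h1.extDeriv_eq]
    ext v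
    rw [extDeriv_apply (differentiableAt_const _)]
    simp⟩
  map_add' η η' := by
    apply Subtype.ext
    funext x
    exact extDeriv_add ((testForms.contDiff η).differentiable (by simp) x)
      ((testForms.contDiff η').differentiable (by simp) x)
  map_smul' c η := by
    apply Subtype.ext
    funext x
    exact extDeriv_smul c η.1

lemma extDForm_euclForm {m j : ℕ} {O : Opens (Fin m → ℝ)} (η : testForms O j) :
    extDForm (opn O) j (euclForm O j η) = euclForm O (j + 1) (testD O j η) := by
  refine Subtype.ext (funext fun (ψ : LocalParam (O : Set (Fin m → ℝ)) m) =>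
    funext fun (x : Fin m → ℝ) => ?_)
  by_cases hx : x ∈ ψ.source
  · exact (extD_apply (U := opn O) (euclForm O j η).1 ψ hx).trans
      (ψ.extDeriv_pull (testForms.contDiff η) hx)
  · exact (extD_apply_of_notMem (U := opn O) (euclForm O j η).1 ψ hx).trans
      (ψ.pull_of_notMem hx).symm

/-! ### Parametrizations of open subsets -/

/-- Injective immersions between open subsets of `ℝᵐ` as parametrizations. -/
def LocalParam.ofOpen {m : ℕ} (O : Opens (Fin m → ℝ)) (N : Opens (Fin m → ℝ))
    (τ : (Fin m → ℝ) → (Fin m → ℝ)) (hmem : ∀ x ∈ N, τ x ∈ O) (hs : ContDiffOn ℝ ∞ τ N)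
    (hinj : ∀ x ∈ N, Function.Injective (fderiv ℝ τ x)) (hN : InjOn τ N) :
    LocalParam (O : Set (Fin m → ℝ)) m where
  source := N
  toFun := τ
  mem := hmem
  smooth := hs
  immersive := hinj
  injOn := hN
  image_open Q hQ hQN := by
    refine ⟨τ '' Q, isOpen_iff_mem_nhds.mpr ?_, ?_⟩
    · rintro _ ⟨x, hx, rfl⟩
      have h1 : ContDiffAt ℝ ∞ τ x := hs.contDiffAt (N.isOpen.mem_nhds (hQN hx))
      have h2 : HasStrictFDerivAt τ (fderiv ℝ τ x) x := h1.hasStrictFDerivAt (by simp)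
      let e : (Fin m → ℝ) ≃L[ℝ] (Fin m → ℝ) :=
        (LinearEquiv.ofInjectiveEndo (fderiv ℝ τ x : (Fin m → ℝ) →ₗ[ℝ] (Fin m → ℝ))
          (hinj x (hQN hx))).toContinuousLinearEquiv
      have h3 : HasStrictFDerivAt τ (e : (Fin m → ℝ) →L[ℝ] (Fin m → ℝ)) x := by
        convert h2 using 1
        ext v
        rfl
      rw [← h3.map_nhds_eq_of_equiv]
      exact Filter.image_mem_map (hQ.mem_nhds hx)
    · refine (inter_eq_right.mpr ?_).symm
      rintro _ ⟨x, hx, rfl⟩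
      exact hmem x (hQN hx)

/-- The restriction of a parametrization to a smaller open subset. -/
def LocalParam.restrict {n m : ℕ} {S : Set (Fin n → ℝ)} (ψ : LocalParam S m)
    (N : Opens (Fin m → ℝ)) (hN : N ≤ ψ.source) : LocalParam S m where
  source := N
  toFun := ψ
  mem x hx := ψ.mem x (hN hx)
  smooth := ψ.smooth.mono hN
  immersive x hx := ψ.immersive x (hN hx)
  injOn := ψ.injOn.mono hN
  image_open Q hQ hQN := ψ.image_open Q hQ (hQN.trans hN)

/-! ### Submersions -/

lemma isSmoothMap_lift {U : OrientedSubmanifold} (ψ : U.Param) :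
    IsSmoothMap 𝓘(ℝ, Fin U.ambient → ℝ) (opn ψ.source)
      (fun p => (ψ.lift p : Fin U.ambient → ℝ)) := by
  intro χ x
  refine contMDiffAt_subtype_iff (f := fun z => ψ (χ z)) |>.mpr (ContDiffAt.contMDiffAt ?_)
  exact (ψ.contDiffAt (χ.mem x x.2)).comp _ (χ.contDiffAt x.2)

/-- Parametrizations are submersions. -/
lemma isSubmersion_lift {U : OrientedSubmanifold} (ψ : U.Param) :
    IsSubmersion (opn ψ.source) U ψ.lift where
  smooth := isSmoothMap_lift ψ
  surjective := by
    rintro (θ : LocalParam (ψ.source : Set (Fin U.dim → ℝ)) U.dim) ⟨(x : Fin U.dim → ℝ), (hx : x ∈ θ.source)⟩ χ y hxy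
    have hθx : θ x ∈ ψ.source := θ.mem x hx
    have hval : ψ (θ x) = χ y := congrArg Subtype.val hxy
    obtain ⟨τ, hτ, hτy, hev⟩ := ψ.exists_factor (x := (y : Fin U.dim → ℝ)) hθx
      (χ.contDiffAt y.2) hval.symm (by
        filter_upwards [χ.source.isOpen.mem_nhds y.2] with z hz using χ.mem z hz)
    have h1 : fderiv ℝ χ y = (fderiv ℝ ψ (θ x)).comp (fderiv ℝ τ y) := by
      have h2 : χ.toFun =ᶠ[𝓝 (y : Fin U.dim → ℝ)] fun z => ψ (τ z) := hev.mono fun z hz => hz.2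
      rw [h2.fderiv_eq, ← hτy]
      exact fderiv_comp _ ((ψ.contDiffAt (hτy ▸ hθx)).differentiableAt (by simp))
        (hτ.differentiableAt (by simp))
    have h3 : fderiv ℝ (coordMap (V := opn ψ.source) (U := U) ψ.lift θ) x =
        (fderiv ℝ ψ (θ x)).comp (fderiv ℝ θ x) := by
      have h2 : coordMap (V := opn ψ.source) (U := U) ψ.lift θ =ᶠ[𝓝 x]
          fun z => ψ (θ z) := by
        filter_upwards [θ.source.isOpen.mem_nhds hx] with z hz
        exact coordMap_apply (V := opn ψ.source) (U := U) ψ.lift θ hz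
      refine h2.fderiv_eq.trans ?_
      exact fderiv_comp _ ((ψ.contDiffAt hθx).differentiableAt (by simp))
        ((θ.contDiffAt hx).differentiableAt (by simp))
    have h4 : Function.Surjective (fderiv ℝ θ x : (Fin U.dim → ℝ) →ₗ[ℝ] (Fin U.dim → ℝ)) :=
      LinearMap.injective_iff_surjective.mp (θ.immersive x hx)
    rintro _ ⟨v, rfl⟩
    obtain ⟨w, hw⟩ := h4 (fderiv ℝ τ y v)
    refine ⟨w, ?_⟩
    change fderiv ℝ (coordMap (V := opn ψ.source) (U := U) ψ.lift θ) x w = fderiv ℝ χ y v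
    rw [h3, h1]
    exact congrArg (fderiv ℝ ψ (θ x)) hw

/-- The base coordinates of a point of `ℝᵐ × ℝʳ`. -/
def baseCoord {m r m' : ℕ} (h : m' = m + r) : (Fin m' → ℝ) →L[ℝ] (Fin m → ℝ) :=
  ContinuousLinearMap.pi fun a => ContinuousLinearMap.proj (Fin.cast h.symm (Fin.castAdd r a))

lemma baseCoord_join {m r m' : ℕ} (h : m' = m + r) (x : Fin m → ℝ) (y : Fin r → ℝ) :
    baseCoord h (join h x y) = x := by
  subst h
  funext c
  simp [baseCoord, join]

lemma join_baseCoord_fiberCoord {m r m' : ℕ} (h : m' = m + r) (z : Fin m' → ℝ) :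
    join h (baseCoord h z) (fiberCoord h z) = z := by
  subst h
  funext i
  refine Fin.addCases (fun a => ?_) (fun a => ?_) i <;> simp [join, baseCoord, fiberCoord]

/-- The projection between open subsets of `ℝᵐ × ℝʳ` and `ℝᵐ`. -/
def projMap {m r m' : ℕ} (h : m' = m + r) (O' : Opens (Fin m' → ℝ)) (O : Opens (Fin m → ℝ))
    (hO : ∀ z ∈ O', baseCoord h z ∈ O) (z : (opn O').carrier) : (opn O).carrier :=
  ⟨baseCoord h z.1, hO z.1 z.2⟩

lemma isSubmersion_projMap {m r m' : ℕ} (h : m' = m + r) (O' : Opens (Fin m' → ℝ))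
    (O : Opens (Fin m → ℝ)) (hO : ∀ z ∈ O', baseCoord h z ∈ O) :
    IsSubmersion (opn O') (opn O) (projMap h O' O hO) where
  smooth := by
    intro (χ : LocalParam (O' : Set (Fin m' → ℝ)) m') x
    change ContMDiffAt 𝓘(ℝ, Fin m' → ℝ) 𝓘(ℝ, Fin m → ℝ) ∞
      (fun z : χ.source => baseCoord h (χ z)) x
    refine contMDiffAt_subtype_iff (f := fun z => baseCoord h (χ z)) |>.mpr
      (ContDiffAt.contMDiffAt ?_)
    exact (baseCoord h).contDiff.contDiffAt.comp _ (χ.contDiffAt x.2)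
  surjective := by
    rintro (θ : LocalParam (O' : Set (Fin m' → ℝ)) m') ⟨(x : Fin m' → ℝ), (hx : x ∈ θ.source)⟩ χ y hxy
    have h3 : fderiv ℝ (coordMap (V := opn O') (U := opn O) (projMap h O' O hO) θ) x =
        (baseCoord h).comp (fderiv ℝ θ x) := by
      have h2 : coordMap (V := opn O') (U := opn O) (projMap h O' O hO) θ
          =ᶠ[𝓝 x] fun z => baseCoord h (θ z) := by
        filter_upwards [θ.source.isOpen.mem_nhds hx] with z hz
        exact coordMap_apply (V := opn O') (U := opn O) (projMap h O' O hO) θ hz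
      refine h2.fderiv_eq.trans ?_
      exact (baseCoord h).hasFDerivAt.comp _
        ((θ.contDiffAt hx).differentiableAt (by simp)).hasFDerivAt |>.fderiv
    have h4 : Function.Surjective (fderiv ℝ θ x : (Fin m' → ℝ) →ₗ[ℝ] (Fin m' → ℝ)) :=
      LinearMap.injective_iff_surjective.mp (θ.immersive x hx)
    rintro v -
    obtain ⟨w, hw⟩ := h4 (join h (v : Fin m → ℝ) 0)
    refine ⟨w, ?_⟩
    change fderiv ℝ (coordMap (V := opn O') (U := opn O) (projMap h O' O hO) θ) x w = v
    rw [h3]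
    exact (congrArg (baseCoord h) hw).trans (baseCoord_join h _ _)

/-! ### De Rham chains given by open subsets of Euclidean spaces -/

lemma integral_fin_zero (f : (Fin 0 → ℝ) → ℝ) : ∫ y, f y = f 0 := by
  have h : (volume : Measure (Fin 0 → ℝ)) = Measure.dirac 0 := by
    rw [volume_pi]
    exact Measure.pi_of_empty _ _
  rw [h, integral_dirac]

lemma join_zero {m : ℕ} (h : m = m + 0) (x : Fin m → ℝ) (y : Fin 0 → ℝ) : join h x y = x := by
  funext i
  exact Fin.append_left x y i

lemma frame_zero {m j : ℕ} (h : m = m + 0) (hi : j = j + 0) (v : Fin j → Fin m → ℝ) :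
    frame h hi v = v := by
  funext i
  refine (Fin.append_left (fun b => join h (v b) 0) (fun c => join h 0 (Pi.single c 1)) i).trans ?_
  exact join_zero h _ _

lemma sgn_idParam {m : ℕ} (O : Opens (Fin m → ℝ)) {x : Fin m → ℝ} (hx : x ∈ O) :
    (opn O).sgn (idParam (O : Set (Fin m → ℝ)) O.isOpen) x = 1 := by
  have h1 : (opn O).sgn (idParam (O : Set (Fin m → ℝ)) O.isOpen) x =
      SignType.sign (fderiv ℝ (id : (Fin m → ℝ) → (Fin m → ℝ)) x).det := if_pos hx
  rw [h1, fderiv_id]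
  have h2 : (ContinuousLinearMap.id ℝ (Fin m → ℝ)).det = 1 := LinearMap.det_id
  rw [h2, sign_one]

lemma sgn_opn {m : ℕ} (O : Opens (Fin m → ℝ)) (τ : LocalParam (O : Set (Fin m → ℝ)) m)
    {x : Fin m → ℝ} (hx : x ∈ τ.source) :
    (opn O).sgn τ x = SignType.sign (fderiv ℝ τ x).det := if_pos hx

lemma pull_idParam {m j : ℕ} (O : Opens (Fin m → ℝ)) (η : testForms O j) :
    (idParam (O : Set (Fin m → ℝ)) O.isOpen).pull η.1 = η.1 := by
  funext x
  by_cases hx : x ∈ (idParam (O : Set (Fin m → ℝ)) O.isOpen).source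
  · rw [LocalParam.pull_of_mem _ hx]
    change (η.1 x).compContinuousLinearMap (fderiv ℝ id x) = _
    rw [fderiv_id]
    rfl
  · rw [LocalParam.pull_of_notMem _ hx]
    exact (testForms.eq_zero η hx).symm

lemma supportedIn_euclForm {m j : ℕ} (O : Opens (Fin m → ℝ)) (η : testForms O j) :
    SupportedIn (euclForm O j η).1 (idParam (O : Set (Fin m → ℝ)) O.isOpen) := by
  obtain ⟨K, hK, hKO, h⟩ := η.2.2
  refine ⟨K, hK, hKO, fun (ψ : LocalParam (O : Set (Fin m → ℝ)) m) x hx hxK => ?_⟩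
  exact ψ.pull_eq_zero (h _ fun hm => hxK ⟨ψ x, hm, rfl⟩)

section Eucl

variable {X : DiffSpace.{u}} {k m j : ℕ}

/-- The de Rham chain of an open subset of `ℝᵐ`, a plot and a form on it. -/
def eucl (O : Opens (Fin m → ℝ)) (φ : (opn O).carrier → X.carrier) (hφ : X.IsPlot (opn O) φ)
    (hj : j + k = m) : testForms O j →ₗ[ℝ] Chains X k :=
  (relations X k).mkQ ∘ₗ preMk (U := opn O) φ hφ hj ∘ₗ euclForm O j

lemma eucl_apply (O : Opens (Fin m → ℝ)) (φ : (opn O).carrier → X.carrier)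
    (hφ : X.IsPlot (opn O) φ) (hj : j + k = m) (η : testForms O j) :
    eucl O φ hφ hj η = chainMk (U := opn O) φ hφ hj (euclForm O j η) := rfl

lemma eucl_congr {O : Opens (Fin m → ℝ)} {φ φ' : (opn O).carrier → X.carrier}
    (h : φ = φ') (hφ : X.IsPlot (opn O) φ) (hφ' : X.IsPlot (opn O) φ') (hj : j + k = m)
    (η : testForms O j) : eucl O φ hφ hj η = eucl O φ' hφ' hj η := by
  subst h
  rfl

lemma boundary_eucl (O : Opens (Fin m → ℝ)) (φ : (opn O).carrier → X.carrier)
    (hφ : X.IsPlot (opn O) φ) (hj : j + (k + 1) = m) (η : testForms O j) :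
    boundary X k (eucl O φ hφ hj η) =
      eucl O φ hφ (j := j + 1) (by omega) (testD O j η) := by
  exact (boundary_chainMk (U := opn O) φ hφ hj _).trans
    (congrArg (chainMk (U := opn O) φ hφ (j := j + 1) (by change j + 1 + k = m; omega))
      (extDForm_euclForm η))

lemma push_eucl {Y : DiffSpace.{v}} (f : SmoothHom X Y) (O : Opens (Fin m → ℝ))
    (φ : (opn O).carrier → X.carrier) (hφ : X.IsPlot (opn O) φ) (hj : j + k = m)
    (η : testForms O j) :
    push f k (eucl O φ hφ hj η) = eucl O (f.toFun ∘ φ) (f.isPlot hφ) hj η :=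
  push_chainMk f φ hφ hj _

lemma chainMk_eq_of_isRelation {U V : OrientedSubmanifold} {φ : U.carrier → X.carrier}
    {hφ : X.IsPlot U φ} {π : V.carrier → U.carrier} {hπ : IsSubmersion V U π}
    (a : AdaptedParams π) {i : ℕ} (hi : i + k = V.dim) (hj : j + k = U.dim) (hij : i = j + a.r)
    (α : compactForms V i) (β : compactForms U j) (h : IsFiberIntegral a hij α.1 β.1) :
    chainMk φ hφ hj β = chainMk (φ ∘ π) (X.comp_submersion hφ hπ) hi α := by
  rw [← sub_eq_zero, chainMk, chainMk, ← map_sub]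
  exact (Submodule.Quotient.mk_eq_zero _).mpr
    (Submodule.subset_span (IsRelation.fiber φ hφ π hπ a hi hj hij α β h))

/-- A form with compact support in the image of `ψ`, multiplied by the sign of `ψ`, as a form on
the domain of `ψ`. -/
def signedTest {U : OrientedSubmanifold} (α : compactForms U j) (ψ : U.Param)
    (hs : SupportedIn α.1 ψ) : testForms ψ.source j :=
  ⟨signedForm α.1 ψ, (signedForm_spec α.2.1 hs).1, by
    obtain ⟨K, hK, hKs, hv⟩ := hs
    refine ⟨K, hK, hKs, fun z hz => ?_⟩
    by_cases hzs : z ∈ ψ.source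
    · have : ψ z ∉ ψ '' K := by
        rintro ⟨w, hw, hwz⟩
        exact hz (ψ.injOn (hKs hw) hzs hwz ▸ hw)
      simp [signedForm, hv ψ z hzs this]
    · simp [signedForm, α.2.1.eq_zero ψ z hzs]⟩

lemma sgn_mul_self {U : OrientedSubmanifold} (ψ : U.Param) {x : Fin U.dim → ℝ}
    (hx : x ∈ ψ.source) : (U.sgn ψ x : ℝ) * (U.sgn ψ x : ℝ) = 1 := by
  have h : U.sgn ψ x ≠ 0 := fun h => (U.sgn_eq_zero_iff ψ x).mp h hx
  rcases SignType.trichotomy (U.sgn ψ x) with h1 | h1 | h1 <;> simp_all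

/-- De Rham chains given by forms supported in the image of a parametrization. -/
lemma chainMk_eq_eucl {U : OrientedSubmanifold} {φ : U.carrier → X.carrier}
    (hφ : X.IsPlot U φ) (hj : j + k = U.dim) (α : compactForms U j) (ψ : U.Param)
    (hs : SupportedIn α.1 ψ) :
    chainMk φ hφ hj α = eucl ψ.source (φ ∘ ψ.lift)
      (X.comp_submersion hφ (isSubmersion_lift ψ)) hj (signedTest α ψ hs) := by
  let a : AdaptedParams (V := opn ψ.source) (U := U) ψ.lift :=
    { r := 0
      dim_eq := rfl
      ψ := idParam (ψ.source : Set (Fin U.dim → ℝ)) ψ.source.isOpen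
      χ := ψ
      adapted := fun x y hz => by
        have h0 : join (m' := U.dim) rfl x y = x := join_zero rfl x y
        have hz' : join (m' := U.dim) rfl x y ∈ ψ.source := hz
        refine ⟨h0 ▸ hz', Subtype.ext ?_⟩
        exact congrArg ψ h0 }
  refine chainMk_eq_of_isRelation (V := opn ψ.source) (hφ := hφ) (hπ := isSubmersion_lift ψ) a
    hj hj rfl (euclForm ψ.source j (signedTest α ψ hs)) α ⟨supportedIn_euclForm _ _, hs, ?_⟩
  intro (x : Fin U.dim → ℝ) (hx : x ∈ ψ.source) v
  refine Eq.trans ?_ (integral_fin_zero _).symm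
  have h0 : join (m' := U.dim) rfl x (0 : Fin 0 → ℝ) = x := join_zero rfl x 0
  have h1 : (opn ψ.source).sgn (idParam (ψ.source : Set (Fin U.dim → ℝ)) ψ.source.isOpen)
      (join (m' := U.dim) rfl x (0 : Fin 0 → ℝ)) = 1 := by
    rw [h0]
    exact sgn_idParam _ hx
  have h2 : frame (m' := U.dim) (r := 0) rfl rfl v = v := frame_zero rfl rfl v
  have h3 : (idParam (ψ.source : Set (Fin U.dim → ℝ)) ψ.source.isOpen).pull
      (signedTest α ψ hs).1 (join (m' := U.dim) rfl x (0 : Fin 0 → ℝ)) =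
      (U.sgn ψ x : ℝ) • α.1 ψ x := by
    rw [h0, pull_idParam]
    rfl
  have h4 : ((1 : SignType) : ℝ) * (U.sgn ψ x : ℝ) * ((U.sgn ψ x : ℝ) • α.1 ψ x) v =
      α.1 ψ x v := by
    rw [ContinuousAlternatingMap.smul_apply, smul_eq_mul, SignType.coe_one, one_mul, ← mul_assoc,
      sgn_mul_self ψ hx, one_mul]
  rw [← h4]
  change _ = _ * _ * ((idParam (ψ.source : Set (Fin U.dim → ℝ)) ψ.source.isOpen).pull
    (signedTest α ψ hs).1 (join (m' := U.dim) rfl x (0 : Fin 0 → ℝ)))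
      (frame (m' := U.dim) (r := 0) rfl rfl v)
  rw [h3, h2]
  exact congrArg (fun s : SignType => (s : ℝ) * (U.sgn ψ x : ℝ) * _) h1.symm

/-- The standard projection as a map with adapted parametrizations. -/
def projAdapted {r m' : ℕ} (h : m' = m + r) (O' : Opens (Fin m' → ℝ)) (O : Opens (Fin m → ℝ))
    (hO : ∀ z ∈ O', baseCoord h z ∈ O) :
    AdaptedParams (V := opn O') (U := opn O) (projMap h O' O hO) where
  r := r
  dim_eq := h
  ψ := idParam (O' : Set (Fin m' → ℝ)) O'.isOpen
  χ := idParam (O : Set (Fin m → ℝ)) O.isOpen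
  adapted x y hz := by
    have hz' : join h x y ∈ O' := hz
    have h1 := hO _ hz'
    rw [baseCoord_join h (x : Fin m → ℝ) y] at h1
    exact ⟨h1, Subtype.ext (baseCoord_join h (x : Fin m → ℝ) y)⟩

lemma eucl_proj {r m' i : ℕ} (h : m' = m + r) (O' : Opens (Fin m' → ℝ)) (O : Opens (Fin m → ℝ))
    (hO : ∀ z ∈ O', baseCoord h z ∈ O) {φ : (opn O).carrier → X.carrier}
    (hφ : X.IsPlot (opn O) φ) (hi : i + k = m') (hj : j + k = m) (hij : i = j + r)
    (η : testForms O' i) (β : testForms O j)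
    (hβ : ∀ x ∈ O, ∀ v, β.1 x v = ∫ y : Fin r → ℝ, η.1 (join h x y) (frame h hij v)) :
    eucl O φ hφ hj β = eucl O' (φ ∘ projMap h O' O hO)
      (X.comp_submersion hφ (isSubmersion_projMap h O' O hO)) hi η := by
  refine chainMk_eq_of_isRelation (V := opn O') (U := opn O) (hφ := hφ)
    (hπ := isSubmersion_projMap h O' O hO) (projAdapted h O' O hO) hi hj hij (euclForm O' i η)
    (euclForm O j β) ⟨supportedIn_euclForm _ _, supportedIn_euclForm _ _, ?_⟩
  intro (x : Fin m → ℝ) (hx : x ∈ O) (v : Fin j → Fin m → ℝ)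
  change (idParam (O : Set (Fin m → ℝ)) O.isOpen).pull β.1 x v = ∫ y : Fin r → ℝ,
    (((opn O').sgn (idParam (O' : Set (Fin m' → ℝ)) O'.isOpen) (join h x y) : SignType) : ℝ) *
      (((opn O).sgn (idParam (O : Set (Fin m → ℝ)) O.isOpen) x : SignType) : ℝ) *
      (idParam (O' : Set (Fin m' → ℝ)) O'.isOpen).pull η.1 (join h x y) (frame h hij v)
  rw [pull_idParam, hβ x hx v]
  refine integral_congr_ae (Filter.Eventually.of_forall fun y => ?_)
  simp only []
  rw [pull_idParam, sgn_idParam O hx]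
  by_cases hy : join h x y ∈ O'
  · refine Eq.trans ?_ (congrArg (fun s : SignType => (s : ℝ) * ((1 : SignType) : ℝ) *
      η.1 (join h x y) (frame h hij v)) (sgn_idParam O' hy).symm)
    simp
  · rw [testForms.eq_zero η hy]
    simp

lemma eucl_eq_zero {r m' i : ℕ} (h : m' = m + r) (O' : Opens (Fin m' → ℝ))
    (O : Opens (Fin m → ℝ)) (hO : ∀ z ∈ O', baseCoord h z ∈ O) {φ : (opn O).carrier → X.carrier}
    (hφ : X.IsPlot (opn O) φ) (hi : i + k = m') (hk : m < k) (η : testForms O' i) :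
    eucl O' (φ ∘ projMap h O' O hO)
      (X.comp_submersion hφ (isSubmersion_projMap h O' O hO)) hi η = 0 := by
  have h1 := IsRelation.negative (X := X) (k := k) (V := opn O') (U := opn O) φ hφ _
    (isSubmersion_projMap h O' O hO) (projAdapted h O' O hO) hi hk (euclForm O' i η)
    (supportedIn_euclForm _ _)
  rw [zero_sub] at h1
  have h2 := (relations X k).neg_mem (Submodule.subset_span h1)
  rw [neg_neg] at h2
  exact (Submodule.Quotient.mk_eq_zero _).mpr h2

end Eucl

/-! ### Multiplication of forms by functions -/

section Mul

variable {U : OrientedSubmanifold} {j : ℕ}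

open Classical in
/-- Coordinate expressions of functions. -/
def coordFun (f : U.carrier → ℝ) (ψ : U.Param) (x : Fin U.dim → ℝ) : ℝ :=
  if hx : x ∈ ψ.source then f (ψ.lift ⟨x, hx⟩) else 0

lemma coordFun_apply (f : U.carrier → ℝ) (ψ : U.Param) {x : Fin U.dim → ℝ} (hx : x ∈ ψ.source) :
    coordFun f ψ x = f (ψ.lift ⟨x, hx⟩) := dif_pos hx

lemma contDiffAt_coordFun {f : U.carrier → ℝ} (hf : IsSmoothMap 𝓘(ℝ, ℝ) U f) (ψ : U.Param)
    {x : Fin U.dim → ℝ} (hx : x ∈ ψ.source) : ContDiffAt ℝ ∞ (coordFun f ψ) x := by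
  have h1 : ContMDiffAt 𝓘(ℝ, Fin U.dim → ℝ) 𝓘(ℝ, ℝ) ∞
      (fun z : ψ.source => coordFun f ψ z) ⟨x, hx⟩ := by
    have : (fun z : ψ.source => coordFun f ψ z) = fun z => f (ψ.lift z) := by
      funext z; exact coordFun_apply f ψ z.2
    rw [this]
    exact hf ψ ⟨x, hx⟩
  exact (contMDiffAt_subtype_iff.mp h1).contDiffAt

/-- Multiplication of compactly supported forms by a smooth function. -/
def mulForm (f : U.carrier → ℝ) (hf : IsSmoothMap 𝓘(ℝ, ℝ) U f) (j : ℕ) :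
    compactForms U j →ₗ[ℝ] compactForms U j where
  toFun α := ⟨fun ψ x => coordFun f ψ x • α.1 ψ x,
    { eq_zero := fun ψ x hx => by
        rw [α.2.1.eq_zero ψ x hx, smul_zero]
      smooth := fun ψ x hx => ((contDiffAt_coordFun hf ψ hx).smul
        (α.2.1.contDiffAt ψ hx)).contDiffWithinAt
      compat := fun ψ χ x y A hx hy h hA => by
        have h1 : ψ.lift ⟨x, hx⟩ = χ.lift ⟨y, hy⟩ := Subtype.ext h
        rw [α.2.1.compat ψ χ x y A hx hy h hA, coordFun_apply f ψ hx, coordFun_apply f χ hy, h1]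
        rfl },
    by
      obtain ⟨K, hK, hKU, h⟩ := α.2.2
      exact ⟨K, hK, hKU, fun ψ x hx hxK => by simp [h ψ x hx hxK]⟩⟩
  map_add' α β := by
    apply Subtype.ext
    funext ψ x
    exact smul_add _ _ _
  map_smul' c α := by
    apply Subtype.ext
    funext ψ x
    exact smul_comm (coordFun f ψ x) c (α.1 ψ x)

lemma mulForm_apply {f : U.carrier → ℝ} (hf : IsSmoothMap 𝓘(ℝ, ℝ) U f) (α : compactForms U j)
    (ψ : U.Param) (x : Fin U.dim → ℝ) : (mulForm f hf j α).1 ψ x = coordFun f ψ x • α.1 ψ x := rfl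

lemma VanishesOff.mulForm {f : U.carrier → ℝ} (hf : IsSmoothMap 𝓘(ℝ, ℝ) U f)
    {α : compactForms U j} {K : Set (Fin U.ambient → ℝ)} (h : VanishesOff α.1 K) :
    VanishesOff (mulForm f hf j α).1 K := fun ψ x hx hxK => by
  rw [mulForm_apply, h ψ x hx hxK, smul_zero]

lemma SupportedIn.mulForm {f : U.carrier → ℝ} (hf : IsSmoothMap 𝓘(ℝ, ℝ) U f)
    {α : compactForms U j} {ψ : U.Param} (h : SupportedIn α.1 ψ) :
    SupportedIn (mulForm f hf j α).1 ψ := by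
  obtain ⟨K, hK, hKs, hv⟩ := h
  exact ⟨K, hK, hKs, hv.mulForm hf⟩

end Mul

/-! ### Partitions of unity -/

lemma LocalParam.isInducing {n m : ℕ} {S : Set (Fin n → ℝ)} (ψ : LocalParam S m) :
    Topology.IsInducing fun x : ψ.source => ψ x := by
  have hc : Continuous fun x : ψ.source => ψ x := ψ.smooth.continuousOn.domRestrict
  have h1 : Topology.IsOpenEmbedding ψ.lift := by
    refine Topology.IsOpenEmbedding.of_continuous_injective_isOpenMap (hc.subtype_mk _)
      (fun x y h => Subtype.ext (ψ.injOn x.2 y.2 (congrArg Subtype.val h))) fun Q hQ => ?_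
    obtain ⟨W, hW, hWS⟩ := ψ.image_open (Subtype.val '' Q)
      (ψ.source.isOpen.isOpenMap_subtype_val Q hQ) (by rintro _ ⟨x, -, rfl⟩; exact x.2)
    refine isOpen_induced_iff.mpr ⟨W, hW, ?_⟩
    ext p
    constructor
    · intro hp
      have : (p : Fin n → ℝ) ∈ S ∩ W := ⟨p.2, hp⟩
      rw [← hWS] at this
      obtain ⟨_, ⟨x, hx, rfl⟩, hxp⟩ := this
      exact ⟨x, hx, Subtype.ext hxp⟩
    · rintro ⟨x, hx, rfl⟩
      have : ψ x ∈ S ∩ W := by rw [← hWS]; exact ⟨x, ⟨x, hx, rfl⟩, rfl⟩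
      exact this.2
  exact Topology.IsInducing.subtypeVal.comp h1.isInducing

lemma LocalParam.isCompact_preimage {n m : ℕ} {S : Set (Fin n → ℝ)} (ψ : LocalParam S m)
    {C : Set (Fin n → ℝ)} (hC : IsCompact C) (hCs : C ⊆ ψ '' ψ.source) :
    ∃ K : Set (Fin m → ℝ), IsCompact K ∧ K ⊆ ψ.source ∧ ψ '' K = C := by
  have h1 : IsCompact ((fun x : ψ.source => ψ x) ⁻¹' C) := by
    rw [ψ.isInducing.isCompact_preimage_iff]
    · exact hC
    · intro p hp
      obtain ⟨x, hx, rfl⟩ := hCs hp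
      exact ⟨⟨x, hx⟩, rfl⟩
  refine ⟨_, h1.image continuous_subtype_val, ?_, ?_⟩
  · rintro _ ⟨x, -, rfl⟩
    exact x.2
  · ext p
    constructor
    · rintro ⟨_, ⟨x, hx, rfl⟩, rfl⟩
      exact hx
    · intro hp
      obtain ⟨x, hx, rfl⟩ := hCs hp
      exact ⟨x, ⟨⟨x, hx⟩, hp, rfl⟩, rfl⟩

/-- Partitions of unity subordinate to parametrizations. -/
lemma exists_partition {U : OrientedSubmanifold} {K : Set (Fin U.ambient → ℝ)} (hK : IsCompact K)
    (hKU : K ⊆ U.carrier) :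
    ∃ (t : Finset U.carrier) (ψ : U.carrier → U.Param) (f : U.carrier → U.carrier → ℝ)
      (hf : ∀ i, IsSmoothMap 𝓘(ℝ, ℝ) U (f i)),
      ∀ (j : ℕ) (α : compactForms U j), VanishesOff α.1 K →
        (∀ i, ∃ K', IsCompact K' ∧ K' ⊆ (ψ i).source ∧ ψ i '' K' ⊆ K ∧
          VanishesOff (mulForm (f i) (hf i) j α).1 (ψ i '' K')) ∧
        ∑ i ∈ t, mulForm (f i) (hf i) j α = α := by
  have hex : ∀ p : U.carrier, ∃ ψ : U.Param, ∃ W : Set (Fin U.ambient → ℝ), IsOpen W ∧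
      ψ '' ψ.source = U.carrier ∩ W ∧ (p : Fin U.ambient → ℝ) ∈ W := fun p => by
    obtain ⟨ψ, x, hx, hψx⟩ := U.exists_param p p.2
    obtain ⟨W, hW, hWS⟩ := ψ.image_open _ ψ.source.isOpen subset_rfl
    have : (p : Fin U.ambient → ℝ) ∈ U.carrier ∩ W := by
      rw [← hWS]
      exact ⟨x, hx, hψx⟩
    exact ⟨ψ, W, hW, hWS, this.2⟩
  choose ψ W hWo hWS hpW using hex
  obtain ⟨F, hF⟩ := SmoothPartitionOfUnity.exists_isSubordinate 𝓘(ℝ, Fin U.ambient → ℝ)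
    hK.isClosed W hWo (fun p hp => mem_iUnion.mpr ⟨⟨p, hKU hp⟩, hpW ⟨p, hKU hp⟩⟩)
  have hfin := F.locallyFinite.finite_nonempty_inter_compact hK
  have hf : ∀ i : U.carrier, IsSmoothMap 𝓘(ℝ, ℝ) U (fun p => F i p) := fun i ψ =>
    (F i).contMDiff.comp (isSmoothMap_coe U ψ)
  refine ⟨hfin.toFinset, ψ, fun i p => F i p, hf, fun j α hα => ⟨fun i => ?_, ?_⟩⟩
  · have hC : IsCompact (K ∩ tsupport (F i)) := hK.inter_right (isClosed_tsupport _)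
    obtain ⟨K', hK', hKs, hKi⟩ := (ψ i).isCompact_preimage hC (by
      rw [hWS]
      exact fun p hp => ⟨hKU hp.1, hF i hp.2⟩)
    refine ⟨K', hK', hKs, hKi ▸ inter_subset_left, fun χ x hx hxK => ?_⟩
    rw [hKi] at hxK
    rw [mulForm_apply, coordFun_apply _ χ hx]
    by_cases h1 : χ x ∈ K
    · have h2 : F i (χ x) = 0 := image_eq_zero_of_notMem_tsupport fun h => hxK ⟨h1, h⟩
      exact (congrArg (· • α.1 χ x) h2).trans (zero_smul _ _)
    · rw [hα χ x hx h1, smul_zero]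
  · apply Subtype.ext
    funext χ x
    have h1 : (∑ i ∈ hfin.toFinset, mulForm (fun p => F i p) (hf i) j α).1 χ x =
        (∑ i ∈ hfin.toFinset, coordFun (fun p => F i p) χ x) • α.1 χ x := by
      rw [AddSubmonoidClass.coe_finsetSum, Finset.sum_apply, Finset.sum_apply, Finset.sum_smul]
      rfl
    rw [h1]
    by_cases hx : x ∈ χ.source
    · by_cases hxK : χ x ∈ K
      · have h2 : ∑ i ∈ hfin.toFinset, coordFun (fun p : U.carrier => F i p) χ x = 1 := by
          rw [← F.sum_eq_one hxK, finsum_eq_sum_of_support_subset]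
          · exact Finset.sum_congr rfl fun i _ => coordFun_apply _ χ hx
          · intro i hi
            exact hfin.mem_toFinset.mpr ⟨χ x, hi, hxK⟩
        rw [h2, one_smul]
      · rw [hα χ x hx hxK, smul_zero]
    · rw [α.2.1.eq_zero χ x hx, smul_zero]

/-! ### Linear maps on de Rham chains defined on open subsets of Euclidean spaces -/

universe w

/-- Families of linear maps on the forms on open subsets of Euclidean spaces which are compatible
with changes of coordinates and with integration along the fibers of projections. -/
structure EuclFunctional (X : DiffSpace.{u}) (k : ℕ) (N : Type w) [AddCommGroup N]
    [Module ℝ N] where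
  T : ∀ {m j : ℕ} (O : Opens (Fin m → ℝ)) (φ : (opn O).carrier → X.carrier)
    (_ : X.IsPlot (opn O) φ) (_ : j + k = m), testForms O j →ₗ[ℝ] N
  chart : ∀ {m j : ℕ} (O : Opens (Fin m → ℝ)) (φ : (opn O).carrier → X.carrier)
    (hφ : X.IsPlot (opn O) φ) (hj : j + k = m) (τ : LocalParam (O : Set (Fin m → ℝ)) m)
    (η : testForms O j) (η' : testForms τ.source j),
    (∀ x ∈ τ.source, η'.1 x = ((SignType.sign (fderiv ℝ τ x).det : SignType) : ℝ) •
      τ.pull η.1 x) →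
    (∃ K, IsCompact K ∧ K ⊆ (τ.source : Set (Fin m → ℝ)) ∧ ∀ y ∉ τ '' K, η.1 y = 0) →
    T τ.source (fun x : (opn τ.source).carrier => φ (LocalParam.lift τ x))
      (X.comp_submersion hφ (isSubmersion_lift (U := opn O) τ)) hj η' = T O φ hφ hj η
  proj : ∀ {m r m' i j : ℕ} (h : m' = m + r) (O' : Opens (Fin m' → ℝ)) (O : Opens (Fin m → ℝ))
    (hO : ∀ z ∈ O', baseCoord h z ∈ O) {φ : (opn O).carrier → X.carrier}
    (hφ : X.IsPlot (opn O) φ) (hi : i + k = m') (hj : j + k = m) (hij : i = j + r)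
    (η : testForms O' i) (β : testForms O j),
    (∀ x ∈ O, ∀ v, β.1 x v = ∫ y : Fin r → ℝ, η.1 (join h x y) (frame h hij v)) →
    T O φ hφ hj β = T O' (φ ∘ projMap h O' O hO)
      (X.comp_submersion hφ (isSubmersion_projMap h O' O hO)) hi η
  negative : ∀ {m r m' i : ℕ} (h : m' = m + r) (O' : Opens (Fin m' → ℝ))
    (O : Opens (Fin m → ℝ)) (hO : ∀ z ∈ O', baseCoord h z ∈ O) {φ : (opn O).carrier → X.carrier}
    (hφ : X.IsPlot (opn O) φ) (hi : i + k = m') (_ : m < k) (η : testForms O' i),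
    T O' (φ ∘ projMap h O' O hO) (X.comp_submersion hφ (isSubmersion_projMap h O' O hO)) hi η = 0

/-- Linear maps on a sum of submodules which agree on relations. -/
lemma exists_linearMap_of_submodules {ι V N : Type*} [AddCommGroup V] [Module ℝ V]
    [AddCommGroup N] [Module ℝ N] (A : ι → Submodule ℝ V) (hA : ∀ v, v ∈ ⨆ i, A i)
    (t : ∀ i, A i →ₗ[ℝ] N)
    (h : ∀ (s : Finset ι) (a : ∀ i, A i), ∑ i ∈ s, (a i : V) = 0 → ∑ i ∈ s, t i (a i) = 0) :
    ∃ T : V →ₗ[ℝ] N, ∀ i (a : A i), T a = t i a := by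
  classical
  let q : (DirectSum ι fun i => A i) →ₗ[ℝ] V := DirectSum.toModule ℝ ι V fun i => (A i).subtype
  let t' : (DirectSum ι fun i => A i) →ₗ[ℝ] N := DirectSum.toModule ℝ ι N t
  have hq : Function.Surjective q := by
    rw [← LinearMap.range_eq_top, eq_top_iff]
    intro v _
    have h1 : (⨆ i, A i) ≤ LinearMap.range q := iSup_le fun i x hx =>
      ⟨DirectSum.lof ℝ ι (fun i => A i) i ⟨x, hx⟩, by simp [q, DirectSum.toModule_lof]⟩
    exact h1 (hA v)
  have hker : LinearMap.ker q ≤ LinearMap.ker t' := by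
    intro x hx
    have hx1 : x = ∑ i ∈ DFinsupp.support x, DirectSum.lof ℝ ι (fun i => A i) i (x i) :=
      (DirectSum.sum_support_of x).symm
    have h1 : q x = ∑ i ∈ DFinsupp.support x, (x i : V) := by
      conv_lhs => rw [hx1]
      simp [q, DirectSum.toModule_lof]
    have h2 : t' x = ∑ i ∈ DFinsupp.support x, t i (x i) := by
      conv_lhs => rw [hx1]
      simp [t', DirectSum.toModule_lof]
    rw [LinearMap.mem_ker, h2]
    exact h _ (fun i => x i) (h1.symm.trans hx)
  obtain ⟨g, hg⟩ := q.exists_rightInverse_of_surjective (LinearMap.range_eq_top.mpr hq)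
  refine ⟨t' ∘ₗ g, fun i a => ?_⟩
  have h1 : g (a : V) - DirectSum.lof ℝ ι (fun i => A i) i a ∈ LinearMap.ker q := by
    rw [LinearMap.mem_ker, map_sub, sub_eq_zero]
    refine (congrArg (fun F : V →ₗ[ℝ] V => F a) hg).trans ?_
    simp [q, DirectSum.toModule_lof]
  have h2 := hker h1
  rw [LinearMap.mem_ker, map_sub, sub_eq_zero] at h2
  rw [LinearMap.comp_apply, h2]
  simp [t', DirectSum.toModule_lof]

/-- The forms supported in the image of a parametrization. -/
def supportedForms {U : OrientedSubmanifold} (ψ : U.Param) (j : ℕ) :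
    Submodule ℝ (compactForms U j) where
  carrier := {α | SupportedIn α.1 ψ}
  zero_mem' := ⟨∅, isCompact_empty, empty_subset _, fun _ _ _ _ => rfl⟩
  add_mem' := by
    rintro α β ⟨K, hK, hKs, hv⟩ ⟨L, hL, hLs, hw⟩
    refine ⟨K ∪ L, hK.union hL, union_subset hKs hLs, fun χ x hx h => ?_⟩
    rw [image_union, mem_union, not_or] at h
    change α.1 χ x + β.1 χ x = 0
    rw [hv χ x hx h.1, hw χ x hx h.2, add_zero]
  smul_mem' := by
    rintro c α ⟨K, hK, hKs, hv⟩
    refine ⟨K, hK, hKs, fun χ x hx h => ?_⟩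
    change c • α.1 χ x = 0
    rw [hv χ x hx h, smul_zero]

namespace EuclFunctional

variable {X : DiffSpace.{u}} {k : ℕ} {N : Type w} [AddCommGroup N] [Module ℝ N]
  (F : EuclFunctional X k N)

lemma T_congr {m j : ℕ} {O : Opens (Fin m → ℝ)} {φ φ' : (opn O).carrier → X.carrier}
    (h : φ = φ') (hφ : X.IsPlot (opn O) φ) (hφ' : X.IsPlot (opn O) φ') (hj : j + k = m)
    (η : testForms O j) : F.T O φ hφ hj η = F.T O φ' hφ' hj η := by
  subst h
  rfl

/-- The value on a form supported in the image of a parametrization. -/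
def onParam {U : OrientedSubmanifold} (φ : U.carrier → X.carrier) (hφ : X.IsPlot U φ) {j : ℕ}
    (hj : j + k = U.dim) (ψ : U.Param) : supportedForms (U := U) ψ j →ₗ[ℝ] N where
  toFun α := F.T ψ.source (fun x : (opn ψ.source).carrier => φ (ψ.lift x))
    (X.comp_submersion hφ (isSubmersion_lift ψ)) hj (signedTest α.1 ψ α.2)
  map_add' α β := by
    rw [← map_add]
    congr 1
    exact Subtype.ext (funext fun x => smul_add _ _ _)
  map_smul' c α := by
    rw [RingHom.id_apply, ← map_smul]
    congr 1
    exact Subtype.ext (funext fun x => smul_comm (U.sgn ψ x : ℝ) c (α.1.1 ψ x))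

lemma onParam_apply {U : OrientedSubmanifold} (φ : U.carrier → X.carrier) (hφ : X.IsPlot U φ)
    {j : ℕ} (hj : j + k = U.dim) (ψ : U.Param) (α : compactForms U j) (h : SupportedIn α.1 ψ) :
    F.onParam φ hφ hj ψ ⟨α, h⟩ = F.T ψ.source (fun x : (opn ψ.source).carrier => φ (ψ.lift x))
      (X.comp_submersion hφ (isSubmersion_lift ψ)) hj (signedTest α ψ h) := rfl

lemma onParam_eq {U : OrientedSubmanifold} (φ : U.carrier → X.carrier) (hφ : X.IsPlot U φ) {j : ℕ}
    (hj : j + k = U.dim) (ψ ψ' : U.Param) (α : compactForms U j) (h : SupportedIn α.1 ψ)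
    (h' : SupportedIn α.1 ψ') : F.onParam φ hφ hj ψ ⟨α, h⟩ = F.onParam φ hφ hj ψ' ⟨α, h'⟩ := by
  obtain ⟨K, hK, hKs, hv⟩ := id h
  obtain ⟨K', hK', hKs', hv'⟩ := id h'
  obtain ⟨W, hW, hWS⟩ := ψ'.image_open _ ψ'.source.isOpen subset_rfl
  let N : Opens (Fin U.dim → ℝ) := ⟨ψ.source ∩ ψ ⁻¹' W,
    ψ.smooth.continuousOn.isOpen_inter_preimage ψ.source.isOpen hW⟩
  have hN : ∀ x, x ∈ N ↔ x ∈ ψ.source ∧ ∃ y ∈ ψ'.source, ψ' y = ψ x := fun x => by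
    refine ⟨fun hx => ⟨hx.1, ?_⟩, fun hx => ⟨hx.1, ?_⟩⟩
    · have : ψ x ∈ ψ' '' ψ'.source := by rw [hWS]; exact ⟨ψ.mem x hx.1, hx.2⟩
      obtain ⟨y, hy, hyx⟩ := this
      exact ⟨y, hy, hyx⟩
    · obtain ⟨y, hy, hyx⟩ := hx.2
      have : ψ x ∈ U.carrier ∩ W := by rw [← hWS]; exact ⟨y, hy, hyx⟩
      exact this.2
  have hN' : ∀ x : N, ∃ y, y ∈ ψ'.source ∧ ψ' y = ψ x := fun x => by
    obtain ⟨y, hy, hyx⟩ := ((hN x).mp x.2).2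
    exact ⟨y, hy, hyx⟩
  classical
  let θ : (Fin U.dim → ℝ) → (Fin U.dim → ℝ) := fun x =>
    if hx : x ∈ N then (hN' ⟨x, hx⟩).choose else 0
  have hθ : ∀ x ∈ N, θ x ∈ ψ'.source ∧ ψ' (θ x) = ψ x := fun x hx => by
    simp only [θ, hx, dif_pos]
    exact (hN' ⟨x, hx⟩).choose_spec
  have hθs : ∀ x ∈ N, ContDiffAt ℝ ∞ θ x := fun x hx => by
    obtain ⟨τ, hτ, hτx, hev⟩ := ψ'.exists_factor (hθ x hx).1 (ψ.contDiffAt ((hN x).mp hx).1)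
      (hθ x hx).2.symm (by
        filter_upwards [ψ.source.isOpen.mem_nhds ((hN x).mp hx).1] with z hz using ψ.mem z hz)
    refine hτ.congr_of_eventuallyEq ?_
    filter_upwards [hev, N.isOpen.mem_nhds hx] with z hz hzN
    exact ψ'.injOn (hθ z hzN).1 hz.1 ((hθ z hzN).2.trans hz.2)
  have hθd : ∀ x ∈ N, fderiv ℝ ψ x = (fderiv ℝ ψ' (θ x)).comp (fderiv ℝ θ x) := fun x hx => by
    have h1 : ψ.toFun =ᶠ[𝓝 x] fun z => ψ' (θ z) := by
      filter_upwards [N.isOpen.mem_nhds hx] with z hz using (hθ z hz).2.symm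
    rw [h1.fderiv_eq]
    exact fderiv_comp x ((ψ'.contDiffAt (hθ x hx).1).differentiableAt (by simp))
      ((hθs x hx).differentiableAt (by simp))
  let inc : LocalParam (ψ.source : Set (Fin U.dim → ℝ)) U.dim :=
    (idParam (ψ.source : Set (Fin U.dim → ℝ)) ψ.source.isOpen).restrict N fun x hx => hx.1
  let Θ : LocalParam (ψ'.source : Set (Fin U.dim → ℝ)) U.dim :=
    LocalParam.ofOpen ψ'.source N θ (fun x hx => (hθ x hx).1)
      (fun x hx => (hθs x hx).contDiffWithinAt) (fun x hx v w hvw => by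
        apply ψ.immersive x ((hN x).mp hx).1
        rw [hθd x hx]
        exact congrArg (fderiv ℝ ψ' (θ x)) hvw)
      (fun x hx y hy hxy => ψ.injOn ((hN x).mp hx).1 ((hN y).mp hy).1 (by
        rw [← (hθ x hx).2, ← (hθ y hy).2, hxy]))
  let K'' := K ∩ ψ ⁻¹' (ψ' '' K')
  have hKc : IsCompact K'' := by
    refine hK.of_isClosed_subset ?_ inter_subset_left
    exact (ψ.smooth.continuousOn.mono hKs).preimage_isClosed_of_isClosed hK.isClosed
      (hK'.image_of_continuousOn (ψ'.smooth.continuousOn.mono hKs')).isClosed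
  have hKN : K'' ⊆ N := fun x hx => (hN x).mpr ⟨hKs hx.1, by
    obtain ⟨y, hy, hyx⟩ := hx.2
    exact ⟨y, hKs' hy, hyx⟩⟩
  have hKz : ∀ x ∉ K'', signedForm α.1 ψ x = 0 := fun x hx => by
    by_cases hxs : x ∈ ψ.source
    · by_cases h1 : ψ x ∈ ψ '' K
      · obtain ⟨z, hz, hzx⟩ := h1
        have hzx' := ψ.injOn (hKs hz) hxs hzx
        subst hzx'
        simp [signedForm, hv' ψ z hxs fun h => hx ⟨hz, h⟩]
      · simp [signedForm, hv ψ x hxs h1]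
    · simp [signedForm, α.2.1.eq_zero ψ x hxs]
  let η : testForms N j := ⟨signedForm α.1 ψ, (signedForm_spec α.2.1 h).1, K'', hKc, hKN, hKz⟩
  have e1 := F.chart ψ.source (fun x : (opn ψ.source).carrier => φ (ψ.lift x))
    (X.comp_submersion hφ (isSubmersion_lift ψ)) hj inc (signedTest α ψ h) η (fun x hx => by
      rw [inc.pull_of_mem hx]
      have h1 : fderiv ℝ inc x = ContinuousLinearMap.id ℝ (Fin U.dim → ℝ) := fderiv_id
      have h2 : (ContinuousLinearMap.id ℝ (Fin U.dim → ℝ)).det = 1 := LinearMap.det_id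
      rw [h1, h2, sign_one, SignType.coe_one, one_smul]
      rfl) ⟨K'', hKc, hKN, fun y hy => hKz y fun hy' => hy ⟨y, hy', rfl⟩⟩
  have e2 := F.chart ψ'.source (fun x : (opn ψ'.source).carrier => φ (ψ'.lift x))
    (X.comp_submersion hφ (isSubmersion_lift ψ')) hj Θ (signedTest α ψ' h') η (fun x hx => by
      have hxs := ((hN x).mp hx).1
      rw [Θ.pull_of_mem hx]
      change (U.sgn ψ x : ℝ) • α.1 ψ x = ((SignType.sign (fderiv ℝ θ x).det : SignType) : ℝ) •
        ((U.sgn ψ' (θ x) : ℝ) • α.1 ψ' (θ x)).compContinuousLinearMap (fderiv ℝ θ x)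
      rw [α.2.1.compat ψ ψ' x (θ x) _ hxs (hθ x hx).1 (hθ x hx).2.symm (hθd x hx),
        U.sgn_compat ψ ψ' x (θ x) _ hxs (hθ x hx).1 (hθ x hx).2.symm (hθd x hx)]
      ext v
      simp [mul_assoc]) ⟨K'', hKc, hKN, fun y hy => by
        change (U.sgn ψ' y : ℝ) • α.1 ψ' y = 0
        by_cases hys : y ∈ ψ'.source
        · by_cases h1 : ψ' y ∈ ψ '' K
          · obtain ⟨z, hz, hzy⟩ := h1
            have h2 : ψ' y ∉ ψ' '' K' := fun h2 => hy ⟨z, ⟨hz, by rwa [mem_preimage, hzy]⟩, by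
              have hzN : z ∈ N := (hN z).mpr ⟨hKs hz, y, hys, hzy.symm⟩
              exact ψ'.injOn (hθ z hzN).1 hys ((hθ z hzN).2.trans hzy)⟩
            rw [hv' ψ' y hys h2, smul_zero]
          · rw [hv ψ' y hys h1, smul_zero]
        · rw [α.2.1.eq_zero ψ' y hys, smul_zero]⟩
  rw [onParam_apply, onParam_apply, ← e1, ← e2]
  refine F.T_congr ?_ _ _ _ _
  funext x
  exact congrArg φ (Subtype.ext (hθ x.1 x.2).2.symm)

lemma exists_onForms {U : OrientedSubmanifold} (φ : U.carrier → X.carrier) (hφ : X.IsPlot U φ)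
    {j : ℕ} (hj : j + k = U.dim) :
    ∃ T : compactForms U j →ₗ[ℝ] N, ∀ (ψ : U.Param) (α : supportedForms (U := U) ψ j),
      T α = F.onParam φ hφ hj ψ α := by
  refine exists_linearMap_of_submodules (fun ψ : U.Param => supportedForms (U := U) ψ j)
    (fun α => ?_) (fun ψ => F.onParam φ hφ hj ψ) fun s a ha => ?_
  · obtain ⟨K, hK, hKU, hv⟩ := α.2.2
    obtain ⟨t, ψ, f, hf, H⟩ := exists_partition hK hKU
    rw [← (H j α hv).2]
    refine Submodule.sum_mem _ fun i _ => Submodule.mem_iSup_of_mem (ψ i) ?_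
    obtain ⟨K', hK', hKs, -, hv'⟩ := (H j α hv).1 i
    exact ⟨K', hK', hKs, hv'⟩
  · have hKa : ∀ ψ : U.Param, ∃ K, IsCompact K ∧ K ⊆ U.carrier ∧ VanishesOff (a ψ).1.1 K :=
      fun ψ => (a ψ).1.2.2
    choose K hK hKU hv using hKa
    let L := ⋃ ψ ∈ s, K ψ
    have hL : IsCompact L := s.isCompact_biUnion fun ψ _ => hK ψ
    obtain ⟨t, χ, f, hf, H⟩ := exists_partition hL (iUnion₂_subset fun ψ _ => hKU ψ)
    have hvL : ∀ ψ ∈ s, VanishesOff (a ψ).1.1 L := fun ψ hψ θ x hx hxL =>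
      hv ψ θ x hx fun h => hxL (mem_biUnion hψ h)
    have hχ : ∀ (i : U.carrier) (α : compactForms U j), VanishesOff α.1 L →
        mulForm (f i) (hf i) j α ∈ supportedForms (χ i) j := fun i α hα => by
      obtain ⟨K', hK', hKs, -, hv'⟩ := (H j α hα).1 i
      exact ⟨K', hK', hKs, hv'⟩
    have hψ : ∀ (ψ : U.Param) (i : U.carrier),
        mulForm (f i) (hf i) j (a ψ).1 ∈ supportedForms ψ j := fun ψ i =>
      SupportedIn.mulForm (hf i) (a ψ).2
    have h1 : ∀ ψ ∈ s, F.onParam φ hφ hj ψ (a ψ) = ∑ i ∈ t,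
        F.onParam φ hφ hj ψ ⟨mulForm (f i) (hf i) j (a ψ).1, hψ ψ i⟩ := fun ψ hs => by
      rw [← map_sum]
      congr 1
      apply Subtype.ext
      rw [AddSubmonoidClass.coe_finsetSum]
      exact (H j (a ψ).1 (hvL ψ hs)).2.symm
    rw [Finset.sum_congr rfl h1, Finset.sum_comm]
    refine Finset.sum_eq_zero fun i _ => ?_
    have h2 : ∀ ψ : s, F.onParam φ hφ hj ψ ⟨mulForm (f i) (hf i) j (a ψ).1, hψ ψ i⟩ =
        F.onParam φ hφ hj (χ i) ⟨mulForm (f i) (hf i) j (a ψ).1, hχ i _ (hvL ψ ψ.2)⟩ :=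
      fun ψ => F.onParam_eq φ hφ hj _ _ _ _ _
    rw [← Finset.sum_coe_sort s, Finset.sum_congr rfl fun ψ _ => h2 ψ, ← map_sum]
    have h3 : ∑ ψ : s, (⟨mulForm (f i) (hf i) j (a ψ).1, hχ i _ (hvL ψ ψ.2)⟩ :
        supportedForms (χ i) j) = 0 := by
      apply Subtype.ext
      rw [AddSubmonoidClass.coe_finsetSum, ← map_sum, Finset.sum_coe_sort s fun ψ => (a ψ).1, ha,
        map_zero]
      rfl
    rw [h3, map_zero]

/-- The linear map on the summand of a plot. -/
def onForms (g : ChainIndex X k) : compactForms g.U g.degree →ₗ[ℝ] N :=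
  (F.exists_onForms g.φ g.isPlot g.degree_add).choose

lemma onForms_apply {U : OrientedSubmanifold} (φ : U.carrier → X.carrier) (hφ : X.IsPlot U φ)
    {j : ℕ} (hj : j + k = U.dim) (ψ : U.Param) (α : compactForms U j) (h : SupportedIn α.1 ψ) :
    F.onForms ⟨U, φ, hφ, j, hj⟩ α = F.T ψ.source (fun x : (opn ψ.source).carrier => φ (ψ.lift x))
      (X.comp_submersion hφ (isSubmersion_lift ψ)) hj (signedTest α ψ h) :=
  (F.exists_onForms φ hφ hj).choose_spec ψ ⟨α, h⟩

lemma isSmoothProj {V U : OrientedSubmanifold} {π : V.carrier → U.carrier} (a : AdaptedParams π) :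
    ∀ z ∈ a.ψ.source, baseCoord a.dim_eq z ∈ a.χ.source := fun z hz => by
  have hz' : join a.dim_eq (baseCoord a.dim_eq z) (fiberCoord a.dim_eq z) ∈ a.ψ.source := by
    rwa [join_baseCoord_fiberCoord]
  exact (a.adapted _ _ hz').1

lemma adapted_comp {V U : OrientedSubmanifold} {π : V.carrier → U.carrier} (a : AdaptedParams π)
    (x : (opn a.ψ.source).carrier) : π (a.ψ.lift x) =
      a.χ.lift (projMap a.dim_eq a.ψ.source a.χ.source (isSmoothProj a) x) := by
  obtain ⟨(z : Fin V.dim → ℝ), (hz : z ∈ a.ψ.source)⟩ := x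
  have hz' : join a.dim_eq (baseCoord a.dim_eq z) (fiberCoord a.dim_eq z) ∈ a.ψ.source := by
    rwa [join_baseCoord_fiberCoord]
  obtain ⟨h1, h2⟩ := a.adapted _ _ hz'
  refine Eq.trans (congrArg (fun p => π (a.ψ.lift p)) (Subtype.ext ?_)) h2
  exact (join_baseCoord_fiberCoord a.dim_eq z).symm

lemma relations_le_ker : relations X k ≤ LinearMap.ker (preLift F.onForms) := by
  refine Submodule.span_le.mpr fun c hc => ?_
  change preLift F.onForms c = 0
  cases hc with
  | @fiber U V φ hφ π hπ a i j hi hj hij α β hαβ =>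
    rw [map_sub, preLift_preMk, preLift_preMk, sub_eq_zero,
      F.onForms_apply φ hφ hj a.χ β hαβ.supported',
      F.onForms_apply (φ ∘ π) _ hi a.ψ α hαβ.supported]
    refine (F.proj a.dim_eq a.ψ.source a.χ.source (isSmoothProj a)
      (X.comp_submersion hφ (isSubmersion_lift a.χ)) hi hj hij (signedTest α a.ψ hαβ.supported)
      (signedTest β a.χ hαβ.supported') ?_).trans ?_
    rotate_left
    · refine F.T_congr ?_ _ _ _ _
      funext x
      exact congrArg φ (adapted_comp a x).symm
    · intro x hx v
      change (U.sgn a.χ x : ℝ) * β.1 a.χ x v = _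
      rw [hαβ.formula x hx v, ← integral_const_mul]
      refine integral_congr_ae (Filter.Eventually.of_forall fun y => ?_)
      change (U.sgn a.χ x : ℝ) * _ = (V.sgn a.ψ _ : ℝ) * α.1 a.ψ _ _
      rw [← mul_assoc, mul_comm (V.sgn a.ψ _ : ℝ), ← mul_assoc, sgn_mul_self a.χ hx, one_mul]
  | @negative U V φ hφ π hπ a i hi hk α hα =>
    rw [map_sub, map_zero, preLift_preMk, zero_sub, neg_eq_zero,
      F.onForms_apply (φ ∘ π) _ hi a.ψ α hα]
    refine Eq.trans ?_ (F.negative a.dim_eq a.ψ.source a.χ.source (isSmoothProj a)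
      (X.comp_submersion hφ (isSubmersion_lift a.χ)) hi hk (signedTest α a.ψ hα))
    refine F.T_congr ?_ _ _ _ _
    funext x
    exact congrArg φ (adapted_comp a x)

/-- The linear map on de Rham chains. -/
def lift : Chains X k →ₗ[ℝ] N := (relations X k).liftQ (preLift F.onForms) F.relations_le_ker

lemma lift_chainMk {U : OrientedSubmanifold} (φ : U.carrier → X.carrier) (hφ : X.IsPlot U φ)
    {j : ℕ} (hj : j + k = U.dim) (ψ : U.Param) (α : compactForms U j) (h : SupportedIn α.1 ψ) :
    F.lift (chainMk φ hφ hj α) = F.T ψ.source (fun x : (opn ψ.source).carrier => φ (ψ.lift x))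
      (X.comp_submersion hφ (isSubmersion_lift ψ)) hj (signedTest α ψ h) := by
  rw [← F.onForms_apply φ hφ hj ψ α h, ← preLift_preMk F.onForms φ hφ hj α]
  rfl

lemma signedTest_euclForm {m j : ℕ} (O : Opens (Fin m → ℝ)) (η : testForms O j) :
    (signedTest (U := opn O) (euclForm O j η) (idParam (O : Set (Fin m → ℝ)) O.isOpen)
      (supportedIn_euclForm O η) : testForms O j) = η := by
  refine Subtype.ext (funext fun (x : Fin m → ℝ) => ?_)
  change (((opn O).sgn (idParam (O : Set (Fin m → ℝ)) O.isOpen) x : SignType) : ℝ) •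
    (idParam (O : Set (Fin m → ℝ)) O.isOpen).pull η.1 x = η.1 x
  rw [pull_idParam]
  by_cases hx : x ∈ O
  · rw [sgn_idParam O hx]
    simp
  · rw [testForms.eq_zero η hx, smul_zero]

lemma lift_eucl {m j : ℕ} (O : Opens (Fin m → ℝ)) (φ : (opn O).carrier → X.carrier)
    (hφ : X.IsPlot (opn O) φ) (hj : j + k = m) (η : testForms O j) :
    F.lift (eucl O φ hφ hj η) = F.T O φ hφ hj η := by
  refine (F.lift_chainMk (U := opn O) φ hφ hj (idParam (O : Set (Fin m → ℝ)) O.isOpen)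
    (euclForm O j η) (supportedIn_euclForm O η)).trans ?_
  exact congrArg (F.T O φ hφ hj) (signedTest_euclForm O η)

end EuclFunctional

/-- De Rham chains are sums of chains given by open subsets of Euclidean spaces. -/
lemma chainMk_mem_span {X : DiffSpace.{u}} {k : ℕ} {U : OrientedSubmanifold}
    (φ : U.carrier → X.carrier) (hφ : X.IsPlot U φ) {j : ℕ} (hj : j + k = U.dim)
    (α : compactForms U j) {K : Set (Fin U.ambient → ℝ)} (hK : IsCompact K) (hKU : K ⊆ U.carrier)
    (hv : VanishesOff α.1 K) {S : Set X.carrier} (hS : ∀ p : U.carrier, p.1 ∈ K → φ p ∈ S) :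
    chainMk φ hφ hj α ∈ Submodule.span ℝ {c : Chains X k | ∃ (m j : ℕ) (O : Opens (Fin m → ℝ))
      (φ : (opn O).carrier → X.carrier) (hφ : X.IsPlot (opn O) φ) (hj : j + k = m)
      (η : testForms O j), (∃ K', IsCompact K' ∧ K' ⊆ (O : Set (Fin m → ℝ)) ∧
        (∀ x ∉ K', η.1 x = 0) ∧ ∀ p : (opn O).carrier, p.1 ∈ K' → φ p ∈ S) ∧
      c = eucl O φ hφ hj η} := by
  obtain ⟨t, ψ, f, hf, H⟩ := exists_partition hK hKU
  obtain ⟨h1, h2⟩ := H j α hv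
  have h3 : chainMk φ hφ hj α = ∑ i ∈ t, chainMk φ hφ hj (mulForm (f i) (hf i) j α) := by
    conv_lhs => rw [← h2]
    simp only [chainMk, map_sum]
  rw [h3]
  refine Submodule.sum_mem _ fun i _ => Submodule.subset_span ?_
  obtain ⟨K', hK', hKs, hKi, hv'⟩ := h1 i
  have hs : SupportedIn (mulForm (f i) (hf i) j α).1 (ψ i) := ⟨K', hK', hKs, hv'⟩
  refine ⟨U.dim, j, (ψ i).source, φ ∘ (ψ i).lift, _, hj, signedTest _ (ψ i) hs,
    ⟨K', hK', hKs, fun x hx => ?_, fun p hp => hS _ (hKi ⟨p.1, hp, rfl⟩)⟩,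
    chainMk_eq_eucl hφ hj _ (ψ i) hs⟩
  change (U.sgn (ψ i) x : ℝ) • (mulForm (f i) (hf i) j α).1 (ψ i) x = 0
  by_cases hxs : x ∈ (ψ i).source
  · rw [hv' (ψ i) x hxs, smul_zero]
    rintro ⟨z, hz, hzx⟩
    exact hx ((ψ i).injOn (hKs hz) hxs hzx ▸ hz)
  · rw [(mulForm (f i) (hf i) j α).2.1.eq_zero (ψ i) x hxs, smul_zero]

/-- Induction principle for de Rham chains. -/
lemma chains_induction {X : DiffSpace.{u}} {k : ℕ} {P : Chains X k → Prop} (zero : P 0)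
    (add : ∀ a b, P a → P b → P (a + b)) (smul : ∀ (r : ℝ) a, P a → P (r • a))
    (eucl : ∀ (m j : ℕ) (O : Opens (Fin m → ℝ)) (φ : (opn O).carrier → X.carrier)
      (hφ : X.IsPlot (opn O) φ) (hj : j + k = m) (η : testForms O j), P (eucl O φ hφ hj η))
    (c : Chains X k) : P c := by
  let Q : Submodule ℝ (Chains X k) :=
    { carrier := {c | P c}, add_mem' := fun {a b} => add a b, zero_mem' := zero,
      smul_mem' := smul }
  have h1 : (LinearMap.id : Chains X k →ₗ[ℝ] Chains X k).range ≤ Q := by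
    have h2 : Q.mkQ = 0 := chains_hom_ext fun U φ hφ j hj α => by
      rw [LinearMap.zero_apply, Submodule.mkQ_apply, Submodule.Quotient.mk_eq_zero]
      obtain ⟨K, hK, hKU, hv⟩ := α.2.2
      refine Submodule.span_le.mpr ?_ (chainMk_mem_span φ hφ hj α hK hKU hv (S := univ)
        fun _ _ => mem_univ _)
      rintro _ ⟨m, j, O, φ, hφ, hj, η, -, rfl⟩
      exact eucl m j O φ hφ hj η
    rintro x -
    rw [← Submodule.Quotient.mk_eq_zero, ← Submodule.mkQ_apply, h2, LinearMap.zero_apply]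
  exact h1 ⟨c, rfl⟩

section Eucl

variable {X : DiffSpace.{u}} {k m j : ℕ}

lemma eucl_chart (O : Opens (Fin m → ℝ)) (φ : (opn O).carrier → X.carrier)
    (hφ : X.IsPlot (opn O) φ) (hj : j + k = m) (τ : LocalParam (O : Set (Fin m → ℝ)) m)
    (η : testForms O j) (η' : testForms τ.source j)
    (h : ∀ x ∈ τ.source, η'.1 x = ((SignType.sign (fderiv ℝ τ x).det : SignType) : ℝ) •
      τ.pull η.1 x)
    (hs : ∃ K, IsCompact K ∧ K ⊆ (τ.source : Set (Fin m → ℝ)) ∧ ∀ y ∉ τ '' K, η.1 y = 0) :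
    eucl τ.source (fun x : (opn τ.source).carrier => φ (LocalParam.lift τ x))
      (X.comp_submersion hφ (isSubmersion_lift (U := opn O) τ)) hj η' = eucl O φ hφ hj η := by
  have hs' : SupportedIn (V := opn O) (euclForm O j η).1 τ := by
    obtain ⟨K, hK, hKs, hz⟩ := hs
    exact ⟨K, hK, hKs, fun (ψ : LocalParam (O : Set (Fin m → ℝ)) m) x hx hxK =>
      ψ.pull_eq_zero (hz _ hxK)⟩
  rw [eucl_apply O φ hφ hj η]
  refine Eq.trans ?_ (chainMk_eq_eucl (U := opn O) hφ hj (euclForm O j η) τ hs').symm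
  refine congrArg (eucl τ.source _ _ hj) (Subtype.ext (funext fun (x : Fin m → ℝ) => ?_))
  change η'.1 x = (((opn O).sgn τ x : SignType) : ℝ) • τ.pull η.1 x
  by_cases hx : x ∈ τ.source
  · rw [h x hx, sgn_opn O τ hx]
  · rw [testForms.eq_zero η' hx, τ.pull_of_notMem hx, smul_zero]

/-- The inclusion of open subsets. -/
def inclMap {O N : Opens (Fin m → ℝ)} (h : N ≤ O) (x : (opn N).carrier) : (opn O).carrier :=
  ⟨x.1, h x.2⟩

lemma isSubmersion_inclMap {O N : Opens (Fin m → ℝ)} (h : N ≤ O) :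
    IsSubmersion (opn N) (opn O) (inclMap h) :=
  isSubmersion_lift (U := opn O) ((idParam (O : Set (Fin m → ℝ)) O.isOpen).restrict N h)

lemma eucl_restrict {O N : Opens (Fin m → ℝ)} (hN : N ≤ O) (φ : (opn O).carrier → X.carrier)
    (hφ : X.IsPlot (opn O) φ) (hj : j + k = m) (η : testForms O j) (η' : testForms N j)
    (h : η'.1 = η.1) :
    eucl O φ hφ hj η =
      eucl N (φ ∘ inclMap hN) (X.comp_submersion hφ (isSubmersion_inclMap hN)) hj η' := by
  obtain ⟨K, hK, hKN, hz⟩ := η'.2.2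
  refine (eucl_chart O φ hφ hj ((idParam (O : Set (Fin m → ℝ)) O.isOpen).restrict N hN) η η'
    (fun x hx => ?_) ⟨K, hK, hKN, fun y hy => ?_⟩).symm
  · rw [LocalParam.pull_of_mem _ hx]
    have h1 : fderiv ℝ ((idParam (O : Set (Fin m → ℝ)) O.isOpen).restrict N hN) x =
      ContinuousLinearMap.id ℝ (Fin m → ℝ) := fderiv_id
    have h2 : (ContinuousLinearMap.id ℝ (Fin m → ℝ)).det = 1 := LinearMap.det_id
    rw [h1, h2, sign_one, SignType.coe_one, one_smul, h]
    rfl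
  · rw [← h]
    exact hz y fun hy' => hy ⟨y, hy', rfl⟩

/-- A chain only depends on the plot near the support of the form. -/
lemma eucl_germ {O N : Opens (Fin m → ℝ)} (hN : N ≤ O) {φ φ' : (opn O).carrier → X.carrier}
    (hφ : X.IsPlot (opn O) φ) (hφ' : X.IsPlot (opn O) φ') (hj : j + k = m) (η : testForms O j)
    (h : ∀ p : (opn O).carrier, p.1 ∈ N → φ p = φ' p)
    (hs : ∃ K, IsCompact K ∧ K ⊆ (N : Set (Fin m → ℝ)) ∧ ∀ y ∉ K, η.1 y = 0) :
    eucl O φ hφ hj η = eucl O φ' hφ' hj η := by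
  let η' : testForms N j := ⟨η.1, testForms.contDiff η, hs⟩
  rw [eucl_restrict hN φ hφ hj η η' rfl, eucl_restrict hN φ' hφ' hj η η' rfl]
  exact eucl_congr (funext fun (p : (opn N).carrier) => h (inclMap hN p) p.2) _ _ _ _

end Eucl

/-! ### Integration -/

/-- The standard frame. -/
def stdFrame {j m : ℕ} (h : j = m) : Fin j → Fin m → ℝ := fun i => Pi.single (Fin.cast h i) 1

lemma alt_stdFrame_comp {j m : ℕ} (h : j = m) (B : (Fin m → ℝ) [⋀^Fin j]→L[ℝ] ℝ)
    (A : (Fin m → ℝ) →L[ℝ] (Fin m → ℝ)) :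
    B (A ∘ stdFrame h) = A.det * B (stdFrame h) := by
  subst h
  let e := Pi.basisFun ℝ (Fin j)
  have h1 : stdFrame (rfl : j = j) = e := by
    funext i
    simp [stdFrame, e]
  have h2 := B.toAlternatingMap.eq_smul_basis_det e
  have h3 : ∀ v, B v = B e * e.det v := fun v =>
    congrArg (fun F : (Fin j → ℝ) [⋀^Fin j]→ₗ[ℝ] ℝ => F v) h2
  rw [h1, h3, mul_comm]
  congr 1
  have h4 := e.det_comp (A : (Fin j → ℝ) →ₗ[ℝ] (Fin j → ℝ)) e
  rw [e.det_self, mul_one] at h4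
  exact h4

lemma join_single_left {m r m' : ℕ} (h : m' = m + r) (a : Fin m) :
    join h (Pi.single a 1) 0 = Pi.single (Fin.cast h.symm (Fin.castAdd r a)) 1 := by
  subst h
  funext i
  refine Fin.addCases (fun b => ?_) (fun b => ?_) i
  · simp [join, Pi.single_apply]
  · simp [join, Pi.single_apply, Fin.ext_iff]
    omega

lemma join_single_right {m r m' : ℕ} (h : m' = m + r) (a : Fin r) :
    join h 0 (Pi.single a 1) = Pi.single (Fin.cast h.symm (Fin.natAdd m a)) 1 := by
  subst h
  funext i
  refine Fin.addCases (fun b => ?_) (fun b => ?_) i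
  · simp [join, Pi.single_apply, Fin.ext_iff]
    omega
  · simp [join, Pi.single_apply]

lemma frame_stdFrame {m r m' i j : ℕ} (h : m' = m + r) (hi : i = j + r) (hj : j = m)
    (hi' : i = m') : frame h hi (stdFrame hj) = stdFrame hi' := by
  subst hj hi
  funext a
  refine Fin.addCases (fun b => ?_) (fun c => ?_) a
  · refine (frame_castAdd h rfl (stdFrame rfl) b).trans ?_
    exact join_single_left h b
  · refine (frame_natAdd h rfl (stdFrame rfl) c).trans ?_
    exact join_single_right h c

lemma measurePreserving_join {m r m' : ℕ} (h : m' = m + r) :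
    MeasurePreserving (fun p : (Fin m → ℝ) × (Fin r → ℝ) => join h p.1 p.2) := by
  subst h
  have h1 := volume_measurePreserving_sumPiEquivProdPi_symm (fun _ : Fin m ⊕ Fin r => ℝ)
  have h2 := volume_measurePreserving_piCongrLeft (fun _ : Fin (m + r) => ℝ) finSumFinEquiv
  have h3 : (fun p : (Fin m → ℝ) × (Fin r → ℝ) => join (m' := m + r) rfl p.1 p.2) =
      MeasurableEquiv.piCongrLeft (fun _ : Fin (m + r) => ℝ) finSumFinEquiv ∘
        (MeasurableEquiv.sumPiEquivProdPi fun _ : Fin m ⊕ Fin r => ℝ).symm := by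
    funext p i
    obtain ⟨i, rfl⟩ := finSumFinEquiv.surjective i
    refine Eq.trans ?_ (MeasurableEquiv.piCongrLeft_apply_apply
      (β := fun _ : Fin (m + r) => ℝ) finSumFinEquiv
      ((MeasurableEquiv.sumPiEquivProdPi fun _ : Fin m ⊕ Fin r => ℝ).symm p) i).symm
    cases i with
    | inl a => simp [join, MeasurableEquiv.sumPiEquivProdPi, Equiv.sumPiEquivProdPi]
    | inr a => simp [join, MeasurableEquiv.sumPiEquivProdPi, Equiv.sumPiEquivProdPi]
  rw [h3]
  exact h2.comp h1

lemma integral_join {m r m' : ℕ} (h : m' = m + r) {g : (Fin m' → ℝ) → ℝ} (hg : Continuous g)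
    (hc : HasCompactSupport g) : ∫ z, g z = ∫ x : Fin m → ℝ, ∫ y : Fin r → ℝ, g (join h x y) := by
  have hmp := measurePreserving_join h
  have hcont : Continuous fun p : (Fin m → ℝ) × (Fin r → ℝ) => join h p.1 p.2 :=
    (joinL h).continuous
  have hemb : MeasurableEmbedding fun p : (Fin m → ℝ) × (Fin r → ℝ) => join h p.1 p.2 :=
    hcont.measurableEmbedding fun p q hpq => Prod.ext
      (by simpa [baseCoord_join] using congrArg (baseCoord h) hpq)
      (by simpa [fiberCoord_join] using congrArg (fiberCoord h) hpq)
  rw [← hmp.integral_comp hemb]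
  have hi : Integrable g := hg.integrable_of_hasCompactSupport hc
  exact integral_prod _ ((hmp.integrable_comp_emb hemb).mpr hi)

/-! ### The augmentation -/

lemma testForms.continuous_apply {m j : ℕ} {O : Opens (Fin m → ℝ)} (η : testForms O j)
    (v : Fin j → Fin m → ℝ) : Continuous fun x => η.1 x v :=
  (ContinuousAlternatingMap.apply ℝ (Fin m → ℝ) ℝ v).continuous.comp (testForms.contDiff η).continuous

lemma testForms.hasCompactSupport_apply {m j : ℕ} {O : Opens (Fin m → ℝ)} (η : testForms O j)
    (v : Fin j → Fin m → ℝ) : HasCompactSupport fun x => η.1 x v :=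
  (testForms.hasCompactSupport η).comp_left
    (g := fun A : (Fin m → ℝ) [⋀^Fin j]→L[ℝ] ℝ => A v) rfl

lemma integral_proj {m r m' i j : ℕ} (h : m' = m + r) (O' : Opens (Fin m' → ℝ))
    (O : Opens (Fin m → ℝ)) (hO : ∀ z ∈ O', baseCoord h z ∈ O) (hj : j = m) (hi : i = m')
    (hij : i = j + r) (η : testForms O' i) (β : testForms O j)
    (hβ : ∀ x ∈ O, ∀ v, β.1 x v = ∫ y : Fin r → ℝ, η.1 (join h x y) (frame h hij v)) :
    ∫ x, β.1 x (stdFrame hj) = ∫ z, η.1 z (stdFrame hi) := by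
  rw [integral_join h (testForms.continuous_apply η _) (testForms.hasCompactSupport_apply η _)]
  refine integral_congr_ae (Filter.Eventually.of_forall fun x => ?_)
  change β.1 x (stdFrame hj) = ∫ y, η.1 (join h x y) (stdFrame hi)
  by_cases hx : x ∈ O
  · rw [hβ x hx, frame_stdFrame h hij hj hi]
  · rw [testForms.eq_zero β hx]
    symm
    refine integral_eq_zero_of_ae (Filter.Eventually.of_forall fun y => ?_)
    change η.1 (join h x y) (stdFrame hi) = 0
    rw [testForms.eq_zero η fun hy => hx (by simpa [baseCoord_join] using hO _ hy)]
    rfl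

/-- The integral of forms of top degree. -/
def integralForm {m j : ℕ} (O : Opens (Fin m → ℝ)) (h : j = m) : testForms O j →ₗ[ℝ] ℝ where
  toFun η := ∫ x, η.1 x (stdFrame h)
  map_add' η η' := integral_add
    ((testForms.continuous_apply η _).integrable_of_hasCompactSupport
      (testForms.hasCompactSupport_apply η _))
    ((testForms.continuous_apply η' _).integrable_of_hasCompactSupport
      (testForms.hasCompactSupport_apply η' _))
  map_smul' c _ := integral_const_mul c _

lemma integral_chart {m j : ℕ} (h : j = m) {O : Opens (Fin m → ℝ)}
    (τ : LocalParam (O : Set (Fin m → ℝ)) m) (η : testForms O j) (η' : testForms τ.source j)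
    (hη : ∀ x ∈ τ.source, η'.1 x = ((SignType.sign (fderiv ℝ τ x).det : SignType) : ℝ) •
      τ.pull η.1 x)
    (hs : ∃ K, IsCompact K ∧ K ⊆ (τ.source : Set (Fin m → ℝ)) ∧ ∀ y ∉ τ '' K, η.1 y = 0) :
    ∫ x, η'.1 x (stdFrame h) = ∫ x, η.1 x (stdFrame h) := by
  obtain ⟨K, hK, hKs, hz⟩ := hs
  have h1 : ∫ x in (τ.source : Set (Fin m → ℝ)), η'.1 x (stdFrame h) =
      ∫ x, η'.1 x (stdFrame h) :=
    setIntegral_eq_integral_of_forall_compl_eq_zero fun x hx => by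
      rw [testForms.eq_zero η' hx]; rfl
  have h2 : ∫ x in τ '' τ.source, η.1 x (stdFrame h) = ∫ x, η.1 x (stdFrame h) :=
    setIntegral_eq_integral_of_forall_compl_eq_zero fun x hx => by
      rw [hz x fun hx' => hx (image_mono hKs hx')]; rfl
  rw [← h1, ← h2, integral_image_eq_integral_abs_det_fderiv_smul volume
    τ.source.isOpen.measurableSet
    (fun x hx => ((τ.contDiffAt hx).differentiableAt (by simp)).hasFDerivAt.hasFDerivWithinAt)
    τ.injOn]
  refine setIntegral_congr_fun τ.source.isOpen.measurableSet fun x hx => ?_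
  have hx' : x ∈ τ.source := hx
  rw [hη x hx', τ.pull_of_mem hx']
  change _ * η.1 (τ x) (fderiv ℝ τ x ∘ stdFrame h) = _
  rw [alt_stdFrame_comp, ← mul_assoc, sign_mul_self, smul_eq_mul]

/-- The augmentation, as a family of maps on forms. -/
def augFunctional (X : DiffSpace.{u}) : EuclFunctional X 0 ℝ where
  T O _ _ hj := integralForm O ((add_zero _).symm.trans hj)
  chart _ _ _ _ τ η η' h hs := integral_chart _ τ η η' h hs
  proj h O' O hO _ _ hi hj hij η β hβ :=
    integral_proj h O' O hO ((add_zero _).symm.trans hj) ((add_zero _).symm.trans hi) hij η β hβ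
  negative _ _ _ _ _ _ _ h := absurd h (Nat.not_lt_zero _)

/-- The augmentation `[(U, φ, η)] ↦ ∫ η`. -/
def aug (X : DiffSpace.{u}) : Chains X 0 →ₗ[ℝ] ℝ := (augFunctional X).lift

lemma aug_eucl {X : DiffSpace.{u}} {m j : ℕ} (O : Opens (Fin m → ℝ))
    (φ : (opn O).carrier → X.carrier) (hφ : X.IsPlot (opn O) φ) (hj : j + 0 = m)
    (η : testForms O j) :
    aug X (eucl O φ hφ hj η) = ∫ x, η.1 x (stdFrame ((add_zero _).symm.trans hj)) :=
  (augFunctional X).lift_eucl O φ hφ hj η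

lemma aug_push {X : DiffSpace.{u}} {Y : DiffSpace.{v}} (f : SmoothHom X Y) (c : Chains X 0) :
    aug Y (push f 0 c) = aug X c := by
  induction c using chains_induction with
  | zero => simp
  | add c c' h h' => rw [map_add, map_add, map_add, h, h']
  | smul a c h => rw [map_smul, map_smul, map_smul, h]
  | eucl m j O φ hφ hj η => rw [push_eucl, aug_eucl, aug_eucl]

lemma aug_boundary {X : DiffSpace.{u}} (c : Chains X 1) : aug X (boundary X 0 c) = 0 := by
  induction c using chains_induction with
  | zero => simp
  | add c c' h h' => rw [map_add, map_add, h, h', add_zero]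
  | smul a c h => rw [map_smul, map_smul, h, smul_zero]
  | eucl m j O φ hφ hj η =>
    rw [boundary_eucl, aug_eucl]
    change ∫ x, extDeriv η.1 x (stdFrame _) = 0
    have h1 := integral_extDeriv_frame (m := 0) (r := m) (m' := m) (i := j) (j := 0)
      (zero_add m).symm (by omega) (testForms.contDiff η) (testForms.hasCompactSupport η) 0
      Fin.elim0
    rw [Finset.univ_eq_empty, Finset.sum_empty] at h1
    rw [← h1]
    refine integral_congr_ae (Filter.Eventually.of_forall fun y => ?_)
    simp only []
    have hj0 : join (zero_add m).symm (0 : Fin 0 → ℝ) y = y := by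
      funext i
      simp [join, Fin.append, Fin.addCases]
    rw [hj0]
    congr 1
    funext i
    refine Eq.trans ?_ (congrFun (frame_stdFrame (zero_add m).symm (by omega) rfl (by omega)) i).symm
    rfl

/-! ### Chains of points -/

/-- The unit form on `ℝ⁰`. -/
def oneTest : testForms (⊤ : Opens (Fin 0 → ℝ)) 0 :=
  ⟨fun _ => ContinuousAlternatingMap.constOfIsEmpty ℝ (Fin 0 → ℝ) (Fin 0) (1 : ℝ), contDiff_const,
    univ, (Set.toFinite (univ : Set (Fin 0 → ℝ))).isCompact, subset_rfl,
    fun _ h => absurd (mem_univ _) h⟩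

/-- Differentiable spaces whose constant maps are plots. -/
class HasPoints (X : DiffSpace.{u}) : Prop where
  isPlot (U : OrientedSubmanifold) (x : X.carrier) : X.IsPlot U fun _ => x

/-- The chain of a point. -/
def ptChain {X : DiffSpace.{u}} [HasPoints X] (x : X.carrier) : Chains X 0 :=
  eucl (⊤ : Opens (Fin 0 → ℝ)) (fun _ => x) (HasPoints.isPlot _ x) (add_zero 0) oneTest

lemma aug_ptChain {X : DiffSpace.{u}} [HasPoints X] (x : X.carrier) : aug X (ptChain x) = 1 := by
  rw [ptChain, aug_eucl, integral_fin_zero]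
  rfl

lemma eucl_const {X : DiffSpace.{u}} [HasPoints X] {m j k : ℕ} (O : Opens (Fin m → ℝ))
    (x : X.carrier) (hφ : X.IsPlot (opn O) fun _ => x) (hj : j + (k + 1) = m)
    (η : testForms O j) : eucl O (fun _ => x) hφ hj η = 0 :=
  eucl_eq_zero (zero_add m).symm O (⊤ : Opens (Fin 0 → ℝ)) (fun _ _ => trivial)
    (HasPoints.isPlot _ x) hj (Nat.succ_pos k) η

lemma eucl_const_zero {X : DiffSpace.{u}} [HasPoints X] {m j : ℕ} (O : Opens (Fin m → ℝ))
    (x : X.carrier) (hφ : X.IsPlot (opn O) fun _ => x) (hj : j + 0 = m) (η : testForms O j) :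
    eucl O (fun _ => x) hφ hj η = aug X (eucl O (fun _ => x) hφ hj η) • ptChain x := by
  have hjm : j = m := (add_zero _).symm.trans hj
  let c : ℝ := ∫ y, η.1 y (stdFrame hjm)
  have h1 : eucl (⊤ : Opens (Fin 0 → ℝ)) (fun _ => x) (HasPoints.isPlot _ x) (add_zero 0)
      (c • oneTest) = eucl O (fun _ => x) hφ hj η := by
    refine eucl_proj (zero_add m).symm O (⊤ : Opens (Fin 0 → ℝ)) (fun _ _ => trivial)
      (HasPoints.isPlot _ x) hj (add_zero 0) (by omega) η (c • oneTest) fun z _ v => ?_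
    change c * 1 = _
    rw [mul_one]
    refine integral_congr_ae (Filter.Eventually.of_forall fun y => ?_)
    simp only []
    have hj0 : join (zero_add m).symm z y = y := by
      funext i
      simp [join, Fin.append, Fin.addCases]
    rw [hj0, Subsingleton.elim v (stdFrame rfl), frame_stdFrame (zero_add m).symm _ rfl hjm]
  rw [aug_eucl, ptChain, ← map_smul]
  exact h1.symm

/-- Constant maps. -/
def constHom (X : DiffSpace.{u}) {Y : DiffSpace.{v}} [HasPoints Y] (y : Y.carrier) :
    SmoothHom X Y where
  toFun _ := y
  isPlot _ := HasPoints.isPlot _ y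

lemma push_constHom {X : DiffSpace.{u}} {Y : DiffSpace.{v}} [HasPoints Y] (y : Y.carrier) (k : ℕ)
    (c : Chains X (k + 1)) : push (constHom X y) (k + 1) c = 0 := by
  induction c using chains_induction with
  | zero => simp
  | add c c' h h' => rw [map_add, h, h', add_zero]
  | smul a c h => rw [map_smul, h, smul_zero]
  | eucl m j O φ hφ hj η =>
    rw [push_eucl]
    exact eucl_const O y _ hj η

lemma push_constHom_zero {X : DiffSpace.{u}} {Y : DiffSpace.{v}} [HasPoints Y] (y : Y.carrier)
    (c : Chains X 0) : push (constHom X y) 0 c = aug X c • ptChain y := by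
  induction c using chains_induction with
  | zero => simp
  | add c c' h h' => rw [map_add, h, h', map_add, add_smul]
  | smul a c h => rw [map_smul, h, map_smul, smul_eq_mul, mul_smul]
  | eucl m j O φ hφ hj η =>
    rw [← aug_push (constHom X y), push_eucl]
    exact eucl_const_zero O y _ hj η

/-! ### Cylinders -/

section Cyl

variable {m j : ℕ}

/-- The linear map `(t, x) ↦ x`. -/
def tailL (m : ℕ) : (Fin (m + 1) → ℝ) →L[ℝ] (Fin m → ℝ) :=
  ContinuousLinearMap.pi fun i => ContinuousLinearMap.proj i.succ

/-- The linear map `(t, x) ↦ t`. -/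
def timeL (m : ℕ) : (Fin (m + 1) → ℝ) →L[ℝ] ℝ := ContinuousLinearMap.proj 0

/-- The linear isomorphism `ℝ × ℝᵐ ≃ ℝᵐ⁺¹`. -/
def consL (m : ℕ) : (ℝ × (Fin m → ℝ)) ≃ₗ[ℝ] (Fin (m + 1) → ℝ) where
  toFun p := Fin.cons p.1 p.2
  invFun z := (timeL m z, tailL m z)
  map_add' p q := by
    funext i
    refine Fin.cases ?_ (fun a => ?_) i <;> simp
  map_smul' c p := by
    funext i
    refine Fin.cases ?_ (fun a => ?_) i <;> simp
  left_inv p := by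
    refine Prod.ext rfl (funext fun i => ?_)
    simp [tailL]
  right_inv z := by
    funext i
    refine Fin.cases ?_ (fun a => ?_) i <;> simp [tailL, timeL]

/-- The open subset `ℝ × O` of `ℝᵐ⁺¹`. -/
def cyl (O : Opens (Fin m → ℝ)) : Opens (Fin (m + 1) → ℝ) :=
  ⟨tailL m ⁻¹' O, O.isOpen.preimage (tailL m).continuous⟩

lemma mem_cyl {O : Opens (Fin m → ℝ)} {z : Fin (m + 1) → ℝ} : z ∈ cyl O ↔ tailL m z ∈ O := Iff.rfl

/-- The projection of `ℝ × O` to `ℝ`. -/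
def cylTime {O : Opens (Fin m → ℝ)} (z : (opn (cyl O)).carrier) : ℝ := timeL m z.1

/-- The projection of `ℝ × O` to `O`. -/
def cylBase {O : Opens (Fin m → ℝ)} (z : (opn (cyl O)).carrier) : (opn O).carrier :=
  ⟨tailL m z.1, z.2⟩

/-- The form `f(t) α` on the cylinder. -/
def cylForm (f : ℝ → ℝ) (η : (Fin m → ℝ) → (Fin m → ℝ) [⋀^Fin j]→L[ℝ] ℝ)
    (z : Fin (m + 1) → ℝ) : (Fin (m + 1) → ℝ) [⋀^Fin j]→L[ℝ] ℝ :=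
  f (timeL m z) • (η (tailL m z)).compContinuousLinearMap (tailL m)

/-- The form `g(t) dt ∧ α` on the cylinder. -/
def dtForm (g : ℝ → ℝ) (η : (Fin m → ℝ) → (Fin m → ℝ) [⋀^Fin j]→L[ℝ] ℝ)
    (z : Fin (m + 1) → ℝ) : (Fin (m + 1) → ℝ) [⋀^Fin (j + 1)]→L[ℝ] ℝ :=
  ContinuousAlternatingMap.alternatizeUncurryFin
    ((timeL m).smulRight (cylForm g η z))

lemma contDiff_cylForm {f : ℝ → ℝ} (hf : ContDiff ℝ ∞ f)
    {η : (Fin m → ℝ) → (Fin m → ℝ) [⋀^Fin j]→L[ℝ] ℝ} (hη : ContDiff ℝ ∞ η) :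
    ContDiff ℝ ∞ (cylForm f η) :=
  (hf.comp (timeL m).contDiff).smul
    (contDiff_iff_contDiffAt.mpr fun _ => ContDiffAt.alt_comp
      (hη.comp (tailL m).contDiff).contDiffAt contDiffAt_const)

lemma dtForm_apply (g : ℝ → ℝ) (η : (Fin m → ℝ) → (Fin m → ℝ) [⋀^Fin j]→L[ℝ] ℝ)
    (z : Fin (m + 1) → ℝ) (v : Fin (j + 1) → Fin (m + 1) → ℝ) :
    dtForm g η z v = ∑ i : Fin (j + 1), (-1 : ℝ) ^ i.val * (timeL m (v i) *
      (g (timeL m z) * η (tailL m z) (fun b => tailL m (v (i.succAbove b))))) := by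
  rw [dtForm, ContinuousAlternatingMap.alternatizeUncurryFin_apply]
  refine Finset.sum_congr rfl fun i _ => ?_
  rw [zsmul_eq_mul]
  push_cast
  rfl

lemma contDiff_dtForm {g : ℝ → ℝ} (hg : ContDiff ℝ ∞ g)
    {η : (Fin m → ℝ) → (Fin m → ℝ) [⋀^Fin j]→L[ℝ] ℝ} (hη : ContDiff ℝ ∞ η) :
    ContDiff ℝ ∞ (dtForm g η) := by
  refine contDiff_iff_contDiffAt.mpr fun z => contDiffAt_alt fun v => ?_
  simp only [dtForm_apply]
  refine ContDiffAt.sum fun i _ => contDiffAt_const.mul (contDiffAt_const.mul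
    ((hg.comp (timeL m).contDiff).contDiffAt.mul ?_))
  exact ((ContinuousAlternatingMap.apply ℝ (Fin m → ℝ) ℝ _).contDiff.comp
    (hη.comp (tailL m).contDiff)).contDiffAt

lemma extDeriv_cylForm {f g : ℝ → ℝ} (hf : ∀ t, HasDerivAt f (g t) t)
    {η : (Fin m → ℝ) → (Fin m → ℝ) [⋀^Fin j]→L[ℝ] ℝ} (hη : ContDiff ℝ ∞ η) :
    extDeriv (cylForm f η) = cylForm f (extDeriv η) + dtForm g η := by
  funext z
  let P : (Fin (m + 1) → ℝ) → (Fin (m + 1) → ℝ) [⋀^Fin j]→L[ℝ] ℝ := fun z =>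
    (η (tailL m z)).compContinuousLinearMap (tailL m)
  have hP : ContDiff ℝ ∞ P :=
    contDiff_iff_contDiffAt.mpr fun _ => ContDiffAt.alt_comp
      (hη.comp (tailL m).contDiff).contDiffAt contDiffAt_const
  have h1 : HasFDerivAt (fun z => f (timeL m z)) (g (timeL m z) • timeL m) z := by
    exact (hf (timeL m z)).comp_hasFDerivAt z (timeL m).hasFDerivAt
  have h2 : HasFDerivAt (cylForm f η) (f (timeL m z) • fderiv ℝ P z +
      (g (timeL m z) • timeL m).smulRight (P z)) z :=
    h1.smul (hP.differentiable (by simp) z).hasFDerivAt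
  have h3 : extDeriv P z = (extDeriv η (tailL m z)).compContinuousLinearMap (tailL m) := by
    have := extDeriv_pullback (x := z) (f := tailL m) (r := ∞)
      (hη.differentiable (by simp) (tailL m z)) (tailL m).contDiff.contDiffAt minSmoothness_le
    simpa only [ContinuousLinearMap.fderiv] using this
  rw [extDeriv, h2.fderiv, ContinuousAlternatingMap.alternatizeUncurryFin_add,
    ContinuousAlternatingMap.alternatizeUncurryFin_smul]
  have h4 : (g (timeL m z) • timeL m).smulRight (P z) = (timeL m).smulRight (cylForm g η z) := by
    ext v w
    simp only [cylForm, P, ContinuousLinearMap.smulRight_apply, smul_apply,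
      ContinuousAlternatingMap.smul_apply, smul_eq_mul]
    ring
  rw [h4]
  exact congrArg₂ (· + ·) (congrArg (f (timeL m z) • ·) h3) rfl

lemma exists_compact_cyl {f : ℝ → ℝ} (hc : HasCompactSupport f) {O : Opens (Fin m → ℝ)}
    (K : Set (Fin m → ℝ)) (hK : IsCompact K) (hKO : K ⊆ O) :
    ∃ C : Set (Fin (m + 1) → ℝ), IsCompact C ∧ C ⊆ (cyl O : Set _) ∧
      (∀ z ∈ C, tailL m z ∈ K) ∧ ∀ z ∉ C, f (timeL m z) = 0 ∨ tailL m z ∉ K := by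
  have hcont : Continuous (consL m) := (consL m).toContinuousLinearEquiv.continuous
  have h1 : ∀ z ∈ consL m '' (tsupport f ×ˢ K), tailL m z ∈ K := by
    rintro _ ⟨⟨t, x⟩, ⟨-, hx⟩, rfl⟩
    exact hx
  refine ⟨consL m '' (tsupport f ×ˢ K), (hc.isCompact.prod hK).image hcont,
    fun z hz => hKO (h1 z hz), h1, fun z hz => ?_⟩
  by_contra! h
  exact hz ⟨(timeL m z, tailL m z), ⟨subset_tsupport _ h.1, h.2⟩, (consL m).right_inv z⟩

/-- `cylForm` on forms with compact support. -/
def cylTest (f : ℝ → ℝ) (hf : ContDiff ℝ ∞ f) (hc : HasCompactSupport f) (O : Opens (Fin m → ℝ))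
    (j : ℕ) : testForms O j →ₗ[ℝ] testForms (cyl O) j where
  toFun η := ⟨cylForm f η.1, contDiff_cylForm hf (testForms.contDiff η), by
    obtain ⟨K, hK, hKO, hz⟩ := η.2.2
    obtain ⟨C, hC, hCO, -, h⟩ := exists_compact_cyl hc K hK hKO
    refine ⟨C, hC, hCO, fun z hzC => ?_⟩
    rcases h z hzC with h | h
    · rw [cylForm, h, zero_smul]
    · rw [cylForm, hz _ h]
      ext v
      simp⟩
  map_add' η η' := Subtype.ext (funext fun z => by
    ext v
    exact mul_add _ _ _)
  map_smul' c η := Subtype.ext (funext fun z => by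
    ext v
    exact mul_left_comm _ _ _)

/-- `dtForm` on forms with compact support. -/
def dtTest (g : ℝ → ℝ) (hg : ContDiff ℝ ∞ g) (hc : HasCompactSupport g) (O : Opens (Fin m → ℝ))
    (j : ℕ) (η : testForms O j) : testForms (cyl O) (j + 1) :=
  ⟨dtForm g η.1, contDiff_dtForm hg (testForms.contDiff η), by
    obtain ⟨K, hK, hKO, h⟩ := (cylTest g hg hc O j η).2.2
    refine ⟨K, hK, hKO, fun z hz => ?_⟩
    have h1 : cylForm g η.1 z = 0 := h z hz
    rw [dtForm, h1, ContinuousLinearMap.smulRight_zero]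
    ext v
    simp [ContinuousAlternatingMap.alternatizeUncurryFin_apply]⟩

/-! ### Changes of coordinates on cylinders -/

/-- The map `id × τ`. -/
def cylMap (τ : (Fin m → ℝ) → (Fin m → ℝ)) (z : Fin (m + 1) → ℝ) : Fin (m + 1) → ℝ :=
  consL m (timeL m z, τ (tailL m z))

lemma hasFDerivAt_cylMap {τ : (Fin m → ℝ) → (Fin m → ℝ)} {z : Fin (m + 1) → ℝ}
    (h : DifferentiableAt ℝ τ (tailL m z)) :
    HasFDerivAt (cylMap τ) (((consL m).toContinuousLinearEquiv :
      (ℝ × (Fin m → ℝ)) →L[ℝ] (Fin (m + 1) → ℝ)).comp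
        ((timeL m).prod ((fderiv ℝ τ (tailL m z)).comp (tailL m)))) z :=
  ((consL m).toContinuousLinearEquiv : (ℝ × (Fin m → ℝ)) →L[ℝ] (Fin (m + 1) → ℝ)).hasFDerivAt.comp z
    ((timeL m).hasFDerivAt.prodMk (h.hasFDerivAt.comp z (tailL m).hasFDerivAt))

lemma tailL_fderiv_cylMap {τ : (Fin m → ℝ) → (Fin m → ℝ)} {z : Fin (m + 1) → ℝ}
    (h : DifferentiableAt ℝ τ (tailL m z)) (v : Fin (m + 1) → ℝ) :
    tailL m (fderiv ℝ (cylMap τ) z v) = fderiv ℝ τ (tailL m z) (tailL m v) := by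
  rw [(hasFDerivAt_cylMap h).fderiv]
  rfl

lemma timeL_fderiv_cylMap {τ : (Fin m → ℝ) → (Fin m → ℝ)} {z : Fin (m + 1) → ℝ}
    (h : DifferentiableAt ℝ τ (tailL m z)) (v : Fin (m + 1) → ℝ) :
    timeL m (fderiv ℝ (cylMap τ) z v) = timeL m v := by
  rw [(hasFDerivAt_cylMap h).fderiv]
  rfl

lemma det_fderiv_cylMap {τ : (Fin m → ℝ) → (Fin m → ℝ)} {z : Fin (m + 1) → ℝ}
    (h : DifferentiableAt ℝ τ (tailL m z)) :
    (fderiv ℝ (cylMap τ) z).det = (fderiv ℝ τ (tailL m z)).det := by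
  rw [(hasFDerivAt_cylMap h).fderiv]
  have h1 := LinearMap.det_conj (LinearMap.prodMap (LinearMap.id : ℝ →ₗ[ℝ] ℝ)
    (fderiv ℝ τ (tailL m z) : (Fin m → ℝ) →ₗ[ℝ] (Fin m → ℝ))) (consL m)
  rw [LinearMap.det_prodMap, LinearMap.det_id, one_mul] at h1
  rw [ContinuousLinearMap.det, ContinuousLinearMap.det, ← h1]
  rfl

/-- The parametrization `id × τ`. -/
def cylParam {O : Opens (Fin m → ℝ)} (τ : LocalParam (O : Set (Fin m → ℝ)) m) :
    LocalParam (cyl O : Set (Fin (m + 1) → ℝ)) (m + 1) :=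
  LocalParam.ofOpen (cyl O) (cyl τ.source) (cylMap τ)
    (fun z hz => by
      change tailL m (consL m (timeL m z, τ (tailL m z))) ∈ O
      exact τ.mem _ hz)
    (fun z hz => by
      refine ContDiffAt.contDiffWithinAt ?_
      exact ((consL m).toContinuousLinearEquiv.contDiff.contDiffAt).comp z
        ((timeL m).contDiff.contDiffAt.prodMk ((τ.contDiffAt hz).comp z (tailL m).contDiff.contDiffAt)))
    (fun z hz v w hvw => by
      have hd := (τ.contDiffAt (mem_cyl.mp hz)).differentiableAt (by simp)
      have h1 := congrArg (timeL m) hvw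
      have h2 := congrArg (tailL m) hvw
      rw [timeL_fderiv_cylMap hd, timeL_fderiv_cylMap hd] at h1
      rw [tailL_fderiv_cylMap hd, tailL_fderiv_cylMap hd] at h2
      exact (consL m).symm.injective (Prod.ext h1 (τ.immersive _ hz h2)))
    (fun z hz w hw h => by
      have h1 := (consL m).injective h
      exact (consL m).symm.injective
        (Prod.ext (congrArg Prod.fst h1 :) (τ.injOn hz hw (congrArg Prod.snd h1 :))))

lemma cylTest_chart {O : Opens (Fin m → ℝ)} {f : ℝ → ℝ} (hf : ContDiff ℝ ∞ f)
    (hc : HasCompactSupport f) (τ : LocalParam (O : Set (Fin m → ℝ)) m)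
    (η : testForms O j) (η' : testForms τ.source j)
    (h : ∀ x ∈ τ.source, η'.1 x = ((SignType.sign (fderiv ℝ τ x).det : SignType) : ℝ) •
      τ.pull η.1 x) (z : Fin (m + 1) → ℝ) (hz : z ∈ cyl τ.source) :
    (cylTest f hf hc _ j η').1 z =
      ((SignType.sign (fderiv ℝ (cylParam τ) z).det : SignType) : ℝ) •
        (cylParam τ).pull (cylTest f hf hc _ j η).1 z := by
  have hd := (τ.contDiffAt (mem_cyl.mp hz)).differentiableAt (by simp)
  have hz' : z ∈ (cylParam τ).source := hz
  rw [LocalParam.pull_of_mem _ hz']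
  have h1 : (fderiv ℝ (cylParam τ) z).det = (fderiv ℝ τ (tailL m z)).det := det_fderiv_cylMap hd
  rw [h1]
  ext v
  change f (timeL m z) * η'.1 (tailL m z) (fun i => tailL m (v i)) =
    _ * (f (timeL m z) * η.1 (τ (tailL m z)) fun i => tailL m (fderiv ℝ (cylMap τ) z (v i)))
  rw [h _ hz, τ.pull_of_mem hz]
  simp only [tailL_fderiv_cylMap hd]
  exact mul_left_comm _ _ _

lemma cylTest_support {O : Opens (Fin m → ℝ)} {f : ℝ → ℝ} (hf : ContDiff ℝ ∞ f)
    (hc : HasCompactSupport f) (τ : LocalParam (O : Set (Fin m → ℝ)) m) (η : testForms O j)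
    (hs : ∃ K, IsCompact K ∧ K ⊆ (τ.source : Set (Fin m → ℝ)) ∧ ∀ y ∉ τ '' K, η.1 y = 0) :
    ∃ K, IsCompact K ∧ K ⊆ ((cylParam τ).source : Set (Fin (m + 1) → ℝ)) ∧
      ∀ y ∉ cylParam τ '' K, (cylTest f hf hc _ j η).1 y = 0 := by
  obtain ⟨K, hK, hKs, hz⟩ := hs
  obtain ⟨C, hC, hCO, -, h⟩ := exists_compact_cyl hc K hK hKs
  refine ⟨C, hC, hCO, fun y hy => ?_⟩
  change f (timeL m y) • (η.1 (tailL m y)).compContinuousLinearMap (tailL m) = 0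
  by_cases hy' : tailL m y ∈ τ '' K
  · obtain ⟨x, hx, hxy⟩ := hy'
    have h1 : consL m (timeL m y, x) ∉ C := fun hC' => hy ⟨_, hC', by
      change consL m (timeL m y, τ x) = y
      rw [hxy]
      exact (consL m).right_inv y⟩
    rcases h _ h1 with h2 | h2
    · have h3 : f (timeL m y) = 0 := h2
      rw [h3, zero_smul]
    · exact absurd hx h2
  · rw [hz _ hy']
    ext v
    simp

/-! ### Projections and cylinders -/

lemma succ_add_eq {r m' : ℕ} (h : m' = m + r) : m' + 1 = (m + 1) + r := by omega

lemma timeL_join {r m' : ℕ} (h : m' = m + r) (z : Fin (m + 1) → ℝ) (y : Fin r → ℝ) :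
    timeL m' (join (succ_add_eq h) z y) = timeL m z := by
  subst h
  have : Fin.cast (succ_add_eq rfl) (0 : Fin (m + r + 1)) = Fin.castAdd r (0 : Fin (m + 1)) := by
    ext; simp
  change Fin.append z y (Fin.cast (succ_add_eq rfl) (0 : Fin (m + r + 1))) = z 0
  rw [this, Fin.append_left]

lemma tailL_join {r m' : ℕ} (h : m' = m + r) (z : Fin (m + 1) → ℝ) (y : Fin r → ℝ) :
    tailL m' (join (succ_add_eq h) z y) = join h (tailL m z) y := by
  subst h
  funext i
  change Fin.append z y (Fin.cast (succ_add_eq rfl) i.succ) = Fin.append (tailL m z) y i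
  refine Fin.addCases (fun a => ?_) (fun a => ?_) i
  · have : Fin.cast (succ_add_eq rfl) (Fin.castAdd r a).succ = Fin.castAdd r a.succ := by
      ext; simp
    rw [this, Fin.append_left, Fin.append_left]
    rfl
  · have : Fin.cast (succ_add_eq rfl) (Fin.natAdd m a).succ = Fin.natAdd (m + 1) a := by
      ext; simp; omega
    rw [this, Fin.append_right, Fin.append_right]

lemma tailL_baseCoord {r m' : ℕ} (h : m' = m + r) (z : Fin (m' + 1) → ℝ) :
    tailL m (baseCoord (succ_add_eq h) z) = baseCoord h (tailL m' z) := by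
  subst h
  rfl

lemma tailL_frame {r m' i : ℕ} (h : m' = m + r) (hi : i = j + r)
    (v : Fin j → Fin (m + 1) → ℝ) (a : Fin i) :
    tailL m' (frame (succ_add_eq h) hi v a) = frame h hi (fun b => tailL m (v b)) a := by
  subst hi
  refine Fin.addCases (fun b => ?_) (fun c => ?_) a
  · have h1 := frame_castAdd (succ_add_eq h) rfl v b
    have h2 := frame_castAdd h rfl (fun b => tailL m (v b)) b
    refine (congrArg (tailL m') h1).trans (Eq.trans ?_ h2.symm)
    rw [tailL_join h]
  · have h1 := frame_natAdd (succ_add_eq h) rfl v c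
    have h2 := frame_natAdd h rfl (fun b => tailL m (v b)) c
    refine (congrArg (tailL m') h1).trans (Eq.trans ?_ h2.symm)
    rw [tailL_join h]
    rfl

lemma cylTest_proj {r m' i : ℕ} (h : m' = m + r) {O' : Opens (Fin m' → ℝ)}
    {O : Opens (Fin m → ℝ)} {f : ℝ → ℝ} (hf : ContDiff ℝ ∞ f) (hc : HasCompactSupport f)
    (hij : i = j + r) (η : testForms O' i) (β : testForms O j)
    (hβ : ∀ x ∈ O, ∀ v, β.1 x v = ∫ y : Fin r → ℝ, η.1 (join h x y) (frame h hij v))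
    (z : Fin (m + 1) → ℝ) (hz : z ∈ cyl O) (v : Fin j → Fin (m + 1) → ℝ) :
    (cylTest f hf hc O j β).1 z v = ∫ y : Fin r → ℝ,
      (cylTest f hf hc O' i η).1 (join (succ_add_eq h) z y) (frame (succ_add_eq h) hij v) := by
  change f (timeL m z) * β.1 (tailL m z) (fun b => tailL m (v b)) = ∫ y : Fin r → ℝ,
    f (timeL m' (join (succ_add_eq h) z y)) * η.1 (tailL m' (join (succ_add_eq h) z y))
      (fun b => tailL m' (frame (succ_add_eq h) hij v b))
  rw [hβ _ hz, ← integral_const_mul]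
  simp only [timeL_join h, tailL_join h, tailL_frame h hij]

end Cyl

/-! ### Projection of a cylinder to its base -/

section Rotate

variable {m j : ℕ}

/-- The linear map `(x, t) ↦ (t, x)`. -/
def rotL (m : ℕ) : (Fin (m + 1) → ℝ) →L[ℝ] (Fin (m + 1) → ℝ) :=
  ContinuousLinearMap.pi fun i => ContinuousLinearMap.proj ((finRotate (m + 1)).symm i)

lemma rotL_apply (z : Fin (m + 1) → ℝ) (i : Fin (m + 1)) :
    rotL m z i = z ((finRotate (m + 1)).symm i) := rfl

lemma rotL_injective (m : ℕ) : Function.Injective (rotL m) := fun z w h => by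
  funext i
  have := congrFun h (finRotate (m + 1) i)
  simpa [rotL_apply] using this

lemma det_rotL (m : ℕ) : (rotL m).det = (-1) ^ m := by
  have h1 : (rotL m : (Fin (m + 1) → ℝ) →ₗ[ℝ] (Fin (m + 1) → ℝ)) =
      Matrix.toLin' ((1 : Matrix (Fin (m + 1)) (Fin (m + 1)) ℝ).submatrix
        (finRotate (m + 1)).symm id) := by
    refine LinearMap.ext fun z => funext fun i => ?_
    simp [rotL, Matrix.mulVec, dotProduct, Matrix.one_apply]
  rw [ContinuousLinearMap.det, h1, LinearMap.det_toLin', Matrix.det_permute,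
    Equiv.Perm.sign_symm, sign_finRotate, Matrix.det_one]
  simp

lemma tailL_rotL (z : Fin (m + 1) → ℝ) : tailL m (rotL m z) = baseCoord rfl z := by
  funext i
  change z ((finRotate (m + 1)).symm i.succ) = z (Fin.castAdd 1 i)
  congr 1
  rw [Equiv.symm_apply_eq, finRotate_apply]
  exact Fin.ext (Fin.val_add_one_of_lt (Fin.castSucc_lt_last i)).symm

lemma timeL_rotL (z : Fin (m + 1) → ℝ) : timeL m (rotL m z) = fiberCoord (m := m) rfl z 0 := by
  change z ((finRotate (m + 1)).symm 0) = z (Fin.natAdd m 0)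
  congr 1

/-- The parametrization `(x, t) ↦ (t, x)` of a cylinder. -/
def rotParam (O : Opens (Fin m → ℝ)) : LocalParam (cyl O : Set (Fin (m + 1) → ℝ)) (m + 1) :=
  LocalParam.ofOpen (cyl O) ⟨rotL m ⁻¹' cyl O, (cyl O).isOpen.preimage (rotL m).continuous⟩ (rotL m)
    (fun _ h => h) (rotL m).contDiff.contDiffOn
    (fun x _ => by rw [ContinuousLinearMap.fderiv]; exact rotL_injective m)
    (rotL_injective m).injOn

lemma fderiv_rotParam (O : Opens (Fin m → ℝ)) (x : Fin (m + 1) → ℝ) :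
    fderiv ℝ (rotParam O) x = rotL m := (rotL m).fderiv

lemma integral_fin_one (g : ℝ → ℝ) : ∫ y : Fin 1 → ℝ, g (y 0) = ∫ t, g t :=
  (volume_preserving_funUnique (Fin 1) ℝ).integral_comp
    (MeasurableEquiv.funUnique (Fin 1) ℝ).measurableEmbedding g

variable {X : DiffSpace.{u}} {k : ℕ}

lemma isSubmersion_cylBase (O : Opens (Fin m → ℝ)) :
    IsSubmersion (opn (cyl O)) (opn O) cylBase where
  smooth := by
    intro (χ : LocalParam (cyl O : Set (Fin (m + 1) → ℝ)) (m + 1)) x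
    change ContMDiffAt 𝓘(ℝ, Fin (m + 1) → ℝ) 𝓘(ℝ, Fin m → ℝ) ∞
      (fun z : χ.source => tailL m (χ z)) x
    refine contMDiffAt_subtype_iff (f := fun z => tailL m (χ z)) |>.mpr
      (ContDiffAt.contMDiffAt ?_)
    exact (tailL m).contDiff.contDiffAt.comp _ (χ.contDiffAt x.2)
  surjective := by
    rintro (θ : LocalParam (cyl O : Set (Fin (m + 1) → ℝ)) (m + 1)) ⟨(x : Fin (m + 1) → ℝ),
      (hx : x ∈ θ.source)⟩ χ y hxy
    have h3 : fderiv ℝ (coordMap (V := opn (cyl O)) (U := opn O) cylBase θ) x =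
        (tailL m).comp (fderiv ℝ θ x) := by
      have h2 : coordMap (V := opn (cyl O)) (U := opn O) cylBase θ
          =ᶠ[𝓝 x] fun z => tailL m (θ z) := by
        filter_upwards [θ.source.isOpen.mem_nhds hx] with z hz
        exact coordMap_apply (V := opn (cyl O)) (U := opn O) cylBase θ hz
      refine h2.fderiv_eq.trans ?_
      exact (tailL m).hasFDerivAt.comp _
        ((θ.contDiffAt hx).differentiableAt (by simp)).hasFDerivAt |>.fderiv
    have h4 : Function.Surjective (fderiv ℝ θ x :
        (Fin (m + 1) → ℝ) →ₗ[ℝ] (Fin (m + 1) → ℝ)) :=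
      LinearMap.injective_iff_surjective.mp (θ.immersive x hx)
    rintro v -
    obtain ⟨w, hw⟩ := h4 (consL m (0, (v : Fin m → ℝ)))
    refine ⟨w, ?_⟩
    change fderiv ℝ (coordMap (V := opn (cyl O)) (U := opn O) cylBase θ) x w = v
    rw [h3]
    exact congrArg (tailL m) hw

lemma eucl_dtTest {g : ℝ → ℝ} (hg : ContDiff ℝ ∞ g) (hc : HasCompactSupport g)
    (hg1 : ∫ t, g t = 1) (O : Opens (Fin m → ℝ)) (φ : (opn O).carrier → X.carrier)
    (hφ : X.IsPlot (opn O) φ) (hφ' : X.IsPlot (opn (cyl O)) fun z => φ (cylBase z))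
    (hj : j + k = m) (hj' : j + 1 + k = m + 1) (η : testForms O j) :
    eucl (cyl O) (fun z => φ (cylBase z)) hφ' hj' (dtTest g hg hc O j η) =
      (-1 : ℝ) ^ k • eucl O φ hφ hj η := by
  let N := (rotParam O).source
  have hdet : ∀ x, ((SignType.sign (fderiv ℝ (rotParam O) x).det : SignType) : ℝ) = (-1) ^ m := by
    intro x
    rw [fderiv_rotParam, det_rotL]
    rcases Nat.even_or_odd m with h | h <;> simp [h.neg_one_pow]
  obtain ⟨K, hK, hKO, hz⟩ := (dtTest g hg hc O j η).2.2
  have hrot : Function.Surjective (rotL m) := fun w =>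
    ⟨fun i => w (finRotate (m + 1) i), by funext i; simp [rotL_apply]⟩
  let e := (LinearEquiv.ofBijective (rotL m : (Fin (m + 1) → ℝ) →ₗ[ℝ] (Fin (m + 1) → ℝ))
    ⟨rotL_injective m, hrot⟩).toContinuousLinearEquiv
  have hK' : IsCompact (e.symm '' K) := hK.image e.symm.continuous
  have he : ∀ w, rotL m (e.symm w) = w := fun w => e.apply_symm_apply w
  have he' : ∀ w, e.symm (rotL m w) = w := fun w => e.symm_apply_apply w
  have hKN : e.symm '' K ⊆ (N : Set (Fin (m + 1) → ℝ)) := by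
    rintro _ ⟨w, hw, rfl⟩
    change rotL m (e.symm w) ∈ cyl O
    rw [he]
    exact hKO hw
  let η' : testForms N (j + 1) := ⟨fun x => (-1 : ℝ) ^ m •
      (dtForm g η.1 (rotL m x)).compContinuousLinearMap (rotL m),
    ContDiff.const_smul ((-1 : ℝ) ^ m) (contDiff_iff_contDiffAt.mpr fun _ =>
      ContDiffAt.alt_comp ((contDiff_dtForm hg (testForms.contDiff η)).comp
        (rotL m).contDiff).contDiffAt contDiffAt_const), e.symm '' K, hK', hKN, fun x hx => by
      have h1 : dtForm g η.1 (rotL m x) = 0 := hz _ fun h => hx ⟨_, h, he' x⟩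
      simp only [h1]
      ext v
      simp⟩
  have h1 := eucl_chart (cyl O) (fun z => φ (cylBase z)) hφ' hj' (rotParam O)
    (dtTest g hg hc O j η) η' (fun x hx => by
      rw [hdet, LocalParam.pull_of_mem _ hx, fderiv_rotParam]
      rfl) ⟨e.symm '' K, hK', hKN, fun y hy => hz y fun h => hy ⟨e.symm y, ⟨y, h, rfl⟩, he y⟩⟩
  have hN : ∀ z ∈ N, baseCoord (m := m) (r := 1) rfl z ∈ O := fun z hz => by
    rw [← tailL_rotL]
    exact hz
  have h2 := eucl_proj (m := m) (r := 1) rfl N O hN hφ hj' hj rfl η' ((-1 : ℝ) ^ k • η)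
    fun x hx v => by
      have hrot1 : ∀ y : Fin 1 → ℝ, tailL m (rotL m (join rfl x y)) = x := fun y => by
        rw [tailL_rotL, baseCoord_join]
      have hrot2 : ∀ (x : Fin m → ℝ) (y : Fin 1 → ℝ), timeL m (rotL m (join rfl x y)) = y 0 :=
        fun x y => by rw [timeL_rotL, fiberCoord_join]
      have hfr1 : ∀ a : Fin j, frame (m := m) (r := 1) rfl (rfl : j + 1 = j + 1) v a.castSucc =
        join rfl (v a) 0 := fun a => frame_castAdd _ rfl v a
      have hfr2 : frame (m := m) (r := 1) rfl (rfl : j + 1 = j + 1) v (Fin.last j) =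
        join rfl 0 (Pi.single 0 1) := frame_natAdd _ rfl v 0
      have h3 : ∀ y : Fin 1 → ℝ, η'.1 (join rfl x y) (frame rfl rfl v) =
          ((-1) ^ k * η.1 x v) * g (y 0) := fun y => by
        change (-1 : ℝ) ^ m * dtForm g η.1 (rotL m (join rfl x y))
          (fun i => rotL m (frame rfl rfl v i)) = _
        rw [dtForm_apply, Fin.sum_univ_castSucc, Finset.sum_eq_zero, zero_add]
        · rw [hfr2, hrot2, hrot2, hrot1]
          have h4 : (fun b => tailL m (rotL m (frame (m := m) (r := 1) rfl (rfl : j + 1 = j + 1) v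
              ((Fin.last j).succAbove b)))) = v := by
            funext b
            rw [Fin.succAbove_last, hfr1, tailL_rotL, baseCoord_join]
          have hm : (-1 : ℝ) ^ m = (-1) ^ j * (-1) ^ k := by rw [← pow_add, hj]
          rw [h4, Pi.single_eq_same, Fin.val_last, hm]
          have h5 : (-1 : ℝ) ^ j * (-1) ^ j = 1 := by rw [← mul_pow]; simp
          linear_combination ((-1 : ℝ) ^ k * η.1 x v * g (y 0)) * h5
        · intro a _
          rw [hfr1, hrot2]
          simp
      simp_rw [h3]
      rw [integral_const_mul, integral_fin_one, hg1, mul_one]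
      rfl
  rw [← map_smul, h2, ← h1]
  exact eucl_congr (funext fun (z : (opn N).carrier) => congrArg φ (Subtype.ext (tailL_rotL z.1))) _ _ _ _

end Rotate

/-! ### Homotopies -/

/-- The derivative of the cutoff function which rises on `[-2, -1]`. -/
def riseFun (t : ℝ) : ℝ := deriv Real.smoothTransition (t + 2)

/-- Minus the derivative of the cutoff function which falls on `[2, 3]`. -/
def fallFun (t : ℝ) : ℝ := deriv Real.smoothTransition (3 - t)

/-- A smooth cutoff function with support in `[-2, 3]` which is `1` on `[-1, 2]`. -/
def plateau (t : ℝ) : ℝ := Real.smoothTransition (t + 2) * Real.smoothTransition (3 - t)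

lemma hasDerivAt_smoothTransition (t : ℝ) :
    HasDerivAt Real.smoothTransition (deriv Real.smoothTransition t) t :=
  ((Real.smoothTransition.contDiff (n := 1)).differentiable (by simp) t).hasDerivAt

lemma contDiff_deriv_smoothTransition : ContDiff ℝ ∞ (deriv Real.smoothTransition) :=
  ((contDiff_succ_iff_deriv (n := ∞)).mp Real.smoothTransition.contDiff).2.2

lemma deriv_smoothTransition_of_nonpos {t : ℝ} (h : t < 0) :
    deriv Real.smoothTransition t = 0 := by
  have : Real.smoothTransition =ᶠ[𝓝 t] fun _ => 0 := by
    filter_upwards [gt_mem_nhds h] with s hs using Real.smoothTransition.zero_of_nonpos hs.le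
  rw [this.deriv_eq, deriv_const]

lemma deriv_smoothTransition_of_one_lt {t : ℝ} (h : 1 < t) :
    deriv Real.smoothTransition t = 0 := by
  have : Real.smoothTransition =ᶠ[𝓝 t] fun _ => 1 := by
    filter_upwards [lt_mem_nhds h] with s hs using Real.smoothTransition.one_of_one_le hs.le
  rw [this.deriv_eq, deriv_const]

lemma deriv_smoothTransition_eq_zero {t : ℝ} (h : t ∉ Icc (0 : ℝ) 1) :
    deriv Real.smoothTransition t = 0 := by
  rcases lt_or_ge t 0 with h0 | h0
  · exact deriv_smoothTransition_of_nonpos h0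
  · exact deriv_smoothTransition_of_one_lt (lt_of_not_ge fun h1 => h ⟨h0, h1⟩)

lemma integral_deriv_smoothTransition : ∫ t, deriv Real.smoothTransition t = 1 := by
  have hc : HasCompactSupport (deriv Real.smoothTransition) :=
    HasCompactSupport.intro isCompact_Icc fun _ => deriv_smoothTransition_eq_zero
  have h := integral_of_hasDerivAt_of_tendsto (m := 0) (n := 1) hasDerivAt_smoothTransition
    (contDiff_deriv_smoothTransition.continuous.integrable_of_hasCompactSupport hc)
    (tendsto_const_nhds.congr' (by
      filter_upwards [Filter.eventually_le_atBot 0] with t ht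
      exact (Real.smoothTransition.zero_of_nonpos ht).symm))
    (tendsto_const_nhds.congr' (by
      filter_upwards [Filter.eventually_ge_atTop 1] with t ht
      exact (Real.smoothTransition.one_of_one_le ht).symm))
  rw [h, sub_zero]

lemma contDiff_riseFun : ContDiff ℝ ∞ riseFun :=
  contDiff_deriv_smoothTransition.comp (contDiff_id.add contDiff_const)

lemma contDiff_fallFun : ContDiff ℝ ∞ fallFun :=
  contDiff_deriv_smoothTransition.comp (contDiff_const.sub contDiff_id)

lemma contDiff_plateau : ContDiff ℝ ∞ plateau :=
  (Real.smoothTransition.contDiff.comp (contDiff_id.add contDiff_const)).mul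
    (Real.smoothTransition.contDiff.comp (contDiff_const.sub contDiff_id))

lemma riseFun_eq_zero {t : ℝ} (h : t ∉ Icc (-2 : ℝ) (-1)) : riseFun t = 0 :=
  deriv_smoothTransition_eq_zero fun h' => h ⟨by linarith [h'.1], by linarith [h'.2]⟩

lemma fallFun_eq_zero {t : ℝ} (h : t ∉ Icc (2 : ℝ) 3) : fallFun t = 0 :=
  deriv_smoothTransition_eq_zero fun h' => h ⟨by linarith [h'.2], by linarith [h'.1]⟩

lemma hasCompactSupport_riseFun : HasCompactSupport riseFun :=
  HasCompactSupport.intro isCompact_Icc fun _ => riseFun_eq_zero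

lemma hasCompactSupport_fallFun : HasCompactSupport fallFun :=
  HasCompactSupport.intro isCompact_Icc fun _ => fallFun_eq_zero

lemma hasCompactSupport_plateau : HasCompactSupport plateau :=
  HasCompactSupport.intro (isCompact_Icc (a := (-2 : ℝ)) (b := 3)) fun t ht => by
    rw [mem_Icc, not_and_or, not_le, not_le] at ht
    rcases ht with h | h
    · rw [plateau, Real.smoothTransition.zero_of_nonpos (by linarith), zero_mul]
    · rw [plateau, Real.smoothTransition.zero_of_nonpos (x := 3 - t) (by linarith), mul_zero]

lemma integral_riseFun : ∫ t, riseFun t = 1 :=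
  (integral_add_right_eq_self (deriv Real.smoothTransition) 2).trans integral_deriv_smoothTransition

lemma integral_fallFun : ∫ t, fallFun t = 1 :=
  (integral_sub_left_eq_self (deriv Real.smoothTransition) volume 3).trans
    integral_deriv_smoothTransition

lemma hasDerivAt_plateau (t : ℝ) : HasDerivAt plateau (riseFun t - fallFun t) t := by
  have h1 : HasDerivAt (fun t => Real.smoothTransition (t + 2)) (riseFun t) t := by
    exact (hasDerivAt_smoothTransition (t + 2)).comp_add_const t 2
  have h2 : HasDerivAt (fun t => Real.smoothTransition (3 - t)) (-fallFun t) t :=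
    (hasDerivAt_smoothTransition (3 - t)).comp_const_sub 3 t
  refine (h1.mul h2).congr_deriv ?_
  by_cases hr : t ∈ Icc (-2 : ℝ) (-1)
  · rw [fallFun_eq_zero fun h => by linarith [h.1, hr.2],
      Real.smoothTransition.one_of_one_le (x := 3 - t) (by linarith [hr.2])]
    ring
  · rw [riseFun_eq_zero hr]
    by_cases hf : t ∈ Icc (2 : ℝ) 3
    · rw [Real.smoothTransition.one_of_one_le (x := t + 2) (by linarith [hf.1])]
      ring
    · rw [fallFun_eq_zero hf]
      ring

/-- Smooth homotopies, with parameter in `ℝ`, between smooth maps. -/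
structure Homotopy {X : DiffSpace.{u}} {Y : DiffSpace.{v}} (f g : SmoothHom X Y) where
  toFun : ℝ → X.carrier → Y.carrier
  isPlot : ∀ {m : ℕ} (O : Opens (Fin m → ℝ)) (φ : (opn O).carrier → X.carrier),
    X.IsPlot (opn O) φ →
      Y.IsPlot (opn (cyl O)) fun z => toFun (cylTime z) (φ (cylBase z))
  left : ∀ t ≤ 0, ∀ x, toFun t x = f.toFun x
  right : ∀ t, 1 ≤ t → ∀ x, toFun t x = g.toFun x

namespace Homotopy

variable {X : DiffSpace.{u}} {Y : DiffSpace.{v}} {f g : SmoothHom X Y} (H : Homotopy f g)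

/-- The operator on forms inducing the chain homotopy. -/
def onForm (k : ℕ) {m j : ℕ} (O : Opens (Fin m → ℝ)) (φ : (opn O).carrier → X.carrier)
    (hφ : X.IsPlot (opn O) φ) (hj : j + k = m) : testForms O j →ₗ[ℝ] Chains Y (k + 1) :=
  eucl (cyl O) (fun z => H.toFun (cylTime z) (φ (cylBase z))) (H.isPlot O φ hφ)
    (by omega : j + (k + 1) = m + 1) ∘ₗ cylTest plateau contDiff_plateau
      hasCompactSupport_plateau O j

/-- The chain homotopy, as a family of maps on forms. -/
def functional (k : ℕ) : EuclFunctional X k (Chains Y (k + 1)) where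
  T O φ hφ hj := H.onForm k O φ hφ hj
  chart O φ hφ hj τ η η' h hs := by
    refine Eq.trans ?_ (eucl_chart (cyl O) (fun z => H.toFun (cylTime z) (φ (cylBase z)))
      (H.isPlot O φ hφ) (by omega) (cylParam τ) (cylTest plateau contDiff_plateau
        hasCompactSupport_plateau O _ η) (cylTest plateau contDiff_plateau
        hasCompactSupport_plateau τ.source _ η')
      (cylTest_chart contDiff_plateau hasCompactSupport_plateau τ η η' h)
      (cylTest_support contDiff_plateau hasCompactSupport_plateau τ η hs))
    rfl
  proj {m r m' i j} h O' O hO φ hφ hi hj hij η β hβ := by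
    have hO' : ∀ z ∈ cyl O', baseCoord (succ_add_eq h) z ∈ cyl O := fun z hz => by
      rw [mem_cyl, tailL_baseCoord]
      exact hO _ hz
    refine (eucl_proj (succ_add_eq h) (cyl O') (cyl O) hO' (H.isPlot O φ hφ) (by omega) (by omega)
      hij (cylTest plateau contDiff_plateau hasCompactSupport_plateau O' _ η)
      (cylTest plateau contDiff_plateau hasCompactSupport_plateau O _ β)
      (cylTest_proj h contDiff_plateau hasCompactSupport_plateau hij η β hβ)).trans ?_
    rfl
  negative {m r m' i} h O' O hO φ hφ hi hk η := by
    have hO' : ∀ z ∈ cyl O', baseCoord (succ_add_eq h) z ∈ cyl O := fun z hz => by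
      rw [mem_cyl, tailL_baseCoord]
      exact hO _ hz
    exact eucl_eq_zero (succ_add_eq h) (cyl O') (cyl O) hO' (H.isPlot O φ hφ) (by omega) (by omega)
      (cylTest plateau contDiff_plateau hasCompactSupport_plateau O' _ η)

/-- The chain homotopy induced by a homotopy. -/
def chain (k : ℕ) : Chains X k →ₗ[ℝ] Chains Y (k + 1) := (H.functional k).lift

lemma chain_eucl {k m j : ℕ} (O : Opens (Fin m → ℝ)) (φ : (opn O).carrier → X.carrier)
    (hφ : X.IsPlot (opn O) φ) (hj : j + k = m) (η : testForms O j) :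
    H.chain k (eucl O φ hφ hj η) =
      eucl (cyl O) (fun z => H.toFun (cylTime z) (φ (cylBase z))) (H.isPlot O φ hφ)
        (by omega : j + (k + 1) = m + 1) (cylTest plateau contDiff_plateau
          hasCompactSupport_plateau O j η) :=
  (H.functional k).lift_eucl O φ hφ hj η

lemma boundary_chain_eucl {k m j : ℕ} (O : Opens (Fin m → ℝ)) (φ : (opn O).carrier → X.carrier)
    (hφ : X.IsPlot (opn O) φ) (hj : j + k = m) (η : testForms O j) :
    boundary Y k (H.chain k (eucl O φ hφ hj η)) =
      eucl (cyl O) (fun z => H.toFun (cylTime z) (φ (cylBase z))) (H.isPlot O φ hφ)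
        (by omega : j + 1 + k = m + 1) (cylTest plateau contDiff_plateau
          hasCompactSupport_plateau O (j + 1) (testD O j η)) +
      (-1 : ℝ) ^ k • (push f k (eucl O φ hφ hj η) - push g k (eucl O φ hφ hj η)) := by
  obtain ⟨K, hK, hKO, hz⟩ := η.2.2
  have h1 : testD (cyl O) j (cylTest plateau contDiff_plateau hasCompactSupport_plateau O j η) =
      cylTest plateau contDiff_plateau hasCompactSupport_plateau O (j + 1) (testD O j η) +
      (dtTest riseFun contDiff_riseFun hasCompactSupport_riseFun O j η -
        dtTest fallFun contDiff_fallFun hasCompactSupport_fallFun O j η) := by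
    apply Subtype.ext
    change extDeriv (cylForm plateau η.1) = cylForm plateau (extDeriv η.1) +
      (dtForm riseFun η.1 - dtForm fallFun η.1)
    rw [extDeriv_cylForm hasDerivAt_plateau (testForms.contDiff η)]
    congr 1
    funext z
    ext v
    change dtForm (fun t => riseFun t - fallFun t) η.1 z v =
      dtForm riseFun η.1 z v - dtForm fallFun η.1 z v
    rw [dtForm_apply, dtForm_apply, dtForm_apply, ← Finset.sum_sub_distrib]
    exact Finset.sum_congr rfl fun i _ => by ring
  have hd : ∀ (g : ℝ → ℝ) (hg : ContDiff ℝ ∞ g) (hc : HasCompactSupport g) (S : Set ℝ),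
      IsCompact S → (∀ t ∉ S, g t = 0) → ∃ C : Set (Fin (m + 1) → ℝ), IsCompact C ∧
        C ⊆ {z | z ∈ cyl O ∧ timeL m z ∈ S} ∧ ∀ z ∉ C, (dtTest g hg hc O j η).1 z = 0 := by
    intro g hg hc S hS hgS
    refine ⟨consL m '' (S ×ˢ K), (hS.prod hK).image (consL m).toContinuousLinearEquiv.continuous,
      ?_, fun z hz' => ?_⟩
    · rintro _ ⟨⟨t, x⟩, ⟨ht, hx⟩, rfl⟩
      exact ⟨hKO hx, ht⟩
    · have h2 : cylForm g η.1 z = 0 := by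
        by_cases h : timeL m z ∈ S
        · rw [cylForm, hz _ fun h' => hz' ⟨(timeL m z, tailL m z), ⟨h, h'⟩, (consL m).right_inv z⟩]
          ext v
          simp
        · rw [cylForm, hgS _ h, zero_smul]
      change dtForm g η.1 z = 0
      rw [dtForm, h2, ContinuousLinearMap.smulRight_zero]
      ext v
      simp [ContinuousAlternatingMap.alternatizeUncurryFin_apply]
  have hleft : eucl (cyl O) (fun z => H.toFun (cylTime z) (φ (cylBase z))) (H.isPlot O φ hφ)
      (by omega : j + 1 + k = m + 1)
        (dtTest riseFun contDiff_riseFun hasCompactSupport_riseFun O j η) =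
      (-1 : ℝ) ^ k • push f k (eucl O φ hφ hj η) := by
    rw [push_eucl, ← eucl_dtTest contDiff_riseFun hasCompactSupport_riseFun integral_riseFun O
      (f.toFun ∘ φ) (f.isPlot hφ) (Y.comp_submersion (f.isPlot hφ) (isSubmersion_cylBase O)) hj
      (by omega)]
    let N : Opens (Fin (m + 1) → ℝ) := ⟨(cyl O : Set _) ∩ timeL m ⁻¹' Iio 0,
      (cyl O).isOpen.inter (isOpen_Iio.preimage (timeL m).continuous)⟩
    obtain ⟨C, hC, hCN, hC0⟩ := hd riseFun contDiff_riseFun hasCompactSupport_riseFun _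
      isCompact_Icc fun _ => riseFun_eq_zero
    refine eucl_germ (N := N) inter_subset_left _ _ _ _
      (fun p hp => H.left _ (le_of_lt hp.2) _) ⟨C, hC, fun z hzC => ?_, hC0⟩
    exact ⟨(hCN hzC).1, lt_of_le_of_lt (hCN hzC).2.2 (by norm_num)⟩
  have hright : eucl (cyl O) (fun z => H.toFun (cylTime z) (φ (cylBase z))) (H.isPlot O φ hφ)
      (by omega : j + 1 + k = m + 1)
        (dtTest fallFun contDiff_fallFun hasCompactSupport_fallFun O j η) =
      (-1 : ℝ) ^ k • push g k (eucl O φ hφ hj η) := by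
    rw [push_eucl, ← eucl_dtTest contDiff_fallFun hasCompactSupport_fallFun integral_fallFun O
      (g.toFun ∘ φ) (g.isPlot hφ) (Y.comp_submersion (g.isPlot hφ) (isSubmersion_cylBase O)) hj
      (by omega)]
    let N : Opens (Fin (m + 1) → ℝ) := ⟨(cyl O : Set _) ∩ timeL m ⁻¹' Ioi 1,
      (cyl O).isOpen.inter (isOpen_Ioi.preimage (timeL m).continuous)⟩
    obtain ⟨C, hC, hCN, hC0⟩ := hd fallFun contDiff_fallFun hasCompactSupport_fallFun _
      isCompact_Icc fun _ => fallFun_eq_zero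
    refine eucl_germ (N := N) inter_subset_left _ _ _ _
      (fun p hp => H.right _ (le_of_lt hp.2) _) ⟨C, hC, fun z hzC => ?_, hC0⟩
    exact ⟨(hCN hzC).1, lt_of_lt_of_le (by norm_num) (hCN hzC).2.1⟩
  rw [chain_eucl, boundary_eucl, h1, map_add, map_sub, hleft, hright, smul_sub]

lemma boundary_chain {k : ℕ} (c : Chains X (k + 1)) :
    boundary Y (k + 1) (H.chain (k + 1) c) = H.chain k (boundary X k c) +
      (-1 : ℝ) ^ (k + 1) • (push f (k + 1) c - push g (k + 1) c) := by
  induction c using chains_induction with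
  | zero => simp
  | add a b ha hb =>
    simp only [map_add, ha, hb, smul_sub, smul_add]
    abel
  | smul r a ha =>
    simp only [map_smul, ha, smul_sub, smul_add]
    simp only [smul_comm r]
  | eucl m j O φ hφ hj η =>
    rw [boundary_chain_eucl, boundary_eucl, chain_eucl]

lemma boundary_chain_zero (c : Chains X 0) :
    boundary Y 0 (H.chain 0 c) = push f 0 c - push g 0 c := by
  induction c using chains_induction with
  | zero => simp
  | add a b ha hb =>
    simp only [map_add, ha, hb]
    abel
  | smul r a ha => simp only [map_smul, ha, smul_sub]
  | eucl m j O φ hφ hj η =>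
    have h1 : testD O j η = 0 := by
      refine Subtype.ext (funext fun x => ?_)
      ext v
      refine (testD O j η).1 x |>.toAlternatingMap.map_linearDependent v fun h => ?_
      have := h.fintype_card_le_finrank
      simp at this
      omega
    rw [boundary_chain_eucl, h1, map_zero, map_zero, zero_add, pow_zero, one_smul]

end Homotopy

/-! ### Convex subsets of Euclidean spaces -/

/-- The identity map. -/
def SmoothHom.id (X : DiffSpace.{u}) : SmoothHom X X where
  toFun x := x
  isPlot h := h

lemma push_id {X : DiffSpace.{u}} (k : ℕ) (c : Chains X k) : push (SmoothHom.id X) k c = c := by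
  have h : push (SmoothHom.id X) k = LinearMap.id := chains_hom_ext fun U φ hφ j hj α =>
    push_chainMk _ φ hφ hj α
  exact congrArg (fun F => F c) h

/-- Cycles for the augmented chain complex. -/
def IsCycle {X : DiffSpace.{u}} : ∀ {k : ℕ}, Chains X k → Prop
  | 0, c => aug X c = 0
  | k + 1, c => boundary X k c = 0

lemma Homotopy.exists_boundary {X : DiffSpace.{u}} [HasPoints X] {x : X.carrier}
    (H : Homotopy (SmoothHom.id X) (constHom X x)) {k : ℕ} {c : Chains X k} (hc : IsCycle c) :
    ∃ b, boundary X k b = c := by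
  cases k with
  | zero =>
    have hc' : aug X c = 0 := hc
    refine ⟨H.chain 0 c, ?_⟩
    rw [H.boundary_chain_zero, push_id, push_constHom_zero, hc', zero_smul, sub_zero]
  | succ k =>
    have hc' : boundary X k c = 0 := hc
    refine ⟨(-1 : ℝ) ^ (k + 1) • H.chain (k + 1) c, ?_⟩
    rw [map_smul, H.boundary_chain, push_id, push_constHom, hc', map_zero, zero_add, sub_zero,
      smul_smul, ← mul_pow]
    simp

instance {k : ℕ} (S : Set (Fin k → ℝ)) : HasPoints ((euclidean k).sub S) where
  isPlot _ _ := fun _ => contMDiff_const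

lemma contMDiff_cylTime {m : ℕ} (O : Opens (Fin m → ℝ)) (ψ : (opn (cyl O)).Param) :
    ContMDiff 𝓘(ℝ, Fin (opn (cyl O)).dim → ℝ) 𝓘(ℝ, ℝ) ∞
      fun z : ψ.source => cylTime (ψ.lift z) := fun x =>
  contMDiffAt_subtype_iff (f := fun z => timeL m (ψ z)) |>.mpr
    ((timeL m).contDiff.contDiffAt.comp _ (ψ.contDiffAt x.2)).contMDiffAt

/-- The contraction of a convex set to a point. -/
def convexHomotopy {k : ℕ} {S : Set (Fin k → ℝ)} (hS : Convex ℝ S) (x : S) :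
    Homotopy (SmoothHom.id ((euclidean k).sub S)) (constHom _ x) where
  toFun t (y : S) := ⟨y.1 + Real.smoothTransition t • (x.1 - y.1), hS.add_smul_sub_mem y.2 x.2
    ⟨Real.smoothTransition.nonneg t, Real.smoothTransition.le_one t⟩⟩
  isPlot O φ hφ := fun ψ => by
    have h1 : ContMDiff (M' := Fin k → ℝ) 𝓘(ℝ, Fin (opn (cyl O)).dim → ℝ) 𝓘(ℝ, Fin k → ℝ) ∞
        fun z : ψ.source => ((φ (cylBase (ψ.lift z))).1 : Fin k → ℝ) :=
      ((euclidean k).sub S).comp_submersion hφ (isSubmersion_cylBase O) ψ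
    have h2 : ContMDiff 𝓘(ℝ, Fin (opn (cyl O)).dim → ℝ) 𝓘(ℝ, ℝ) ∞
        fun z : ψ.source => Real.smoothTransition (cylTime (ψ.lift z)) :=
      (Real.smoothTransition.contDiff (n := ⊤)).contMDiff.comp (contMDiff_cylTime O ψ)
    exact h1.add (h2.smul (contMDiff_const.sub h1))
  left t ht (y : S) := Subtype.ext (by
    change y.1 + Real.smoothTransition t • (x.1 - y.1) = y.1
    rw [Real.smoothTransition.zero_of_nonpos ht, zero_smul, add_zero])
  right t ht (y : S) := Subtype.ext (by
    change y.1 + Real.smoothTransition t • (x.1 - y.1) = x.1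
    rw [Real.smoothTransition.one_of_one_le ht, one_smul, add_sub_cancel])

lemma convex_simplexSet (k : ℕ) : Convex ℝ (simplexSet k) := by
  rintro x ⟨h0, h1, h2⟩ y ⟨h0', h1', h2'⟩ a b ha hb hab
  refine ⟨fun i => ?_, fun i i' hii => ?_, fun i => ?_⟩
  · exact add_nonneg (mul_nonneg ha (h0 i)) (mul_nonneg hb (h0' i))
  · exact add_le_add (mul_le_mul_of_nonneg_left (h1 hii) ha) (mul_le_mul_of_nonneg_left (h1' hii) hb)
  · refine (add_le_add (mul_le_mul_of_nonneg_left (h2 i) ha)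
      (mul_le_mul_of_nonneg_left (h2' i) hb)).trans_eq ?_
    rw [mul_one, mul_one, hab]

lemma zero_mem_simplexSet (k : ℕ) : (0 : Fin k → ℝ) ∈ simplexSet k :=
  ⟨fun _ => le_rfl, fun _ _ _ => le_rfl, fun _ => zero_le_one⟩

lemma exists_boundary_simplex {k l : ℕ} {c : Chains (simplex k) l} (hc : IsCycle c) :
    ∃ b, boundary (simplex k) l b = c :=
  (convexHomotopy (convex_simplexSet k) ⟨0, zero_mem_simplexSet k⟩).exists_boundary hc

/-! ### Simplex sequences -/

/-- The alternating sum of the faces. -/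
def faceSum (k l : ℕ) : Chains (simplex k) l →ₗ[ℝ] Chains (simplex (k + 1)) l :=
  ∑ j : Fin (k + 2), (-1 : ℝ) ^ j.val • push (face k j) l

lemma faceSum_apply (k l : ℕ) (c : Chains (simplex k) l) :
    faceSum k l c = ∑ j : Fin (k + 2), (-1 : ℝ) ^ j.val • push (face k j) l c := by
  simp [faceSum]

lemma boundary_faceSum (k l : ℕ) (c : Chains (simplex k) (l + 1)) :
    boundary (simplex (k + 1)) l (faceSum k (l + 1) c) = faceSum k l (boundary (simplex k) l c) := by
  simp only [faceSum_apply, map_sum, map_smul, boundary_push]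

/-- The face maps. -/
def faceMap (k : ℕ) (j : Fin (k + 2)) (t : simplexSet k) : simplexSet (k + 1) :=
  ⟨faceFun k j t.1, faceFun_mem k j t.2⟩

/-- The alternating sum over the faces of faces vanishes. -/
lemma sum_faceMap_faceMap {N : Type*} [AddCommGroup N] [Module ℝ N] (k : ℕ)
    (T : (simplexSet k → simplexSet (k + 2)) → N) :
    ∑ j : Fin (k + 3), ∑ i : Fin (k + 2),
      ((-1 : ℝ) ^ j.val * (-1 : ℝ) ^ i.val) • T (faceMap (k + 1) j ∘ faceMap k i) = 0 := by
  let X : DiffSpace := ⟨simplexSet (k + 2), fun _ _ => True, fun _ _ => trivial⟩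
  let Ψ : SmoothChains X k →ₗ[ℝ] N := Finsupp.linearCombination ℝ fun τ => T τ.1
  let σ : SmoothSimplex X (k + 2) := ⟨fun t => t, by
    classical
    refine ⟨univ, subset_univ _, ⟨fun t => if h : t.1 ∈ simplexSet (k + 2) then ⟨t.1, h⟩
      else ⟨0, zero_mem_simplexSet _⟩, fun _ => trivial⟩, isOpen_univ, fun t => dif_pos t.2⟩⟩
  have h := congrArg (fun F => Ψ (F (Finsupp.single σ 1))) (smoothBoundary_comp X k)
  simp only [LinearMap.comp_apply, smoothBoundary_single, map_sum, map_smul,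
    LinearMap.zero_apply, map_zero, Finset.smul_sum, smul_smul, Ψ,
    Finsupp.linearCombination_single, one_smul] at h
  exact h

lemma faceSum_faceSum (k l : ℕ) (c : Chains (simplex k) l) :
    faceSum (k + 1) l (faceSum k l c) = 0 := by
  classical
  have h := sum_faceMap_faceMap (N := Chains (simplex (k + 2)) l) k fun ρ =>
    if h : ∃ f : SmoothHom (simplex k) (simplex (k + 2)), f.toFun = ρ then push h.choose l c else 0
  rw [← h]
  simp only [faceSum_apply, map_sum, map_smul, Finset.smul_sum, smul_smul]
  rw [Finset.sum_comm]
  refine Finset.sum_congr rfl fun j _ => Finset.sum_congr rfl fun i _ => ?_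
  rw [mul_comm]
  have h1 : ∃ f : SmoothHom (simplex k) (simplex (k + 2)),
      f.toFun = faceMap (k + 1) j ∘ faceMap k i := ⟨(face (k + 1) j).comp (face k i), rfl⟩
  rw [dif_pos h1, ← push_comp]
  congr 2
  have h2 := h1.choose_spec
  generalize h1.choose = f at h2
  cases f
  subst h2
  rfl

lemma exists_isSimplexSequence : ∃ u : ∀ k, Chains (simplex k) k, IsSimplexSequence u := by
  classical
  let D : ℕ → Type := fun k => {c : Chains (simplex k) k // IsCycle (faceSum k k c)}
  have h0 : IsCycle (faceSum 0 0 pointChain) := by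
    change aug _ _ = 0
    rw [faceSum_apply, Fin.sum_univ_two]
    simp [aug_push]
  have hs : ∀ k (c : D k), ∃ b : D (k + 1), boundary (simplex (k + 1)) k b.1 = faceSum k k c.1 := by
    intro k c
    obtain ⟨b, hb⟩ := exists_boundary_simplex c.2
    refine ⟨⟨b, ?_⟩, hb⟩
    change boundary _ _ _ = 0
    rw [boundary_faceSum, hb, faceSum_faceSum]
  let u : ∀ k, D k := fun k => Nat.rec ⟨pointChain, h0⟩ (fun k c => (hs k c).choose) k
  refine ⟨fun k => (u k).1, rfl, fun k => ?_⟩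
  rw [← faceSum_apply]
  exact (hs k (u k)).choose_spec

lemma IsSimplexSequence.exists_homotopy {u u' : ∀ k, Chains (simplex k) k}
    (hu : IsSimplexSequence u) (hu' : IsSimplexSequence u') :
    ∃ h : ∀ k, Chains (simplex k) (k + 1), h 0 = 0 ∧ ∀ k,
      boundary (simplex (k + 1)) (k + 1) (h (k + 1)) =
        u (k + 1) - u' (k + 1) - faceSum k (k + 1) (h k) := by
  classical
  let D : ℕ → Type := fun k => {c : Chains (simplex k) (k + 1) //
    faceSum k k (u k - u' k - boundary (simplex k) k c) = 0}
  have h0 : faceSum 0 0 (u 0 - u' 0 - boundary (simplex 0) 0 0) = 0 := by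
    rw [hu.zero, hu'.zero, sub_self, map_zero, sub_zero, map_zero]
  have hs : ∀ k (c : D k), ∃ b : D (k + 1), boundary (simplex (k + 1)) (k + 1) b.1 =
      u (k + 1) - u' (k + 1) - faceSum k (k + 1) c.1 := by
    intro k c
    have hc : IsCycle (u (k + 1) - u' (k + 1) - faceSum k (k + 1) c.1) := by
      change boundary _ _ _ = 0
      rw [map_sub, map_sub, hu.succ, hu'.succ, ← faceSum_apply, ← faceSum_apply, boundary_faceSum,
        ← map_sub, ← map_sub]
      exact c.2
    obtain ⟨b, hb⟩ := exists_boundary_simplex hc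
    refine ⟨⟨b, ?_⟩, hb⟩
    rw [hb, sub_sub_cancel, faceSum_faceSum]
  let h : ∀ k, D k := fun k => Nat.rec ⟨0, h0⟩ (fun k c => (hs k c).choose) k
  exact ⟨fun k => (h k).1, rfl, fun k => (hs k (h k)).choose_spec⟩

/-! ### Supports of de Rham chains -/

section Supp

variable {X : DiffSpace.{u}} {k m j : ℕ}

/-- The plot `φ` maps the support of `η` to `S`. -/
def MapsSupport (O : Opens (Fin m → ℝ)) (φ : (opn O).carrier → X.carrier) (η : testForms O j)
    (S : Set X.carrier) : Prop :=
  ∃ K : Set (Fin m → ℝ), IsCompact K ∧ K ⊆ (O : Set (Fin m → ℝ)) ∧ (∀ x ∉ K, η.1 x = 0) ∧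
    ∀ p : (opn O).carrier, p.1 ∈ K → φ p ∈ S

/-- The de Rham chains with support in `S`. -/
def suppChains (X : DiffSpace.{u}) (k : ℕ) (S : Set X.carrier) : Submodule ℝ (Chains X k) :=
  Submodule.span ℝ {c : Chains X k | ∃ (m j : ℕ) (O : Opens (Fin m → ℝ))
    (φ : (opn O).carrier → X.carrier) (hφ : X.IsPlot (opn O) φ) (hj : j + k = m)
    (η : testForms O j), MapsSupport O φ η S ∧ c = eucl O φ hφ hj η}

lemma eucl_mem_suppChains {O : Opens (Fin m → ℝ)} {φ : (opn O).carrier → X.carrier}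
    (hφ : X.IsPlot (opn O) φ) (hj : j + k = m) {η : testForms O j} {S : Set X.carrier}
    (h : MapsSupport O φ η S) : eucl O φ hφ hj η ∈ suppChains X k S :=
  Submodule.subset_span ⟨m, j, O, φ, hφ, hj, η, h, rfl⟩

lemma suppChains_induction {S : Set X.carrier} {P : Chains X k → Prop} (zero : P 0)
    (add : ∀ a b, P a → P b → P (a + b)) (smul : ∀ (r : ℝ) a, P a → P (r • a))
    (eucl : ∀ (m j : ℕ) (O : Opens (Fin m → ℝ)) (φ : (opn O).carrier → X.carrier)
      (hφ : X.IsPlot (opn O) φ) (hj : j + k = m) (η : testForms O j), MapsSupport O φ η S →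
        P (eucl O φ hφ hj η)) {c : Chains X k} (hc : c ∈ suppChains X k S) : P c := by
  refine Submodule.span_induction ?_ zero (fun a b _ _ => add a b) (fun r a _ => smul r a) hc
  rintro _ ⟨m, j, O, φ, hφ, hj, η, h, rfl⟩
  exact eucl m j O φ hφ hj η h

lemma suppChains_mono {S S' : Set X.carrier} (h : S ⊆ S') : suppChains X k S ≤ suppChains X k S' :=
  Submodule.span_mono (by
    rintro _ ⟨m, j, O, φ, hφ, hj, η, ⟨K, hK, hKO, hz, hS⟩, rfl⟩
    exact ⟨m, j, O, φ, hφ, hj, η, ⟨K, hK, hKO, hz, fun p hp => h (hS p hp)⟩, rfl⟩)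

lemma suppChains_univ : suppChains X k univ = ⊤ := by
  refine eq_top_iff.mpr fun c _ => ?_
  induction c using chains_induction with
  | zero => exact zero_mem _
  | add a b ha hb => exact add_mem (ha trivial) (hb trivial)
  | smul r a ha => exact Submodule.smul_mem _ r (ha trivial)
  | eucl m j O φ hφ hj η =>
    obtain ⟨K, hK, hKO, hz⟩ := η.2.2
    exact eucl_mem_suppChains hφ hj ⟨K, hK, hKO, hz, fun _ _ => mem_univ _⟩

lemma suppChains_empty : suppChains X k ∅ = ⊥ := by
  refine eq_bot_iff.mpr (Submodule.span_le.mpr ?_)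
  rintro _ ⟨m, j, O, φ, hφ, hj, η, ⟨K, hK, hKO, hz, hS⟩, rfl⟩
  have h1 : η = 0 := Subtype.ext (funext fun x => hz x fun hx => hS ⟨x, hKO hx⟩ hx)
  rw [h1, map_zero]
  exact zero_mem _

lemma testD_eq_zero {O : Opens (Fin m → ℝ)} (η : testForms O j) {K : Set (Fin m → ℝ)}
    (hK : IsCompact K) (hz : ∀ x ∉ K, η.1 x = 0) : ∀ x ∉ K, (testD O j η).1 x = 0 := by
  intro x hx
  have h1 : η.1 =ᶠ[𝓝 x] fun _ => 0 := by
    filter_upwards [hK.isClosed.isOpen_compl.mem_nhds hx] with z hz' using hz z hz'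
  change extDeriv η.1 x = 0
  rw [h1.extDeriv_eq]
  ext v
  rw [extDeriv_apply (differentiableAt_const _)]
  simp

lemma boundary_mem_suppChains {S : Set X.carrier} {c : Chains X (k + 1)}
    (hc : c ∈ suppChains X (k + 1) S) : boundary X k c ∈ suppChains X k S := by
  refine suppChains_induction (P := fun c => boundary X k c ∈ suppChains X k S) ?_ ?_ ?_ ?_ hc
  · rw [map_zero]; exact zero_mem _
  · intro a b ha hb; rw [map_add]; exact add_mem ha hb
  · intro r a ha; rw [map_smul]; exact Submodule.smul_mem _ r ha
  · rintro m j O φ hφ hj η ⟨K, hK, hKO, hz, hS⟩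
    rw [boundary_eucl]
    exact eucl_mem_suppChains hφ _ ⟨K, hK, hKO, testD_eq_zero η hK hz, hS⟩

lemma push_mem_suppChains {Y : DiffSpace.{v}} (f : SmoothHom X Y) {S : Set Y.carrier}
    {S' : Set X.carrier} (hS : ∀ x ∈ S', f.toFun x ∈ S) {c : Chains X k}
    (hc : c ∈ suppChains X k S') : push f k c ∈ suppChains Y k S := by
  refine suppChains_induction (P := fun c => push f k c ∈ suppChains Y k S) ?_ ?_ ?_ ?_ hc
  · rw [map_zero]; exact zero_mem _
  · intro a b ha hb; rw [map_add]; exact add_mem ha hb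
  · intro r a ha; rw [map_smul]; exact Submodule.smul_mem _ r ha
  · rintro m j O φ hφ hj η ⟨K, hK, hKO, hz, hS'⟩
    rw [push_eucl]
    exact eucl_mem_suppChains _ hj ⟨K, hK, hKO, hz, fun p hp => hS _ (hS' p hp)⟩

lemma Homotopy.chain_mem_suppChains {Y : DiffSpace.{v}} {f g : SmoothHom X Y} (H : Homotopy f g)
    {S : Set X.carrier} {S' : Set Y.carrier} (hS : ∀ t, ∀ x ∈ S, H.toFun t x ∈ S')
    {c : Chains X k} (hc : c ∈ suppChains X k S) : H.chain k c ∈ suppChains Y (k + 1) S' := by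
  refine suppChains_induction (P := fun c => H.chain k c ∈ suppChains Y (k + 1) S') ?_ ?_ ?_ ?_ hc
  · rw [map_zero]; exact zero_mem _
  · intro a b ha hb; rw [map_add]; exact add_mem ha hb
  · intro r a ha; rw [map_smul]; exact Submodule.smul_mem _ r ha
  · rintro m j O φ hφ hj η ⟨K, hK, hKO, hz, hS''⟩
    rw [H.chain_eucl]
    obtain ⟨C, hC, hCO, hCK, h⟩ := exists_compact_cyl hasCompactSupport_plateau K hK hKO
    refine eucl_mem_suppChains _ _ ⟨C, hC, hCO, fun z hzC => ?_, fun p hp =>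
      hS _ _ (hS'' _ (hCK _ hp))⟩
    change plateau (timeL m z) • (η.1 (tailL m z)).compContinuousLinearMap (tailL m) = 0
    rcases h z hzC with h | h
    · rw [h, zero_smul]
    · rw [hz _ h]
      ext v
      simp

open Classical in
/-- The function `χ ∘ φ`, extended by zero. -/
def extFun (O : Opens (Fin m → ℝ)) (φ : (opn O).carrier → X.carrier) (χ : X.carrier → ℝ)
    (x : Fin m → ℝ) : ℝ := if h : x ∈ O then χ (φ ⟨x, h⟩) else 0

lemma extFun_of_mem {O : Opens (Fin m → ℝ)} (φ : (opn O).carrier → X.carrier)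
    (χ : X.carrier → ℝ) {x : Fin m → ℝ} (h : x ∈ O) : extFun O φ χ x = χ (φ ⟨x, h⟩) := dif_pos h

/-- Smooth functions. -/
def IsSmoothFun (X : DiffSpace.{u}) (χ : X.carrier → ℝ) : Prop :=
  ∀ {m : ℕ} (O : Opens (Fin m → ℝ)) (φ : (opn O).carrier → X.carrier), X.IsPlot (opn O) φ →
    ContDiffOn ℝ ∞ (extFun O φ χ) O

/-- The product of a form with a function which is smooth on `O`. -/
def mulTest (O : Opens (Fin m → ℝ)) (f : (Fin m → ℝ) → ℝ) (hf : ContDiffOn ℝ ∞ f O) (j : ℕ) :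
    testForms O j →ₗ[ℝ] testForms O j where
  toFun η := ⟨fun x => f x • η.1 x, by
    obtain ⟨K, hK, hKO, hz⟩ := η.2.2
    refine contDiff_iff_contDiffAt.mpr fun x => ?_
    by_cases hx : x ∈ O
    · exact (hf.contDiffAt (O.isOpen.mem_nhds hx)).smul (testForms.contDiff η).contDiffAt
    · refine contDiffAt_const (c := 0) |>.congr_of_eventuallyEq ?_
      filter_upwards [hK.isClosed.isOpen_compl.mem_nhds fun h => hx (hKO h)] with z hz'
      rw [hz z hz', smul_zero], by
    obtain ⟨K, hK, hKO, hz⟩ := η.2.2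
    exact ⟨K, hK, hKO, fun x hx => by simp only [hz x hx, smul_zero]⟩⟩
  map_add' η η' := Subtype.ext (funext fun x => smul_add _ _ _)
  map_smul' c η := Subtype.ext (funext fun x => smul_comm (f x) c (η.1 x))

/-- Multiplication with a smooth function, as a family of maps on forms. -/
def mulFunctional {χ : X.carrier → ℝ} (hχ : IsSmoothFun X χ) (k : ℕ) :
    EuclFunctional X k (Chains X k) where
  T O φ hφ hj := eucl O φ hφ hj ∘ₗ mulTest O (extFun O φ χ) (hχ O φ hφ) _
  chart O φ hφ hj τ η η' h hs := by
    refine eucl_chart O φ hφ hj τ (mulTest O (extFun O φ χ) (hχ O φ hφ) _ η) _ (fun x hx => ?_) ?_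
    · change extFun τ.source _ χ x • η'.1 x = _
      rw [h x hx, τ.pull_of_mem hx, τ.pull_of_mem hx, extFun_of_mem _ _ hx, smul_comm]
      congr 1
      ext v
      change _ = extFun O φ χ (τ x) * _
      rw [extFun_of_mem φ χ (τ.mem x hx)]
      rfl
    · obtain ⟨K, hK, hKs, hz⟩ := hs
      refine ⟨K, hK, hKs, fun y hy => ?_⟩
      change _ • η.1 y = 0
      rw [hz y hy, smul_zero]
  proj {m r m' i j} h O' O hO φ hφ hi hj hij η β hβ := by
    refine eucl_proj h O' O hO hφ hi hj hij (mulTest O' (extFun O' (φ ∘ projMap h O' O hO) χ)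
      (hχ O' _ (X.comp_submersion hφ (isSubmersion_projMap h O' O hO))) _ η) _ fun x hx v => ?_
    change extFun O φ χ x * β.1 x v = ∫ y : Fin r → ℝ, extFun O' (φ ∘ projMap h O' O hO) χ
      (join h x y) * η.1 (join h x y) (frame h hij v)
    rw [hβ x hx, ← integral_const_mul]
    refine integral_congr_ae (Filter.Eventually.of_forall fun y => ?_)
    change _ * _ = _ * _
    by_cases hy : join h x y ∈ O'
    · rw [extFun_of_mem _ _ hx, extFun_of_mem _ _ hy]
      congr 3
      exact Subtype.ext (baseCoord_join h x y).symm
    · rw [testForms.eq_zero η hy]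
      simp
  negative h O' O hO φ hφ hi hk η := eucl_eq_zero h O' O hO hφ hi hk _

/-- Multiplication of chains with a smooth function. -/
def mulChain {χ : X.carrier → ℝ} (hχ : IsSmoothFun X χ) (k : ℕ) : Chains X k →ₗ[ℝ] Chains X k :=
  (mulFunctional hχ k).lift

lemma mulChain_eucl {χ : X.carrier → ℝ} (hχ : IsSmoothFun X χ) (O : Opens (Fin m → ℝ))
    (φ : (opn O).carrier → X.carrier) (hφ : X.IsPlot (opn O) φ) (hj : j + k = m)
    (η : testForms O j) : mulChain hχ k (eucl O φ hφ hj η) =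
      eucl O φ hφ hj (mulTest O (extFun O φ χ) (hχ O φ hφ) j η) :=
  (mulFunctional hχ k).lift_eucl O φ hφ hj η

lemma mulChain_eq_self {χ : X.carrier → ℝ} (hχ : IsSmoothFun X χ) {S : Set X.carrier}
    (h : ∀ x ∈ S, χ x = 1) {c : Chains X k} (hc : c ∈ suppChains X k S) :
    mulChain hχ k c = c := by
  refine suppChains_induction (P := fun c => mulChain hχ k c = c) ?_ ?_ ?_ ?_ hc
  · rw [map_zero]
  · intro a b ha hb; rw [map_add, ha, hb]
  · intro r a ha; rw [map_smul, ha]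
  · rintro m j O φ hφ hj η ⟨K, hK, hKO, hz, hS⟩
    rw [mulChain_eucl]
    congr 1
    refine Subtype.ext (funext fun x => ?_)
    change extFun O φ χ x • η.1 x = η.1 x
    by_cases hx : x ∈ K
    · rw [extFun_of_mem φ χ (hKO hx), h _ (hS ⟨x, hKO hx⟩ hx), one_smul]
    · rw [hz x hx, smul_zero]

end Supp

/-! ### Supports in manifolds -/

section Manifold

variable {E : Type*} [NormedAddCommGroup E] [NormedSpace ℝ E] {H : Type*} [TopologicalSpace H]
  {I : ModelWithCorners ℝ E H} {M : Type u} [TopologicalSpace M] [ChartedSpace H M] {k m j : ℕ}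

lemma continuous_plot {O : Opens (Fin m → ℝ)} {φ : (opn O).carrier → M}
    (hφ : (DiffSpace.ofManifold I M).IsPlot (opn O) φ) :
    Continuous fun x : O => φ ⟨x.1, x.2⟩ :=
  (hφ (idParam (O : Set (Fin m → ℝ)) O.isOpen)).continuous

lemma isSmoothFun_of_contMDiff {χ : M → ℝ} (hχ : ContMDiff I 𝓘(ℝ, ℝ) ∞ χ) :
    IsSmoothFun (DiffSpace.ofManifold I M) χ := by
  intro m O φ hφ x hx
  have h1 : ContMDiff 𝓘(ℝ, Fin m → ℝ) 𝓘(ℝ, ℝ) ∞ fun z : O => χ (φ ⟨z.1, z.2⟩) :=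
    hχ.comp (hφ (idParam (O : Set (Fin m → ℝ)) O.isOpen))
  have h2 : ContMDiffAt 𝓘(ℝ, Fin m → ℝ) 𝓘(ℝ, ℝ) ∞
      (fun z : O => extFun (X := DiffSpace.ofManifold I M) O φ χ z) ⟨x, hx⟩ := by
    have : (fun z : O => extFun (X := DiffSpace.ofManifold I M) O φ χ z) =
        fun z : O => χ (φ ⟨z.1, z.2⟩) := by
      funext z
      exact extFun_of_mem (X := DiffSpace.ofManifold I M) φ χ z.2
    rw [this]
    exact h1 ⟨x, hx⟩
  exact (contMDiffAt_subtype_iff.mp h2).contDiffAt.contDiffWithinAt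

lemma exists_cutoff {E : Type*} [NormedAddCommGroup E] [NormedSpace ℝ E] [FiniteDimensional ℝ E]
    {H : Type*} [TopologicalSpace H] (I : ModelWithCorners ℝ E H) {M : Type*} [TopologicalSpace M]
    [ChartedSpace H M] [IsManifold I ∞ M] [T2Space M] [NormalSpace M] [SigmaCompactSpace M]
    {S U : Set M} (hS : IsClosed S) (hU : IsOpen U) (hSU : S ⊆ U) :
    ∃ χ : M → ℝ, ContMDiff I 𝓘(ℝ, ℝ) ∞ χ ∧ (∀ x, χ x ∈ Icc (0 : ℝ) 1) ∧
      (∃ N, IsOpen N ∧ S ⊆ N ∧ ∀ x ∈ N, χ x = 1) ∧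
      ∃ C, IsClosed C ∧ C ⊆ U ∧ ∀ x ∉ C, χ x = 0 := by
  obtain ⟨f, h0, h1, hf⟩ := exists_contMDiffMap_zero_one_nhds_of_isClosed I (n := ⊤)
    hU.isClosed_compl hS (disjoint_compl_left_iff_subset.mpr hSU)
  obtain ⟨W, hW, hUW, hW0⟩ := mem_nhdsSet_iff_exists.mp h0
  obtain ⟨N, hN, hSN, hN1⟩ := mem_nhdsSet_iff_exists.mp h1
  exact ⟨f, f.contMDiff, hf, ⟨N, hN, hSN, fun x hx => hN1 hx⟩, Wᶜ, hW.isClosed_compl,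
    compl_subset_comm.mp hUW, fun x hx => hW0 (not_not.mp hx)⟩

variable (I) in
/-- The chains of `M` with support in `S`. -/
abbrev mSupp (k : ℕ) (S : Set M) : Submodule ℝ (Chains (DiffSpace.ofManifold I M) k) :=
  suppChains (DiffSpace.ofManifold I M) k S

lemma exists_compact_suppChains {U : Set M} {c : Chains (DiffSpace.ofManifold I M) k}
    (hc : c ∈ mSupp I k U) : ∃ S, IsCompact S ∧ S ⊆ U ∧ c ∈ mSupp I k S := by
  refine suppChains_induction (P := fun c => ∃ S, IsCompact S ∧ S ⊆ U ∧ c ∈ mSupp I k S)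
    ⟨∅, isCompact_empty, empty_subset _, zero_mem _⟩ ?_ ?_ ?_ hc
  · rintro a b ⟨S, hS, hSU, ha⟩ ⟨S', hS', hSU', hb⟩
    exact ⟨S ∪ S', hS.union hS', union_subset hSU hSU', add_mem
      (suppChains_mono subset_union_left ha) (suppChains_mono subset_union_right hb)⟩
  · rintro r a ⟨S, hS, hSU, ha⟩
    exact ⟨S, hS, hSU, Submodule.smul_mem _ r ha⟩
  · rintro m j O φ hφ hj η ⟨K, hK, hKO, hz, hS⟩
    let S : Set M := (fun x : O => φ ⟨x.1, x.2⟩) '' (Subtype.val ⁻¹' K)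
    have hKc : IsCompact (Subtype.val ⁻¹' K : Set O) :=
      Topology.IsInducing.subtypeVal.isCompact_preimage_iff (by
        intro x hx; exact ⟨⟨x, hKO hx⟩, rfl⟩) |>.mpr hK
    refine ⟨S, hKc.image (continuous_plot hφ), ?_, ?_⟩
    · rintro _ ⟨x, hx, rfl⟩
      exact hS ⟨x.1, x.2⟩ hx
    · exact eucl_mem_suppChains hφ hj ⟨K, hK, hKO, hz, fun p hp => ⟨⟨p.1, p.2⟩, hp, rfl⟩⟩

lemma mSupp_sup_le {U V : Set M} (hU : IsOpen U) (hV : IsOpen V) :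
    mSupp I k (U ∪ V) ≤ mSupp I k U ⊔ mSupp I k V := by
  refine Submodule.span_le.mpr ?_
  rintro _ ⟨m, j, O, φ, hφ, hj, η, ⟨K, hK, hKO, hz, hS⟩, rfl⟩
  have hpre : ∀ W : Set M, IsOpen W → IsOpen {x | ∃ h : x ∈ O, φ ⟨x, h⟩ ∈ W} := fun W hW => by
    have := O.isOpen.isOpenMap_subtype_val _ (hW.preimage (continuous_plot hφ))
    convert this using 1
    ext x
    simp
    exact Iff.rfl
  let A := {x | ∃ h : x ∈ O, φ ⟨x, h⟩ ∈ U}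
  let B := {x | ∃ h : x ∈ O, φ ⟨x, h⟩ ∈ V}
  obtain ⟨χ, hχ, -, ⟨N, hN, hSN, hN1⟩, C, hC, hCA, hC0⟩ := exists_cutoff 𝓘(ℝ, Fin m → ℝ)
    (S := K \ B) (U := A) (hK.isClosed.sdiff (hpre V hV)) (hpre U hU) (fun x hx => by
      have hxO := hKO hx.1
      rcases hS ⟨x, hxO⟩ hx.1 with h | h
      · exact ⟨hxO, h⟩
      · exact absurd ⟨hxO, h⟩ hx.2)
  have h1 : eucl O φ hφ hj η = eucl O φ hφ hj (mulTest O χ hχ.contDiff.contDiffOn j η) +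
      eucl O φ hφ hj (η - mulTest O χ hχ.contDiff.contDiffOn j η) := by
    rw [← map_add, add_sub_cancel]
  rw [h1]
  refine Submodule.add_mem_sup (eucl_mem_suppChains hφ hj ⟨K ∩ C, hK.inter_right hC,
    inter_subset_left.trans hKO, fun x hx => ?_, fun p hp => ?_⟩)
    (eucl_mem_suppChains hφ hj ⟨K \ N, hK.diff hN, sdiff_subset.trans hKO, fun x hx => ?_,
      fun p hp => ?_⟩)
  · change χ x • η.1 x = 0
    by_cases hxK : x ∈ K
    · rw [hC0 x fun h => hx ⟨hxK, h⟩, zero_smul]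
    · rw [hz x hxK, smul_zero]
  · exact (hCA hp.2).2
  · change η.1 x - χ x • η.1 x = 0
    by_cases hxK : x ∈ K
    · rw [hN1 x (by_contra fun h => hx ⟨hxK, h⟩), one_smul, sub_self]
    · rw [hz x hxK, smul_zero, sub_zero]
  · exact (by_contra fun h => hp.2 (hSN ⟨hp.1, h⟩) : p.1 ∈ B).2

lemma mSupp_inf_le [FiniteDimensional ℝ E] [IsManifold I ∞ M] [T2Space M] [NormalSpace M]
    [SigmaCompactSpace M] {U V : Set M} (hU : IsOpen U) :
    mSupp I k U ⊓ mSupp I k V ≤ mSupp I k (U ∩ V) := by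
  rintro c ⟨hcU, hcV⟩
  obtain ⟨S, hS, hSU, hc⟩ := exists_compact_suppChains hcU
  obtain ⟨χ, hχ, -, ⟨N, hN, hSN, hN1⟩, C, hC, hCA, hC0⟩ := exists_cutoff I hS.isClosed hU hSU
  rw [← mulChain_eq_self (isSmoothFun_of_contMDiff hχ) (fun x hx => hN1 x (hSN hx)) hc]
  refine suppChains_induction (P := fun c => mulChain (isSmoothFun_of_contMDiff hχ) k c ∈
    mSupp I k (U ∩ V)) ?_ ?_ ?_ ?_ hcV
  · rw [map_zero]; exact zero_mem _
  · intro a b ha hb; rw [map_add]; exact add_mem ha hb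
  · intro r a ha; rw [map_smul]; exact Submodule.smul_mem _ r ha
  · rintro m j O φ hφ hj η ⟨K, hK, hKO, hz, hS⟩
    refine (congrArg (· ∈ mSupp I k (U ∩ V)) (mulChain_eucl (isSmoothFun_of_contMDiff hχ) O φ hφ
      hj η)).mpr ?_
    have hcl : IsCompact (Subtype.val '' ((fun x : O => φ ⟨x.1, x.2⟩) ⁻¹' C ∩ Subtype.val ⁻¹' K)) := by
      have hKc : IsCompact (Subtype.val ⁻¹' K : Set O) :=
        Topology.IsInducing.subtypeVal.isCompact_preimage_iff (by
          intro x hx; exact ⟨⟨x, hKO hx⟩, rfl⟩) |>.mpr hK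
      exact (hKc.inter_left (hC.preimage (continuous_plot hφ))).image continuous_subtype_val
    refine eucl_mem_suppChains hφ hj ⟨_, hcl, ?_, fun x hx => ?_, fun p hp => ?_⟩
    · rintro _ ⟨x, -, rfl⟩
      exact x.2
    · change extFun (X := DiffSpace.ofManifold I M) O φ χ x • η.1 x = 0
      by_cases hxK : x ∈ K
      · rw [extFun_of_mem (X := DiffSpace.ofManifold I M) φ χ (hKO hxK)]
        have : χ (φ ⟨x, hKO hxK⟩) = 0 := hC0 _ fun h => hx ⟨⟨x, hKO hxK⟩, ⟨h, hxK⟩, rfl⟩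
        rw [this, zero_smul]
      · rw [hz x hxK, smul_zero]
    · obtain ⟨x, ⟨hx1, hx2⟩, hxp⟩ := hp
      have : p = ⟨x.1, x.2⟩ := Subtype.ext hxp.symm
      subst this
      exact ⟨hCA hx1, hS _ hx2⟩

/-- Chains with support in a directed union. -/
lemma exists_mem_mSupp_of_directed {ι : Type*} [Nonempty ι] {U : ι → Set M}
    (hU : ∀ i, IsOpen (U i)) (hd : Directed (· ⊆ ·) U)
    {c : Chains (DiffSpace.ofManifold I M) k} (hc : c ∈ mSupp I k (⋃ i, U i)) :
    ∃ i, c ∈ mSupp I k (U i) := by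
  obtain ⟨S, hS, hSU, hc⟩ := exists_compact_suppChains hc
  obtain ⟨i, hi⟩ := hS.elim_directed_cover U hU hSU hd
  exact ⟨i, suppChains_mono hi hc⟩

end Manifold

/-! ### Contractions of open sets which are convex in a chart -/

section ChartConvex

variable {E : Type*} [NormedAddCommGroup E] [NormedSpace ℝ E] {M : Type u} [TopologicalSpace M]

/-- Open sets which are contained in the domain of the chart `e` and convex in this chart. -/
structure ChartConvex (e : OpenPartialHomeomorph M E) (U : Set M) : Prop where
  isOpen : IsOpen U
  subset : U ⊆ e.source
  convex : Convex ℝ (e '' U)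

lemma ChartConvex.inter {e : OpenPartialHomeomorph M E} {U V : Set M} (hU : ChartConvex e U)
    (hV : ChartConvex e V) : ChartConvex e (U ∩ V) where
  isOpen := hU.isOpen.inter hV.isOpen
  subset := inter_subset_left.trans hU.subset
  convex := by
    rw [e.injOn.image_inter hU.subset hV.subset]
    exact hU.convex.inter hV.convex

/-- The segment, in the chart `e`, from `x` to `p`. -/
def chartSegment (e : OpenPartialHomeomorph M E) (p : M) (s : ℝ) (x : M) : M :=
  e.symm (e x + s • (e p - e x))

lemma ChartConvex.segment_mem_image {e : OpenPartialHomeomorph M E} {U : Set M}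
    (hU : ChartConvex e U) {p x : M} (hp : p ∈ U) (hx : x ∈ U) {s : ℝ} (hs : s ∈ Icc (0 : ℝ) 1) :
    e x + s • (e p - e x) ∈ e '' U :=
  hU.convex.add_smul_sub_mem (mem_image_of_mem e hx) (mem_image_of_mem e hp) hs

lemma ChartConvex.image_subset_target {e : OpenPartialHomeomorph M E} {U : Set M}
    (hU : ChartConvex e U) : e '' U ⊆ e.target :=
  (image_mono hU.subset).trans_eq e.image_source_eq_target

lemma ChartConvex.symm_mem {e : OpenPartialHomeomorph M E} {U : Set M}
    (hU : ChartConvex e U) {y : E} (hy : y ∈ e '' U) : e.symm y ∈ U := by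
  obtain ⟨x, hx, rfl⟩ := hy
  rwa [e.left_inv (hU.subset hx)]

lemma ChartConvex.segment_mem {e : OpenPartialHomeomorph M E} {U : Set M}
    (hU : ChartConvex e U) {p x : M} (hp : p ∈ U) (hx : x ∈ U) {s : ℝ} (hs : s ∈ Icc (0 : ℝ) 1) :
    chartSegment e p s x ∈ U :=
  hU.symm_mem (hU.segment_mem_image hp hx hs)

lemma ChartConvex.segment_zero {e : OpenPartialHomeomorph M E} {U : Set M}
    (hU : ChartConvex e U) (p : M) {x : M} (hx : x ∈ U) : chartSegment e p 0 x = x := by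
  rw [chartSegment, zero_smul, add_zero, e.left_inv (hU.subset hx)]

lemma ChartConvex.segment_one {e : OpenPartialHomeomorph M E} {U : Set M}
    (hU : ChartConvex e U) {p : M} (hp : p ∈ U) (x : M) : chartSegment e p 1 x = p := by
  rw [chartSegment, one_smul, add_sub_cancel, e.left_inv (hU.subset hp)]

variable [ChartedSpace E M]

lemma ChartConvex.contMDiffAt_segment [IsManifold 𝓘(ℝ, E) ∞ M] {e : OpenPartialHomeomorph M E}
    {U : Set M} (hU : ChartConvex e U) (he : e ∈ IsManifold.maximalAtlas 𝓘(ℝ, E) ∞ M) {p : M}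
    (hp : p ∈ U) {F : Type*} [NormedAddCommGroup F] [NormedSpace ℝ F] {H : Type*}
    [TopologicalSpace H] {J : ModelWithCorners ℝ F H} {N : Type*} [TopologicalSpace N]
    [ChartedSpace H N] {s : N → ℝ} {f : N → M} {z : N} (hs : ContMDiffAt J 𝓘(ℝ, ℝ) ∞ s z)
    (hf : ContMDiffAt J 𝓘(ℝ, E) ∞ f z) (hz : f z ∈ U) (hsz : s z ∈ Icc (0 : ℝ) 1) :
    ContMDiffAt J 𝓘(ℝ, E) ∞ (fun z => chartSegment e p (s z) (f z)) z := by
  have h1 : ContMDiffAt J 𝓘(ℝ, E) ∞ (fun z => e (f z)) z :=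
    (contMDiffAt_of_mem_maximalAtlas he (hU.subset hz)).comp z hf
  have h2 : ContMDiffAt J 𝓘(ℝ, E) ∞ (fun z => e (f z) + s z • (e p - e (f z))) z :=
    h1.add (hs.smul (contMDiffAt_const.sub h1))
  exact ContMDiffAt.comp z (contMDiffAt_symm_of_mem_maximalAtlas he
    (hU.image_subset_target (hU.segment_mem_image hp hz hsz))) h2

end ChartConvex

section Acyclic

instance {E : Type*} [NormedAddCommGroup E] [NormedSpace ℝ E] {H : Type*} [TopologicalSpace H]
    (I : ModelWithCorners ℝ E H) (M : Type u) [TopologicalSpace M] [ChartedSpace H M] :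
    HasPoints (DiffSpace.ofManifold I M) where
  isPlot _ _ := fun _ => contMDiff_const

variable {E : Type*} [NormedAddCommGroup E] [NormedSpace ℝ E] {H : Type*} [TopologicalSpace H]
  {I : ModelWithCorners ℝ E H} {M : Type u} [TopologicalSpace M] [ChartedSpace H M]

/-- Smooth self-maps of a manifold. -/
def homOfContMDiff (f : M → M) (hf : ContMDiff I I ∞ f) :
    SmoothHom (DiffSpace.ofManifold I M) (DiffSpace.ofManifold I M) where
  toFun := f
  isPlot h := fun ψ => hf.comp (h ψ)

/-- A smooth map `ℝ × M → M` which is constant in `t` for `t ≤ 0` and `t ≥ 1`, as a homotopy. -/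
def homotopyOfContMDiff (F : ℝ → M → M)
    (hF : ContMDiff (𝓘(ℝ, ℝ).prod I) I ∞ fun z : ℝ × M => F z.1 z.2) {g : M → M}
    (hg : ContMDiff I I ∞ g) (h0 : ∀ t ≤ 0, ∀ x, F t x = x) (h1 : ∀ t, 1 ≤ t → ∀ x, F t x = g x) :
    Homotopy (SmoothHom.id (DiffSpace.ofManifold I M)) (homOfContMDiff g hg) where
  toFun := F
  isPlot O φ hφ := fun ψ => by
    have h2 : ContMDiff (M' := M) 𝓘(ℝ, Fin (opn (cyl O)).dim → ℝ) I ∞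
        fun z : ψ.source => φ (cylBase (ψ.lift z)) :=
      (DiffSpace.ofManifold I M).comp_submersion hφ (isSubmersion_cylBase O) ψ
    exact hF.comp ((contMDiff_cylTime O ψ).prodMk h2)
  left := h0
  right := h1

/-- Maps which agree on a neighborhood of the support of a chain. -/
lemma push_eq_of_eqOn {f g : SmoothHom (DiffSpace.ofManifold I M) (DiffSpace.ofManifold I M)}
    {S N : Set M} (hN : IsOpen N) (hSN : S ⊆ N) (h : ∀ x ∈ N, f.toFun x = g.toFun x) {k : ℕ}
    {c : Chains (DiffSpace.ofManifold I M) k} (hc : c ∈ mSupp I k S) :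
    push f k c = push g k c := by
  refine suppChains_induction (P := fun c => push f k c = push g k c) ?_ ?_ ?_ ?_ hc
  · rw [map_zero, map_zero]
  · intro a b ha hb; rw [map_add, map_add, ha, hb]
  · intro r a ha; rw [map_smul, map_smul, ha]
  · rintro m j O φ hφ hj η ⟨K, hK, hKO, hz, hS⟩
    rw [push_eucl, push_eucl]
    refine eucl_germ (N := ⟨Subtype.val '' ((fun x : O => φ ⟨x.1, x.2⟩) ⁻¹' N),
      O.isOpen.isOpenMap_subtype_val _ (hN.preimage (continuous_plot hφ))⟩) ?_ _ _ hj η ?_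
      ⟨K, hK, fun x hx => ?_, hz⟩
    · rintro _ ⟨x, -, rfl⟩
      exact x.2
    · rintro p ⟨x, hx, hxp⟩
      have : p = ⟨x.1, x.2⟩ := Subtype.ext hxp.symm
      subst this
      exact h _ hx
    · exact ⟨⟨x, hKO hx⟩, hSN (hS ⟨x, hKO hx⟩ hx), rfl⟩

lemma ptChain_mem {x : M} {S : Set M} (hx : x ∈ S) :
    (ptChain x : Chains (DiffSpace.ofManifold I M) 0) ∈ mSupp I 0 S :=
  eucl_mem_suppChains _ _ ⟨univ, isCompact_univ, fun _ _ => trivial,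
    fun _ h => absurd (mem_univ _) h, fun _ _ => hx⟩

end Acyclic

lemma ChartConvex.exists_boundary {E : Type*} [NormedAddCommGroup E] [NormedSpace ℝ E]
    [FiniteDimensional ℝ E] {M : Type u} [TopologicalSpace M] [ChartedSpace E M]
    [IsManifold 𝓘(ℝ, E) ∞ M] [T2Space M] [NormalSpace M] [SigmaCompactSpace M]
    {e : OpenPartialHomeomorph M E} (he : e ∈ IsManifold.maximalAtlas 𝓘(ℝ, E) ∞ M) {U : Set M}
    (hU : ChartConvex e U) {p : M} (hp : p ∈ U) {k : ℕ}
    {c : Chains (DiffSpace.ofManifold 𝓘(ℝ, E) M) k} (hcU : c ∈ mSupp 𝓘(ℝ, E) k U)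
    (hc : IsCycle c) : ∃ b ∈ mSupp 𝓘(ℝ, E) (k + 1) U, boundary _ k b = c := by
  classical
  obtain ⟨S, hS, hSU, hcS⟩ := exists_compact_suppChains hcU
  obtain ⟨χ, hχ, hχ01, ⟨N, hN, hSN, hN1⟩, C, hC, hCU, hC0⟩ :=
    exists_cutoff 𝓘(ℝ, E) hS.isClosed hU.isOpen hSU
  let F : ℝ → M → M := fun s x =>
    if x ∈ U then chartSegment e p (Real.smoothTransition s * χ x) x else x
  have hmem : ∀ s x, Real.smoothTransition s * χ x ∈ Icc (0 : ℝ) 1 := fun s x =>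
    ⟨mul_nonneg (Real.smoothTransition.nonneg s) (hχ01 x).1,
      mul_le_one₀ (Real.smoothTransition.le_one s) (hχ01 x).1 (hχ01 x).2⟩
  have hFC : ∀ s, ∀ x ∉ C, F s x = x := fun s x hx => by
    by_cases hxU : x ∈ U
    · simp only [F, if_pos hxU, hC0 x hx, mul_zero, hU.segment_zero p hxU]
    · exact if_neg hxU
  have hF : ContMDiff (𝓘(ℝ, ℝ).prod 𝓘(ℝ, E)) 𝓘(ℝ, E) ∞ fun z : ℝ × M => F z.1 z.2 := by
    intro z
    by_cases hz : z.2 ∈ U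
    · have h1 : ContMDiffAt (𝓘(ℝ, ℝ).prod 𝓘(ℝ, E)) 𝓘(ℝ, ℝ) ∞
          (fun z : ℝ × M => Real.smoothTransition z.1 * χ z.2) z :=
        ((Real.smoothTransition.contDiff (n := ⊤)).contMDiff.comp contMDiff_fst).mul
          (hχ.comp contMDiff_snd) z
      refine (hU.contMDiffAt_segment he hp h1 contMDiffAt_snd hz (hmem _ _)).congr_of_eventuallyEq ?_
      filter_upwards [(hU.isOpen.preimage continuous_snd).mem_nhds hz] with w hw
      exact if_pos hw
    · refine contMDiffAt_snd.congr_of_eventuallyEq ?_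
      filter_upwards [(hC.isOpen_compl.preimage continuous_snd).mem_nhds fun h => hz (hCU h)]
        with w hw using hFC _ _ hw
  have hg : ContMDiff 𝓘(ℝ, E) 𝓘(ℝ, E) ∞ (F 1) :=
    hF.comp (contMDiff_const.prodMk contMDiff_id)
  let h := homotopyOfContMDiff F hF hg (fun s hs x => by
    by_cases hxU : x ∈ U
    · simp only [F, if_pos hxU, Real.smoothTransition.zero_of_nonpos hs, zero_mul,
        hU.segment_zero p hxU]
    · exact if_neg hxU) (fun s hs x => by
      simp only [F, Real.smoothTransition.one_of_one_le hs,
        Real.smoothTransition.one_of_one_le le_rfl])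
  obtain ⟨q, hq⟩ : ∃ q : (DiffSpace.ofManifold 𝓘(ℝ, E) M).carrier, q = p := ⟨p, rfl⟩
  have hgc : push (homOfContMDiff (F 1) hg) k c = push (constHom _ q) k c :=
    push_eq_of_eqOn (hN.inter hU.isOpen) (subset_inter hSN hSU) (fun x hx => by
      refine Eq.trans ?_ hq.symm
      change F 1 x = p
      simp only [F, if_pos hx.2, Real.smoothTransition.one_of_one_le le_rfl, hN1 x hx.1, mul_one,
        hU.segment_one hp]) hcS
  have hmaps : ∀ s, ∀ x ∈ U, F s x ∈ U := fun s x hx => by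
    simp only [F, if_pos hx]
    exact hU.segment_mem hp hx (hmem _ _)
  have hb : h.chain k c ∈ mSupp 𝓘(ℝ, E) (k + 1) U := h.chain_mem_suppChains hmaps hcU
  cases k with
  | zero =>
    have hc' : aug _ c = 0 := hc
    refine ⟨_, hb, ?_⟩
    rw [h.boundary_chain_zero, push_id, hgc, push_constHom_zero, hc', zero_smul, sub_zero]
  | succ k =>
    have hc' : boundary _ k c = 0 := hc
    refine ⟨(-1 : ℝ) ^ (k + 1) • h.chain (k + 1) c, Submodule.smul_mem _ _ hb, ?_⟩
    rw [map_smul, h.boundary_chain, push_id, hgc, push_constHom, hc', map_zero, zero_add, sub_zero,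
      smul_smul, ← mul_pow]
    simp

/-! ### Complexes of chains with supports -/

/-- A chain complex whose elements have supports in a topological space, such that chains are
homologous to sums of small chains. -/
structure LocalComplex (M : Type u) [TopologicalSpace M] where
  C : ℕ → Type u
  addCommGroup : ∀ k, AddCommGroup (C k)
  module : ∀ k, Module ℝ (C k)
  d : ∀ k, C (k + 1) →ₗ[ℝ] C k
  d_d : ∀ k x, d k (d (k + 1) x) = 0
  supp : ∀ k, Set M → Submodule ℝ (C k)
  supp_mono : ∀ k {U V : Set M}, U ⊆ V → supp k U ≤ supp k V
  supp_empty : ∀ k, supp k ∅ = ⊥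
  d_mem : ∀ k (U : Set M), ∀ x ∈ supp (k + 1) U, d k x ∈ supp k U
  inter : ∀ k {U V : Set M}, IsOpen U → IsOpen V → supp k U ⊓ supp k V ≤ supp k (U ∩ V)
  small_zero : ∀ {U V : Set M}, IsOpen U → IsOpen V → ∀ x ∈ supp 0 (U ∪ V),
    ∃ w ∈ supp 1 (U ∪ V), x - d 0 w ∈ supp 0 U ⊔ supp 0 V
  small_succ : ∀ k {U V : Set M}, IsOpen U → IsOpen V → ∀ x ∈ supp (k + 1) (U ∪ V),
    d k x ∈ supp k U ⊔ supp k V →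
      ∃ w ∈ supp (k + 2) (U ∪ V), x - d (k + 1) w ∈ supp (k + 1) U ⊔ supp (k + 1) V
  directed : ∀ k {ι : Type u} [Nonempty ι] (U : ι → Set M), (∀ i, IsOpen (U i)) →
    Directed (· ⊆ ·) U → ∀ x ∈ supp k (⋃ i, U i), ∃ i, x ∈ supp k (U i)

namespace LocalComplex

attribute [instance] LocalComplex.addCommGroup LocalComplex.module

variable {M : Type u} [TopologicalSpace M] {K F G : LocalComplex M}

/-- Every cycle with support in `U` is a boundary of a chain with support in `U`. -/
structure Acyclic (K : LocalComplex M) (U : Set M) : Prop where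
  zero : ∀ x ∈ K.supp 0 U, ∃ w ∈ K.supp 1 U, K.d 0 w = x
  succ : ∀ k, ∀ x ∈ K.supp (k + 1) U, K.d k x = 0 → ∃ w ∈ K.supp (k + 2) U, K.d (k + 1) w = x

lemma acyclic_empty : K.Acyclic ∅ where
  zero x hx := by
    rw [K.supp_empty] at hx
    exact ⟨0, zero_mem _, by rw [map_zero, (Submodule.mem_bot ℝ).mp hx]⟩
  succ k x hx _ := by
    rw [K.supp_empty] at hx
    exact ⟨0, zero_mem _, by rw [map_zero, (Submodule.mem_bot ℝ).mp hx]⟩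

lemma Acyclic.union {U V : Set M} (hU : IsOpen U) (hV : IsOpen V) (aU : K.Acyclic U)
    (aV : K.Acyclic V) (aUV : K.Acyclic (U ∩ V)) : K.Acyclic (U ∪ V) := by
  have hUl : ∀ k, K.supp k U ≤ K.supp k (U ∪ V) := fun k => K.supp_mono k subset_union_left
  have hVl : ∀ k, K.supp k V ≤ K.supp k (U ∪ V) := fun k => K.supp_mono k subset_union_right
  refine ⟨fun x hx => ?_, fun k x hx hdx => ?_⟩
  · obtain ⟨w, hw, hxw⟩ := K.small_zero hU hV x hx
    obtain ⟨a, ha, b, hb, hab⟩ := Submodule.mem_sup.mp hxw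
    obtain ⟨a', ha', rfl⟩ := aU.zero a ha
    obtain ⟨b', hb', rfl⟩ := aV.zero b hb
    refine ⟨w + (a' + b'), add_mem hw (add_mem (hUl _ ha') (hVl _ hb')), ?_⟩
    rw [map_add, map_add, hab, add_sub_cancel]
  · obtain ⟨w, hw, hxw⟩ := K.small_succ k hU hV x hx (by rw [hdx]; exact zero_mem _)
    obtain ⟨a, ha, b, hb, hab⟩ := Submodule.mem_sup.mp hxw
    have hdab : K.d k a + K.d k b = 0 := by
      rw [← map_add, hab, map_sub, hdx, K.d_d, sub_zero]
    have hda : K.d k a ∈ K.supp k (U ∩ V) := K.inter k hU hV ⟨K.d_mem k U a ha, by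
      rw [eq_neg_of_add_eq_zero_left hdab]
      exact neg_mem (K.d_mem k V b hb)⟩
    obtain ⟨c, hc, hdc⟩ : ∃ c ∈ K.supp (k + 1) (U ∩ V), K.d k c = K.d k a := by
      cases k with
      | zero => exact aUV.zero _ hda
      | succ k => exact aUV.succ k _ hda (K.d_d k a)
    obtain ⟨a', ha', hda'⟩ := aU.succ k (a - c)
      (sub_mem ha (K.supp_mono _ inter_subset_left hc)) (by rw [map_sub, hdc, sub_self])
    obtain ⟨b', hb', hdb'⟩ := aV.succ k (b + c)
      (add_mem hb (K.supp_mono _ inter_subset_right hc)) (by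
        rw [map_add, hdc, add_comm, hdab])
    refine ⟨w + (a' + b'), add_mem hw (add_mem (hUl _ ha') (hVl _ hb')), ?_⟩
    rw [map_add, map_add, hda', hdb', sub_add_add_cancel, hab, add_sub_cancel]

lemma Acyclic.directed {ι : Type u} [Nonempty ι] (U : ι → Set M) (hU : ∀ i, IsOpen (U i))
    (hd : Directed (· ⊆ ·) U) (a : ∀ i, K.Acyclic (U i)) : K.Acyclic (⋃ i, U i) := by
  refine ⟨fun x hx => ?_, fun k x hx hdx => ?_⟩
  · obtain ⟨i, hi⟩ := K.directed 0 U hU hd x hx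
    obtain ⟨w, hw, h⟩ := (a i).zero x hi
    exact ⟨w, K.supp_mono _ (subset_iUnion U i) hw, h⟩
  · obtain ⟨i, hi⟩ := K.directed _ U hU hd x hx
    obtain ⟨w, hw, h⟩ := (a i).succ k x hi hdx
    exact ⟨w, K.supp_mono _ (subset_iUnion U i) hw, h⟩

lemma Acyclic.iUnion_fin {B : Set M → Prop} (hB : ∀ U, B U → IsOpen U)
    (hBi : ∀ U V, B U → B V → B (U ∩ V)) (a : ∀ U, B U → K.Acyclic U) (n : ℕ) :
    ∀ U : Fin n → Set M, (∀ i, B (U i)) → K.Acyclic (⋃ i, U i) := by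
  induction n with
  | zero =>
    intro U _
    rw [iUnion_of_empty]
    exact acyclic_empty
  | succ n ih =>
    intro U hU
    have h1 : ⋃ i, U i = U 0 ∪ ⋃ i : Fin n, U i.succ := by
      ext x
      simp [Fin.exists_fin_succ]
    rw [h1]
    refine Acyclic.union (hB _ (hU 0)) (isOpen_iUnion fun i => hB _ (hU _)) (a _ (hU 0))
      (ih _ fun i => hU _) ?_
    rw [inter_iUnion]
    exact ih _ fun i => hBi _ _ (hU 0) (hU _)

lemma Acyclic.sUnion {B : Set M → Prop} (hB : ∀ U, B U → IsOpen U)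
    (hBi : ∀ U V, B U → B V → B (U ∩ V)) (a : ∀ U, B U → K.Acyclic U) (S : Set (Set M))
    (hS : ∀ U ∈ S, B U) : K.Acyclic (⋃₀ S) := by
  classical
  have h1 : ⋃₀ S = ⋃ t : Finset S, ⋃ i : Fin t.card, (t.equivFin.symm i : Set M) := by
    ext x
    simp only [mem_sUnion, mem_iUnion]
    constructor
    · rintro ⟨U, hU, hx⟩
      exact ⟨{⟨U, hU⟩}, Finset.equivFin _ ⟨⟨U, hU⟩, Finset.mem_singleton_self _⟩, by simpa using hx⟩
    · rintro ⟨t, i, hx⟩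
      exact ⟨_, (t.equivFin.symm i).1.2, hx⟩
  rw [h1]
  refine Acyclic.directed _ (fun t => isOpen_iUnion fun i => hB _ (hS _ (t.equivFin.symm i).1.2))
    ?_ fun t => Acyclic.iUnion_fin hB hBi a _ _ fun i => hS _ (t.equivFin.symm i).1.2
  refine Monotone.directed_le fun t t' htt => ?_
  refine iUnion_subset fun i => ?_
  refine subset_iUnion_of_subset (t'.equivFin ⟨_, htt (t.equivFin.symm i).2⟩) ?_
  simp

/-- Chain maps which preserve supports. -/
structure Hom (F G : LocalComplex M) where
  f : ∀ k, F.C k →ₗ[ℝ] G.C k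
  comm : ∀ k x, G.d k (f (k + 1) x) = f k (F.d k x)
  mem : ∀ k (U : Set M), ∀ x ∈ F.supp k U, f k x ∈ G.supp k U

/-- The chains of the mapping cone. -/
def ConeC (F G : LocalComplex M) : ℕ → Type u
  | 0 => G.C 0
  | k + 1 => F.C k × G.C (k + 1)

instance : ∀ k, AddCommGroup (ConeC F G k)
  | 0 => inferInstanceAs (AddCommGroup (G.C 0))
  | k + 1 => inferInstanceAs (AddCommGroup (F.C k × G.C (k + 1)))

instance : ∀ k, Module ℝ (ConeC F G k)
  | 0 => inferInstanceAs (Module ℝ (G.C 0))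
  | k + 1 => inferInstanceAs (Module ℝ (F.C k × G.C (k + 1)))

/-- The differential `(x, y) ↦ (dx, f x - dy)` of the mapping cone. -/
def coneD (f : Hom F G) : ∀ k, ConeC F G (k + 1) →ₗ[ℝ] ConeC F G k
  | 0 => (f.f 0).comp (LinearMap.fst ℝ (F.C 0) (G.C 1)) -
      (G.d 0).comp (LinearMap.snd ℝ (F.C 0) (G.C 1))
  | k + 1 => ((F.d k).comp (LinearMap.fst ℝ (F.C (k + 1)) (G.C (k + 2)))).prod
      ((f.f (k + 1)).comp (LinearMap.fst ℝ (F.C (k + 1)) (G.C (k + 2))) -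
        (G.d (k + 1)).comp (LinearMap.snd ℝ (F.C (k + 1)) (G.C (k + 2))))

/-- The elements of the mapping cone with supports in `U`. -/
def coneSupp (F G : LocalComplex M) : ∀ k, Set M → Submodule ℝ (ConeC F G k)
  | 0, U => G.supp 0 U
  | k + 1, U => show Submodule ℝ (F.C k × G.C (k + 1)) from (F.supp k U).prod (G.supp (k + 1) U)

lemma small_pair {k : ℕ} {U V : Set M} {x : F.C k} {y : G.C (k + 1)}
    (hx : x ∈ F.supp k U ⊔ F.supp k V) (hy : y ∈ G.supp (k + 1) U ⊔ G.supp (k + 1) V) :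
    (show ConeC F G (k + 1) from (x, y)) ∈ coneSupp F G (k + 1) U ⊔ coneSupp F G (k + 1) V := by
  obtain ⟨a, ha, b, hb, rfl⟩ := Submodule.mem_sup.mp hx
  obtain ⟨a', ha', b', hb', rfl⟩ := Submodule.mem_sup.mp hy
  exact Submodule.mem_sup.mpr ⟨show ConeC F G (k + 1) from (a, a'), ⟨ha, ha'⟩,
    show ConeC F G (k + 1) from (b, b'), ⟨hb, hb'⟩, rfl⟩

lemma small_fst {k : ℕ} {U V : Set M} {z : ConeC F G (k + 1)}
    (h : z ∈ coneSupp F G (k + 1) U ⊔ coneSupp F G (k + 1) V) :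
    z.1 ∈ F.supp k U ⊔ F.supp k V ∧ z.2 ∈ G.supp (k + 1) U ⊔ G.supp (k + 1) V := by
  obtain ⟨a, ha, b, hb, hab⟩ := Submodule.mem_sup.mp h
  subst hab
  exact ⟨Submodule.mem_sup.mpr ⟨a.1, ha.1, b.1, hb.1, rfl⟩,
    Submodule.mem_sup.mpr ⟨a.2, ha.2, b.2, hb.2, rfl⟩⟩

lemma Hom.small (f : Hom F G) {k : ℕ} {U V : Set M} {x : F.C k}
    (hx : x ∈ F.supp k U ⊔ F.supp k V) : f.f k x ∈ G.supp k U ⊔ G.supp k V := by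
  obtain ⟨a, ha, b, hb, rfl⟩ := Submodule.mem_sup.mp hx
  rw [map_add]
  exact Submodule.mem_sup.mpr ⟨_, f.mem k U a ha, _, f.mem k V b hb, rfl⟩

lemma Hom.cone_small (f : Hom F G) {k : ℕ} {U V : Set M} (hU : IsOpen U) (hV : IsOpen V)
    {x : F.C k} {y : G.C (k + 1)} (hy : y ∈ G.supp (k + 1) (U ∪ V))
    (hd : f.f k x - G.d k y ∈ G.supp k U ⊔ G.supp k V) {w : F.C (k + 1)}
    (hw : w ∈ F.supp (k + 1) (U ∪ V)) (hxw : x - F.d k w ∈ F.supp k U ⊔ F.supp k V) :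
    ∃ z ∈ coneSupp F G (k + 2) (U ∪ V), (show ConeC F G (k + 1) from (x, y)) - coneD f (k + 1) z ∈
      coneSupp F G (k + 1) U ⊔ coneSupp F G (k + 1) V := by
  have h1 : G.d k (y - f.f (k + 1) w) ∈ G.supp k U ⊔ G.supp k V := by
    have : G.d k (y - f.f (k + 1) w) = f.f k (x - F.d k w) - (f.f k x - G.d k y) := by
      rw [map_sub, map_sub, f.comm]; abel
    rw [this]
    exact sub_mem (f.small hxw) hd
  obtain ⟨v, hv, hyv⟩ := G.small_succ k hU hV _ (sub_mem hy (f.mem _ _ _ hw)) h1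
  refine ⟨((w, -v) : F.C (k + 1) × G.C (k + 2)), ⟨hw, neg_mem hv⟩, ?_⟩
  have h2 : (show ConeC F G (k + 1) from (x, y)) - coneD f (k + 1) ((w, -v) : F.C (k + 1) × G.C (k + 2)) =
      ((x - F.d k w, y - f.f (k + 1) w - G.d (k + 1) v) : F.C k × G.C (k + 1)) := by
    change ((x - F.d k w, y - (f.f (k + 1) w - G.d (k + 1) (-v))) : F.C k × G.C (k + 1)) = _
    rw [map_neg]
    congr 1
    abel
  rw [h2]
  exact small_pair hxw hyv

/-- The mapping cone. -/
def cone (f : Hom F G) : LocalComplex M where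
  C := ConeC F G
  addCommGroup := inferInstance
  module := inferInstance
  d := coneD f
  d_d k z := by
    cases k with
    | zero =>
      change f.f 0 (F.d 0 z.1) - G.d 0 (f.f 1 z.1 - G.d 1 z.2) = 0
      rw [map_sub, f.comm, G.d_d, sub_zero, sub_self]
    | succ k =>
      refine Prod.ext (F.d_d k z.1) ?_
      change f.f (k + 1) (F.d (k + 1) z.1) - G.d (k + 1) (f.f (k + 2) z.1 - G.d (k + 2) z.2) = 0
      rw [map_sub, f.comm, G.d_d, sub_zero, sub_self]
  supp := coneSupp F G
  supp_mono k U V h := by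
    cases k with
    | zero => exact G.supp_mono 0 h
    | succ k => exact Submodule.prod_mono (F.supp_mono k h) (G.supp_mono _ h)
  supp_empty k := by
    cases k with
    | zero => exact G.supp_empty 0
    | succ k =>
      change (F.supp k ∅).prod (G.supp (k + 1) ∅) = ⊥
      rw [F.supp_empty, G.supp_empty, Submodule.prod_bot]
  d_mem k U z hz := by
    cases k with
    | zero => exact sub_mem (f.mem _ _ _ hz.1) (G.d_mem _ _ _ hz.2)
    | succ k =>
      exact ⟨F.d_mem _ _ _ hz.1, sub_mem (f.mem _ _ _ hz.1) (G.d_mem _ _ _ hz.2)⟩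
  inter k U V hU hV := by
    cases k with
    | zero => exact G.inter 0 hU hV
    | succ k => exact fun z hz => ⟨F.inter k hU hV ⟨hz.1.1, hz.2.1⟩, G.inter _ hU hV ⟨hz.1.2, hz.2.2⟩⟩
  small_zero hU hV y hy := by
    obtain ⟨w, hw, h⟩ := G.small_zero hU hV y hy
    refine ⟨((0, -w) : F.C 0 × G.C 1), ⟨zero_mem _, neg_mem hw⟩, ?_⟩
    have : coneD f 0 ((0, -w) : F.C 0 × G.C 1) = G.d 0 w := by
      change f.f 0 0 - G.d 0 (-w) = _
      rw [map_zero, map_neg, zero_sub, neg_neg]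
    rw [this]
    exact h
  small_succ k {U V} hU hV z hz hdz := by
    cases k with
    | zero =>
      obtain ⟨w, hw, hxw⟩ := F.small_zero hU hV z.1 hz.1
      exact f.cone_small hU hV hz.2 hdz hw hxw
    | succ k =>
      have h := small_fst hdz
      obtain ⟨w, hw, hxw⟩ := F.small_succ k hU hV z.1 hz.1 h.1
      exact f.cone_small hU hV hz.2 h.2 hw hxw
  directed k ι _ U hU hd z hz := by
    cases k with
    | zero => exact G.directed 0 U hU hd z hz
    | succ k =>
      obtain ⟨i, hi⟩ := F.directed k U hU hd _ hz.1
      obtain ⟨j, hj⟩ := G.directed _ U hU hd _ hz.2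
      obtain ⟨l, hil, hjl⟩ := hd i j
      exact ⟨l, F.supp_mono _ hil hi, G.supp_mono _ hjl hj⟩

/-- The homology of the chains with supports in `U` is that of a point. -/
structure AugAcyclic (F : LocalComplex M) (ε : F.C 0 →ₗ[ℝ] ℝ) (U : Set M) : Prop where
  point : ∃ x ∈ F.supp 0 U, ε x = 1
  zero : ∀ x ∈ F.supp 0 U, ε x = 0 → ∃ w ∈ F.supp 1 U, F.d 0 w = x
  succ : ∀ k, ∀ x ∈ F.supp (k + 1) U, F.d k x = 0 → ∃ w ∈ F.supp (k + 2) U, F.d (k + 1) w = x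

lemma AugAcyclic.cone (f : Hom F G) {εF : F.C 0 →ₗ[ℝ] ℝ} {εG : G.C 0 →ₗ[ℝ] ℝ}
    (hε : ∀ x, εG (f.f 0 x) = εF x) (hd : ∀ y, εG (G.d 0 y) = 0) {U : Set M}
    (aF : F.AugAcyclic εF U) (aG : G.AugAcyclic εG U) : (cone f).Acyclic U := by
  have key : ∀ k (x : F.C k) (y : G.C (k + 1)), y ∈ G.supp (k + 1) U → f.f k x = G.d k y →
      ∀ w ∈ F.supp (k + 1) U, F.d k w = x →
        ∃ z ∈ coneSupp F G (k + 2) U, coneD f (k + 1) z = ((x, y) : F.C k × G.C (k + 1)) := by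
    intro k x y hy hxy w hw hwx
    obtain ⟨v, hv, hdv⟩ := aG.succ k (y - f.f (k + 1) w) (sub_mem hy (f.mem _ _ _ hw)) (by
      rw [map_sub, f.comm, hwx, hxy, sub_self])
    refine ⟨((w, -v) : F.C (k + 1) × G.C (k + 2)), ⟨hw, neg_mem hv⟩, ?_⟩
    change ((F.d k w, f.f (k + 1) w - G.d (k + 1) (-v)) : F.C k × G.C (k + 1)) = _
    rw [hwx, map_neg, hdv, sub_neg_eq_add, add_sub_cancel]
  refine ⟨fun (y : G.C 0) hy => ?_, fun k z hz hdz => ?_⟩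
  · obtain ⟨p, hp, hp1⟩ := aF.point
    obtain ⟨v, hv, hdv⟩ := aG.zero (y - εG y • f.f 0 p)
      (sub_mem hy (Submodule.smul_mem _ _ (f.mem _ _ _ hp))) (by
        rw [map_sub, map_smul, hε, hp1, smul_eq_mul, mul_one, sub_self])
    refine ⟨((εG y • p, -v) : F.C 0 × G.C 1), ⟨Submodule.smul_mem _ _ hp, neg_mem hv⟩, ?_⟩
    change f.f 0 (εG y • p) - G.d 0 (-v) = y
    rw [map_neg, hdv, map_smul, sub_neg_eq_add, add_sub_cancel]
  · cases k with
    | zero =>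
      have h1 : f.f 0 z.1 - G.d 0 z.2 = 0 := hdz
      have h2 := sub_eq_zero.mp h1
      obtain ⟨w, hw, hwx⟩ := aF.zero z.1 hz.1 (by rw [← hε, h2, hd])
      exact key 0 z.1 z.2 hz.2 h2 w hw hwx
    | succ k =>
      have h1 : F.d k z.1 = 0 := congrArg Prod.fst hdz
      have h2 : f.f (k + 1) z.1 - G.d (k + 1) z.2 = 0 := congrArg Prod.snd hdz
      obtain ⟨w, hw, hwx⟩ := aF.succ k z.1 hz.1 h1
      exact key _ z.1 z.2 hz.2 (sub_eq_zero.mp h2) w hw hwx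

/-- A chain map with acyclic mapping cone is injective on homology. -/
lemma exists_of_map_eq (f : Hom F G) {U : Set M} (h : (cone f).Acyclic U) {k : ℕ} {x : F.C k}
    (hx : x ∈ F.supp k U) (hdx : ∀ l (hl : l + 1 = k), F.d l (hl ▸ x) = 0) {y : G.C (k + 1)}
    (hy : y ∈ G.supp (k + 1) U) (hxy : f.f k x = G.d k y) : ∃ w, F.d k w = x := by
  obtain ⟨z, -, hz⟩ := h.succ k ((x, y) : F.C k × G.C (k + 1)) ⟨hx, hy⟩ (by
    cases k with
    | zero => exact sub_eq_zero.mpr hxy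
    | succ k => exact Prod.ext (hdx k rfl) (sub_eq_zero.mpr hxy))
  exact ⟨z.1, congrArg Prod.fst hz⟩

/-- A chain map with acyclic mapping cone is surjective on homology. -/
lemma exists_map_add (f : Hom F G) {U : Set M} (h : (cone f).Acyclic U) {k : ℕ} {y : G.C k}
    (hy : y ∈ G.supp k U) (hdy : ∀ l (hl : l + 1 = k), G.d l (hl ▸ y) = 0) :
    ∃ (x : F.C k) (v : G.C (k + 1)), (∀ l (hl : l + 1 = k), F.d l (hl ▸ x) = 0) ∧
      y = f.f k x + G.d k v := by
  cases k with
  | zero =>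
    obtain ⟨z, -, hz⟩ := h.zero y hy
    have hz' : f.f 0 z.1 - G.d 0 z.2 = y := hz
    exact ⟨z.1, -z.2, fun l hl => absurd hl (Nat.succ_ne_zero l), by
      rw [map_neg, ← sub_eq_add_neg, hz']⟩
  | succ k =>
    obtain ⟨z, -, hz⟩ := h.succ k ((0, y) : F.C k × G.C (k + 1)) ⟨zero_mem _, hy⟩ (by
      cases k with
      | zero =>
        change f.f 0 0 - G.d 0 y = 0
        rw [hdy 0 rfl, map_zero, sub_zero]
      | succ k =>
        refine Prod.ext (map_zero (F.d k)) ?_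
        change f.f _ 0 - G.d _ y = 0
        rw [hdy _ rfl, map_zero, sub_zero])
    have h1 : F.d k z.1 = 0 := congrArg Prod.fst hz
    have h2 : f.f (k + 1) z.1 - G.d (k + 1) z.2 = y := congrArg Prod.snd hz
    refine ⟨z.1, -z.2, fun l hl => ?_, by rw [map_neg, ← sub_eq_add_neg, h2]⟩
    obtain rfl : l = k := Nat.succ.inj hl
    exact h1

end LocalComplex

/-! ### Ordered tuples and their subdivision -/

section Tuples

variable {V W : Type*}

/-- The formal linear combinations of `n`-tuples. -/
abbrev TupleChains (V : Type*) (n : ℕ) := (Fin n → V) →₀ ℝ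

/-- The alternating sum of the faces. -/
def tupleD (V : Type*) (n : ℕ) : TupleChains V (n + 1) →ₗ[ℝ] TupleChains V n :=
  Finsupp.linearCombination ℝ fun v => ∑ j : Fin (n + 1), (-1 : ℝ) ^ j.val •
    Finsupp.single (v ∘ j.succAbove) 1

lemma tupleD_single {n : ℕ} (v : Fin (n + 1) → V) : tupleD V n (Finsupp.single v 1) =
    ∑ j : Fin (n + 1), (-1 : ℝ) ^ j.val • Finsupp.single (v ∘ j.succAbove) 1 := by
  rw [tupleD, Finsupp.linearCombination_single, one_smul]

/-- The cone with apex `b`. -/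
def tupleCone (b : V) (n : ℕ) : TupleChains V n →ₗ[ℝ] TupleChains V (n + 1) :=
  Finsupp.linearCombination ℝ fun v => Finsupp.single (Fin.cons b v) 1

lemma tupleCone_single (b : V) {n : ℕ} (v : Fin n → V) :
    tupleCone b n (Finsupp.single v 1) = Finsupp.single (Fin.cons b v) 1 := by
  rw [tupleCone, Finsupp.linearCombination_single, one_smul]

lemma tupleChains_hom_ext {N : Type*} [AddCommGroup N] [Module ℝ N] {n : ℕ}
    {f g : TupleChains V n →ₗ[ℝ] N}
    (h : ∀ v, f (Finsupp.single v 1) = g (Finsupp.single v 1)) : f = g :=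
  Finsupp.lhom_ext' fun v => LinearMap.ext_ring (h v)

lemma tupleD_tupleCone_zero (b : V) (c : TupleChains V 0) : tupleD V 0 (tupleCone b 0 c) = c := by
  have h : (tupleD V 0).comp (tupleCone b 0) = LinearMap.id := by
    refine tupleChains_hom_ext fun v => ?_
    rw [LinearMap.comp_apply, tupleCone_single, tupleD_single, Fin.sum_univ_one, LinearMap.id_apply,
      Fin.val_zero, pow_zero, one_smul]
    exact congrArg (fun w => Finsupp.single w 1) (Subsingleton.elim _ _)
  exact congrArg (fun F => F c) h

lemma tupleD_tupleCone (b : V) (n : ℕ) (c : TupleChains V (n + 1)) :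
    tupleD V (n + 1) (tupleCone b (n + 1) c) = c - tupleCone b n (tupleD V n c) := by
  have h : (tupleD V (n + 1)).comp (tupleCone b (n + 1)) =
      LinearMap.id - (tupleCone b n).comp (tupleD V n) := by
    refine tupleChains_hom_ext fun v => ?_
    rw [LinearMap.comp_apply, tupleCone_single, tupleD_single, LinearMap.sub_apply,
      LinearMap.id_apply, LinearMap.comp_apply, tupleD_single, map_sum, Fin.sum_univ_succ,
      sub_eq_add_neg, ← Finset.sum_neg_distrib]
    congr 1
    · rw [Fin.val_zero, pow_zero, one_smul]
      rfl
    · refine Finset.sum_congr rfl fun j _ => ?_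
      rw [map_smul, tupleCone_single, Fin.val_succ, pow_succ, mul_neg, mul_one, neg_smul]
      congr 3
      funext i
      refine Fin.cases ?_ (fun i => ?_) i
      · simp
      · simp
  exact congrArg (fun F => F c) h

lemma tupleD_tupleD (n : ℕ) (c : TupleChains V (n + 2)) : tupleD V n (tupleD V (n + 1) c) = 0 := by
  induction n with
  | zero =>
    have h : (tupleD V 0).comp (tupleD V 1) = 0 := by
      refine tupleChains_hom_ext fun v => ?_
      have hv : Finsupp.single v (1 : ℝ) = tupleCone (v 0) 1 (Finsupp.single (Fin.tail v) 1) := by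
        rw [tupleCone_single, Fin.cons_self_tail]
      rw [LinearMap.comp_apply, hv, tupleD_tupleCone, map_sub, tupleD_tupleCone_zero, sub_self,
        LinearMap.zero_apply]
    exact congrArg (fun F => F c) h
  | succ n ih =>
    have h : (tupleD V (n + 1)).comp (tupleD V (n + 2)) = 0 := by
      refine tupleChains_hom_ext fun v => ?_
      have hv : Finsupp.single v (1 : ℝ) =
          tupleCone (v 0) (n + 2) (Finsupp.single (Fin.tail v) 1) := by
        rw [tupleCone_single, Fin.cons_self_tail]
      rw [LinearMap.comp_apply, hv, tupleD_tupleCone, map_sub, tupleD_tupleCone, ih, map_zero,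
        sub_zero, sub_self, LinearMap.zero_apply]
    exact congrArg (fun F => F c) h

/-- The map on chains induced by a map. -/
def tupleMap (f : V → W) (n : ℕ) : TupleChains V n →ₗ[ℝ] TupleChains W n :=
  Finsupp.linearCombination ℝ fun v => Finsupp.single (f ∘ v) 1

lemma tupleMap_single (f : V → W) {n : ℕ} (v : Fin n → V) :
    tupleMap f n (Finsupp.single v 1) = Finsupp.single (f ∘ v) 1 := by
  rw [tupleMap, Finsupp.linearCombination_single, one_smul]

lemma tupleMap_tupleD (f : V → W) (n : ℕ) (c : TupleChains V (n + 1)) :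
    tupleMap f n (tupleD V n c) = tupleD W n (tupleMap f (n + 1) c) := by
  have h : (tupleMap f n).comp (tupleD V n) = (tupleD W n).comp (tupleMap f (n + 1)) := by
    refine tupleChains_hom_ext fun v => ?_
    simp only [LinearMap.comp_apply, tupleD_single, map_sum, map_smul, tupleMap_single]
    rfl
  exact congrArg (fun F => F c) h

lemma tupleMap_tupleCone (f : V → W) (b : V) (n : ℕ) (c : TupleChains V n) :
    tupleMap f (n + 1) (tupleCone b n c) = tupleCone (f b) n (tupleMap f n c) := by
  have h : (tupleMap f (n + 1)).comp (tupleCone b n) = (tupleCone (f b) n).comp (tupleMap f n) := by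
    refine tupleChains_hom_ext fun v => ?_
    simp only [LinearMap.comp_apply, tupleMap_single, tupleCone_single]
    congr 1
    funext i
    refine Fin.cases ?_ (fun i => ?_) i <;> simp
  exact congrArg (fun F => F c) h

variable (β : ∀ n, (Fin (n + 1) → V) → V)

/-- The chain homotopy between the identity and the barycentric subdivision, where `β` are the
barycenters. -/
def tupleT : ∀ n, TupleChains V n →ₗ[ℝ] TupleChains V (n + 1)
  | 0 => 0
  | n + 1 => Finsupp.linearCombination ℝ fun v => tupleCone (β n v) (n + 1)
      (Finsupp.single v 1 - tupleT n (tupleD V n (Finsupp.single v 1)))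

lemma tupleT_single {n : ℕ} (v : Fin (n + 1) → V) : tupleT β (n + 1) (Finsupp.single v 1) =
    tupleCone (β n v) (n + 1) (Finsupp.single v 1 - tupleT β n (tupleD V n (Finsupp.single v 1))) := by
  rw [tupleT, Finsupp.linearCombination_single, one_smul]

/-- The barycentric subdivision. -/
def tupleSd (n : ℕ) : TupleChains V (n + 1) →ₗ[ℝ] TupleChains V (n + 1) :=
  LinearMap.id - (tupleD V (n + 1)).comp (tupleT β (n + 1)) - (tupleT β n).comp (tupleD V n)

lemma tupleSd_apply (n : ℕ) (c : TupleChains V (n + 1)) : tupleSd β n c =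
    c - tupleD V (n + 1) (tupleT β (n + 1) c) - tupleT β n (tupleD V n c) := rfl

lemma tupleSd_single_zero (v : Fin 1 → V) :
    tupleSd β 0 (Finsupp.single v 1) = Finsupp.single (fun _ => β 0 v) 1 := by
  rw [tupleSd_apply, tupleT_single, tupleD_tupleCone, map_sub]
  simp only [tupleT, LinearMap.zero_apply, map_zero, sub_zero, sub_sub_cancel]
  rw [tupleD_single, Fin.sum_univ_one, Fin.val_zero, pow_zero, one_smul, tupleCone_single]
  congr 1
  funext i
  obtain rfl : i = 0 := Fin.fin_one_eq_zero i
  rfl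

lemma tupleSd_single_succ {n : ℕ} (v : Fin (n + 2) → V) : tupleSd β (n + 1) (Finsupp.single v 1) =
    tupleCone (β (n + 1) v) (n + 1) (tupleSd β n (tupleD V (n + 1) (Finsupp.single v 1))) := by
  rw [tupleSd_apply, tupleT_single, tupleD_tupleCone, tupleSd_apply, tupleD_tupleD, map_zero,
    sub_zero, map_sub]
  abel

variable {β} {γ : ∀ n, (Fin (n + 1) → W) → W}

lemma tupleMap_tupleT {f : V → W} (hf : ∀ n v, f (β n v) = γ n (f ∘ v)) (n : ℕ)
    (c : TupleChains V n) : tupleMap f (n + 1) (tupleT β n c) = tupleT γ n (tupleMap f n c) := by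
  induction n with
  | zero => simp [tupleT]
  | succ n ih =>
    have h : (tupleMap f (n + 2)).comp (tupleT β (n + 1)) =
        (tupleT γ (n + 1)).comp (tupleMap f (n + 1)) := by
      refine tupleChains_hom_ext fun v => ?_
      rw [LinearMap.comp_apply, LinearMap.comp_apply, tupleMap_single, tupleT_single, tupleT_single,
        tupleMap_tupleCone, map_sub, ih, tupleMap_tupleD, tupleMap_single, hf]
    exact congrArg (fun F => F c) h

end Tuples

/-! ### Affine simplices -/

/-- The standard simplex with barycentric coordinates. -/
abbrev Simp (k : ℕ) := stdSimplex ℝ (Fin (k + 1))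

/-- The affine map of simplices with given images of the vertices. -/
def affMap {k l : ℕ} (w : Fin (k + 1) → Simp l) (s : Simp k) : Simp l :=
  ⟨∑ i, s i • (w i).1, (convex_stdSimplex ℝ _).sum_mem (fun i _ => s.2.1 i) s.2.2 fun i _ => (w i).2⟩

/-- The vertices of the standard simplex. -/
def vert (k : ℕ) (i : Fin (k + 1)) : Simp k := stdSimplex.vertex i

lemma affMap_coe {k l : ℕ} (w : Fin (k + 1) → Simp l) (s : Simp k) :
    (affMap w s).1 = ∑ i, s i • (w i).1 := rfl

lemma affMap_apply {k l : ℕ} (w : Fin (k + 1) → Simp l) (s : Simp k) (a : Fin (l + 1)) :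
    affMap w s a = ∑ i, s i * w i a := by
  change (∑ i, s i • (w i).1) a = _
  rw [Finset.sum_apply]
  rfl

lemma continuous_affMap {k l : ℕ} (w : Fin (k + 1) → Simp l) : Continuous (affMap w) :=
  Continuous.subtype_mk (continuous_finsetSum _ fun i _ =>
    ((continuous_apply i).comp continuous_subtype_val).smul continuous_const) _

lemma affMap_vert {k l : ℕ} (w : Fin (k + 1) → Simp l) (i : Fin (k + 1)) :
    affMap w (vert k i) = w i := by
  refine Subtype.ext ?_
  rw [affMap_coe, Finset.sum_eq_single i]
  · simp [vert]
  · intro j _ hj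
    simp [vert, Pi.single_eq_of_ne hj]
  · simp

lemma affMap_affMap {k l m : ℕ} (w : Fin (l + 1) → Simp m) (v : Fin (k + 1) → Simp l)
    (s : Simp k) : affMap w (affMap v s) = affMap (affMap w ∘ v) s := by
  refine stdSimplex.ext (funext fun a => ?_)
  simp only [affMap_apply, Function.comp_apply, Finset.sum_mul, Finset.mul_sum]
  rw [Finset.sum_comm]
  simp only [mul_assoc]

lemma affMap_vert_self {k : ℕ} (s : Simp k) : affMap (vert k) s = s := by
  refine stdSimplex.ext (funext fun a => ?_)
  rw [affMap_apply, Finset.sum_eq_single a]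
  · simp [vert]
  · intro j _ hj
    simp [vert, Pi.single_eq_of_ne hj.symm]
  · simp

/-- The barycenter of a tuple. -/
def baryc {l : ℕ} (n : ℕ) (w : Fin (n + 1) → Simp l) : Simp l := affMap w stdSimplex.barycenter

lemma affMap_baryc {k l : ℕ} (w : Fin (k + 1) → Simp l) (n : ℕ) (v : Fin (n + 1) → Simp k) :
    affMap w (baryc n v) = baryc n (affMap w ∘ v) := affMap_affMap w v _

lemma baryc_coe {l n : ℕ} (w : Fin (n + 1) → Simp l) :
    (baryc n w).1 = ∑ i, ((n : ℝ) + 1)⁻¹ • (w i).1 := by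
  rw [baryc, affMap_coe]
  refine Finset.sum_congr rfl fun i _ => ?_
  congr 1
  change (Fintype.card (Fin (n + 1)) : ℝ)⁻¹ = _
  rw [Fintype.card_fin]
  push_cast
  rfl

lemma dist_baryc_le {l n : ℕ} (w : Fin (n + 1) → Simp l) {D : ℝ}
    (h : ∀ i j, dist (w i) (w j) ≤ D) (j : Fin (n + 1)) :
    dist (baryc n w) (w j) ≤ n / (n + 1) * D := by
  have hn : (n : ℝ) + 1 ≠ 0 := by positivity
  have h1 : (baryc n w).1 - (w j).1 = ∑ i, ((n : ℝ) + 1)⁻¹ • ((w i).1 - (w j).1) := by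
    simp only [smul_sub, Finset.sum_sub_distrib]
    rw [← baryc_coe, Finset.sum_const, Finset.card_univ, Fintype.card_fin, ← Nat.cast_smul_eq_nsmul ℝ,
      smul_smul]
    push_cast
    rw [mul_inv_cancel₀ hn, one_smul]
  rw [Subtype.dist_eq, dist_eq_norm, h1]
  refine (norm_sum_le _ _).trans ?_
  have h2 : ∀ i ∈ Finset.univ.erase j, ‖((n : ℝ) + 1)⁻¹ • ((w i).1 - (w j).1)‖ ≤
      ((n : ℝ) + 1)⁻¹ * D := fun i _ => by
    rw [norm_smul, Real.norm_of_nonneg (by positivity)]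
    refine mul_le_mul_of_nonneg_left ?_ (by positivity)
    rw [← dist_eq_norm, ← Subtype.dist_eq]
    exact h i j
  rw [← Finset.add_sum_erase _ _ (Finset.mem_univ j), sub_self, smul_zero, norm_zero, zero_add]
  refine (Finset.sum_le_sum h2).trans_eq ?_
  rw [Finset.sum_const, Finset.card_erase_of_mem (Finset.mem_univ j), Finset.card_univ,
    Fintype.card_fin, Nat.add_sub_cancel, nsmul_eq_mul]
  ring

lemma dist_affMap_le {l n : ℕ} (w : Fin (n + 1) → Simp l) {ε : ℝ}
    (h : ∀ i, dist (w i) (w 0) ≤ ε) (s : Simp n) : dist (affMap w s) (w 0) ≤ ε :=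
  (convex_closedBall (w 0).1 ε).sum_mem (fun i _ => s.2.1 i) s.2.2 fun i _ => h i

lemma supported_induction {α N : Type*} [AddCommGroup N] [Module ℝ N] {A : Set α}
    (f : (α →₀ ℝ) →ₗ[ℝ] N) (p : Submodule ℝ N) (h : ∀ a ∈ A, f (Finsupp.single a 1) ∈ p)
    {c : α →₀ ℝ} (hc : c ∈ Finsupp.supported ℝ ℝ A) : f c ∈ p := by
  rw [Finsupp.supported_eq_span_single] at hc
  have : Submodule.span ℝ ((fun i => Finsupp.single i (1 : ℝ)) '' A) ≤ p.comap f :=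
    Submodule.span_le.mpr (by rintro _ ⟨a, ha, rfl⟩; exact h a ha)
  exact this hc

/-- The tuples whose members have pairwise distances at most `D`. -/
def smallTuples (l n : ℕ) (D : ℝ) : Set (Fin n → Simp l) := {w | ∀ i j, dist (w i) (w j) ≤ D}

lemma tupleSd_single_mem (L : ℕ) {l : ℕ} {D : ℝ} (hD : 0 ≤ D) (n : ℕ) (hn : n ≤ L) :
    ∀ v ∈ smallTuples l (n + 1) D, tupleSd baryc n (Finsupp.single v 1) ∈
      Finsupp.supported ℝ ℝ {w : Fin (n + 1) → Simp l |
        (∀ i, (w i).1 ∈ convexHull ℝ (range fun j => (v j).1)) ∧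
          w ∈ smallTuples l (n + 1) (L / (L + 1) * D)} := by
  have hbar : ∀ {n : ℕ} (v : Fin (n + 1) → Simp l),
      (baryc n v).1 ∈ convexHull ℝ (range fun j => (v j).1) := fun v =>
    (convex_convexHull ℝ _).sum_mem (fun i _ => (stdSimplex.barycenter (𝕜 := ℝ)).2.1 i)
      (stdSimplex.barycenter (𝕜 := ℝ)).2.2 fun i _ =>
        subset_convexHull ℝ (range fun j => (v j).1) (mem_range_self i)
  induction n with
  | zero =>
    intro v hv
    rw [tupleSd_single_zero]
    refine Finsupp.single_mem_supported ℝ 1 ⟨fun i => hbar v, fun i j => ?_⟩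
    rw [dist_self]
    positivity
  | succ n ih =>
    intro v hv
    rw [tupleSd_single_succ, tupleD_single, map_sum, map_sum]
    refine Submodule.sum_mem _ fun j _ => ?_
    rw [map_smul, map_smul]
    refine Submodule.smul_mem _ _ ?_
    refine supported_induction (tupleCone (baryc (n + 1) v) (n + 1)) _ ?_
      (ih (by omega) (v ∘ j.succAbove) fun i i' => hv _ _)
    rintro w ⟨hw, hws⟩
    rw [tupleCone_single]
    have hw' : ∀ i, (w i).1 ∈ convexHull ℝ (range fun j => (v j).1) := fun i =>
      convexHull_mono (range_subset_iff.mpr fun i' =>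
        mem_range_self (f := fun j => (v j).1) (j.succAbove i')) (hw i)
    have hb : ∀ i, dist (baryc (n + 1) v) (w i) ≤ L / (L + 1) * D := fun i => by
      rw [dist_comm]
      have h1 : convexHull ℝ (range fun j => (v j).1) ⊆
          Metric.closedBall (baryc (n + 1) v).1 (L / (L + 1) * D) := by
        refine convexHull_min (range_subset_iff.mpr fun i' => ?_) (convex_closedBall _ _)
        rw [Metric.mem_closedBall, dist_comm]
        refine (dist_baryc_le v hv i').trans (mul_le_mul_of_nonneg_right ?_ hD)
        rw [div_le_div_iff₀ (by positivity) (by positivity)]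
        have : ((n + 1 : ℕ) : ℝ) ≤ L := by exact_mod_cast hn
        linarith
      exact h1 (hw' i)
    refine Finsupp.single_mem_supported ℝ 1 ⟨fun i => ?_, fun i i' => ?_⟩
    · refine Fin.cases ?_ (fun i => ?_) i
      · exact hbar v
      · exact hw' i
    · refine Fin.cases ?_ (fun i => ?_) i <;> refine Fin.cases ?_ (fun i' => ?_) i'
      · simp only [dist_self]
        positivity
      · exact hb i'
      · rw [dist_comm]
        exact hb i
      · exact hws i i'

lemma tupleSd_iterate_mem {l n : ℕ} {D : ℝ} (hD : 0 ≤ D) {c : TupleChains (Simp l) (n + 1)}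
    (hc : c ∈ Finsupp.supported ℝ ℝ (smallTuples l (n + 1) D)) (N : ℕ) :
    (tupleSd baryc n)^[N] c ∈
      Finsupp.supported ℝ ℝ (smallTuples l (n + 1) ((n / (n + 1)) ^ N * D)) := by
  induction N with
  | zero => simpa using hc
  | succ N ih =>
    rw [Function.iterate_succ_apply', pow_succ', mul_assoc]
    refine supported_induction (tupleSd baryc n) _ (fun v hv => ?_) ih
    exact Finsupp.supported_mono (fun w hw => hw.2)
      (tupleSd_single_mem n (by positivity) n le_rfl v hv)

/-! ### Classes of simplices and small chains -/

/-- A class of continuous simplices of a topological space which is closed under composition with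
affine maps. -/
structure SimplexClass (X : Type u) [TopologicalSpace X] where
  mem : ∀ k, Set (Simp k → X)
  continuous : ∀ {k : ℕ} {σ : Simp k → X}, σ ∈ mem k → Continuous σ
  comp : ∀ {k l : ℕ} {σ : Simp l → X}, σ ∈ mem l → ∀ w : Fin (k + 1) → Simp l,
    σ ∘ affMap w ∈ mem k

namespace SimplexClass

variable {X : Type u} [TopologicalSpace X] (Q : SimplexClass X) {k l n : ℕ}

/-- The chains of simplices of the class. -/
abbrev Ch (k : ℕ) : Type u := Q.mem k →₀ ℝ

variable {Q} in
/-- The composition of a simplex with an affine map. -/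
def precomp (σ : Q.mem l) (w : Fin (k + 1) → Simp l) : Q.mem k := ⟨σ.1 ∘ affMap w, Q.comp σ.2 w⟩

variable {Q} in
/-- The image of a chain of affine simplices. -/
def sPush (σ : Q.mem l) (n : ℕ) : TupleChains (Simp l) (n + 1) →ₗ[ℝ] Q.Ch n :=
  Finsupp.linearCombination ℝ fun w => Finsupp.single (precomp σ w) 1

/-- The vertices of the standard simplex, as a chain. -/
def iota (k : ℕ) : TupleChains (Simp k) (k + 1) := Finsupp.single (vert k) 1

/-- The boundary operator. -/
def sD (n : ℕ) : Q.Ch (n + 1) →ₗ[ℝ] Q.Ch n :=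
  Finsupp.linearCombination ℝ fun σ => sPush σ n (tupleD _ (n + 1) (iota (n + 1)))

/-- The chain homotopy between the identity and the barycentric subdivision. -/
def sT (n : ℕ) : Q.Ch n →ₗ[ℝ] Q.Ch (n + 1) :=
  Finsupp.linearCombination ℝ fun σ => sPush σ (n + 1) (tupleT baryc (n + 1) (iota n))

/-- The barycentric subdivision. -/
def sSd (n : ℕ) : Q.Ch (n + 1) →ₗ[ℝ] Q.Ch (n + 1) :=
  LinearMap.id - (Q.sD (n + 1)).comp (Q.sT (n + 1)) - (Q.sT n).comp (Q.sD n)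

variable {Q}

lemma sSd_apply (c : Q.Ch (n + 1)) :
    Q.sSd n c = c - Q.sD (n + 1) (Q.sT (n + 1) c) - Q.sT n (Q.sD n c) := rfl

lemma sPush_single (σ : Q.mem l) (w : Fin (n + 1) → Simp l) :
    sPush σ n (Finsupp.single w 1) = Finsupp.single (precomp σ w) 1 := by
  rw [sPush, Finsupp.linearCombination_single, one_smul]

lemma sD_single (σ : Q.mem (n + 1)) :
    Q.sD n (Finsupp.single σ 1) = sPush σ n (tupleD _ (n + 1) (iota (n + 1))) := by
  rw [sD, Finsupp.linearCombination_single, one_smul]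

lemma sD_single_eq_sum (σ : Q.mem (n + 1)) : Q.sD n (Finsupp.single σ 1) =
    ∑ j : Fin (n + 2), (-1 : ℝ) ^ j.val •
      Finsupp.single (precomp σ (vert (n + 1) ∘ j.succAbove)) 1 := by
  simp only [sD_single, iota, tupleD_single, map_sum, map_smul, sPush_single]

lemma sT_single (σ : Q.mem n) :
    Q.sT n (Finsupp.single σ 1) = sPush σ (n + 1) (tupleT baryc (n + 1) (iota n)) := by
  rw [sT, Finsupp.linearCombination_single, one_smul]

lemma sPush_iota (σ : Q.mem n) : sPush σ n (iota n) = Finsupp.single σ 1 := by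
  rw [iota, sPush_single]
  congr 1
  exact Subtype.ext (funext fun s => congrArg σ.1 (affMap_vert_self s))

lemma sPush_precomp (σ : Q.mem l) (w : Fin (k + 1) → Simp l) (c : TupleChains (Simp k) (n + 1)) :
    sPush (precomp σ w) n c = sPush σ n (tupleMap (affMap w) (n + 1) c) := by
  have h : sPush (precomp σ w) n = (sPush σ n).comp (tupleMap (affMap w) (n + 1)) := by
    refine tupleChains_hom_ext fun v => ?_
    rw [LinearMap.comp_apply, tupleMap_single, sPush_single, sPush_single]
    congr 1
    exact Subtype.ext (funext fun s => congrArg σ.1 (affMap_affMap w v s))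
  exact congrArg (fun F => F c) h

lemma tupleMap_iota (w : Fin (k + 1) → Simp l) :
    tupleMap (affMap w) (k + 1) (iota k) = Finsupp.single w 1 := by
  rw [iota, tupleMap_single]
  congr 1
  exact funext fun i => affMap_vert w i

lemma sD_sPush (σ : Q.mem l) (c : TupleChains (Simp l) (n + 2)) :
    Q.sD n (sPush σ (n + 1) c) = sPush σ n (tupleD _ (n + 1) c) := by
  have h : (Q.sD n).comp (sPush σ (n + 1)) = (sPush σ n).comp (tupleD _ (n + 1)) := by
    refine tupleChains_hom_ext fun w => ?_
    rw [LinearMap.comp_apply, LinearMap.comp_apply, sPush_single, sD_single, sPush_precomp,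
      tupleMap_tupleD, tupleMap_iota]
  exact congrArg (fun F => F c) h

lemma sT_sPush (σ : Q.mem l) (c : TupleChains (Simp l) (n + 1)) :
    Q.sT n (sPush σ n c) = sPush σ (n + 1) (tupleT baryc (n + 1) c) := by
  have h : (Q.sT n).comp (sPush σ n) = (sPush σ (n + 1)).comp (tupleT baryc (n + 1)) := by
    refine tupleChains_hom_ext fun w => ?_
    rw [LinearMap.comp_apply, LinearMap.comp_apply, sPush_single, sT_single, sPush_precomp,
      tupleMap_tupleT (γ := baryc) (affMap_baryc w), tupleMap_iota]
  exact congrArg (fun F => F c) h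

lemma sSd_sPush (σ : Q.mem l) (c : TupleChains (Simp l) (n + 2)) :
    Q.sSd n (sPush σ (n + 1) c) = sPush σ (n + 1) (tupleSd baryc (n + 1) c) := by
  rw [sSd_apply, tupleSd_apply, sT_sPush, sD_sPush, sD_sPush, sT_sPush, map_sub, map_sub]

lemma sSd_iterate_single (σ : Q.mem (n + 1)) (N : ℕ) :
    (Q.sSd n)^[N] (Finsupp.single σ 1) =
      sPush σ (n + 1) ((tupleSd baryc (n + 1))^[N] (iota (n + 1))) := by
  induction N with
  | zero => exact (sPush_iota σ).symm
  | succ N ih => rw [Function.iterate_succ_apply', Function.iterate_succ_apply', ih, sSd_sPush]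

lemma sD_sD (n : ℕ) (c : Q.Ch (n + 2)) : Q.sD n (Q.sD (n + 1) c) = 0 := by
  have h : (Q.sD n).comp (Q.sD (n + 1)) = 0 := by
    refine Finsupp.lhom_ext' fun σ => LinearMap.ext_ring ?_
    rw [LinearMap.comp_apply, LinearMap.comp_apply, Finsupp.lsingle_apply, sD_single, sD_sPush,
      tupleD_tupleD, map_zero]
    rfl
  exact congrArg (fun F => F c) h

variable (Q) in
/-- The chains of simplices contained in `U`. -/
def sSupp (k : ℕ) (U : Set X) : Submodule ℝ (Q.Ch k) :=
  Finsupp.supported ℝ ℝ {σ : Q.mem k | ∀ s, σ.1 s ∈ U}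

lemma sPush_mem {σ : Q.mem l} {U : Set X} (c : TupleChains (Simp l) (n + 1))
    (hσ : ∀ s, σ.1 s ∈ U) : sPush σ n c ∈ Q.sSupp n U := by
  refine supported_induction (A := univ) (sPush σ n) _ (fun w _ => ?_) (by simp)
  rw [sPush_single]
  exact Finsupp.single_mem_supported ℝ 1 fun s => hσ _

lemma sD_mem {U : Set X} {c : Q.Ch (n + 1)} (hc : c ∈ Q.sSupp (n + 1) U) :
    Q.sD n c ∈ Q.sSupp n U := by
  refine supported_induction (Q.sD n) _ (fun σ hσ => ?_) hc
  rw [sD_single]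
  exact sPush_mem _ hσ

lemma sT_mem {U : Set X} {c : Q.Ch n} (hc : c ∈ Q.sSupp n U) : Q.sT n c ∈ Q.sSupp (n + 1) U := by
  refine supported_induction (Q.sT n) _ (fun σ hσ => ?_) hc
  rw [sT_single]
  exact sPush_mem _ hσ

lemma sSd_mem {U : Set X} {c : Q.Ch (n + 1)} (hc : c ∈ Q.sSupp (n + 1) U) :
    Q.sSd n c ∈ Q.sSupp (n + 1) U :=
  sub_mem (sub_mem hc (sD_mem (sT_mem hc))) (sT_mem (sD_mem hc))

lemma map_mem_sup {m : ℕ} (f : Q.Ch n →ₗ[ℝ] Q.Ch m)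
    (hf : ∀ U : Set X, ∀ c ∈ Q.sSupp n U, f c ∈ Q.sSupp m U) {U V : Set X} {c : Q.Ch n}
    (hc : c ∈ Q.sSupp n U ⊔ Q.sSupp n V) : f c ∈ Q.sSupp m U ⊔ Q.sSupp m V := by
  obtain ⟨a, ha, b, hb, rfl⟩ := Submodule.mem_sup.mp hc
  rw [map_add]
  exact Submodule.mem_sup.mpr ⟨_, hf U a ha, _, hf V b hb, rfl⟩

lemma exists_iterate_mem {U V : Set X} (hU : IsOpen U) (hV : IsOpen V) {c : Q.Ch (n + 1)}
    (hc : c ∈ Q.sSupp (n + 1) (U ∪ V)) :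
    ∃ N, ∀ m ≥ N, (Q.sSd n)^[m] c ∈ Q.sSupp (n + 1) U ⊔ Q.sSupp (n + 1) V := by
  have hadd : ∀ m (a b : Q.Ch (n + 1)), (Q.sSd n)^[m] (a + b) = (Q.sSd n)^[m] a + (Q.sSd n)^[m] b :=
    fun m => iterate_map_add (Q.sSd n) m
  have hsmul : ∀ m (r : ℝ) (a : Q.Ch (n + 1)), (Q.sSd n)^[m] (r • a) = r • (Q.sSd n)^[m] a := by
    intro m r a
    induction m with
    | zero => rfl
    | succ m ih => rw [Function.iterate_succ_apply', Function.iterate_succ_apply', ih, map_smul]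
  have hzero : ∀ m, (Q.sSd n)^[m] 0 = 0 := fun m => iterate_map_zero (Q.sSd n) m
  rw [sSupp, Finsupp.supported_eq_span_single] at hc
  refine Submodule.span_induction ?_ ⟨0, fun m _ => by rw [hzero]; exact zero_mem _⟩ ?_ ?_ hc
  · rintro _ ⟨σ, hσ, rfl⟩
    have hcont := Q.continuous σ.2
    obtain ⟨δ, hδ, hδc⟩ := lebesgue_number_lemma_of_metric (s := (univ : Set (Simp (n + 1))))
      (c := fun b : Bool => σ.1 ⁻¹' (bif b then U else V)) isCompact_univ
      (fun b => by cases b; exacts [hV.preimage hcont, hU.preimage hcont]) (fun s _ => by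
        rcases hσ s with h | h
        · exact mem_iUnion.mpr ⟨true, h⟩
        · exact mem_iUnion.mpr ⟨false, h⟩)
    set D := Metric.diam (univ : Set (Simp (n + 1)))
    have hι : iota (n + 1) ∈ Finsupp.supported ℝ ℝ (smallTuples (n + 1) (n + 2) D) :=
      Finsupp.single_mem_supported ℝ 1 fun i j =>
        Metric.dist_le_diam_of_mem isCompact_univ.isBounded (mem_univ _) (mem_univ _)
    have hr : (((n + 1 : ℕ) : ℝ) / ((n + 1 : ℕ) + 1)) < 1 := by
      rw [div_lt_one (by positivity)]; linarith
    have hlim := (tendsto_pow_atTop_nhds_zero_of_lt_one (by positivity) hr).mul_const D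
    rw [zero_mul] at hlim
    obtain ⟨N, hN⟩ := Filter.eventually_atTop.mp (hlim.eventually (gt_mem_nhds hδ))
    refine ⟨N, fun m hm => ?_⟩
    rw [sSd_iterate_single]
    refine supported_induction (sPush σ (n + 1)) _ (fun w hw => ?_)
      (tupleSd_iterate_mem Metric.diam_nonneg hι m)
    rw [sPush_single]
    obtain ⟨b, hb⟩ := hδc (w 0) (mem_univ _)
    have hball : ∀ s, affMap w s ∈ Metric.ball (w 0) δ := fun s =>
      (dist_affMap_le w (fun i => hw i 0) s).trans_lt (hN m hm)
    cases b with
    | true => exact Submodule.mem_sup_left (Finsupp.single_mem_supported ℝ 1 fun s => hb (hball s))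
    | false => exact Submodule.mem_sup_right (Finsupp.single_mem_supported ℝ 1 fun s => hb (hball s))
  · rintro a b - - ⟨N, hN⟩ ⟨N', hN'⟩
    exact ⟨max N N', fun m hm => by
      rw [hadd]
      exact add_mem (hN m ((le_max_left _ _).trans hm)) (hN' m ((le_max_right _ _).trans hm))⟩
  · rintro r a - ⟨N, hN⟩
    exact ⟨N, fun m hm => by rw [hsmul]; exact Submodule.smul_mem _ r (hN m hm)⟩

lemma exists_sub_iterate_mem {U V : Set X} (N : ℕ) {c : Q.Ch (n + 1)}
    (hc : c ∈ Q.sSupp (n + 1) (U ∪ V)) (hd : Q.sD n c ∈ Q.sSupp n U ⊔ Q.sSupp n V) :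
    ∃ w ∈ Q.sSupp (n + 2) (U ∪ V), c - Q.sD (n + 1) w - (Q.sSd n)^[N] c ∈
      Q.sSupp (n + 1) U ⊔ Q.sSupp (n + 1) V := by
  induction N generalizing c with
  | zero =>
    refine ⟨0, zero_mem _, ?_⟩
    rw [map_zero, sub_zero, Function.iterate_zero_apply, sub_self]
    exact zero_mem _
  | succ N ih =>
    have hT : Q.sT n (Q.sD n c) ∈ Q.sSupp (n + 1) U ⊔ Q.sSupp (n + 1) V :=
      map_mem_sup _ (fun _ _ => sT_mem) hd
    obtain ⟨w, hw, h⟩ := ih (sSd_mem hc) (by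
      rw [sSd_apply, map_sub, map_sub, sD_sD, sub_zero]
      exact sub_mem hd (map_mem_sup _ (fun _ _ => sD_mem) hT))
    refine ⟨Q.sT (n + 1) c + w, add_mem (sT_mem hc) hw, ?_⟩
    have h2 : c - Q.sD (n + 1) (Q.sT (n + 1) c + w) - (Q.sSd n)^[N + 1] c =
        (Q.sSd n c - Q.sD (n + 1) w - (Q.sSd n)^[N] (Q.sSd n c)) + Q.sT n (Q.sD n c) := by
      rw [Function.iterate_succ_apply, map_add]
      generalize (Q.sSd n)^[N] (Q.sSd n c) = y
      rw [sSd_apply]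
      abel
    rw [h2]
    exact add_mem h hT

variable (Q) in
/-- The chain complex of a class of simplices. -/
def localComplex : LocalComplex X where
  C k := Q.Ch k
  addCommGroup _ := inferInstance
  module _ := inferInstance
  d := Q.sD
  d_d := sD_sD
  supp := Q.sSupp
  supp_mono k U V h := Finsupp.supported_mono fun σ hσ s => h (hσ s)
  supp_empty k := by
    rw [sSupp, ← Finsupp.supported_empty]
    congr 1
    ext σ
    exact ⟨fun h => h (vert k 0), fun h => h.elim⟩
  d_mem k U x hx := sD_mem hx
  inter k U V _ _ := by
    rw [sSupp, sSupp, ← Finsupp.supported_inter]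
    exact Finsupp.supported_mono fun σ hσ s => ⟨hσ.1 s, hσ.2 s⟩
  small_zero {U V} _ _ x hx := by
    refine ⟨0, zero_mem _, ?_⟩
    rw [map_zero, sub_zero, sSupp, sSupp, ← Finsupp.supported_union]
    refine Finsupp.supported_mono (fun σ hσ => ?_) hx
    rcases hσ (vert 0 0) with h | h
    · exact Or.inl fun s => Subsingleton.elim (vert 0 0) s ▸ h
    · exact Or.inr fun s => Subsingleton.elim (vert 0 0) s ▸ h
  small_succ k {U V} hU hV x hx hdx := by
    obtain ⟨N, hN⟩ := exists_iterate_mem hU hV hx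
    obtain ⟨w, hw, h⟩ := exists_sub_iterate_mem N hx hdx
    exact ⟨w, hw, by simpa using add_mem h (hN N le_rfl)⟩
  directed k ι _ U hU hd x hx := by
    have hK : IsCompact (⋃ σ ∈ x.support, range σ.1) :=
      x.support.isCompact_biUnion fun σ _ => isCompact_range (Q.continuous σ.2)
    obtain ⟨i, hi⟩ := hK.elim_directed_cover U hU (iUnion₂_subset fun σ hσ => by
      rintro _ ⟨s, rfl⟩
      exact (Finsupp.mem_supported ℝ x).mp hx hσ s) hd
    exact ⟨i, (Finsupp.mem_supported ℝ x).mpr fun σ hσ s => hi (mem_biUnion hσ ⟨s, rfl⟩)⟩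

/-- The augmentation. -/
def sAug : Q.Ch 0 →ₗ[ℝ] ℝ := Finsupp.linearCombination ℝ fun _ => 1

end SimplexClass

/-! ### Cones of simplices -/

/-- The `j`-th face map of the standard simplex. -/
def sFace {k : ℕ} (j : Fin (k + 2)) : Simp k → Simp (k + 1) := affMap (vert (k + 1) ∘ j.succAbove)

lemma sFace_succAbove {k : ℕ} (j : Fin (k + 2)) (s : Simp k) (i : Fin (k + 1)) :
    sFace j s (j.succAbove i) = s i := by
  rw [sFace, affMap_apply, Finset.sum_eq_single i]
  · simp [vert]
  · intro i' _ hi'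
    have : j.succAbove i ≠ j.succAbove i' := fun h => hi' (Fin.succAbove_right_injective h).symm
    simp [vert, Pi.single_eq_of_ne this]
  · simp

lemma sFace_self {k : ℕ} (j : Fin (k + 2)) (s : Simp k) : sFace j s j = 0 := by
  rw [sFace, affMap_apply]
  refine Finset.sum_eq_zero fun i _ => ?_
  simp [vert]

/-- The projection from the last vertex to the opposite face, in coordinates. -/
def dropFun {k : ℕ} (s : Fin (k + 2) → ℝ) (i : Fin (k + 1)) : ℝ :=
  s i.castSucc / (1 - s (Fin.last (k + 1)))

lemma dropFun_mem {k : ℕ} (s : Simp (k + 1)) (h : 0 < 1 - s (Fin.last (k + 1))) :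
    dropFun s ∈ stdSimplex ℝ (Fin (k + 1)) := by
  refine ⟨fun i => div_nonneg (s.2.1 _) h.le, ?_⟩
  have h1 : ∑ i, s i = 1 := s.2.2
  rw [Fin.sum_univ_castSucc] at h1
  simp only [dropFun]
  rw [← Finset.sum_div, eq_sub_of_add_eq h1, div_self h.ne']

open Classical in
/-- The projection from the last vertex to the opposite face (with an irrelevant value at the last
vertex). -/
def dropLast {k : ℕ} (s : Simp (k + 1)) : Simp k :=
  if h : 0 < 1 - s (Fin.last (k + 1)) then ⟨dropFun s, dropFun_mem s h⟩ else vert k 0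

lemma dropLast_coe {k : ℕ} {s : Simp (k + 1)} (h : 0 < 1 - s (Fin.last (k + 1))) :
    (dropLast s).1 = dropFun s := by
  rw [dropLast, dif_pos h]

lemma sFace_last_last {k : ℕ} (s : Simp k) : 1 - sFace (Fin.last (k + 1)) s (Fin.last (k + 1)) = 1 := by
  rw [sFace_self, sub_zero]

lemma dropLast_sFace_last {k : ℕ} (s : Simp k) : dropLast (sFace (Fin.last (k + 1)) s) = s := by
  refine stdSimplex.ext (funext fun i => ?_)
  have h : 0 < 1 - sFace (Fin.last (k + 1)) s (Fin.last (k + 1)) := by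
    rw [sFace_last_last]; exact one_pos
  refine (congrFun (dropLast_coe h) i).trans ?_
  rw [dropFun, sFace_last_last, div_one, ← Fin.succAbove_last_apply, sFace_succAbove]

lemma sFace_castSucc_last {k : ℕ} (j : Fin (k + 2)) (s : Simp (k + 1)) :
    sFace j.castSucc s (Fin.last (k + 2)) = s (Fin.last (k + 1)) := by
  rw [← Fin.succAbove_ne_last_last (a := j.castSucc) (Fin.castSucc_lt_last j).ne, sFace_succAbove]

lemma dropLast_sFace_castSucc {k : ℕ} (j : Fin (k + 2)) (s : Simp (k + 1))
    (h : 0 < 1 - s (Fin.last (k + 1))) :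
    dropLast (sFace j.castSucc s) = sFace j (dropLast s) := by
  have h' : 0 < 1 - sFace j.castSucc s (Fin.last (k + 2)) := by rwa [sFace_castSucc_last]
  refine stdSimplex.ext (funext fun i => ?_)
  refine (congrFun (dropLast_coe h') i).trans ?_
  rw [dropFun, sFace_castSucc_last]
  rcases Fin.eq_self_or_eq_succAbove j i with rfl | ⟨i, rfl⟩
  · rw [sFace_self, sFace_self, zero_div]
  · rw [sFace_succAbove, ← Fin.castSucc_succAbove_castSucc, sFace_succAbove]
    exact (congrFun (dropLast_coe h) i).symm

section Cone

variable {E : Type*} [NormedAddCommGroup E] [NormedSpace ℝ E] {X : Type u} [TopologicalSpace X]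

/-- The parameter of a point of a cone on the segment to the apex. -/
def coneTime (r : ℝ) : ℝ := 1 - Real.smoothTransition (2 * (1 - r) - 1)

lemma coneTime_mem (r : ℝ) : coneTime r ∈ Icc (0 : ℝ) 1 :=
  ⟨sub_nonneg.mpr (Real.smoothTransition.le_one _),
    sub_le_self _ (Real.smoothTransition.nonneg _)⟩

lemma coneTime_of_half_le {r : ℝ} (hr : 1 / 2 ≤ r) : coneTime r = 1 := by
  rw [coneTime, Real.smoothTransition.zero_of_nonpos (by linarith), sub_zero]

lemma coneTime_zero : coneTime 0 = 0 := by
  rw [coneTime, Real.smoothTransition.one_of_one_le (by norm_num), sub_self]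

lemma contDiff_coneTime : ContDiff ℝ ∞ coneTime :=
  contDiff_const.sub ((Real.smoothTransition.contDiff (n := ⊤)).comp
    ((contDiff_const.mul (contDiff_const.sub contDiff_id)).sub contDiff_const))

/-- The cone of a simplex with apex `p` as last vertex, in the chart `e`. -/
def coneFun (e : OpenPartialHomeomorph X E) (p : X) {k : ℕ} (σ : Simp k → X) (s : Simp (k + 1)) :
    X :=
  chartSegment e p (coneTime (s (Fin.last (k + 1)))) (σ (dropLast s))

variable {e : OpenPartialHomeomorph X E} {U : Set X} {p : X} {k : ℕ}

lemma coneFun_mem (hU : ChartConvex e U) (hp : p ∈ U) {σ : Simp k → X} (hσ : ∀ s, σ s ∈ U)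
    (s : Simp (k + 1)) : coneFun e p σ s ∈ U :=
  hU.segment_mem hp (hσ _) (coneTime_mem _)

lemma coneFun_sFace_last (hU : ChartConvex e U) {σ : Simp k → X} (hσ : ∀ s, σ s ∈ U) :
    coneFun e p σ ∘ sFace (Fin.last (k + 1)) = σ := by
  funext s
  change chartSegment _ _ (coneTime (sFace (Fin.last (k + 1)) s (Fin.last (k + 1)))) _ = _
  rw [sFace_self, coneTime_zero, dropLast_sFace_last, hU.segment_zero p (hσ s)]

lemma coneFun_sFace_castSucc (hU : ChartConvex e U) (hp : p ∈ U) (σ : Simp (k + 1) → X)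
    (j : Fin (k + 2)) : coneFun e p σ ∘ sFace j.castSucc = coneFun e p (σ ∘ sFace j) := by
  funext s
  change chartSegment _ _ (coneTime (sFace j.castSucc s (Fin.last (k + 2)))) _ = chartSegment _ _ _ _
  rw [sFace_castSucc_last]
  by_cases h : 0 < 1 - s (Fin.last (k + 1))
  · rw [dropLast_sFace_castSucc j s h]
    rfl
  · rw [coneTime_of_half_le (by linarith), hU.segment_one hp, hU.segment_one hp]

lemma coneFun_sFace_zero (hU : ChartConvex e U) (hp : p ∈ U) (σ : Simp 0 → X) :
    coneFun e p σ ∘ sFace 0 = fun _ => p := by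
  funext s
  change chartSegment _ _ (coneTime (sFace 0 s (Fin.last 1))) _ = _
  have h : sFace 0 s (Fin.last 1) = 1 := by
    have h1 := sFace_succAbove (0 : Fin 2) s 0
    rw [Subsingleton.elim s (vert 0 0)] at h1 ⊢
    exact h1.trans (by simp [vert])
  rw [h, coneTime_of_half_le (by norm_num), hU.segment_one hp]

namespace SimplexClass

variable {Q : SimplexClass X}

variable (Q e p U) in
/-- The class is closed under forming cones of simplices in `U`. -/
structure ConeClosed : Prop where
  const : (fun _ => p) ∈ Q.mem 0
  cone : ∀ {k : ℕ} {σ : Simp k → X}, σ ∈ Q.mem k → (∀ s, σ s ∈ U) → coneFun e p σ ∈ Q.mem (k + 1)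

open Classical in
/-- The cone operator on chains in `U`. -/
def sCone (hQ : Q.ConeClosed e U p) (k : ℕ) : Q.Ch k →ₗ[ℝ] Q.Ch (k + 1) :=
  Finsupp.linearCombination ℝ fun σ => if h : ∀ s, σ.1 s ∈ U then
    Finsupp.single ⟨coneFun e p σ.1, hQ.cone σ.2 h⟩ 1 else 0

lemma sCone_single (hQ : Q.ConeClosed e U p) (σ : Q.mem k) (h : ∀ s, σ.1 s ∈ U) :
    sCone hQ k (Finsupp.single σ 1) = Finsupp.single ⟨coneFun e p σ.1, hQ.cone σ.2 h⟩ 1 := by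
  rw [sCone, Finsupp.linearCombination_single, one_smul, dif_pos h]

lemma sCone_mem (hQ : Q.ConeClosed e U p) (hU : ChartConvex e U) (hp : p ∈ U) {c : Q.Ch k}
    (hc : c ∈ Q.sSupp k U) : sCone hQ k c ∈ Q.sSupp (k + 1) U := by
  refine supported_induction (sCone hQ k) _ (fun σ hσ => ?_) hc
  rw [sCone_single hQ σ hσ]
  exact Finsupp.single_mem_supported ℝ 1 (coneFun_mem hU hp hσ)

lemma sAug_single (σ : Q.mem 0) : sAug (Finsupp.single σ 1) = 1 := by
  rw [sAug, Finsupp.linearCombination_single, one_smul]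

lemma sAug_sD (c : Q.Ch 1) : sAug (Q.sD 0 c) = 0 := by
  have h : sAug.comp (Q.sD 0) = 0 := by
    refine Finsupp.lhom_ext' fun σ => LinearMap.ext_ring ?_
    rw [LinearMap.comp_apply, LinearMap.comp_apply, Finsupp.lsingle_apply, sD_single_eq_sum,
      Fin.sum_univ_two]
    simp [sAug_single]
  exact congrArg (fun F => F c) h

lemma sD_sCone_zero (hQ : Q.ConeClosed e U p) (hU : ChartConvex e U) (hp : p ∈ U) {c : Q.Ch 0}
    (hc : c ∈ Q.sSupp 0 U) :
    Q.sD 0 (sCone hQ 0 c) = sAug c • Finsupp.single ⟨_, hQ.const⟩ 1 - c := by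
  have h := supported_induction (A := {σ : Q.mem 0 | ∀ s, σ.1 s ∈ U})
    ((Q.sD 0).comp (sCone hQ 0) - (sAug.smulRight (Finsupp.single ⟨_, hQ.const⟩ 1) - LinearMap.id))
    ⊥ (fun σ hσ => ?_) hc
  · exact sub_eq_zero.mp ((Submodule.mem_bot ℝ).mp h)
  · refine (Submodule.mem_bot ℝ).mpr (sub_eq_zero.mpr ?_)
    rw [LinearMap.comp_apply, sCone_single hQ σ hσ, sD_single_eq_sum, Fin.sum_univ_two,
      LinearMap.sub_apply, LinearMap.smulRight_apply, sAug_single, sub_eq_add_neg]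
    congr 1
    · rw [Fin.val_zero, pow_zero]
      congr 2
      exact Subtype.ext (coneFun_sFace_zero hU hp σ.1)
    · rw [Fin.val_one, pow_one, neg_smul, one_smul]
      congr 2
      exact Subtype.ext (coneFun_sFace_last hU hσ)

lemma sD_sCone (hQ : Q.ConeClosed e U p) (hU : ChartConvex e U) (hp : p ∈ U) {c : Q.Ch (k + 1)}
    (hc : c ∈ Q.sSupp (k + 1) U) :
    Q.sD (k + 1) (sCone hQ (k + 1) c) = sCone hQ k (Q.sD k c) + (-1 : ℝ) ^ k • c := by
  have h := supported_induction (A := {σ : Q.mem (k + 1) | ∀ s, σ.1 s ∈ U})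
    ((Q.sD (k + 1)).comp (sCone hQ (k + 1)) - ((sCone hQ k).comp (Q.sD k) +
      (-1 : ℝ) ^ k • LinearMap.id)) ⊥ (fun σ hσ => ?_) hc
  · exact sub_eq_zero.mp ((Submodule.mem_bot ℝ).mp h)
  · refine (Submodule.mem_bot ℝ).mpr (sub_eq_zero.mpr ?_)
    rw [LinearMap.comp_apply, sCone_single hQ σ hσ, sD_single_eq_sum, Fin.sum_univ_castSucc,
      LinearMap.add_apply, LinearMap.comp_apply, sD_single_eq_sum, map_sum]
    congr 1
    · refine Finset.sum_congr rfl fun j _ => ?_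
      rw [map_smul, Fin.val_castSucc, sCone_single hQ (k := k) (precomp σ (vert (k + 1) ∘ j.succAbove)) fun s => hσ _]
      congr 2
      exact Subtype.ext (coneFun_sFace_castSucc hU hp σ.1 j)
    · rw [Fin.val_last, pow_add, neg_one_sq, mul_one]
      change _ = (-1 : ℝ) ^ k • Finsupp.single σ 1
      congr 2
      exact Subtype.ext (coneFun_sFace_last hU hσ)

lemma ConeClosed.augAcyclic (hQ : Q.ConeClosed e U p) (hU : ChartConvex e U) (hp : p ∈ U) :
    Q.localComplex.AugAcyclic sAug U where
  point := ⟨Finsupp.single ⟨_, hQ.const⟩ 1, Finsupp.single_mem_supported ℝ 1 fun _ => hp,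
    sAug_single _⟩
  zero (c : Q.Ch 0) (hc : c ∈ Q.sSupp 0 U) (hc0 : sAug c = 0) := by
    refine ⟨-sCone hQ 0 c, neg_mem (sCone_mem hQ hU hp hc), ?_⟩
    change Q.sD 0 (-sCone hQ 0 c) = c
    rw [map_neg, sD_sCone_zero hQ hU hp hc, hc0, zero_smul, zero_sub, neg_neg]
  succ k (c : Q.Ch (k + 1)) (hc : c ∈ Q.sSupp (k + 1) U) (hdc : Q.sD k c = 0) := by
    refine ⟨(-1 : ℝ) ^ k • sCone hQ (k + 1) c, Submodule.smul_mem _ _ (sCone_mem hQ hU hp hc), ?_⟩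
    change Q.sD (k + 1) ((-1 : ℝ) ^ k • sCone hQ (k + 1) c) = c
    rw [map_smul, sD_sCone hQ hU hp hc, hdc, map_zero, zero_add, smul_smul, ← mul_pow]
    simp

end SimplexClass

end Cone

/-! ### Continuous and smooth simplices -/

/-- The class of continuous simplices. -/
def contClass (X : Type u) [TopologicalSpace X] : SimplexClass X where
  mem _ := {σ | Continuous σ}
  continuous h := h
  comp h w := h.comp (continuous_affMap w)

lemma continuous_last (k : ℕ) : Continuous fun s : Simp k => s (Fin.last k) :=
  (continuous_apply (Fin.last k)).comp continuous_subtype_val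

lemma continuousAt_dropLast {k : ℕ} {s : Simp (k + 1)} (h : 0 < 1 - s (Fin.last (k + 1))) :
    ContinuousAt (dropLast (k := k)) s := by
  rw [Topology.IsInducing.subtypeVal.continuousAt_iff]
  have h1 : ContinuousAt (fun s : Simp (k + 1) => dropFun s) s := by
    refine continuousAt_pi.mpr fun i => ContinuousAt.div₀ ?_ ?_ h.ne'
    · exact ((continuous_apply i.castSucc).comp continuous_subtype_val).continuousAt
    · exact (continuous_const.sub (continuous_last _)).continuousAt
  refine h1.congr ?_
  filter_upwards [(continuous_const.sub (continuous_last _)).continuousAt.eventually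
    (lt_mem_nhds h)] with s' hs' using (dropLast_coe hs').symm

section Cont

variable {E : Type*} [NormedAddCommGroup E] [NormedSpace ℝ E] {X : Type u} [TopologicalSpace X]
  {e : OpenPartialHomeomorph X E} {U : Set X} {p : X} {k : ℕ}

lemma continuous_coneFun (hU : ChartConvex e U) (hp : p ∈ U) {σ : Simp k → X} (hσ : Continuous σ)
    (hσU : ∀ s, σ s ∈ U) : Continuous (coneFun e p σ) := by
  rw [continuous_iff_continuousAt]
  intro s
  by_cases h : 1 / 2 < s (Fin.last (k + 1))
  · refine ContinuousAt.congr (f := fun _ => p) continuousAt_const ?_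
    filter_upwards [(continuous_last _).continuousAt.eventually (lt_mem_nhds h)] with s' hs'
    change p = chartSegment e p _ _
    rw [coneTime_of_half_le (le_of_lt hs'), hU.segment_one hp]
  · have h1 : 0 < 1 - s (Fin.last (k + 1)) := by linarith
    have h2 : ContinuousAt (fun s => e (σ (dropLast s))) s :=
      ContinuousAt.comp (g := fun x => e x) (e.continuousAt (hU.subset (hσU _)))
        (hσ.continuousAt.comp (continuousAt_dropLast h1))
    have h3 : ContinuousAt (fun s : Simp (k + 1) => coneTime (s (Fin.last (k + 1)))) s :=
      (contDiff_coneTime.continuous.comp (continuous_last _)).continuousAt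
    exact ContinuousAt.comp (g := e.symm) (e.symm.continuousAt
      (hU.image_subset_target (hU.segment_mem_image hp (hσU _) (coneTime_mem _))))
      (h2.add (h3.smul (continuousAt_const.sub h2)))

lemma contClass_coneClosed (hU : ChartConvex e U) (hp : p ∈ U) : (contClass X).ConeClosed e U p where
  const := continuous_const
  cone hσ hσU := continuous_coneFun hU hp hσ hσU

end Cont

section Smooth

variable {E : Type*} [NormedAddCommGroup E] [NormedSpace ℝ E] {H : Type*} [TopologicalSpace H]
  (I : ModelWithCorners ℝ E H) (M : Type u) [TopologicalSpace M] [ChartedSpace H M]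

/-- The class of simplices which extend to a smooth map on a neighborhood of the standard
simplex. -/
def smoothClass : SimplexClass M where
  mem k := {σ | ∃ (W : Set (Fin (k + 1) → ℝ)) (F : (Fin (k + 1) → ℝ) → M), IsOpen W ∧
    ContMDiffOn 𝓘(ℝ, Fin (k + 1) → ℝ) I ∞ F W ∧ ∀ s : Simp k, s.1 ∈ W ∧ F s.1 = σ s}
  continuous := by
    rintro k σ ⟨W, F, hW, hF, hσ⟩
    have h1 : Continuous fun s : Simp k => F s.1 :=
      hF.continuousOn.comp_continuous continuous_subtype_val fun s => (hσ s).1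
    exact h1.congr fun s => (hσ s).2
  comp := by
    rintro k l σ ⟨W, F, hW, hF, hσ⟩ w
    let A : (Fin (k + 1) → ℝ) → (Fin (l + 1) → ℝ) := fun x => ∑ i, x i • (w i).1
    have hA : ContDiff ℝ ∞ A := ContDiff.sum fun i _ => (contDiff_apply ℝ ℝ i).smul contDiff_const
    exact ⟨A ⁻¹' W, F ∘ A, hW.preimage hA.continuous,
      hF.comp hA.contMDiff.contMDiffOn fun x hx => hx, fun s => hσ (affMap w s)⟩

end Smooth

section SmoothCone

variable {E : Type*} [NormedAddCommGroup E] [NormedSpace ℝ E] {M : Type u} [TopologicalSpace M]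
  [ChartedSpace E M] [IsManifold 𝓘(ℝ, E) ∞ M] {e : OpenPartialHomeomorph M E} {U : Set M} {p : M}

lemma contDiffAt_dropFun {k : ℕ} {x : Fin (k + 2) → ℝ} (h : x (Fin.last (k + 1)) < 1) :
    ContDiffAt ℝ ∞ (dropFun (k := k)) x :=
  contDiffAt_pi.mpr fun i => (contDiff_apply ℝ ℝ i.castSucc).contDiffAt.div
    (contDiffAt_const.sub (contDiff_apply ℝ ℝ _).contDiffAt) (sub_pos.mpr h).ne'

lemma smoothClass_coneClosed (he : e ∈ IsManifold.maximalAtlas 𝓘(ℝ, E) ∞ M)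
    (hU : ChartConvex e U) (hp : p ∈ U) : (smoothClass 𝓘(ℝ, E) M).ConeClosed e U p where
  const := ⟨univ, fun _ => p, isOpen_univ, contMDiffOn_const, fun _ => ⟨mem_univ _, rfl⟩⟩
  cone {k σ} := by
    rintro ⟨W, F, hW, hF, hσ⟩ hσU
    have hWU : IsOpen (W ∩ F ⁻¹' U) := hF.continuousOn.isOpen_inter_preimage hW hU.isOpen
    have hlo : IsOpen {x : Fin (k + 2) → ℝ | x (Fin.last (k + 1)) < 1} :=
      isOpen_lt (continuous_apply _) continuous_const
    have hhi : IsOpen {x : Fin (k + 2) → ℝ | 1 / 2 < x (Fin.last (k + 1))} :=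
      isOpen_lt continuous_const (continuous_apply _)
    have hmid : IsOpen ({x : Fin (k + 2) → ℝ | x (Fin.last (k + 1)) < 1} ∩
        dropFun ⁻¹' (W ∩ F ⁻¹' U)) :=
      ContinuousOn.isOpen_inter_preimage (fun x hx =>
        (contDiffAt_dropFun hx).continuousAt.continuousWithinAt) hlo hWU
    have hlast : ∀ s : Simp (k + 1), s.1 (Fin.last (k + 1)) < 1 → dropFun s.1 = (dropLast s).1 :=
      fun s hs => (dropLast_coe (sub_pos.mpr hs)).symm
    refine ⟨_, fun x => chartSegment e p (coneTime (x (Fin.last (k + 1)))) (F (dropFun x)),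
      hhi.union hmid, ?_, fun s => ⟨?_, ?_⟩⟩
    · rintro x (hx | ⟨hx1, hx2, hx3⟩)
      · refine ContMDiffAt.contMDiffWithinAt ?_
        refine (contMDiffAt_const (c := p)).congr_of_eventuallyEq ?_
        filter_upwards [hhi.mem_nhds hx] with y hy
        rw [coneTime_of_half_le (le_of_lt hy), hU.segment_one hp]
      · refine ContMDiffAt.contMDiffWithinAt ?_
        refine hU.contMDiffAt_segment he hp (s := fun x : Fin (k + 2) → ℝ =>
          coneTime (x (Fin.last (k + 1)))) ?_ ?_ hx3 (coneTime_mem _)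
        · exact (contDiff_coneTime.comp (contDiff_apply ℝ ℝ (Fin.last (k + 1)))).contMDiff _
        · exact ContMDiffAt.comp x ((hF _ hx2).contMDiffAt (hW.mem_nhds hx2))
            (contDiffAt_dropFun hx1).contMDiffAt
    · by_cases h : 1 / 2 < s.1 (Fin.last (k + 1))
      · exact Or.inl h
      · have h1 : s.1 (Fin.last (k + 1)) < 1 := by linarith
        refine Or.inr ⟨h1, ?_⟩
        rw [mem_preimage, hlast s h1]
        exact ⟨(hσ _).1, by rw [mem_preimage, (hσ _).2]; exact hσU _⟩
    · by_cases h : s.1 (Fin.last (k + 1)) < 1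
      · simp only [hlast s h, (hσ _).2]
        rfl
      · change chartSegment e p (coneTime (s.1 (Fin.last (k + 1)))) _ =
          chartSegment e p (coneTime (s.1 (Fin.last (k + 1)))) _
        rw [coneTime_of_half_le (by linarith), hU.segment_one hp, hU.segment_one hp]

end SmoothCone

/-! ### Smooth simplices in barycentric coordinates -/

/-- The barycentric coordinates of a point of the ordered simplex. -/
def baryCoord (k : ℕ) (t : Fin k → ℝ) (i : Fin (k + 1)) : ℝ :=
  (if h : i.val < k then t ⟨i.val, h⟩ else 1) -
    if h : 0 < i.val then t ⟨i.val - 1, by have := i.2; omega⟩ else 0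

lemma contDiff_baryCoord (k : ℕ) : ContDiff ℝ ∞ (baryCoord k) := by
  refine contDiff_pi.mpr fun i => ContDiff.sub ?_ ?_
  · split_ifs
    · exact contDiff_apply ℝ ℝ _
    · exact contDiff_const
  · split_ifs
    · exact contDiff_apply ℝ ℝ _
    · exact contDiff_const

lemma contDiff_partialSum (k : ℕ) : ContDiff ℝ ∞ (partialSum k) := by
  refine contDiff_pi.mpr fun l => ContDiff.sum fun i _ => ?_
  split_ifs
  · exact contDiff_apply ℝ ℝ _
  · exact contDiff_const

lemma sum_range_baryCoord {k : ℕ} (t : Fin k → ℝ) (n : ℕ) (hn : n < k + 1) :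
    ∑ i : Fin (k + 1), (if i.val ≤ n then baryCoord k t i else 0) =
      if h : n < k then t ⟨n, h⟩ else 1 := by
  induction n with
  | zero =>
    rw [Finset.sum_eq_single 0]
    · exact (if_pos le_rfl).trans ((congrArg _ (dif_neg (lt_irrefl 0))).trans (sub_zero _))
    · exact fun i _ hi => if_neg fun h => hi (Fin.ext (Nat.le_zero.mp h))
    · simp
  | succ n ih =>
    have h1 : ∀ i : Fin (k + 1), (if i.val ≤ n + 1 then baryCoord k t i else 0) =
        (if i.val ≤ n then baryCoord k t i else 0) +
          if i = ⟨n + 1, hn⟩ then baryCoord k t i else 0 := by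
      intro i
      rcases lt_trichotomy i.val (n + 1) with h | h | h
      · rw [if_pos h.le, if_pos (Nat.lt_succ_iff.mp h), if_neg (by simp [Fin.ext_iff, h.ne]),
          add_zero]
      · rw [if_pos h.le, if_neg (by omega), if_pos (Fin.ext h), zero_add]
      · rw [if_neg (by omega), if_neg (by omega), if_neg (by simp [Fin.ext_iff, h.ne']), add_zero]
    rw [Finset.sum_congr rfl fun i _ => h1 i, Finset.sum_add_distrib, ih (by omega),
      Finset.sum_ite_eq' Finset.univ, if_pos (Finset.mem_univ _), dif_pos (by omega)]
    simp [baryCoord]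

lemma baryCoord_mem {k : ℕ} {t : Fin k → ℝ} (ht : t ∈ simplexSet k) :
    baryCoord k t ∈ stdSimplex ℝ (Fin (k + 1)) := by
  obtain ⟨h0, hm, h1⟩ := ht
  refine ⟨fun i => sub_nonneg.mpr ?_, ?_⟩
  · split_ifs
    · exact hm (Fin.mk_le_mk.mpr (Nat.sub_le _ _))
    · exact h1 _
    · exact h0 _
    · exact zero_le_one
  · have h := sum_range_baryCoord t k (Nat.lt_succ_self k)
    rw [dif_neg (lt_irrefl k)] at h
    rw [← h]
    exact Finset.sum_congr rfl fun i _ => (if_pos (Nat.lt_succ_iff.mp i.2)).symm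

lemma partialSum_baryCoord {k : ℕ} (t : Fin k → ℝ) : partialSum k (baryCoord k t) = t := by
  funext l
  rw [partialSum, sum_range_baryCoord t l.val (by omega), dif_pos l.2]

lemma baryCoord_partialSum {k : ℕ} (s : Simp k) : baryCoord k (partialSum k s) = s := by
  have hs : ∑ i, s i = 1 := s.2.2
  have h1 : ∀ i : Fin (k + 1), (if h : i.val < k then partialSum k s ⟨i.val, h⟩ else 1) =
      ∑ a : Fin (k + 1), if a.val ≤ i.val then s a else 0 := by
    intro i
    split_ifs with h
    · rfl
    · rw [← hs]
      refine Finset.sum_congr rfl fun a _ => (if_pos ?_).symm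
      have := a.2
      omega
  have h2 : ∀ i : Fin (k + 1), (if h : 0 < i.val then
      partialSum k s ⟨i.val - 1, by have := i.2; omega⟩ else 0) =
        ∑ a : Fin (k + 1), if a.val < i.val then s a else 0 := by
    intro i
    split_ifs with h
    · refine Finset.sum_congr rfl fun a _ => ?_
      simp only []
      congr 1
      exact propext (by omega)
    · refine (Finset.sum_eq_zero fun a _ => if_neg ?_).symm
      omega
  funext i
  rw [baryCoord, h1, h2, ← Finset.sum_sub_distrib, Finset.sum_eq_single i]
  · simp
  · intro a _ ha
    rcases lt_or_gt_of_ne fun h => ha (Fin.ext h) with h | h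
    · rw [if_pos h.le, if_pos h, sub_self]
    · rw [if_neg (by omega), if_neg (by omega), sub_self]
  · simp

lemma sFace_eq_map {k : ℕ} (j : Fin (k + 2)) (s : Simp k) :
    sFace j s = stdSimplex.map j.succAbove s := by
  refine stdSimplex.ext (funext fun a => ?_)
  rw [sFace, affMap_apply, stdSimplex.map_coe, FunOnFinite.linearMap_apply_apply,
    Finset.sum_filter]
  refine Finset.sum_congr rfl fun i _ => ?_
  by_cases h : j.succAbove i = a
  · subst h
    simp [vert]
  · simp [vert, h]

section Equiv

variable {E : Type*} [NormedAddCommGroup E] [NormedSpace ℝ E] {H : Type*} [TopologicalSpace H]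
  {I : ModelWithCorners ℝ E H} {M : Type u} [TopologicalSpace M] [ChartedSpace H M] {k : ℕ}

open Classical in
lemma SmoothSimplex.mem_smoothClass (σ : SmoothSimplex (DiffSpace.ofManifold I M) k) :
    (fun s : Simp k => σ.1 ⟨partialSum k s, partialSum_mem s⟩) ∈ (smoothClass I M).mem k := by
  obtain ⟨W, hW, F, hWo, hF⟩ := σ.2
  have hid : ((euclidean k).sub W).IsPlot (openSubmanifold W hWo) id :=
    isSmoothMap_coe (openSubmanifold W hWo)
  have h1 : ContMDiff (M' := M) 𝓘(ℝ, Fin k → ℝ) I ∞ fun x : (idParam W hWo).source =>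
      F.toFun ⟨x.1, x.2⟩ := F.isPlot hid (idParam W hWo)
  let G : (Fin k → ℝ) → M := fun x => if h : x ∈ W then F.toFun ⟨x, h⟩
    else σ.1 ⟨0, zero_mem_simplexSet k⟩
  have hG : ContMDiffOn 𝓘(ℝ, Fin k → ℝ) I ∞ G W := by
    intro x hx
    have h2 : ContMDiffAt 𝓘(ℝ, Fin k → ℝ) I ∞ (fun z : (idParam W hWo).source => G z) ⟨x, hx⟩ := by
      have : (fun z : (idParam W hWo).source => G z) = fun z => F.toFun ⟨z.1, z.2⟩ :=
        funext fun z => dif_pos (show z.1 ∈ W from z.2)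
      rw [this]
      exact h1 ⟨x, hx⟩
    exact (contMDiffAt_subtype_iff.mp h2).contMDiffWithinAt
  have hGσ : ∀ t : simplexSet k, G t.1 = σ.1 t := fun t => (dif_pos (hW t.2)).trans (hF t)
  exact ⟨partialSum k ⁻¹' W, G ∘ partialSum k, hWo.preimage (continuous_partialSum k),
    hG.comp (contDiff_partialSum k).contMDiff.contMDiffOn fun x hx => hx,
    fun s => ⟨hW (partialSum_mem s), hGσ ⟨_, partialSum_mem s⟩⟩⟩

lemma isStronglySmooth_of_mem_smoothClass {τ : Simp k → M} (hτ : τ ∈ (smoothClass I M).mem k) :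
    IsStronglySmooth (X := DiffSpace.ofManifold I M)
      fun t : simplexSet k => τ ⟨baryCoord k t.1, baryCoord_mem t.2⟩ := by
  obtain ⟨W, F, hW, hF, hτ⟩ := hτ
  refine ⟨baryCoord k ⁻¹' W, fun t ht => (hτ ⟨_, baryCoord_mem ht⟩).1,
    ⟨fun t => F (baryCoord k t.1), fun {U φ} hφ => ?_⟩,
    hW.preimage (contDiff_baryCoord k).continuous, fun t => (hτ ⟨_, baryCoord_mem t.2⟩).2⟩
  intro ψ
  have h1 : ContMDiff (M' := Fin k → ℝ) 𝓘(ℝ, Fin U.dim → ℝ) 𝓘(ℝ, Fin k → ℝ) ∞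
      fun x : ψ.source => (φ (ψ.lift x)).1 := hφ ψ
  have h2 : ContMDiff (M' := M) 𝓘(ℝ, Fin U.dim → ℝ) I ∞
      fun x : ψ.source => F (baryCoord k (φ (ψ.lift x)).1) :=
    hF.comp_contMDiff ((contDiff_baryCoord k).contMDiff.comp h1) fun x => (φ (ψ.lift x)).2
  exact h2

/-- Smooth simplices on the ordered simplex correspond to smooth simplices on the standard
simplex. -/
def smoothEquiv (k : ℕ) :
    SmoothSimplex (DiffSpace.ofManifold I M) k ≃ (smoothClass I M).mem k where
  toFun σ := ⟨_, σ.mem_smoothClass⟩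
  invFun τ := ⟨fun t : simplexSet k => τ.1 ⟨baryCoord k t.1, baryCoord_mem t.2⟩,
    isStronglySmooth_of_mem_smoothClass (M := M) τ.2⟩
  left_inv σ := Subtype.ext (funext fun t =>
    congrArg σ.1 (Subtype.ext (partialSum_baryCoord t.1)))
  right_inv τ := Subtype.ext (funext fun s =>
    congrArg τ.1 (Subtype.ext (baryCoord_partialSum s)))

lemma smoothEquiv_face (σ : SmoothSimplex (DiffSpace.ofManifold I M) (k + 1)) (j : Fin (k + 2)) :
    smoothEquiv k (σ.face j) =
      SimplexClass.precomp (smoothEquiv (k + 1) σ) (vert (k + 1) ∘ j.succAbove) := by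
  refine Subtype.ext (funext fun s => ?_)
  change σ.1 ⟨faceFun k j (partialSum k s), _⟩ = σ.1 ⟨partialSum (k + 1) (sFace j s), _⟩
  refine congrArg σ.1 (Subtype.ext ?_)
  change faceFun k j (partialSum k s) = partialSum (k + 1) (sFace j s)
  rw [sFace_eq_map, partialSum_map]

/-- Smooth chains as chains of the class of smooth simplices. -/
def smoothChainEquiv (k : ℕ) :
    SmoothChains (DiffSpace.ofManifold I M) k ≃ₗ[ℝ] (smoothClass I M).Ch k :=
  Finsupp.domLCongr (smoothEquiv k)

lemma smoothChainEquiv_single (σ : SmoothSimplex (DiffSpace.ofManifold I M) k) (r : ℝ) :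
    smoothChainEquiv k (Finsupp.single σ r) = Finsupp.single (smoothEquiv k σ) r :=
  Finsupp.domLCongr_single _ _ _

lemma smoothChainEquiv_boundary (c : SmoothChains (DiffSpace.ofManifold I M) (k + 1)) :
    (smoothClass I M).sD k (smoothChainEquiv (k + 1) c) =
      smoothChainEquiv k (smoothBoundary (DiffSpace.ofManifold I M) k c) := by
  have h : ((smoothClass I M).sD k).comp (smoothChainEquiv (k + 1)).toLinearMap =
      (smoothChainEquiv k).toLinearMap.comp (smoothBoundary (DiffSpace.ofManifold I M) k) := by
    refine Finsupp.lhom_ext' fun σ => LinearMap.ext_ring ?_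
    simp only [LinearMap.comp_apply, Finsupp.lsingle_apply, LinearEquiv.coe_coe,
      smoothChainEquiv_single, SimplexClass.sD_single_eq_sum, smoothBoundary_single, map_sum,
      map_smul, smoothEquiv_face]
  exact congrArg (fun F => F c) h

end Equiv

/-! ### Acyclicity of local complexes on manifolds -/

section Manifold

variable {E : Type*} [NormedAddCommGroup E] [NormedSpace ℝ E] {M : Type u} [TopologicalSpace M]

lemma sUnion_chartConvex (e : OpenPartialHomeomorph M E) {O : Set M} (hO : IsOpen O)
    (hOe : O ⊆ e.source) : ⋃₀ {U | ChartConvex e U ∧ U ⊆ O} = O := by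
  refine subset_antisymm (sUnion_subset fun U hU => hU.2) fun x hx => ?_
  obtain ⟨r, hr, hball⟩ := Metric.isOpen_iff.mp (e.isOpen_image_of_subset_source hO hOe) (e x)
    (mem_image_of_mem e hx)
  have hO' : ∀ y ∈ Metric.ball (e x) r, e.symm y ∈ O ∧ y ∈ e.target := fun y hy => by
    obtain ⟨z, hz, rfl⟩ := hball hy
    exact ⟨by rwa [e.left_inv (hOe hz)], e.map_source (hOe hz)⟩
  have hsub : e.symm '' Metric.ball (e x) r ⊆ O := by
    rintro _ ⟨y, hy, rfl⟩
    exact (hO' y hy).1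
  refine ⟨e.symm '' Metric.ball (e x) r, ⟨⟨?_, hsub.trans hOe, ?_⟩, hsub⟩,
    ⟨e x, Metric.mem_ball_self hr, e.left_inv (hOe hx)⟩⟩
  · exact e.symm.isOpen_image_of_subset_source Metric.isOpen_ball fun y hy => (hO' y hy).2
  · have : e '' (e.symm '' Metric.ball (e x) r) = Metric.ball (e x) r := by
      rw [image_image]
      exact (image_congr fun y hy => e.right_inv (hO' y hy).2).trans (image_id' _)
    rw [this]
    exact convex_ball _ _

lemma LocalComplex.acyclic_univ [ChartedSpace E M] (K : LocalComplex M)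
    (h : ∀ e ∈ atlas E M, ∀ U, ChartConvex e U → K.Acyclic U) : K.Acyclic univ := by
  have h1 : ∀ O, (IsOpen O ∧ ∃ e ∈ atlas E M, O ⊆ e.source) → K.Acyclic O := by
    rintro O ⟨hO, e, he, hOe⟩
    rw [← sUnion_chartConvex e hO hOe]
    exact Acyclic.sUnion (B := ChartConvex e) (fun U hU => hU.isOpen) (fun U V => ChartConvex.inter)
      (h e he) _ fun U hU => hU.1
  have h2 : ⋃₀ {O : Set M | IsOpen O ∧ ∃ e ∈ atlas E M, O ⊆ e.source} = univ :=
    eq_univ_of_forall fun x => ⟨(chartAt E x).source,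
      ⟨(chartAt E x).open_source, _, chart_mem_atlas E x, subset_rfl⟩, mem_chart_source E x⟩
  rw [← h2]
  refine Acyclic.sUnion (fun O hO => hO.1) ?_ h1 _ fun O hO => hO
  rintro O O' ⟨hO, e, he, hOe⟩ ⟨hO', -⟩
  exact ⟨hO.inter hO', e, he, inter_subset_left.trans hOe⟩

end Manifold

/-! ### The comparison maps of local complexes -/

/-- The inclusion of chains of a smaller class of simplices. -/
def SimplexClass.inclHom {X : Type u} [TopologicalSpace X] {Q Q' : SimplexClass X}
    (h : ∀ k, Q.mem k ⊆ Q'.mem k) : LocalComplex.Hom Q.localComplex Q'.localComplex where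
  f k := Finsupp.linearCombination (M := Q'.Ch k) ℝ fun σ : Q.mem k =>
    Finsupp.single ⟨σ.1, h k σ.2⟩ 1
  comm k c := by
    have h1 : (Q'.sD k).comp (Finsupp.linearCombination (M := Q'.Ch (k + 1)) ℝ
        fun σ : Q.mem (k + 1) => Finsupp.single ⟨σ.1, h _ σ.2⟩ 1) =
          (Finsupp.linearCombination (M := Q'.Ch k) ℝ fun σ : Q.mem k =>
            Finsupp.single ⟨σ.1, h k σ.2⟩ 1).comp (Q.sD k) := by
      refine Finsupp.lhom_ext' fun σ => LinearMap.ext_ring ?_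
      simp only [LinearMap.comp_apply, Finsupp.lsingle_apply, Finsupp.linearCombination_single,
        one_smul, SimplexClass.sD_single_eq_sum, map_sum, map_smul]
      rfl
    exact congrArg (fun F => F c) h1
  mem k U c hc := by
    refine supported_induction (Finsupp.linearCombination (M := Q'.Ch k) ℝ fun σ : Q.mem k =>
      Finsupp.single ⟨σ.1, h k σ.2⟩ 1) (Q'.sSupp k U) (fun σ hσ => ?_) hc
    rw [Finsupp.linearCombination_single, one_smul]
    exact Finsupp.single_mem_supported ℝ 1 hσ

lemma SimplexClass.sAug_inclHom {X : Type u} [TopologicalSpace X] {Q Q' : SimplexClass X}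
    (h : ∀ k, Q.mem k ⊆ Q'.mem k) (c : Q.Ch 0) : sAug ((inclHom h).f 0 c) = sAug c := by
  have h1 : sAug.comp ((inclHom h).f 0) = sAug := by
    refine Finsupp.lhom_ext' fun σ => LinearMap.ext_ring ?_
    change sAug (Finsupp.linearCombination (M := Q'.Ch 0) ℝ (fun σ : Q.mem 0 =>
      Finsupp.single ⟨σ.1, h 0 σ.2⟩ 1) (Finsupp.single σ 1)) = sAug (Finsupp.single σ 1)
    rw [Finsupp.linearCombination_single, one_smul, sAug_single, sAug_single]
  exact congrArg (fun F => F c) h1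

section DeRham

variable {E : Type*} [NormedAddCommGroup E] [NormedSpace ℝ E] [FiniteDimensional ℝ E]
  {H : Type*} [TopologicalSpace H] (I : ModelWithCorners ℝ E H) (M : Type u) [TopologicalSpace M]
  [ChartedSpace H M] [IsManifold I ∞ M] [T2Space M] [NormalSpace M] [SigmaCompactSpace M]

/-- The complex of de Rham chains of a manifold, with its supports. -/
def deRhamLocal : LocalComplex M where
  C k := Chains (DiffSpace.ofManifold I M) k
  addCommGroup _ := inferInstance
  module _ := inferInstance
  d := boundary (DiffSpace.ofManifold I M)
  d_d k c := congrArg (fun F => F c) (boundary_comp_boundary (DiffSpace.ofManifold I M) k)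
  supp k U := mSupp I k U
  supp_mono k U V h := suppChains_mono h
  supp_empty k := suppChains_empty
  d_mem k U c hc := boundary_mem_suppChains hc
  inter k U V hU _ := mSupp_inf_le hU
  small_zero hU hV c hc := ⟨0, zero_mem _, by
    rw [map_zero, sub_zero]
    exact mSupp_sup_le hU hV hc⟩
  small_succ k U V hU hV c hc _ := ⟨0, zero_mem _, by
    rw [map_zero, sub_zero]
    exact mSupp_sup_le hU hV hc⟩
  directed k ι _ U hU hd c hc := exists_mem_mSupp_of_directed hU hd hc

variable {I M}

/-- The comparison of smooth chains with de Rham chains. -/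
def comparisonHom {u : ∀ k, Chains (simplex k) k} (hu : IsSimplexSequence u) :
    LocalComplex.Hom (smoothClass I M).localComplex (deRhamLocal I M) where
  f k := (comparisonMap u (DiffSpace.ofManifold I M) k).comp (smoothChainEquiv k).symm.toLinearMap
  comm k c := by
    obtain ⟨c, rfl⟩ := (smoothChainEquiv (k + 1)).surjective c
    have h1 := congrArg (fun F => F c) (boundary_comparisonMap hu (DiffSpace.ofManifold I M) k)
    have h2 := congrArg (smoothChainEquiv k).symm (smoothChainEquiv_boundary (I := I) (M := M) c)
    change boundary (DiffSpace.ofManifold I M) k (comparisonMap u (DiffSpace.ofManifold I M) (k + 1)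
      ((smoothChainEquiv (k + 1)).symm (smoothChainEquiv (k + 1) c))) =
        comparisonMap u (DiffSpace.ofManifold I M) k ((smoothChainEquiv k).symm
          ((smoothClass I M).sD k (smoothChainEquiv (k + 1) c)))
    rw [h2, LinearEquiv.symm_apply_apply, LinearEquiv.symm_apply_apply]
    exact h1
  mem k U c hc := by
    refine supported_induction _ _ (fun τ hτ => ?_) hc
    obtain ⟨σ, rfl⟩ := (smoothEquiv k).surjective τ
    change comparisonMap u (DiffSpace.ofManifold I M) k ((smoothChainEquiv k).symm
      (Finsupp.single (smoothEquiv k σ) 1)) ∈ suppChains (DiffSpace.ofManifold I M) k U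
    rw [← smoothChainEquiv_single, LinearEquiv.symm_apply_apply, comparisonMap,
      Finsupp.linearCombination_single, one_smul]
    refine push_mem_suppChains (S' := univ) σ.hom (fun t _ => ?_)
      (by rw [suppChains_univ]; trivial)
    have h := hτ ⟨baryCoord k t.1, baryCoord_mem t.2⟩
    exact (congrArg (· ∈ U) (congrArg σ.1 (Subtype.ext (partialSum_baryCoord t.1)))).mp h

lemma euclForm_oneTest : euclForm (⊤ : Opens (Fin 0 → ℝ)) 0 oneTest = oneForm := by
  refine Subtype.ext (funext fun (ψ : LocalParam (univ : Set (Fin 0 → ℝ)) 0) => funext fun x => ?_)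
  by_cases hx : x ∈ ψ.source
  · refine (ψ.pull_of_mem hx).trans (Eq.trans ?_ (if_pos hx).symm)
    ext v
    rfl
  · exact (ψ.pull_of_notMem hx).trans (if_neg hx).symm

lemma aug_oneForm {X : DiffSpace.{u}} (φ : (opn (⊤ : Opens (Fin 0 → ℝ))).carrier → X.carrier)
    (hφ : X.IsPlot (opn ⊤) φ) :
    aug X (chainMk (U := opn (⊤ : Opens (Fin 0 → ℝ))) φ hφ (add_zero 0) oneForm) = 1 := by
  rw [← euclForm_oneTest, ← eucl_apply, aug_eucl, integral_fin_zero]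
  rfl

lemma aug_pointChain : aug (simplex 0) pointChain = 1 := aug_oneForm _ _

lemma aug_comparisonHom {u : ∀ k, Chains (simplex k) k} (hu : IsSimplexSequence u)
    (c : (smoothClass I M).Ch 0) :
    aug (DiffSpace.ofManifold I M) ((comparisonHom hu).f 0 c) = SimplexClass.sAug c := by
  have h : (aug (DiffSpace.ofManifold I M)).comp ((comparisonHom (I := I) (M := M) hu).f 0) =
      SimplexClass.sAug := by
    refine Finsupp.lhom_ext' fun τ => LinearMap.ext_ring ?_
    obtain ⟨σ, rfl⟩ := (smoothEquiv 0).surjective τ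
    change aug (DiffSpace.ofManifold I M) (comparisonMap u (DiffSpace.ofManifold I M) 0
      ((smoothChainEquiv 0).symm (Finsupp.single (smoothEquiv 0 σ) 1))) =
        SimplexClass.sAug (Finsupp.single (smoothEquiv 0 σ) 1)
    rw [← smoothChainEquiv_single, LinearEquiv.symm_apply_apply, comparisonMap,
      Finsupp.linearCombination_single, one_smul, aug_push, hu.zero, aug_pointChain,
      smoothChainEquiv_single, SimplexClass.sAug_single]
  exact congrArg (fun F => F c) h

end DeRham

section QuasiIso

variable {E : Type*} [NormedAddCommGroup E] [NormedSpace ℝ E] {M : Type u} [TopologicalSpace M]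
  [ChartedSpace E M] [IsManifold 𝓘(ℝ, E) ∞ M]

lemma inclHom_acyclic :
    (LocalComplex.cone (SimplexClass.inclHom (Q := smoothClass 𝓘(ℝ, E) M) (Q' := contClass M)
      fun _ _ h => (smoothClass 𝓘(ℝ, E) M).continuous h)).Acyclic univ := by
  refine LocalComplex.acyclic_univ (E := E) _ fun e he U hU => ?_
  have he' : e ∈ IsManifold.maximalAtlas 𝓘(ℝ, E) ∞ M := IsManifold.subset_maximalAtlas he
  rcases U.eq_empty_or_nonempty with rfl | ⟨p, hp⟩
  · exact LocalComplex.acyclic_empty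
  · exact LocalComplex.AugAcyclic.cone _ (SimplexClass.sAug_inclHom _) SimplexClass.sAug_sD
      ((smoothClass_coneClosed he' hU hp).augAcyclic hU hp)
      ((contClass_coneClosed hU hp).augAcyclic hU hp)

variable [FiniteDimensional ℝ E] [T2Space M] [NormalSpace M] [SigmaCompactSpace M]

lemma deRhamLocal_augAcyclic {e : OpenPartialHomeomorph M E}
    (he : e ∈ IsManifold.maximalAtlas 𝓘(ℝ, E) ∞ M) {U : Set M} (hU : ChartConvex e U) {p : M}
    (hp : p ∈ U) : (deRhamLocal 𝓘(ℝ, E) M).AugAcyclic (aug (DiffSpace.ofManifold 𝓘(ℝ, E) M)) U where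
  point := ⟨ptChain (X := DiffSpace.ofManifold 𝓘(ℝ, E) M) p, ptChain_mem hp, aug_ptChain _⟩
  zero _ hc h0 := hU.exists_boundary he hp hc h0
  succ _ _ hc h0 := hU.exists_boundary he hp hc h0

lemma comparisonHom_acyclic {u : ∀ k, Chains (simplex k) k} (hu : IsSimplexSequence u) :
    (LocalComplex.cone (comparisonHom (I := 𝓘(ℝ, E)) (M := M) hu)).Acyclic univ := by
  refine LocalComplex.acyclic_univ (E := E) _ fun e he U hU => ?_
  have he' : e ∈ IsManifold.maximalAtlas 𝓘(ℝ, E) ∞ M := IsManifold.subset_maximalAtlas he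
  rcases U.eq_empty_or_nonempty with rfl | ⟨p, hp⟩
  · exact LocalComplex.acyclic_empty
  · exact LocalComplex.AugAcyclic.cone _ (aug_comparisonHom hu) (aug_boundary)
      ((smoothClass_coneClosed he' hU hp).augAcyclic hU hp) (deRhamLocal_augAcyclic he' hU hp)

end QuasiIso

/-! ### Homology of chain complexes of modules -/

section Homology

open CategoryTheory

variable {C D : ChainComplex (ModuleCat.{u} ℝ) ℕ}

lemma exists_iCycles_eq {k : ℕ} {x : C.X k} (hx : ∀ l, C.d k l x = 0) :
    ∃ z : C.cycles k, C.iCycles k z = x :=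
  ⟨C.cyclesMk x _ rfl (hx _), C.i_cyclesMk x _ rfl (hx _)⟩

lemma iCycles_injective (C : ChainComplex (ModuleCat.{u} ℝ) ℕ) (k : ℕ) :
    Function.Injective (C.iCycles k) :=
  (ModuleCat.mono_iff_injective _).mp inferInstance

lemma homologyπ_surjective (C : ChainComplex (ModuleCat.{u} ℝ) ℕ) (k : ℕ) :
    Function.Surjective (C.homologyπ k) :=
  (ModuleCat.epi_iff_surjective _).mp inferInstance

lemma d_iCycles (k l : ℕ) (z : C.cycles k) : C.d k l (C.iCycles k z) = 0 := by
  rw [← ModuleCat.comp_apply, HomologicalComplex.iCycles_d]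
  rfl

lemma homologyπ_eq_zero_iff {k : ℕ} (z : C.cycles k) :
    C.homologyπ k z = 0 ↔ ∃ w, C.d (k + 1) k w = C.iCycles k z := by
  constructor
  · intro hz
    have hex : (ShortComplex.mk (C.toCycles (k + 1) k) (C.homologyπ k)
        (C.toCycles_comp_homologyπ _ _)).Exact :=
      ShortComplex.exact_of_g_is_cokernel _ (C.homologyIsCokernel (k + 1) k (by simp))
    obtain ⟨w, hw⟩ := (ShortComplex.moduleCat_exact_iff _).mp hex z hz
    refine ⟨w, ?_⟩
    rw [← C.toCycles_i (k + 1) k, ModuleCat.comp_apply]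
    exact congrArg _ hw
  · rintro ⟨w, hw⟩
    have : z = C.toCycles (k + 1) k w := by
      apply iCycles_injective C k
      rw [← hw, ← ModuleCat.comp_apply, C.toCycles_i]
    rw [this, ← ModuleCat.comp_apply, C.toCycles_comp_homologyπ]
    rfl

lemma homologyMap_homologyπ (φ : C ⟶ D) {k : ℕ} (z : C.cycles k) :
    HomologicalComplex.homologyMap φ k (C.homologyπ k z) =
      D.homologyπ k (HomologicalComplex.cyclesMap φ k z) := by
  rw [← ModuleCat.comp_apply, ← ModuleCat.comp_apply, HomologicalComplex.homologyπ_naturality]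

lemma iCycles_cyclesMap (φ : C ⟶ D) {k : ℕ} (z : C.cycles k) :
    D.iCycles k (HomologicalComplex.cyclesMap φ k z) = φ.f k (C.iCycles k z) := by
  rw [← ModuleCat.comp_apply, ← ModuleCat.comp_apply, HomologicalComplex.cyclesMap_i]

lemma homologyMap_eq_of_exists {φ ψ : C ⟶ D} {k : ℕ}
    (h : ∀ x : C.X k, (∀ l, C.d k l x = 0) → ∃ w, D.d (k + 1) k w = φ.f k x - ψ.f k x) :
    HomologicalComplex.homologyMap φ k = HomologicalComplex.homologyMap ψ k := by
  ext y
  obtain ⟨z, rfl⟩ := homologyπ_surjective C k y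
  obtain ⟨w, hw⟩ := h (C.iCycles k z) fun l => d_iCycles k l z
  rw [homologyMap_homologyπ, homologyMap_homologyπ, ← sub_eq_zero, ← map_sub,
    homologyπ_eq_zero_iff]
  exact ⟨w, by rw [hw, map_sub, iCycles_cyclesMap, iCycles_cyclesMap]⟩

lemma isIso_homologyMap_of_exists {φ : C ⟶ D} {k : ℕ}
    (hinj : ∀ x : C.X k, (∀ l, C.d k l x = 0) → ∀ y, φ.f k x = D.d (k + 1) k y →
      ∃ w, C.d (k + 1) k w = x)
    (hsurj : ∀ y : D.X k, (∀ l, D.d k l y = 0) → ∃ x v, (∀ l, C.d k l x = 0) ∧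
      y = φ.f k x + D.d (k + 1) k v) :
    IsIso (HomologicalComplex.homologyMap φ k) := by
  rw [ConcreteCategory.isIso_iff_bijective]
  constructor
  · rw [injective_iff_map_eq_zero]
    intro y hy
    obtain ⟨z, rfl⟩ := homologyπ_surjective C k y
    rw [homologyMap_homologyπ, homologyπ_eq_zero_iff] at hy
    obtain ⟨w, hw⟩ := hy
    rw [iCycles_cyclesMap] at hw
    exact (homologyπ_eq_zero_iff z).mpr (hinj _ (fun l => d_iCycles k l z) w hw.symm)
  · intro y
    obtain ⟨z, rfl⟩ := homologyπ_surjective D k y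
    obtain ⟨x, v, hx, hxv⟩ := hsurj (D.iCycles k z) fun l => d_iCycles k l z
    obtain ⟨z', rfl⟩ := exists_iCycles_eq hx
    refine ⟨C.homologyπ k z', ?_⟩
    rw [homologyMap_homologyπ, eq_comm, ← sub_eq_zero, ← map_sub, homologyπ_eq_zero_iff]
    exact ⟨v, by rw [map_sub, iCycles_cyclesMap, hxv, add_sub_cancel_left]⟩

lemma LocalComplex.Hom.isIso_homologyMap {M : Type*} [TopologicalSpace M] {F G : LocalComplex M}
    (f : Hom F G) (h : (cone f).Acyclic univ) (hF : ∀ k, F.supp k univ = ⊤)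
    (hG : ∀ k, G.supp k univ = ⊤) (φ : C ⟶ D) (eC : ∀ k, C.X k ≃ₗ[ℝ] F.C k)
    (hC : ∀ k c, F.d k (eC (k + 1) c) = eC k (C.d (k + 1) k c)) (eD : ∀ k, D.X k ≃ₗ[ℝ] G.C k)
    (hD : ∀ k c, G.d k (eD (k + 1) c) = eD k (D.d (k + 1) k c))
    (hφ : ∀ k c, f.f k (eC k c) = eD k (φ.f k c)) (k : ℕ) :
    IsIso (HomologicalComplex.homologyMap φ k) := by
  refine isIso_homologyMap_of_exists (fun x hx y hxy => ?_) fun y hy => ?_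
  · obtain ⟨w, hw⟩ := exists_of_map_eq f h (x := eC k x) (by rw [hF]; trivial) (by
      rintro l rfl
      change F.d l (eC (l + 1) x) = 0
      rw [hC, hx, map_zero]) (y := eD (k + 1) y) (by rw [hG]; trivial) (by rw [hφ, hxy, hD])
    refine ⟨(eC (k + 1)).symm w, (eC k).injective ?_⟩
    rw [← hC, LinearEquiv.apply_symm_apply, hw]
  · obtain ⟨x, v, hx, hxv⟩ := exists_map_add f h (y := eD k y) (by rw [hG]; trivial) (by
      rintro l rfl
      change G.d l (eD (l + 1) y) = 0
      rw [hD, hy, map_zero])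
    refine ⟨(eC k).symm x, (eD (k + 1)).symm v, fun l => ?_, (eD k).injective ?_⟩
    · by_cases hl : l + 1 = k
      · subst hl
        apply (eC l).injective
        rw [← hC, LinearEquiv.apply_symm_apply, map_zero]
        exact hx l rfl
      · rw [C.shape _ _ hl]
        rfl
    · rw [hxv, map_add, ← hφ, ← hD, LinearEquiv.apply_symm_apply, LinearEquiv.apply_symm_apply]

end Homology

/-! ### Singular chains as chains of continuous simplices -/

section Singular

open CategoryTheory

variable {M : Type u} [TopologicalSpace M] {k : ℕ}

/-- Continuous simplices correspond to the simplices of the singular simplicial set. -/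
def contEquiv (M : Type u) [TopologicalSpace M] (k : ℕ) : (contClass M).mem k ≃
    (TopCat.toSSet.obj (TopCat.of M)).obj (Opposite.op (SimplexCategory.mk k)) where
  toFun σ := (TopCat.toSSetObjEquiv (TopCat.of M) (Opposite.op (SimplexCategory.mk k))).symm
    ⟨σ.1, σ.2⟩
  invFun τ := ⟨_, (TopCat.toSSetObjEquiv (TopCat.of M)
    (Opposite.op (SimplexCategory.mk k)) τ).continuous⟩
  left_inv _ := rfl
  right_inv _ := rfl

lemma contEquiv_face (σ : (contClass M).mem (k + 1)) (j : Fin (k + 2)) :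
    contEquiv M k (SimplexClass.precomp σ (vert (k + 1) ∘ j.succAbove)) =
      (TopCat.toSSet.obj (TopCat.of M)).δ j (contEquiv M (k + 1) σ) := by
  apply (TopCat.toSSetObjEquiv (TopCat.of M) _).injective
  ext s
  exact congrArg σ.1 (sFace_eq_map j s)

/-- Chains of continuous simplices as singular chains. -/
def contChainMap (M : Type u) [TopologicalSpace M] (k : ℕ) :
    (contClass M).Ch k →ₗ[ℝ] (singularComplex M).X k :=
  Finsupp.linearCombination ℝ fun σ => singularChain (contEquiv M k σ)

lemma contChainMap_single (σ : (contClass M).mem k) :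
    contChainMap M k (Finsupp.single σ 1) = singularChain (contEquiv M k σ) := by
  rw [contChainMap, Finsupp.linearCombination_single, one_smul]

/-- Singular chains as chains of continuous simplices. -/
def singularChainMap (M : Type u) [TopologicalSpace M] (k : ℕ) :
    (singularComplex M).X k ⟶ ModuleCat.of ℝ ((contClass M).Ch k) :=
  Limits.Sigma.desc fun τ => ModuleCat.ofHom
    ((Finsupp.lsingle ((contEquiv M k).symm τ)).comp ULift.moduleEquiv.toLinearMap)

lemma singularChainMap_singularChain
    (τ : (TopCat.toSSet.obj (TopCat.of M)).obj (Opposite.op (SimplexCategory.mk k))) :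
    singularChainMap M k (singularChain τ) = Finsupp.single ((contEquiv M k).symm τ) 1 := by
  have h : SSet.ιChainComplex (R := ModuleCat.of ℝ (ULift.{u} ℝ))
      (TopCat.toSSet.obj (TopCat.of M)) τ ≫ singularChainMap M k = ModuleCat.ofHom
        ((Finsupp.lsingle ((contEquiv M k).symm τ)).comp ULift.moduleEquiv.toLinearMap) :=
    Limits.Sigma.ι_desc _ _
  exact congrArg (fun F => F.hom (ULift.up 1)) h

/-- Chains of continuous simplices are singular chains. -/
def contChainEquiv (M : Type u) [TopologicalSpace M] (k : ℕ) :
    (contClass M).Ch k ≃ₗ[ℝ] (singularComplex M).X k :=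
  LinearEquiv.ofLinearMap (contChainMap M k) (singularChainMap M k).hom
    (by
      have h : singularChainMap M k ≫ ModuleCat.ofHom (contChainMap M k) = 𝟙 _ := by
        refine SSet.chainComplex_hom_ext fun τ => ?_
        refine ModuleCat.hom_ext (LinearMap.ext fun r => ?_)
        obtain ⟨r⟩ := r
        have hr : (ULift.up r : ULift.{u} ℝ) = r • ULift.up 1 := by
          ext
          simp
        rw [hr, map_smul, map_smul]
        congr 1
        change contChainMap M k (singularChainMap M k (singularChain τ)) = singularChain τ
        rw [singularChainMap_singularChain, contChainMap_single, Equiv.apply_symm_apply]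
      exact congrArg ModuleCat.Hom.hom h)
    (by
      refine Finsupp.lhom_ext' fun σ => LinearMap.ext_ring ?_
      change singularChainMap M k (contChainMap M k (Finsupp.single σ 1)) = Finsupp.single σ 1
      rw [contChainMap_single, singularChainMap_singularChain, Equiv.symm_apply_apply])

lemma contChainMap_sD (c : (contClass M).Ch (k + 1)) :
    contChainMap M k ((contClass M).sD k c) =
      (singularComplex M).d (k + 1) k (contChainMap M (k + 1) c) := by
  have h : (contChainMap M k).comp ((contClass M).sD k) =
      ((singularComplex M).d (k + 1) k).hom.comp (contChainMap M (k + 1)) := by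
    refine Finsupp.lhom_ext' fun σ => LinearMap.ext_ring ?_
    simp only [LinearMap.comp_apply, Finsupp.lsingle_apply, SimplexClass.sD_single_eq_sum, map_sum,
      map_smul, contChainMap_single, contEquiv_face]
    exact (singularChain_d _).symm
  exact congrArg (fun F => F c) h

end Singular

/-! ### Comparison maps in homology -/

section Comparison

open CategoryTheory

lemma d_deRhamComplex (X : DiffSpace.{u}) (k : ℕ) :
    (deRhamComplex X).d (k + 1) k = ModuleCat.ofHom (boundary X k) :=
  ChainComplex.of_d (fun k => ModuleCat.of ℝ (Chains X k))
    (fun k => ModuleCat.ofHom (boundary X k)) k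

lemma d_smoothSingularComplex (X : DiffSpace.{u}) (k : ℕ) :
    (smoothSingularComplex X).d (k + 1) k = ModuleCat.ofHom (smoothBoundary X k) :=
  ChainComplex.of_d (fun k => ModuleCat.of ℝ (SmoothChains X k))
    (fun k => ModuleCat.ofHom (smoothBoundary X k)) k

lemma homologyMap_comparison_eq {u u' : ∀ k, Chains (simplex k) k} (hu : IsSimplexSequence u)
    (hu' : IsSimplexSequence u') (X : DiffSpace.{u}) (k : ℕ) :
    HomologicalComplex.homologyMap (comparison hu X) k =
      HomologicalComplex.homologyMap (comparison hu' X) k := by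
  refine homologyMap_eq_of_exists fun (x : SmoothChains X k) hx => ?_
  obtain ⟨h, h0, hs⟩ := hu.exists_homotopy hu'
  cases k with
  | zero =>
    refine ⟨0, ?_⟩
    rw [map_zero, eq_comm, sub_eq_zero]
    change comparisonMap u X 0 x = comparisonMap u' X 0 x
    rw [comparisonMap, comparisonMap, hu.zero, hu'.zero]
  | succ k =>
    have hx0 : smoothBoundary X k x = 0 := by
      have := hx k
      rwa [d_smoothSingularComplex] at this
    let T : ∀ k, SmoothChains X k →ₗ[ℝ] Chains X (k + 1) := fun k =>
      Finsupp.linearCombination ℝ fun σ => push σ.hom (k + 1) (h k)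
    have hT : (boundary X (k + 1)).comp (T (k + 1)) =
        comparisonMap u X (k + 1) - comparisonMap u' X (k + 1) -
          (T k).comp (smoothBoundary X k) := by
      refine Finsupp.lhom_ext' fun σ => LinearMap.ext_ring ?_
      simp only [T, LinearMap.comp_apply, LinearMap.sub_apply, Finsupp.lsingle_apply,
        smoothBoundary_single, comparisonMap, Finsupp.linearCombination_single, one_smul, map_sum,
        map_smul, boundary_push, hs, map_sub, faceSum_apply]
      congr 1
      refine Finset.sum_congr rfl fun j _ => ?_
      rw [← push_comp]
      rfl
    refine ⟨T (k + 1) x, ?_⟩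
    rw [d_deRhamComplex]
    have := congrArg (fun F => F x) hT
    simp only [LinearMap.comp_apply, LinearMap.sub_apply, hx0, map_zero, sub_zero] at this
    exact this

variable {E : Type*} [NormedAddCommGroup E] [NormedSpace ℝ E] (M : Type u) [TopologicalSpace M]
  [ChartedSpace E M] [IsManifold 𝓘(ℝ, E) ∞ M]

lemma SimplexClass.sSupp_univ {X : Type u} [TopologicalSpace X] (Q : SimplexClass X) (k : ℕ) :
    Q.sSupp k univ = ⊤ :=
  eq_top_iff.mpr fun _ _ => (Finsupp.mem_supported ℝ _).mpr fun _ _ _ => trivial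

lemma isIso_homologyMap_toSingular (k : ℕ) :
    IsIso (HomologicalComplex.homologyMap (toSingular 𝓘(ℝ, E) M) k) := by
  refine LocalComplex.Hom.isIso_homologyMap _ (inclHom_acyclic (E := E) (M := M))
    (SimplexClass.sSupp_univ _) (SimplexClass.sSupp_univ _) _
    (fun k => smoothChainEquiv k) (fun k c => ?_) (fun k => (contChainEquiv M k).symm)
    (fun k c => ?_) (fun k c => ?_) k
  · rw [d_smoothSingularComplex]
    exact smoothChainEquiv_boundary c
  · obtain ⟨c, rfl⟩ := (contChainEquiv M (k + 1)).surjective c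
    exact (congrArg ((contClass M).sD k) ((contChainEquiv M (k + 1)).symm_apply_apply c)).trans
      ((contChainEquiv M k).eq_symm_apply.mpr (contChainMap_sD c))
  · refine (contChainEquiv M k).eq_symm_apply.mpr ?_
    have h : (contChainMap M k).comp (((SimplexClass.inclHom (Q := smoothClass 𝓘(ℝ, E) M)
        (Q' := contClass M) fun _ _ h => (smoothClass 𝓘(ℝ, E) M).continuous h).f k).comp
          (smoothChainEquiv k).toLinearMap) = toSingularMap 𝓘(ℝ, E) M k := by
      refine Finsupp.lhom_ext' fun σ => LinearMap.ext_ring ?_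
      change contChainMap M k (Finsupp.linearCombination (M := (contClass M).Ch k) ℝ
        (fun σ : (smoothClass 𝓘(ℝ, E) M).mem k => Finsupp.single ⟨σ.1, _⟩ 1)
          (smoothChainEquiv k (Finsupp.single σ 1))) = toSingularMap _ M k (Finsupp.single σ 1)
      rw [smoothChainEquiv_single, Finsupp.linearCombination_single, one_smul,
        contChainMap_single, toSingularMap, Finsupp.linearCombination_single, one_smul]
      rfl
    exact congrArg (fun F => F c) h

lemma isIso_homologyMap_comparison [FiniteDimensional ℝ E] [T2Space M] [NormalSpace M]
    [SigmaCompactSpace M] {u : ∀ k, Chains (simplex k) k} (hu : IsSimplexSequence u) (k : ℕ) :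
    IsIso (HomologicalComplex.homologyMap (comparison hu (DiffSpace.ofManifold 𝓘(ℝ, E) M)) k) := by
  refine LocalComplex.Hom.isIso_homologyMap _ (comparisonHom_acyclic (E := E) (M := M) hu)
    (SimplexClass.sSupp_univ _) (fun k => suppChains_univ) _
    (fun k => smoothChainEquiv k) (fun k c => ?_)
    (fun k => LinearEquiv.refl ℝ (Chains (DiffSpace.ofManifold 𝓘(ℝ, E) M) k))
    (fun k c => ?_) (fun k c => ?_) k
  · rw [d_smoothSingularComplex]
    exact smoothChainEquiv_boundary c
  · rw [d_deRhamComplex]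
    rfl
  · exact congrArg (comparisonMap u (DiffSpace.ofManifold 𝓘(ℝ, E) M) k)
      (LinearEquiv.symm_apply_apply (smoothChainEquiv k) c)

end Comparison

end DeRhamChain

end

/-- For every sequence `u` of de Rham chains `u_k` of `Δᵏ` as in `IsSimplexSequence` (such
sequences exist), the map `H^sm_*(M) → H^dR_*(M)` induced by `σ ↦ σ_*(u_k)` is an isomorphism, and
it does not depend on `u`. Hence `H_*(M) ≅ H^dR_*(M)`, compatibly with the map
`H^sm_*(M) → H_*(M)` induced by the inclusion of chain complexes. -/
theorem theorem3p1 {d : ℕ} (M : Type u) [TopologicalSpace M] [T2Space M]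
    [SecondCountableTopology M] [ChartedSpace (EuclideanSpace ℝ (Fin d)) M]
    [IsManifold (𝓡 d) ∞ M] (_o : DeRhamChain.ManifoldOrientation d M) :
    (∃ u : ∀ k, DeRhamChain.Chains (DeRhamChain.simplex k) k, DeRhamChain.IsSimplexSequence u) ∧
    (∀ (u u' : ∀ k, DeRhamChain.Chains (DeRhamChain.simplex k) k)
      (hu : DeRhamChain.IsSimplexSequence u) (hu' : DeRhamChain.IsSimplexSequence u') (k : ℕ),
      HomologicalComplex.homologyMap
          (DeRhamChain.comparison hu (DeRhamChain.DiffSpace.ofManifold (𝓡 d) M)) k =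
        HomologicalComplex.homologyMap
          (DeRhamChain.comparison hu' (DeRhamChain.DiffSpace.ofManifold (𝓡 d) M)) k) ∧
    (∀ (u : ∀ k, DeRhamChain.Chains (DeRhamChain.simplex k) k)
      (hu : DeRhamChain.IsSimplexSequence u) (k : ℕ),
      CategoryTheory.IsIso (HomologicalComplex.homologyMap
          (DeRhamChain.comparison hu (DeRhamChain.DiffSpace.ofManifold (𝓡 d) M)) k) ∧
      ∃ Φ : CategoryTheory.Iso ((DeRhamChain.singularComplex M).homology k)
          ((DeRhamChain.deRhamComplex (DeRhamChain.DiffSpace.ofManifold (𝓡 d) M)).homology k),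
        CategoryTheory.CategoryStruct.comp
            (HomologicalComplex.homologyMap (DeRhamChain.toSingular (𝓡 d) M) k) Φ.hom =
          HomologicalComplex.homologyMap
            (DeRhamChain.comparison hu (DeRhamChain.DiffSpace.ofManifold (𝓡 d) M)) k) := by
  have : LocallyCompactSpace M := ChartedSpace.locallyCompactSpace (EuclideanSpace ℝ (Fin d)) M
  have : SigmaCompactSpace M := inferInstance
  have : NormalSpace M := inferInstance
  refine ⟨DeRhamChain.exists_isSimplexSequence, fun u u' hu hu' k =>
    DeRhamChain.homologyMap_comparison_eq hu hu' _ k, fun u hu k => ?_⟩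
  have h1 := DeRhamChain.isIso_homologyMap_toSingular (E := EuclideanSpace ℝ (Fin d)) M k
  have h2 := DeRhamChain.isIso_homologyMap_comparison (E := EuclideanSpace ℝ (Fin d)) M hu k
  exact ⟨h2, (CategoryTheory.asIso (HomologicalComplex.homologyMap
      (DeRhamChain.toSingular (𝓡 d) M) k)).symm.trans (CategoryTheory.asIso
        (HomologicalComplex.homologyMap (DeRhamChain.comparison hu
          (DeRhamChain.DiffSpace.ofManifold (𝓡 d) M)) k)),
    CategoryTheory.IsIso.hom_inv_id_assoc
      (HomologicalComplex.homologyMap (DeRhamChain.toSingular (𝓡 d) M) k) _⟩
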